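/- Let $H'$ be Khovanov's monoidal category: it has a zero object, biproducts and generating objects $Q_+,Q_-$ (upward and downward strands), and its morphisms are linear combinations of oriented string diagrams (cups, caps and crossings) up to isotopy, modulo the local relations: (i) on $Q_-\otimes Q_+$, cap followed by cup plus the double crossing $Q_-Q_+\to Q_+Q_-\to Q_-Q_+$ equals the identity; (ii) the double crossing $Q_+Q_-\to Q_-Q_+\to Q_+Q_-$ is the identity; (iii) the circle $1\to Q_-Q_+\to 1$ is the identity; (iv) the left curl on $Q_+$ is $0$; (v) like-oriented crossings square to the identity and satisfy the braid relation. Write $H'_R$ for the version with coefficients in a commutative semiring $R$. Let $FS$ be the groupoid of finite sets and bijections. Let $\mathbf{Span}(\mathbf{Gpd})$ have tame groupoids as objects (essentially small, finite hom-sets, finite groupoid cardinality), spans of groupoids that are tame in both directions as morphisms, composed by weak pullback, and equivalence classes of bi-tame spans of spans as $2$-morphisms, added by disjoint union. (A span of groupoids $B\leftarrow X\to A$ is tame if the joint full preimage in $X$ of every pair of objects is tame and, for every $b\in B$, only finitely many isomorphism classes of $a\in A$ have a non-empty joint preimage with $b$; for a span of spans this is required of its two legs.) The combinatorial representation $C$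 sends $Q_-$ to the annihilation span $A=(FS\xleftarrow{\ \mathrm{id}\ }FS\xrightarrow{+1}FS)$ (source leg $+1$, target leg $\mathrm{id}$), $Q_+$ to its converse $A^\dagger$, $X\otimes Y$ to the composite "first $C(Y)$, then $C(X)$", $\oplus$ to disjoint union; the cup $1\to Q_-Q_+$ to the span of spans relating the identity history of $S$ to "add $x$, then remove $x$"; the cup $1\to Q_+Q_-$ to the one relating the identity history of $S+1$ to "remove an element, then add it back"; the crossing $Q_+Q_-\to Q_-Q_+$ to the one relating "remove $x$, then add $y$" to "add $y$, then remove $x$"; the like-oriented crossings to the exchange of the two added or removed elements; and each of the two caps, and the crossing $Q_-Q_+\to Q_+Q_-$, to the converse of the corresponding map. Let $\Lambda$ be the $2$-linearization extended to $FS$: $\Lambda(FS)$ is the category of functors $V$ from $FS$ to complex vector spaces with all $V(S)$ finite-dimensional and $V(S)=0$ outside finitely many isomorphism classes of $S$; $\Lambda$ of a span is restriction along the source leg followed by induction (left Kan extension) along the target leg; $\Lambda$ of a span of spans is the natural transformation built from its two natural transformations, the unit of $S^*\dashv S_*$ and the counit of $T_!\dashv T^*$ for its two legs $S,T$, where $S_*\cong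 S_!$ is normalised by dividing by the orders of the automorphism groups in the homotopy fibres of $S$. Then: 1. $FS$ is tame, $C$ takes values in bi-tame spans and classes of bi-tame spans of spans, and $C$ respects all relations of $H'_{\mathbb N}$. 2. Evaluation on the standard sets $\{1,\dots,n\}$ is an equivalence $\Lambda(FS)\simeq\coprod_n\mathrm{Rep}(S_n)$ onto the category of finite direct sums of finite-dimensional complex representations of the symmetric groups. 3. The composite $\Lambda\circ C$ determines a representation of $H'$ on $\Lambda(FS)$ by functors and natural transformations: there is an action of the monoidal category $H'_{\mathbb C}$ on $\Lambda(FS)$, by $\mathbb C$-linear functors and $\mathbb C$-linear on morphisms, in which every object $X$ acts by $\Lambda(C(X))$, every morphism $f$ of $H'_{\mathbb N}$ acts by $\Lambda(Z)$ for every span of spans $Z$ in the class $C(f)$, and the associativity and unit constraints are those of $\Lambda$. 4. This is Khovanov's induction/restriction bimodule representation: under the equivalence in 2 this action corresponds to an action of $H'_{\mathbb C}$ on $\coprod_n\mathrm{Rep}(S_n)$ in which $Q_+$ acts by the induction functors $\mathrm{Rep}(S_n)\to\mathrm{Rep}(S_{n+1})$, $Q_-$ by the restriction functors $\mathrm{Rep}(S_{n+1})\to\mathrm{Rep}(S_n)$,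 and the generating morphisms act by the following bimodule maps, in which $s\in S_{n+2}$ is the last adjacent transposition: the cup $1\to Q_-Q_+$ by the inclusion $\mathbb C[S_n]\to\mathbb C[S_{n+1}]$; the cap $Q_-Q_+\to1$ by the projection $\mathbb C[S_{n+1}]\to\mathbb C[S_n]$ killing $S_{n+1}\setminus S_n$; the cup $1\to Q_+Q_-$ by $1\mapsto\sum_c c\otimes c^{-1}$ over representatives $c$ of $S_{n+1}/S_n$; the cap $Q_+Q_-\to1$ by multiplication $\mathbb C[S_{n+1}]\otimes_{\mathbb C[S_n]}\mathbb C[S_{n+1}]\to\mathbb C[S_{n+1}]$; the crossings $Q_+Q_+\to Q_+Q_+$ and $Q_-Q_-\to Q_-Q_-$ by right and left multiplication by $s$ on $\mathbb C[S_{n+2}]$; the crossing $Q_+Q_-\to Q_-Q_+$ by $a\otimes b\mapsto asb$, from $\mathbb C[S_{n+1}]\otimes_{\mathbb C[S_n]}\mathbb C[S_{n+1}]$ to $\mathbb C[S_{n+2}]$; and the crossing $Q_-Q_+\to Q_+Q_-$ by $asb\mapsto a\otimes b$ for $a,b\in S_{n+1}$, and $a\mapsto 0$ for $a\in S_{n+1}\subset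 S_{n+2}$. -/

import Mathlib

open CategoryTheory MonoidalCategory
open scoped MonoidalCategory.MonoidalLeftAction

namespace HeisCat

/-! ## Khovanov's monoidal category `H'`, by generators and relations -/

/-- Objects of `H'`: formal tensor words and formal finite biproducts in `Q₊` and `Q₋`. -/
inductive HObj : Type
  | plus : HObj
  | minus : HObj
  | unit : HObj
  | tensor : HObj → HObj → HObj
  | zero : HObj
  | sum : HObj → HObj → HObj

open HObj

/-- Formal morphisms of `H'` with coefficients in `R`. String diagrams are read from bottom
(source) to top (target), and `tensor` is horizontal juxtaposition from left to right. -/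
inductive HMor (R : Type) : HObj → HObj → Type
  | id (X : HObj) : HMor R X X
  | comp {X Y Z : HObj} (f : HMor R X Y) (g : HMor R Y Z) : HMor R X Z
  | tensor {X Y X' Y' : HObj} (f : HMor R X Y) (g : HMor R X' Y') :
      HMor R (X.tensor X') (Y.tensor Y')
  | assocHom (X Y Z : HObj) : HMor R ((X.tensor Y).tensor Z) (X.tensor (Y.tensor Z))
  | assocInv (X Y Z : HObj) : HMor R (X.tensor (Y.tensor Z)) ((X.tensor Y).tensor Z)
  | leftHom (X : HObj) : HMor R (unit.tensor X) X
  | leftInv (X : HObj) : HMor R X (unit.tensor X)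
  | rightHom (X : HObj) : HMor R (X.tensor unit) X
  | rightInv (X : HObj) : HMor R X (X.tensor unit)
  | zero (X Y : HObj) : HMor R X Y
  | add {X Y : HObj} (f g : HMor R X Y) : HMor R X Y
  | smul {X Y : HObj} (r : R) (f : HMor R X Y) : HMor R X Y
  | inl (X Y : HObj) : HMor R X (X.sum Y)
  | inr (X Y : HObj) : HMor R Y (X.sum Y)
  | fst (X Y : HObj) : HMor R (X.sum Y) X
  | snd (X Y : HObj) : HMor R (X.sum Y) Y
  | cupMP : HMor R unit (minus.tensor plus)
  | capMP : HMor R (minus.tensor plus) unit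
  | cupPM : HMor R unit (plus.tensor minus)
  | capPM : HMor R (plus.tensor minus) unit
  | crossPP : HMor R (plus.tensor plus) (plus.tensor plus)
  | crossMM : HMor R (minus.tensor minus) (minus.tensor minus)
  | crossPM : HMor R (plus.tensor minus) (minus.tensor plus)
  | crossMP : HMor R (minus.tensor plus) (plus.tensor minus)

namespace HMor

variable {R : Type}

/-- Whiskering by an object on the left. -/
def wl (X : HObj) {Y Z : HObj} (f : HMor R Y Z) : HMor R (X.tensor Y) (X.tensor Z) :=
  (id X).tensor f

/-- Whiskering by an object on the right. -/
def wr {X Y : HObj} (f : HMor R X Y) (Z : HObj) : HMor R (X.tensor Z) (Y.tensor Z) :=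
  f.tensor (id Z)

/-- The left curl: create a pair `Q₋ ⊗ Q₊` to the left of an upward strand, cross the two upward
strands, and annihilate the pair `Q₋ ⊗ Q₊`. -/
def leftCurl : HMor R plus plus :=
  (leftInv plus).comp <| (cupMP.wr plus).comp <| (assocHom minus plus plus).comp <|
    (crossPP.wl minus).comp <| (assocInv minus plus plus).comp <| (capMP.wr plus).comp <|
    leftHom plus

/-- The four zig-zags. -/
def zigzagP : HMor R plus plus :=
  (rightInv plus).comp <| (cupMP.wl plus).comp <| (assocInv plus minus plus).comp <|
    (capPM.wr plus).comp <| leftHom plus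

def zigzagM : HMor R minus minus :=
  (leftInv minus).comp <| (cupMP.wr minus).comp <| (assocHom minus plus minus).comp <|
    (capPM.wl minus).comp <| rightHom minus

def zigzagM' : HMor R minus minus :=
  (rightInv minus).comp <| (cupPM.wl minus).comp <| (assocInv minus plus minus).comp <|
    (capMP.wr minus).comp <| leftHom minus

def zigzagP' : HMor R plus plus :=
  (leftInv plus).comp <| (cupPM.wr plus).comp <| (assocHom plus minus plus).comp <|
    (capMP.wl plus).comp <| rightHom plus

/-- The braid words `(c ⊗ 1)(1 ⊗ c)(c ⊗ 1)` and `(1 ⊗ c)(c ⊗ 1)(1 ⊗ c)` on three upward strands. -/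
def braidL : HMor R ((plus.tensor plus).tensor plus) ((plus.tensor plus).tensor plus) :=
  (crossPP.wr plus).comp <| (assocHom plus plus plus).comp <| (crossPP.wl plus).comp <|
    (assocInv plus plus plus).comp <| crossPP.wr plus

def braidR : HMor R ((plus.tensor plus).tensor plus) ((plus.tensor plus).tensor plus) :=
  (assocHom plus plus plus).comp <| (crossPP.wl plus).comp <| (assocInv plus plus plus).comp <|
    (crossPP.wr plus).comp <| (assocHom plus plus plus).comp <| (crossPP.wl plus).comp <|
    assocInv plus plus plus

/-- Rotation of a crossing by means of a cup `1 ⟶ Q₋ ⊗ Q₊` on the left and a cap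
`Q₊ ⊗ Q₋ ⟶ 1` on the right. -/
def rotL {B : HObj} (c : HMor R (plus.tensor B) (B.tensor plus)) :
    HMor R (B.tensor minus) (minus.tensor B) :=
  (leftInv (B.tensor minus)).comp <| (cupMP.wr (B.tensor minus)).comp <|
    (assocHom minus plus (B.tensor minus)).comp <| ((assocInv plus B minus).wl minus).comp <|
    ((c.wr minus).wl minus).comp <| ((assocHom B plus minus).wl minus).comp <|
    ((capPM.wl B).wl minus).comp <| (rightHom B).wl minus

/-- Rotation of a crossing by means of a cup `1 ⟶ Q₊ ⊗ Q₋` on the right and a cap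
`Q₋ ⊗ Q₊ ⟶ 1` on the left. -/
def rotR {B : HObj} (c : HMor R (B.tensor plus) (plus.tensor B)) :
    HMor R (minus.tensor B) (B.tensor minus) :=
  (rightInv (minus.tensor B)).comp <| (cupPM.wl (minus.tensor B)).comp <|
    (assocInv (minus.tensor B) plus minus).comp <| ((assocHom minus B plus).wr minus).comp <|
    ((c.wl minus).wr minus).comp <| ((assocInv minus plus B).wr minus).comp <|
    ((capMP.wr B).wr minus).comp <| (leftHom B).wr minus

end HMor

open HMor

/-- The relations of `H'`: an `R`-linear monoidal category with zero object and binary biproducts,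
with string diagrams up to isotopy and Khovanov's local relations. -/
inductive HRel (R : Type) [CommSemiring R] : ∀ {X Y : HObj}, HMor R X Y → HMor R X Y → Prop
  -- congruence
  | refl {X Y : HObj} (f : HMor R X Y) : HRel R f f
  | symm {X Y : HObj} {f g : HMor R X Y} : HRel R f g → HRel R g f
  | trans {X Y : HObj} {f g h : HMor R X Y} : HRel R f g → HRel R g h → HRel R f h
  | comp {X Y Z : HObj} {f f' : HMor R X Y} {g g' : HMor R Y Z} :
      HRel R f f' → HRel R g g' → HRel R (f.comp g) (f'.comp g')
  | tensor {X Y X' Y' : HObj} {f f' : HMor R X Y} {g g' : HMor R X' Y'} :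
      HRel R f f' → HRel R g g' → HRel R (f.tensor g) (f'.tensor g')
  | add {X Y : HObj} {f f' g g' : HMor R X Y} :
      HRel R f f' → HRel R g g' → HRel R (f.add g) (f'.add g')
  | smul {X Y : HObj} (r : R) {f f' : HMor R X Y} :
      HRel R f f' → HRel R (f.smul r) (f'.smul r)
  -- category
  | id_comp {X Y : HObj} (f : HMor R X Y) : HRel R ((HMor.id X).comp f) f
  | comp_id {X Y : HObj} (f : HMor R X Y) : HRel R (f.comp (HMor.id Y)) f
  | assoc {X Y Z W : HObj} (f : HMor R X Y) (g : HMor R Y Z) (h : HMor R Z W) :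
      HRel R ((f.comp g).comp h) (f.comp (g.comp h))
  -- monoidal category
  | id_tensor_id (X Y : HObj) : HRel R ((HMor.id X).tensor (HMor.id Y)) (HMor.id (X.tensor Y))
  | tensor_comp {X Y Z X' Y' Z' : HObj} (f : HMor R X Y) (g : HMor R Y Z)
      (f' : HMor R X' Y') (g' : HMor R Y' Z') :
      HRel R ((f.tensor f').comp (g.tensor g')) ((f.comp g).tensor (f'.comp g'))
  | assoc_hom_inv (X Y Z : HObj) :
      HRel R ((assocHom X Y Z).comp (assocInv X Y Z)) (HMor.id _)
  | assoc_inv_hom (X Y Z : HObj) :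
      HRel R ((assocInv X Y Z).comp (assocHom X Y Z)) (HMor.id _)
  | assoc_nat {X Y Z X' Y' Z' : HObj} (f : HMor R X X') (g : HMor R Y Y') (h : HMor R Z Z') :
      HRel R (((f.tensor g).tensor h).comp (assocHom X' Y' Z'))
        ((assocHom X Y Z).comp (f.tensor (g.tensor h)))
  | left_hom_inv (X : HObj) : HRel R ((leftHom X).comp (leftInv X)) (HMor.id _)
  | left_inv_hom (X : HObj) : HRel R ((leftInv X).comp (leftHom X)) (HMor.id _)
  | left_nat {X Y : HObj} (f : HMor R X Y) :
      HRel R ((f.wl unit).comp (leftHom Y)) ((leftHom X).comp f)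
  | right_hom_inv (X : HObj) : HRel R ((rightHom X).comp (rightInv X)) (HMor.id _)
  | right_inv_hom (X : HObj) : HRel R ((rightInv X).comp (rightHom X)) (HMor.id _)
  | right_nat {X Y : HObj} (f : HMor R X Y) :
      HRel R ((f.wr unit).comp (rightHom Y)) ((rightHom X).comp f)
  | pentagon (W X Y Z : HObj) :
      HRel R (((assocHom W X Y).wr Z).comp
          ((assocHom W (X.tensor Y) Z).comp ((assocHom X Y Z).wl W)))
        ((assocHom (W.tensor X) Y Z).comp (assocHom W X (Y.tensor Z)))
  | triangle (X Y : HObj) :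
      HRel R ((assocHom X unit Y).comp ((leftHom Y).wl X)) ((rightHom X).wr Y)
  -- linear structure
  | add_comm {X Y : HObj} (f g : HMor R X Y) : HRel R (f.add g) (g.add f)
  | add_assoc {X Y : HObj} (f g h : HMor R X Y) :
      HRel R ((f.add g).add h) (f.add (g.add h))
  | zero_add {X Y : HObj} (f : HMor R X Y) : HRel R ((zero X Y).add f) f
  | one_smul {X Y : HObj} (f : HMor R X Y) : HRel R (f.smul 1) f
  | mul_smul {X Y : HObj} (r s : R) (f : HMor R X Y) :
      HRel R (f.smul (r * s)) ((f.smul s).smul r)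
  | smul_add {X Y : HObj} (r : R) (f g : HMor R X Y) :
      HRel R ((f.add g).smul r) ((f.smul r).add (g.smul r))
  | add_smul {X Y : HObj} (r s : R) (f : HMor R X Y) :
      HRel R (f.smul (r + s)) ((f.smul r).add (f.smul s))
  | zero_smul {X Y : HObj} (f : HMor R X Y) : HRel R (f.smul 0) (zero X Y)
  | add_comp {X Y Z : HObj} (f f' : HMor R X Y) (g : HMor R Y Z) :
      HRel R ((f.add f').comp g) ((f.comp g).add (f'.comp g))
  | comp_add {X Y Z : HObj} (f : HMor R X Y) (g g' : HMor R Y Z) :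
      HRel R (f.comp (g.add g')) ((f.comp g).add (f.comp g'))
  | zero_comp (X : HObj) {Y Z : HObj} (g : HMor R Y Z) :
      HRel R ((zero X Y).comp g) (zero X Z)
  | comp_zero {X Y : HObj} (f : HMor R X Y) (Z : HObj) :
      HRel R (f.comp (zero Y Z)) (zero X Z)
  | smul_comp {X Y Z : HObj} (r : R) (f : HMor R X Y) (g : HMor R Y Z) :
      HRel R ((f.smul r).comp g) ((f.comp g).smul r)
  | comp_smul {X Y Z : HObj} (r : R) (f : HMor R X Y) (g : HMor R Y Z) :
      HRel R (f.comp (g.smul r)) ((f.comp g).smul r)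
  | add_tensor {X Y X' Y' : HObj} (f f' : HMor R X Y) (g : HMor R X' Y') :
      HRel R ((f.add f').tensor g) ((f.tensor g).add (f'.tensor g))
  | tensor_add {X Y X' Y' : HObj} (f : HMor R X Y) (g g' : HMor R X' Y') :
      HRel R (f.tensor (g.add g')) ((f.tensor g).add (f.tensor g'))
  | zero_tensor (X Y : HObj) {X' Y' : HObj} (g : HMor R X' Y') :
      HRel R ((zero X Y).tensor g) (zero (X.tensor X') (Y.tensor Y'))
  | tensor_zero {X Y : HObj} (f : HMor R X Y) (X' Y' : HObj) :
      HRel R (f.tensor (zero X' Y')) (zero (X.tensor X') (Y.tensor Y'))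
  | smul_tensor {X Y X' Y' : HObj} (r : R) (f : HMor R X Y) (g : HMor R X' Y') :
      HRel R ((f.smul r).tensor g) ((f.tensor g).smul r)
  | tensor_smul {X Y X' Y' : HObj} (r : R) (f : HMor R X Y) (g : HMor R X' Y') :
      HRel R (f.tensor (g.smul r)) ((f.tensor g).smul r)
  -- zero object and biproducts
  | zero_obj : HRel R (HMor.id HObj.zero) (zero HObj.zero HObj.zero)
  | inl_fst (X Y : HObj) : HRel R ((inl X Y).comp (fst X Y)) (HMor.id X)
  | inl_snd (X Y : HObj) : HRel R ((inl X Y).comp (snd X Y)) (zero X Y)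
  | inr_fst (X Y : HObj) : HRel R ((inr X Y).comp (fst X Y)) (zero Y X)
  | inr_snd (X Y : HObj) : HRel R ((inr X Y).comp (snd X Y)) (HMor.id Y)
  | biprod_total (X Y : HObj) :
      HRel R (((fst X Y).comp (inl X Y)).add ((snd X Y).comp (inr X Y))) (HMor.id (X.sum Y))
  -- isotopy
  | zigzagP : HRel R zigzagP (HMor.id plus)
  | zigzagM : HRel R zigzagM (HMor.id minus)
  | zigzagM' : HRel R zigzagM' (HMor.id minus)
  | zigzagP' : HRel R zigzagP' (HMor.id plus)
  | rotL_PP : HRel R (rotL crossPP) crossPM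
  | rotR_PP : HRel R (rotR crossPP) crossMP
  | rotL_PM : HRel R (rotL crossPM) crossMM
  | rotR_MP : HRel R (rotR crossMP) crossMM
  -- Khovanov's local relations
  | heisenberg :
      HRel R ((capMP.comp cupMP).add (crossMP.comp crossPM)) (HMor.id (minus.tensor plus))
  | crossPM_crossMP : HRel R (crossPM.comp crossMP) (HMor.id (plus.tensor minus))
  | circle : HRel R (cupMP.comp capMP) (HMor.id unit)
  | curl : HRel R leftCurl (zero plus plus)
  | crossPP_sq : HRel R (crossPP.comp crossPP) (HMor.id (plus.tensor plus))
  | crossMM_sq : HRel R (crossMM.comp crossMM) (HMor.id (minus.tensor minus))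
  | braid : HRel R braidL braidR

/-- The setoid of formal morphisms of `H'` modulo the relations. -/
def hSetoid (R : Type) [CommSemiring R] (X Y : HObj) : Setoid (HMor R X Y) :=
  ⟨HRel R, ⟨HRel.refl, HRel.symm, HRel.trans⟩⟩

/-- Khovanov's category `H'` with coefficients in `R`. -/
def H (R : Type) [CommSemiring R] : Type := HObj

section HCategory

variable {R : Type} [CommSemiring R]

instance : Category (H R) where
  Hom X Y := Quotient (hSetoid R X Y)
  id X := Quotient.mk _ (HMor.id X)
  comp := Quotient.map₂ HMor.comp (fun _ _ hf _ _ hg => HRel.comp hf hg)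
  id_comp := by rintro X Y ⟨f⟩; exact Quotient.sound (HRel.id_comp f)
  comp_id := by rintro X Y ⟨f⟩; exact Quotient.sound (HRel.comp_id f)
  assoc := by rintro X Y Z W ⟨f⟩ ⟨g⟩ ⟨h⟩; exact Quotient.sound (HRel.assoc f g h)

/-- The class of a formal morphism. -/
def hom {X Y : HObj} (f : HMor R X Y) : @Quiver.Hom (H R) _ X Y := Quotient.mk (hSetoid R X Y) f

instance : MonoidalCategory (H R) where
  tensorObj X Y := HObj.tensor X Y
  tensorUnit := HObj.unit
  tensorHom := Quotient.map₂ HMor.tensor (fun _ _ hf _ _ hg => HRel.tensor hf hg)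
  whiskerLeft X _ _ := Quotient.map (HMor.wl X) (fun _ _ hf => HRel.tensor (HRel.refl _) hf)
  whiskerRight f Y := Quotient.map (fun f => HMor.wr f Y)
    (fun _ _ hf => HRel.tensor hf (HRel.refl _)) f
  associator X Y Z := ⟨hom (assocHom X Y Z), hom (assocInv X Y Z),
    Quotient.sound (HRel.assoc_hom_inv X Y Z), Quotient.sound (HRel.assoc_inv_hom X Y Z)⟩
  leftUnitor X := ⟨hom (leftHom X), hom (leftInv X),
    Quotient.sound (HRel.left_hom_inv X), Quotient.sound (HRel.left_inv_hom X)⟩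
  rightUnitor X := ⟨hom (rightHom X), hom (rightInv X),
    Quotient.sound (HRel.right_hom_inv X), Quotient.sound (HRel.right_inv_hom X)⟩
  tensorHom_def := by
    rintro X Y X' Y' ⟨f⟩ ⟨g⟩
    exact Quotient.sound (HRel.trans (HRel.tensor (HRel.comp_id f).symm (HRel.id_comp g).symm)
      (HRel.tensor_comp _ _ _ _).symm)
  id_tensorHom_id X Y := Quotient.sound (HRel.id_tensor_id X Y)
  tensorHom_comp_tensorHom := by
    rintro X Y Z X' Y' Z' ⟨f⟩ ⟨f'⟩ ⟨g⟩ ⟨g'⟩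
    exact Quotient.sound (HRel.tensor_comp _ _ _ _)
  whiskerLeft_id X Y := Quotient.sound (HRel.id_tensor_id X Y)
  id_whiskerRight X Y := Quotient.sound (HRel.id_tensor_id X Y)
  associator_naturality := by
    rintro X Y Z X' Y' Z' ⟨f⟩ ⟨g⟩ ⟨h⟩; exact Quotient.sound (HRel.assoc_nat f g h)
  leftUnitor_naturality := by rintro X Y ⟨f⟩; exact Quotient.sound (HRel.left_nat f)
  rightUnitor_naturality := by rintro X Y ⟨f⟩; exact Quotient.sound (HRel.right_nat f)
  pentagon W X Y Z := Quotient.sound (HRel.pentagon W X Y Z)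
  triangle X Y := Quotient.sound (HRel.triangle X Y)

end HCategory

/-- Change of coefficients `ℕ → R` on formal morphisms. -/
def natCast (R : Type) [CommSemiring R] : ∀ {X Y : HObj}, HMor ℕ X Y → HMor R X Y
  | _, _, .id X => .id X
  | _, _, .comp f g => .comp (natCast R f) (natCast R g)
  | _, _, .tensor f g => .tensor (natCast R f) (natCast R g)
  | _, _, .assocHom X Y Z => .assocHom X Y Z
  | _, _, .assocInv X Y Z => .assocInv X Y Z
  | _, _, .leftHom X => .leftHom X
  | _, _, .leftInv X => .leftInv X
  | _, _, .rightHom X => .rightHom X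
  | _, _, .rightInv X => .rightInv X
  | _, _, .zero X Y => .zero X Y
  | _, _, .add f g => .add (natCast R f) (natCast R g)
  | _, _, .smul n f => .smul (n : R) (natCast R f)
  | _, _, .inl X Y => .inl X Y
  | _, _, .inr X Y => .inr X Y
  | _, _, .fst X Y => .fst X Y
  | _, _, .snd X Y => .snd X Y
  | _, _, .cupMP => .cupMP
  | _, _, .capMP => .capMP
  | _, _, .cupPM => .cupPM
  | _, _, .capPM => .capPM
  | _, _, .crossPP => .crossPP
  | _, _, .crossMM => .crossMM
  | _, _, .crossPM => .crossPM
  | _, _, .crossMP => .crossMP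

/-! ## Spans of groupoids, and equivalence classes of spans of spans -/

/-- The comma category of two functors into a groupoid out of groupoids is a groupoid: objects are
triples `(x, y, G x ⟶ J y)`, and this is the weak pullback of `G` and `J`. -/
instance commaGroupoid {X Y B : Type 1} [Groupoid.{0} X] [Groupoid.{0} Y] [Groupoid.{0} B]
    (G : X ⥤ B) (J : Y ⥤ B) : Groupoid.{0} (Comma G J) where
  inv {c d} f :=
    { left := Groupoid.inv f.left
      right := Groupoid.inv f.right
      w := by
        have := f.w
        simp only [Groupoid.inv_eq_inv, Functor.map_inv, IsIso.inv_comp_eq]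
        rw [reassoc_of% this, IsIso.hom_inv_id, Category.comp_id] }
  inv_comp f := by ext <;> simp
  comp_inv f := by ext <;> simp

instance sumGroupoid {X Y : Type 1} [Groupoid.{0} X] [Groupoid.{0} Y] :
    Groupoid.{0} (X ⊕ Y) where
  inv {a b} f := match a, b, f with
    | .inl _, .inl _, f => ⟨Groupoid.inv f.down⟩
    | .inr _, .inr _, f => ⟨Groupoid.inv f.down⟩
  inv_comp {a b} f := match a, b, f with
    | .inl _, .inl _, f => congrArg ULift.up (Groupoid.inv_comp f.down)
    | .inr _, .inr _, f => congrArg ULift.up (Groupoid.inv_comp f.down)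
  comp_inv {a b} f := match a, b, f with
    | .inl _, .inl _, f => congrArg ULift.up (Groupoid.comp_inv f.down)
    | .inr _, .inr _, f => congrArg ULift.up (Groupoid.comp_inv f.down)

/-- The empty groupoid. -/
instance emptyGroupoid : Groupoid.{0} PEmpty.{2} where
  Hom x _ := x.elim
  id x := x.elim
  comp {x _ _} := x.elim
  inv {x _} := x.elim
  id_comp {x} := x.elim
  comp_id {x} := x.elim
  assoc {x} := x.elim
  inv_comp {x} := x.elim
  comp_inv {x} := x.elim

/-- The functor out of the empty groupoid. -/
def emptyFunctor (A : Type 1) [Groupoid.{0} A] : PEmpty.{2} ⥤ A where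
  obj x := x.elim
  map {x _} := x.elim
  map_id x := x.elim
  map_comp {x} := x.elim

instance natTransIsIso {C : Type 1} [Category.{0} C] {D : Type 1} [Groupoid.{0} D] {F G : C ⥤ D}
    (α : F ⟶ G) : IsIso α := NatIso.isIso_of_isIso_app α

/-- A span of groupoids `B ← X → A`, regarded as a morphism `A ⟶ B`. -/
structure GSpan (A B : Type 1) [Groupoid.{0} A] [Groupoid.{0} B] where
  apex : Type 1
  [grpd : Groupoid.{0} apex]
  src : apex ⥤ A
  tgt : apex ⥤ B

attribute [instance] GSpan.grpd

section Spans

variable {A B C : Type 1} [Groupoid.{0} A] [Groupoid.{0} B] [Groupoid.{0} C]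

namespace GSpan

/-- The identity span. -/
def idSpan (A : Type 1) [Groupoid.{0} A] : GSpan A A := ⟨A, 𝟭 A, 𝟭 A⟩

/-- Composition of spans by weak pullback: first `P`, then `P'`. -/
def comp (P : GSpan A B) (P' : GSpan B C) : GSpan A C :=
  ⟨Comma P.tgt P'.src, Comma.fst _ _ ⋙ P.src, Comma.snd _ _ ⋙ P'.tgt⟩

/-- The converse span. -/
def converse (P : GSpan A B) : GSpan B A := ⟨P.apex, P.tgt, P.src⟩

/-- The zero span, with empty apex. -/
def zeroSpan (A B : Type 1) [Groupoid.{0} A] [Groupoid.{0} B] : GSpan A B :=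
  ⟨PEmpty.{2}, emptyFunctor A, emptyFunctor B⟩

/-- The direct sum of spans, given by the disjoint union of apices. -/
def sum (P Q : GSpan A B) : GSpan A B :=
  ⟨P.apex ⊕ Q.apex, Functor.sum' P.src Q.src, Functor.sum' P.tgt Q.tgt⟩

end GSpan

/-- A span of spans `P ⟶ Q`. -/
structure SpanSpan (P Q : GSpan A B) where
  apex : Type 1
  [grpd : Groupoid.{0} apex]
  top : apex ⥤ P.apex
  bot : apex ⥤ Q.apex
  /-- the transformation over the target groupoid `B` -/
  μ : top ⋙ P.tgt ⟶ bot ⋙ Q.tgt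
  /-- the transformation over the source groupoid `A` -/
  ν : top ⋙ P.src ⟶ bot ⋙ Q.src

attribute [instance] SpanSpan.grpd

/-- Equivalence of spans of spans: an equivalence of apices, compatible with the four legs up to
specified transformations `σ`, `τ` whose pastings with `μ'`, `ν'` are `μ`, `ν`. -/
def SpanSpan.Equiv {P Q : GSpan A B} (Z W : SpanSpan P Q) : Prop :=
  ∃ (U : Z.apex ⥤ W.apex) (_ : U.IsEquivalence) (σ : Z.top ⟶ U ⋙ W.top) (τ : Z.bot ⟶ U ⋙ W.bot),
    (∀ z, Z.μ.app z ≫ Q.tgt.map (τ.app z) = P.tgt.map (σ.app z) ≫ W.μ.app (U.obj z)) ∧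
    (∀ z, Z.ν.app z ≫ Q.src.map (τ.app z) = P.src.map (σ.app z) ≫ W.ν.app (U.obj z))

namespace SpanSpan

variable {P Q R : GSpan A B}

theorem Equiv.refl (Z : SpanSpan P Q) : Z.Equiv Z :=
  ⟨𝟭 _, inferInstance, 𝟙 _, 𝟙 _, fun z => by simp, fun z => by simp⟩

theorem Equiv.trans {Z W V : SpanSpan P Q} (h : Z.Equiv W) (h' : W.Equiv V) : Z.Equiv V := by
  obtain ⟨U, hU, σ, τ, h1, h2⟩ := h
  obtain ⟨U', hU', σ', τ', h1', h2'⟩ := h'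
  refine ⟨U ⋙ U', inferInstance, σ ≫ Functor.whiskerLeft U σ', τ ≫ Functor.whiskerLeft U τ',
    fun z => ?_, fun z => ?_⟩
  · have := h1' (U.obj z)
    simp [reassoc_of% (h1 z), this]
  · have := h2' (U.obj z)
    simp [reassoc_of% (h2 z), this]

theorem Equiv.symm {Z W : SpanSpan P Q} (h : Z.Equiv W) : W.Equiv Z := by
  obtain ⟨U, hU, σ, τ, h1, h2⟩ := h
  let ε : 𝟭 W.apex ⟶ U.inv ⋙ U := U.asEquivalence.counitInv
  refine ⟨U.inv, inferInstance,
    { app := fun z => W.top.map (ε.app z) ≫ inv (σ.app (U.inv.obj z))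
      naturality := fun a b f => ?_ },
    { app := fun z => W.bot.map (ε.app z) ≫ inv (τ.app (U.inv.obj z))
      naturality := fun a b f => ?_ }, fun z => ?_, fun z => ?_⟩
  · have n := congrArg W.top.map (ε.naturality f)
    have m := σ.naturality (U.inv.map f)
    simp only [Functor.id_map, Functor.comp_map, Functor.map_comp] at n m ⊢
    rw [reassoc_of% n, Category.assoc, ← IsIso.inv_comp_eq, IsIso.inv_hom_id_assoc,
      IsIso.comp_inv_eq, Category.assoc, m, IsIso.inv_hom_id_assoc]
  · have n := congrArg W.bot.map (ε.naturality f)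
    have m := τ.naturality (U.inv.map f)
    simp only [Functor.id_map, Functor.comp_map, Functor.map_comp] at n m ⊢
    rw [reassoc_of% n, Category.assoc, ← IsIso.inv_comp_eq, IsIso.inv_hom_id_assoc,
      IsIso.comp_inv_eq, Category.assoc, m, IsIso.inv_hom_id_assoc]
  · have n := W.μ.naturality (ε.app z)
    have m := h1 (U.inv.obj z)
    simp only [Functor.id_obj, Functor.comp_obj, Functor.comp_map, Functor.map_comp,
      Functor.map_inv, Category.assoc] at n m ⊢
    rw [← reassoc_of% n]
    congr 1
    rw [IsIso.comp_inv_eq, Category.assoc, m, IsIso.inv_hom_id_assoc]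
  · have n := W.ν.naturality (ε.app z)
    have m := h2 (U.inv.obj z)
    simp only [Functor.id_obj, Functor.comp_obj, Functor.comp_map, Functor.map_comp,
      Functor.map_inv, Category.assoc] at n m ⊢
    rw [← reassoc_of% n]
    congr 1
    rw [IsIso.comp_inv_eq, Category.assoc, m, IsIso.inv_hom_id_assoc]

instance setoid (P Q : GSpan A B) : Setoid (SpanSpan P Q) :=
  ⟨Equiv, ⟨Equiv.refl, Equiv.symm, Equiv.trans⟩⟩

/-- The converse span of spans. -/
noncomputable def converse (Z : SpanSpan P Q) : SpanSpan Q P :=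
  ⟨Z.apex, Z.bot, Z.top, inv Z.μ, inv Z.ν⟩

/-- The span of spans given by a functor between the apices, strictly or up to transformations
compatible with the legs. -/
def ofFunctor (F : P.apex ⥤ Q.apex) (μ : P.tgt ⟶ F ⋙ Q.tgt) (ν : P.src ⟶ F ⋙ Q.src) :
    SpanSpan P Q :=
  ⟨P.apex, 𝟭 _, F, μ, ν⟩

/-- The identity span of spans. -/
def idTwo (P : GSpan A B) : SpanSpan P P := ofFunctor (𝟭 _) (𝟙 _) (𝟙 _)

/-- Vertical composition by weak pullback. -/
def vcomp (Z : SpanSpan P Q) (W : SpanSpan Q R) : SpanSpan P R where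
  apex := Comma Z.bot W.top
  top := Comma.fst _ _ ⋙ Z.top
  bot := Comma.snd _ _ ⋙ W.bot
  μ := { app := fun c => Z.μ.app c.left ≫ Q.tgt.map c.hom ≫ W.μ.app c.right
         naturality := fun c d f => by
          have h1 := Z.μ.naturality f.left
          have h2 := W.μ.naturality f.right
          have h3 := congrArg Q.tgt.map f.w
          simp only [Functor.comp_map, Functor.map_comp, Comma.fst_map, Comma.snd_map] at h1 h2 h3 ⊢
          simp only [Category.assoc, ← h2]
          rw [← reassoc_of% h3, reassoc_of% h1] }
  ν := { app := fun c => Z.ν.app c.left ≫ Q.src.map c.hom ≫ W.ν.app c.right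
         naturality := fun c d f => by
          have h1 := Z.ν.naturality f.left
          have h2 := W.ν.naturality f.right
          have h3 := congrArg Q.src.map f.w
          simp only [Functor.comp_map, Functor.map_comp, Comma.fst_map, Comma.snd_map] at h1 h2 h3 ⊢
          simp only [Category.assoc, ← h2]
          rw [← reassoc_of% h3, reassoc_of% h1] }

/-- Horizontal composition by weak pullback. -/
noncomputable def hcomp {P Q : GSpan A B} {P' Q' : GSpan B C} (Z : SpanSpan P Q) (W : SpanSpan P' Q') :
    SpanSpan (P.comp P') (Q.comp Q') where
  apex := Comma (Z.top ⋙ P.tgt) (W.top ⋙ P'.src)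
  top :=
    { obj := fun c => ⟨Z.top.obj c.left, W.top.obj c.right, c.hom⟩
      map := fun f => ⟨Z.top.map f.left, W.top.map f.right, f.w⟩ }
  bot :=
    { obj := fun c => ⟨Z.bot.obj c.left, W.bot.obj c.right,
        inv (Z.μ.app c.left) ≫ c.hom ≫ W.ν.app c.right⟩
      map := fun {c d} f => ⟨Z.bot.map f.left, W.bot.map f.right, by
        have h1 := Z.μ.naturality f.left
        have h2 := W.ν.naturality f.right
        have h3 := f.w
        simp only [Functor.comp_map] at h1 h2 h3 ⊢
        simp only [Category.assoc, ← h2]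
        rw [← reassoc_of% h3]
        simp only [← Category.assoc]
        congr 2
        rw [IsIso.eq_inv_comp, ← Category.assoc, ← h1, Category.assoc, IsIso.hom_inv_id,
          Category.comp_id]⟩ }
  μ := Functor.whiskerLeft (Comma.snd _ _) W.μ
  ν := Functor.whiskerLeft (Comma.fst _ _) Z.ν

/-- The empty span of spans. -/
def zeroTwo (P Q : GSpan A B) : SpanSpan P Q :=
  ⟨PEmpty.{2}, emptyFunctor _, emptyFunctor _, ⟨fun x => x.elim, fun x => x.elim⟩,
    ⟨fun x => x.elim, fun x => x.elim⟩⟩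

/-- The sum of spans of spans, given by the disjoint union of apices. -/
def add (Z W : SpanSpan P Q) : SpanSpan P Q where
  apex := Z.apex ⊕ W.apex
  top := Functor.sum' Z.top W.top
  bot := Functor.sum' Z.bot W.bot
  μ := { app := fun c => match c with
          | .inl z => Z.μ.app z
          | .inr w => W.μ.app w
         naturality := by
          rintro (c | c) (d | d) ⟨f⟩
          · exact Z.μ.naturality f
          · exact W.μ.naturality f }
  ν := { app := fun c => match c with
          | .inl z => Z.ν.app z
          | .inr w => W.ν.app w
         naturality := by
          rintro (c | c) (d | d) ⟨f⟩
          · exact Z.ν.naturality f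
          · exact W.ν.naturality f }

theorem vcomp_congr {Z Z' : SpanSpan P Q} {W W' : SpanSpan Q R} (h : Z.Equiv Z')
    (h' : W.Equiv W') : (Z.vcomp W).Equiv (Z'.vcomp W') := by
  obtain ⟨U, hU, σ, τ, h1, h2⟩ := h
  obtain ⟨V, hV, σ', τ', h1', h2'⟩ := h'
  have hF : (Comma.map (F₁ := U) (F := 𝟭 Q.apex) (F₂ := V) (L := Z.bot) (R := W.top)
      (L' := Z'.bot) (R' := W'.top) (inv τ) σ').IsEquivalence := by
    have i1 : IsIso (inv τ) := inferInstance
    have i2 : IsIso σ' := inferInstance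
    exact Comma.isEquivalenceMap _ _
  refine ⟨_, hF, Functor.whiskerLeft (Comma.fst _ _) σ,
    Functor.whiskerLeft (Comma.snd _ _) τ', fun z => ?_, fun z => ?_⟩
  · have a := h1 z.left
    have b := h1' z.right
    change (Z.μ.app z.left ≫ Q.tgt.map z.hom ≫ W.μ.app z.right) ≫ R.tgt.map (τ'.app z.right) =
      P.tgt.map (σ.app z.left) ≫ Z'.μ.app (U.obj z.left) ≫
        Q.tgt.map ((inv τ).app z.left ≫ z.hom ≫ σ'.app z.right) ≫ W'.μ.app (V.obj z.right)
    rw [← reassoc_of% a]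
    simp [b]
  · have a := h2 z.left
    have b := h2' z.right
    change (Z.ν.app z.left ≫ Q.src.map z.hom ≫ W.ν.app z.right) ≫ R.src.map (τ'.app z.right) =
      P.src.map (σ.app z.left) ≫ Z'.ν.app (U.obj z.left) ≫
        Q.src.map ((inv τ).app z.left ≫ z.hom ≫ σ'.app z.right) ≫ W'.ν.app (V.obj z.right)
    rw [← reassoc_of% a]
    simp [b]

theorem hcomp_congr {P Q : GSpan A B} {P' Q' : GSpan B C} {Z Z' : SpanSpan P Q}
    {W W' : SpanSpan P' Q'} (h : Z.Equiv Z') (h' : W.Equiv W') :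
    (Z.hcomp W).Equiv (Z'.hcomp W') := by
  obtain ⟨U, hU, σ, τ, h1, h2⟩ := h
  obtain ⟨V, hV, σ', τ', h1', h2'⟩ := h'
  have hF : (Comma.map (F₁ := U) (F := 𝟭 B) (F₂ := V) (L := Z.top ⋙ P.tgt)
      (R := W.top ⋙ P'.src) (L' := Z'.top ⋙ P.tgt) (R' := W'.top ⋙ P'.src)
      (Functor.whiskerRight (inv σ) P.tgt)
      (Functor.whiskerRight σ' P'.src)).IsEquivalence := by
    have i1 : IsIso (Functor.whiskerRight (inv σ) P.tgt) := inferInstance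
    have i2 : IsIso (Functor.whiskerRight σ' P'.src) := inferInstance
    exact Comma.isEquivalenceMap _ _
  refine ⟨_, hF,
    { app := fun z => ⟨σ.app z.left, σ'.app z.right, ?_⟩
      naturality := ?_ },
    { app := fun z => ⟨τ.app z.left, τ'.app z.right, ?_⟩
      naturality := ?_ }, fun z => ?_, fun z => ?_⟩
  · change P.tgt.map (σ.app z.left) ≫ P.tgt.map ((inv σ).app z.left) ≫ z.hom ≫
      P'.src.map (σ'.app z.right) = z.hom ≫ P'.src.map (σ'.app z.right)
    simp
  · intro z z' f
    apply Comma.hom_ext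
    · exact σ.naturality f.left
    · exact σ'.naturality f.right
  · have a := h1 z.left
    have b := h2' z.right
    change Q.tgt.map (τ.app z.left) ≫ inv (Z'.μ.app (U.obj z.left)) ≫
      (P.tgt.map ((inv σ).app z.left) ≫ z.hom ≫ P'.src.map (σ'.app z.right)) ≫
        W'.ν.app (V.obj z.right) =
      (inv (Z.μ.app z.left) ≫ z.hom ≫ W.ν.app z.right) ≫ Q'.src.map (τ'.app z.right)
    simp only [Category.assoc, b, NatIso.isIso_inv_app, Functor.map_inv]
    rw [IsIso.eq_inv_comp, reassoc_of% a]
    simp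
  · intro z z' f
    apply Comma.hom_ext
    · exact τ.naturality f.left
    · exact τ'.naturality f.right
  · exact h1' z.right
  · exact h2 z.left

theorem add_congr {Z Z' W W' : SpanSpan P Q} (h : Z.Equiv Z') (h' : W.Equiv W') :
    (Z.add W).Equiv (Z'.add W') := by
  obtain ⟨U, hU, σ, τ, h1, h2⟩ := h
  obtain ⟨V, hV, σ', τ', h1', h2'⟩ := h'
  have hF : (U.sum V).IsEquivalence :=
    { faithful := ⟨by
        rintro (c | c) (d | d) ⟨f⟩ ⟨g⟩ e
        · exact congrArg ULift.up (U.map_injective (congrArg ULift.down e))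
        · exact congrArg ULift.up (V.map_injective (congrArg ULift.down e))⟩
      full := ⟨by
        rintro (c | c) (d | d) ⟨f⟩
        · exact ⟨⟨U.preimage f⟩, congrArg ULift.up (U.map_preimage f)⟩
        · exact ⟨⟨V.preimage f⟩, congrArg ULift.up (V.map_preimage f)⟩⟩
      essSurj := ⟨by
        rintro (d | d)
        · exact ⟨.inl (U.objPreimage d), ⟨(Sum.inl_ _ _).mapIso (U.objObjPreimageIso d)⟩⟩
        · exact ⟨.inr (V.objPreimage d), ⟨(Sum.inr_ _ _).mapIso (V.objObjPreimageIso d)⟩⟩⟩ }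
  refine ⟨U.sum V, hF,
    { app := fun c => match c with
        | .inl z => σ.app z
        | .inr w => σ'.app w
      naturality := ?_ },
    { app := fun c => match c with
        | .inl z => τ.app z
        | .inr w => τ'.app w
      naturality := ?_ }, ?_, ?_⟩
  · rintro (c | c) (d | d) ⟨f⟩
    · exact σ.naturality f
    · exact σ'.naturality f
  · rintro (c | c) (d | d) ⟨f⟩
    · exact τ.naturality f
    · exact τ'.naturality f
  · rintro (z | z)
    · exact h1 z
    · exact h1' z
  · rintro (z | z)
    · exact h2 z
    · exact h2' z

end SpanSpan

end Spans

/-- 2-cells `P ⟶ Q`: equivalence classes of spans of spans. -/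
def TwoCell {A B : Type 1} [Groupoid.{0} A] [Groupoid.{0} B] (P Q : GSpan A B) : Type 2 :=
  Quotient (SpanSpan.setoid P Q)

namespace TwoCell

variable {A B C : Type 1} [Groupoid.{0} A] [Groupoid.{0} B] [Groupoid.{0} C]

/-- The class of a span of spans. -/
def mk {P Q : GSpan A B} (Z : SpanSpan P Q) : TwoCell P Q := Quotient.mk _ Z

def vcomp {P Q R : GSpan A B} : TwoCell P Q → TwoCell Q R → TwoCell P R :=
  Quotient.map₂ SpanSpan.vcomp (fun _ _ h _ _ h' => SpanSpan.vcomp_congr h h')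

noncomputable def hcomp {P Q : GSpan A B} {P' Q' : GSpan B C} :
    TwoCell P Q → TwoCell P' Q' → TwoCell (P.comp P') (Q.comp Q') :=
  Quotient.map₂ SpanSpan.hcomp (fun _ _ h _ _ h' => SpanSpan.hcomp_congr h h')

def add {P Q : GSpan A B} : TwoCell P Q → TwoCell P Q → TwoCell P Q :=
  Quotient.map₂ SpanSpan.add (fun _ _ h _ _ h' => SpanSpan.add_congr h h')

def zero (P Q : GSpan A B) : TwoCell P Q := mk (SpanSpan.zeroTwo P Q)

/-- The `n`-fold sum. -/
def nsmul {P Q : GSpan A B} : ℕ → TwoCell P Q → TwoCell P Q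
  | 0, _ => zero P Q
  | n + 1, c => add (nsmul n c) c

end TwoCell

section Structural

variable {A B C D : Type 1} [Groupoid.{0} A] [Groupoid.{0} B] [Groupoid.{0} C] [Groupoid.{0} D]

/-- The associator `(P then P') then P'' ⟶ P then (P' then P'')`. -/
def assocSpan (P : GSpan A B) (P' : GSpan B C) (P'' : GSpan C D) :
    SpanSpan ((P.comp P').comp P'') (P.comp (P'.comp P'')) :=
  SpanSpan.ofFunctor
    (P := (P.comp P').comp P'') (Q := P.comp (P'.comp P''))
    { obj := fun c => ⟨c.left.left, ⟨c.left.right, c.right, c.hom⟩, c.left.hom⟩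
      map := fun f => ⟨f.left.left, ⟨f.left.right, f.right, f.w⟩, f.left.w⟩ }
    (𝟙 _) (𝟙 _)

/-- The inverse of the tautological transformation of a comma category. -/
noncomputable def commaInv {X Y : Type 1} [Groupoid.{0} X] [Groupoid.{0} Y] (G : X ⥤ B)
    (J : Y ⥤ B) : Comma.snd G J ⋙ J ⟶ Comma.fst G J ⋙ G := inv (Comma.natTrans G J)

/-- The unitor `P then id ⟶ P`. -/
noncomputable def unitorSrc (P : GSpan A B) : SpanSpan (P.comp (GSpan.idSpan B)) P :=
  SpanSpan.ofFunctor (P := P.comp (GSpan.idSpan B)) (Comma.fst _ _)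
    (commaInv P.tgt (𝟭 B)) (𝟙 _)

/-- The unitor `id then P ⟶ P`. -/
def unitorTgt (P : GSpan A B) : SpanSpan ((GSpan.idSpan A).comp P) P :=
  SpanSpan.ofFunctor (P := (GSpan.idSpan A).comp P) (Comma.snd _ _)
    (𝟙 _) (Comma.natTrans (𝟭 A) P.src)

/-- The inclusions of a direct sum of spans; the projections are their converses. -/
def inlSpan (P Q : GSpan A B) : SpanSpan P (P.sum Q) :=
  SpanSpan.ofFunctor (Q := P.sum Q) (Sum.inl_ _ _) (𝟙 P.tgt) (𝟙 P.src)

def inrSpan (P Q : GSpan A B) : SpanSpan Q (P.sum Q) :=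
  SpanSpan.ofFunctor (Q := P.sum Q) (Sum.inr_ _ _) (𝟙 Q.tgt) (𝟙 Q.src)

end Structural

/-! ## Tameness -/

/-- A groupoid is tame if it is essentially small, locally finite, and of finite groupoid
cardinality. -/
def IsTameGroupoid (X : Type 1) [Category.{0} X] : Prop :=
  EssentiallySmall.{0} X ∧ (∀ x y : X, Finite (x ⟶ y)) ∧
    Summable (fun c : Quotient (isIsomorphicSetoid X) =>
      (Nat.card (Quotient.out c ≅ Quotient.out c) : ℝ)⁻¹)

section Tame

variable {X A B : Type 1} [Groupoid.{0} X] [Groupoid.{0} A] [Groupoid.{0} B]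

/-- The joint (full) preimage of a pair of objects under the legs of a span. -/
def jointPreimage (F : X ⥤ A) (G : X ⥤ B) (a : A) (b : B) : ObjectProperty X :=
  fun x => Nonempty (F.obj x ≅ a) ∧ Nonempty (G.obj x ≅ b)

/-- Tameness of a span `B ← X → A` with source leg `F : X ⥤ A` and target leg `G : X ⥤ B`. -/
def IsTameSpan (F : X ⥤ A) (G : X ⥤ B) : Prop :=
  (∀ a b, IsTameGroupoid (jointPreimage F G a b).FullSubcategory) ∧
  ∀ b, ∃ s : Finset A, ∀ a, (∃ x, jointPreimage F G a b x) → ∃ a' ∈ s, Nonempty (a ≅ a')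

end Tame

section

variable {A B : Type 1} [Groupoid.{0} A] [Groupoid.{0} B]

/-- A span that is both tame and cotame. -/
def GSpan.IsBitame (P : GSpan A B) : Prop := IsTameSpan P.src P.tgt ∧ IsTameSpan P.tgt P.src

/-- A 2-cell represented by a span of spans that is both tame and cotame. -/
def TwoCell.IsBitame {P Q : GSpan A B} (c : TwoCell P Q) : Prop :=
  ∃ Z : SpanSpan P Q, TwoCell.mk Z = c ∧ IsTameSpan Z.top Z.bot ∧ IsTameSpan Z.bot Z.top

end

/-! ## Finite sets and the combinatorial representation `C` -/

/-- A finite set. -/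
structure FS : Type 1 where
  carrier : Type
  [finite : Finite carrier]

attribute [instance] FS.finite

/-- The groupoid of finite sets and bijections. -/
instance : Groupoid.{0} FS where
  Hom S T := S.carrier ≃ T.carrier
  id S := Equiv.refl _
  comp f g := f.trans g
  inv f := f.symm
  inv_comp f := Equiv.symm_trans_self f
  comp_inv f := Equiv.self_trans_symm f

/-- Disjoint union with a one-element set. -/
def plusOne : FS ⥤ FS where
  obj S := ⟨Option S.carrier⟩
  map f := Equiv.optionCongr f
  map_id _ := Equiv.optionCongr_refl
  map_comp f g := Equiv.ext (by rintro (_ | x) <;> rfl)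

/-- The bijection of `S + 1 + 1` exchanging the two added elements. -/
def swapMap (α : Type) : Option (Option α) ≃ Option (Option α) where
  toFun
    | none => some none
    | some none => none
    | some (some x) => some (some x)
  invFun
    | none => some none
    | some none => none
    | some (some x) => some (some x)
  left_inv := by rintro (_ | _ | x) <;> rfl
  right_inv := by rintro (_ | _ | x) <;> rfl

/-- The swap as a natural transformation. -/
def swapTwo : plusOne ⋙ plusOne ⟶ plusOne ⋙ plusOne where
  app S := swapMap S.carrier
  naturality S T f := by
    apply Equiv.ext
    rintro (_ | _ | x) <;> rfl

/-- The annihilation span, with source leg `+1` and target leg the identity. -/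
def annih : GSpan FS FS := ⟨FS, plusOne, 𝟭 FS⟩

/-- The creation span, with source leg the identity and target leg `+1`. -/
def creat : GSpan FS FS := annih.converse

/-- `id ⟶ A ∘ A†`: the identity history of `S` is related to adding and removing the same
element. -/
def iId : SpanSpan (GSpan.idSpan FS) (creat.comp annih) :=
  SpanSpan.ofFunctor (P := GSpan.idSpan FS) (Q := creat.comp annih)
    { obj := fun S => ⟨S, S, 𝟙 _⟩
      map := fun f => ⟨f, f, rfl⟩ }
    (𝟙 (𝟭 FS)) (𝟙 (𝟭 FS))

/-- `A† ∘ A ⟶ A ∘ A†`: removing `x` and then adding `y` is related to adding `y` and then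
removing `x`. -/
def iAA : SpanSpan (annih.comp creat) (creat.comp annih) where
  apex := FS
  top :=
    { obj := fun S => ⟨S, S, 𝟙 _⟩
      map := fun f => ⟨f, f, rfl⟩ }
  bot :=
    { obj := fun S => ⟨plusOne.obj S, plusOne.obj S, swapTwo.app S⟩
      map := fun f => ⟨plusOne.map f, plusOne.map f, swapTwo.naturality f⟩ }
  μ := 𝟙 plusOne
  ν := 𝟙 plusOne

/-- `η : id ⟶ A† ∘ A`: the identity history of `S + 1` is related to removing an element and then
adding it. -/
def etaSpan : SpanSpan (GSpan.idSpan FS) (annih.comp creat) where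
  apex := FS
  top := plusOne
  bot :=
    { obj := fun S => ⟨S, S, 𝟙 _⟩
      map := fun f => ⟨f, f, rfl⟩ }
  μ := 𝟙 plusOne
  ν := 𝟙 plusOne

/-- The action of the transposition on `A† ∘ A†`. -/
def swapCreat : SpanSpan (creat.comp creat) (creat.comp creat) :=
  let d : FS ⥤ (creat.comp creat).apex :=
    { obj := fun S => ⟨S, plusOne.obj S, 𝟙 _⟩
      map := fun f => ⟨f, plusOne.map f, rfl⟩ }
  ⟨FS, d, d, swapTwo, 𝟙 (𝟭 FS)⟩

/-- The action of the transposition on `A ∘ A`. -/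
def swapAnnih : SpanSpan (annih.comp annih) (annih.comp annih) :=
  let d : FS ⥤ (annih.comp annih).apex :=
    { obj := fun S => ⟨plusOne.obj S, S, 𝟙 _⟩
      map := fun f => ⟨plusOne.map f, f, rfl⟩ }
  ⟨FS, d, d, 𝟙 (𝟭 FS), swapTwo⟩

/-- The combinatorial representation on objects: `Q₊` and `Q₋` go to creation and annihilation,
and `X ⊗ Y` goes to the composite "first `Y`, then `X`". -/
def Cobj : HObj → GSpan FS FS
  | .plus => creat
  | .minus => annih
  | .unit => GSpan.idSpan FS
  | .tensor X Y => (Cobj Y).comp (Cobj X)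
  | .zero => GSpan.zeroSpan FS FS
  | .sum X Y => (Cobj X).sum (Cobj Y)

/-- The combinatorial representation on formal morphisms. -/
noncomputable def Cmor : ∀ {X Y : HObj}, HMor ℕ X Y → TwoCell (Cobj X) (Cobj Y)
  | _, _, .id X => .mk (SpanSpan.idTwo (Cobj X))
  | _, _, .comp f g => (Cmor f).vcomp (Cmor g)
  | _, _, .tensor f g => (Cmor g).hcomp (Cmor f)
  | _, _, .assocHom X Y Z => .mk (assocSpan (Cobj Z) (Cobj Y) (Cobj X)).converse
  | _, _, .assocInv X Y Z => .mk (assocSpan (Cobj Z) (Cobj Y) (Cobj X))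
  | _, _, .leftHom X => .mk (unitorSrc (Cobj X))
  | _, _, .leftInv X => .mk (unitorSrc (Cobj X)).converse
  | _, _, .rightHom X => .mk (unitorTgt (Cobj X))
  | _, _, .rightInv X => .mk (unitorTgt (Cobj X)).converse
  | _, _, .zero X Y => .zero (Cobj X) (Cobj Y)
  | _, _, .add f g => (Cmor f).add (Cmor g)
  | _, _, .smul n f => (Cmor f).nsmul n
  | _, _, .inl X Y => .mk (inlSpan (Cobj X) (Cobj Y))
  | _, _, .inr X Y => .mk (inrSpan (Cobj X) (Cobj Y))
  | _, _, .fst X Y => .mk (inlSpan (Cobj X) (Cobj Y)).converse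
  | _, _, .snd X Y => .mk (inrSpan (Cobj X) (Cobj Y)).converse
  | _, _, .cupMP => .mk iId
  | _, _, .capMP => .mk iId.converse
  | _, _, .cupPM => .mk etaSpan
  | _, _, .capPM => .mk etaSpan.converse
  | _, _, .crossPP => .mk swapCreat
  | _, _, .crossMM => .mk swapAnnih
  | _, _, .crossPM => .mk iAA
  | _, _, .crossMP => .mk iAA.converse

/-! ## The 2-linearization `Λ` -/

/-- Complex vector spaces. -/
abbrev Vect : Type 2 := ModuleCat.{1} ℂ

section Lambda

/-- Finite-dimensional representations of a groupoid with essentially finite support, that is,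
finite direct sums of finite-dimensional representations of its vertex groups. -/
def isLam (A : Type 1) [Category.{0} A] : ObjectProperty (A ⥤ Vect) := fun V =>
  (∀ a, Module.Finite ℂ (V.obj a)) ∧
    ∃ s : Finset A, ∀ a, Nontrivial (V.obj a) → ∃ b ∈ s, Nonempty (a ≅ b)

/-- `Λ` on groupoids. -/
abbrev Lam (A : Type 1) [Category.{0} A] : Type 2 := (isLam A).FullSubcategory

variable {A B C : Type 1} [Groupoid.{0} A] [Groupoid.{0} B] [Groupoid.{0} C]

/-- `Λ` on spans: restrict along the source leg, then induce along the target leg. -/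
noncomputable def Lam₁ (P : GSpan A B) : (A ⥤ Vect) ⥤ (B ⥤ Vect) :=
  (Functor.whiskeringLeft _ _ Vect).obj P.src ⋙ P.tgt.lan

section Transfer

variable {Z X : Type 1} [Groupoid.{0} Z] [Groupoid.{0} X]

/-- The contribution of a point of the homotopy fibre of `S` to the transfer map. -/
noncomputable def transferTerm (S : Z ⥤ X) {W U : X ⥤ Vect} (θ : S ⋙ W ⟶ S ⋙ U) {x : X}
    (c : CostructuredArrow S x) : W.obj x ⟶ U.obj x :=
  (Nat.card (c ⟶ c) : ℂ)⁻¹ •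
    (W.map (Groupoid.inv (show S.obj c.left ⟶ x from c.hom)) ≫ θ.app c.left ≫
      U.map (show S.obj c.left ⟶ x from c.hom))

theorem transferTerm_iso (S : Z ⥤ X) {W U : X ⥤ Vect} (θ : S ⋙ W ⟶ S ⋙ U) {x : X}
    {c d : CostructuredArrow S x} (e : c ≅ d) : transferTerm S θ c = transferTerm S θ d := by
  have h1 : Nat.card (c ⟶ c) = Nat.card (d ⟶ d) := Nat.card_congr (e.homCongr e)
  have h2 : S.map e.hom.left ≫ (show S.obj d.left ⟶ x from d.hom) = c.hom :=
    CostructuredArrow.w e.hom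
  have h3 := θ.naturality e.hom.left
  simp only [Functor.comp_map] at h3
  unfold transferTerm
  rw [h1]
  congr 1
  rw [show (show S.obj c.left ⟶ x from c.hom) =
    S.map e.hom.left ≫ (show S.obj d.left ⟶ x from d.hom) from h2.symm]
  simp only [Groupoid.inv_eq_inv, IsIso.inv_comp, Functor.map_comp, Category.assoc,
    Functor.map_inv]
  congr 1
  rw [IsIso.inv_comp_eq, ← Category.assoc, ← Category.assoc, h3]

/-- Isomorphism classes of points of the homotopy fibre of `S` over `x`. -/
abbrev FibreClasses (S : Z ⥤ X) (x : X) : Type 1 :=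
  Quotient (isIsomorphicSetoid (CostructuredArrow S x))

/-- Transport of homotopy fibres along a morphism. -/
noncomputable def fibreEquiv (S : Z ⥤ X) {x y : X} (g : x ⟶ y) :
    FibreClasses S x ≃ FibreClasses S y where
  toFun := Quotient.map (CostructuredArrow.map g).obj
    (fun _ _ ⟨e⟩ => ⟨(CostructuredArrow.map g).mapIso e⟩)
  invFun := Quotient.map (CostructuredArrow.map (inv g)).obj
    (fun _ _ ⟨e⟩ => ⟨(CostructuredArrow.map (inv g)).mapIso e⟩)
  left_inv := by
    rintro ⟨c⟩
    exact Quotient.sound ⟨CostructuredArrow.isoMk (Iso.refl _) (by simp)⟩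
  right_inv := by
    rintro ⟨c⟩
    exact Quotient.sound ⟨CostructuredArrow.isoMk (Iso.refl _) (by simp)⟩

open Classical in
/-- The weighted sum of the contributions of the points of the homotopy fibre of `S` over `x`,
provided that it has finitely many isomorphism classes. -/
noncomputable def transferApp (S : Z ⥤ X) {W U : X ⥤ Vect} (θ : S ⋙ W ⟶ S ⋙ U) (x : X) :
    W.obj x ⟶ U.obj x :=
  if Finite (FibreClasses S x) then
    ∑ᶠ q : FibreClasses S x, transferTerm S θ (Quotient.out q)
  else 0

theorem transferApp_conj (S : Z ⥤ X) {W U W' U' : X ⥤ Vect} (θ : S ⋙ W ⟶ S ⋙ U)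
    (θ' : S ⋙ W' ⟶ S ⋙ U') {x y : X} (g : x ⟶ y) (p : W.obj x ⟶ W'.obj y)
    (r : U.obj x ⟶ U'.obj y)
    (h : ∀ c : CostructuredArrow S x,
      p ≫ transferTerm S θ' ((CostructuredArrow.map g).obj c) = transferTerm S θ c ≫ r) :
    p ≫ transferApp S θ' y = transferApp S θ x ≫ r := by
  unfold transferApp
  by_cases hf : Finite (FibreClasses S x)
  · have hf' : Finite (FibreClasses S y) := (fibreEquiv S g).finite_iff.1 hf
    rw [if_pos hf, if_pos hf', ← finsum_comp_equiv (fibreEquiv S g)]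
    have := Fintype.ofFinite (FibreClasses S x)
    rw [finsum_eq_sum_of_fintype, finsum_eq_sum_of_fintype, Preadditive.comp_sum,
      Preadditive.sum_comp]
    refine Finset.sum_congr rfl fun q _ => ?_
    rw [← h]
    congr 1
    obtain ⟨e⟩ : Nonempty ((fibreEquiv S g q).out ≅ (CostructuredArrow.map g).obj q.out) := by
      apply Quotient.exact (s := isIsomorphicSetoid _)
      rw [Quotient.out_eq]
      conv_lhs => rw [← Quotient.out_eq q]
      rfl
    exact transferTerm_iso S θ' e
  · have hf' : ¬ Finite (FibreClasses S y) := fun h => hf ((fibreEquiv S g).finite_iff.2 h)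
    rw [if_neg hf, if_neg hf', Limits.comp_zero, Limits.zero_comp]

theorem card_map (S : Z ⥤ X) {x y : X} (g : x ⟶ y) (c : CostructuredArrow S x) :
    Nat.card ((CostructuredArrow.map g).obj c ⟶ (CostructuredArrow.map g).obj c) =
      Nat.card (c ⟶ c) :=
  Nat.card_congr
    { toFun := fun f => CostructuredArrow.homMk f.left (by
        have h := CostructuredArrow.w f
        simp only [CostructuredArrow.map_obj_hom, ← Category.assoc] at h
        exact (cancel_mono g).1 h)
      invFun := fun f => (CostructuredArrow.map g).map f
      left_inv := fun f => by ext; rfl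
      right_inv := fun f => by ext; rfl }

/-- The transfer map: the composite
`W ⟶ S_* (S^* W) ≅ S_! (S^* W) ⟶ S_! (S^* U) ⟶ U`
of the unit of `S^* ⊣ S_*`, the isomorphism between right and left Kan extension normalised by
the orders of automorphism groups, `θ`, and the counit of `S_! ⊣ S^*`. -/
noncomputable def transfer (S : Z ⥤ X) (W U : X ⥤ Vect) (θ : S ⋙ W ⟶ S ⋙ U) : W ⟶ U where
  app x := transferApp S θ x
  naturality x y g := by
    apply transferApp_conj S θ θ g
    intro c
    unfold transferTerm
    rw [card_map, Linear.comp_smul, Linear.smul_comp]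
    congr 1
    change W.map g ≫ W.map (Groupoid.inv ((show S.obj c.left ⟶ x from c.hom) ≫ g)) ≫
      θ.app c.left ≫ U.map ((show S.obj c.left ⟶ x from c.hom) ≫ g) = _
    simp only [Groupoid.inv_eq_inv, IsIso.inv_comp, Functor.map_comp, Category.assoc,
      Functor.map_inv, IsIso.hom_inv_id_assoc]

theorem transfer_natural (S : Z ⥤ X) {W U W' U' : X ⥤ Vect} (θ : S ⋙ W ⟶ S ⋙ U)
    (θ' : S ⋙ W' ⟶ S ⋙ U') (p : W ⟶ W') (r : U ⟶ U')
    (h : Functor.whiskerLeft S p ≫ θ' = θ ≫ Functor.whiskerLeft S r) :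
    p ≫ transfer S W' U' θ' = transfer S W U θ ≫ r := by
  ext x : 2
  change p.app x ≫ transferApp S θ' x = transferApp S θ x ≫ r.app x
  apply transferApp_conj S θ θ' (𝟙 x)
  intro c
  have hc : p.app (S.obj c.left) ≫ θ'.app c.left = θ.app c.left ≫ r.app (S.obj c.left) :=
    congrArg (fun t => t.app c.left) h
  unfold transferTerm
  rw [card_map, Linear.comp_smul, Linear.smul_comp]
  congr 1
  change p.app x ≫ W'.map (Groupoid.inv ((show S.obj c.left ⟶ x from c.hom) ≫ 𝟙 x)) ≫
      θ'.app c.left ≫ U'.map ((show S.obj c.left ⟶ x from c.hom) ≫ 𝟙 x) = _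
  simp only [Category.comp_id, Category.assoc, NatTrans.naturality]
  rw [← NatTrans.naturality_assoc, reassoc_of% hc]

end Transfer

variable {P Q : GSpan A B}

/-- The unit of the left Kan extension in the definition of `Λ` on spans. -/
noncomputable def lamUnit (P : GSpan A B) (V : A ⥤ Vect) :
    P.src ⋙ V ⟶ P.tgt ⋙ (Lam₁ P).obj V :=
  P.tgt.lanUnit.app (P.src ⋙ V)

/-- The universal property of the left Kan extension in the definition of `Λ` on spans. -/
noncomputable def lamDesc (P : GSpan A B) (V : A ⥤ Vect) {U : B ⥤ Vect}
    (t : P.src ⋙ V ⟶ P.tgt ⋙ U) : (Lam₁ P).obj V ⟶ U :=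
  ((P.tgt.lanAdjunction Vect).homEquiv _ _).symm t

/-- The natural transformation over the apex of a span of spans from which `Λ` is built. -/
noncomputable def lamCore (Z : SpanSpan P Q) (V : A ⥤ Vect) :
    Z.top ⋙ P.src ⋙ V ⟶ Z.top ⋙ P.tgt ⋙ (Lam₁ Q).obj V :=
  Functor.whiskerRight Z.ν V ≫ Functor.whiskerLeft Z.bot (lamUnit Q V) ≫
    Functor.whiskerRight (inv Z.μ) ((Lam₁ Q).obj V)

theorem paste₃ {D : Type 2} [Category.{1} D] {x₀ x₁ x₂ x₃ y₀ y₁ y₂ y₃ : D} {p₀ : x₀ ⟶ y₀}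
    {p₁ : x₁ ⟶ y₁} {p₂ : x₂ ⟶ y₂} {p₃ : x₃ ⟶ y₃} {a : x₀ ⟶ x₁} {b : x₁ ⟶ x₂} {c : x₂ ⟶ x₃}
    {a' : y₀ ⟶ y₁} {b' : y₁ ⟶ y₂} {c' : y₂ ⟶ y₃} (h₁ : a ≫ p₁ = p₀ ≫ a')
    (h₂ : b ≫ p₂ = p₁ ≫ b') (h₃ : c ≫ p₃ = p₂ ≫ c') :
    p₀ ≫ a' ≫ b' ≫ c' = (a ≫ b ≫ c) ≫ p₃ := by
  rw [← reassoc_of% h₁, ← reassoc_of% h₂, ← h₃, Category.assoc, Category.assoc]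

/-- `Λ` on spans of spans. -/
noncomputable def Lam₂ (Z : SpanSpan P Q) : Lam₁ P ⟶ Lam₁ Q where
  app V := lamDesc P V
    (transfer Z.top (P.src ⋙ V) (P.tgt ⋙ (Lam₁ Q).obj V) (lamCore Z V))
  naturality V V' f := by
    have key : Functor.whiskerLeft P.src f ≫
        transfer Z.top (P.src ⋙ V') (P.tgt ⋙ (Lam₁ Q).obj V') (lamCore Z V') =
        transfer Z.top (P.src ⋙ V) (P.tgt ⋙ (Lam₁ Q).obj V) (lamCore Z V) ≫
          Functor.whiskerLeft P.tgt ((Lam₁ Q).map f) := by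
      apply transfer_natural
      ext z : 2
      exact paste₃ (f.naturality (Z.ν.app z))
        (congrArg (fun t => t.app (Z.bot.obj z))
          (Q.tgt.lanUnit.naturality (Functor.whiskerLeft Q.src f)).symm)
        (((Lam₁ Q).map f).naturality ((inv Z.μ).app z))
    exact ((P.tgt.lanAdjunction Vect).homEquiv_naturality_left_symm _ _).symm.trans
      ((congrArg _ key).trans ((P.tgt.lanAdjunction Vect).homEquiv_naturality_right_symm _ _))


/-- The comparison of `Λ` of a composite span with the composite of the values of `Λ`, determined
by the universal property of induction. -/
noncomputable def lamComp (P : GSpan A B) (P' : GSpan B C) (V : A ⥤ Vect) :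
    (Lam₁ (P.comp P')).obj V ⟶ (Lam₁ P').obj ((Lam₁ P).obj V) :=
  lamDesc (P.comp P') V
    (Functor.whiskerLeft (Comma.fst P.tgt P'.src) (lamUnit P V) ≫
      Functor.whiskerRight (Comma.natTrans P.tgt P'.src) ((Lam₁ P).obj V) ≫
        Functor.whiskerLeft (Comma.snd P.tgt P'.src) (lamUnit P' ((Lam₁ P).obj V)))

/-- The comparison of `Λ` of the identity span with the identity. -/
noncomputable def lamId (V : A ⥤ Vect) : (Lam₁ (GSpan.idSpan A)).obj V ⟶ V :=
  lamDesc (GSpan.idSpan A) V (𝟙 V)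

end Lambda

/-! ## The combinatorial action on `Λ(FS)` -/

/-- The data identifying an action of `H'` on `Λ(FS)` with the composite of `Λ` and `C`. -/
structure Realizes [MonoidalLeftAction (H ℂ) (Lam FS)] where
  /-- An object `X` acts by `Λ(C(X))`. -/
  iso (X : HObj) (V : Lam FS) :
    ((show H ℂ from X) ⊙ₗ V).obj ≅ (Lam₁ (Cobj X)).obj V.obj
  iso_natural (X : HObj) {V W : Lam FS} (f : V ⟶ W) :
    ((show H ℂ from X) ⊴ₗ f).hom ≫ (iso X W).hom = (iso X V).hom ≫ (Lam₁ (Cobj X)).map f.hom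
  /-- A morphism `f` acts by `Λ(C(f))`. -/
  iso_hom {X Y : HObj} (f : HMor ℕ X Y) (Z : SpanSpan (Cobj X) (Cobj Y))
    (hZ : TwoCell.mk Z = Cmor f) (V : Lam FS) :
    (hom (natCast ℂ f) ⊵ₗ V).hom ≫ (iso Y V).hom = (iso X V).hom ≫ (Lam₂ Z).app V.obj
  /-- The associativity constraint is that of `Λ`. -/
  iso_assoc (X Y : HObj) (V : Lam FS) :
    (iso (X.tensor Y) V).hom ≫ lamComp (Cobj Y) (Cobj X) V.obj =
      (αₗ (show H ℂ from X) (show H ℂ from Y) V).hom.hom ≫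
        (iso X ((show H ℂ from Y) ⊙ₗ V)).hom ≫ (Lam₁ (Cobj X)).map (iso Y V).hom
  /-- The unit constraint is that of `Λ`. -/
  iso_unit (V : Lam FS) :
    (iso HObj.unit V).hom ≫ lamId V.obj = (λₗ[H ℂ] V).hom.hom


/-! ## Khovanov's action on representations of the symmetric groups -/

/-- The symmetric group on `n` letters. -/
abbrev Sym (n : ℕ) : Type := Equiv.Perm (Fin n)

/-- The inclusion `S_n ⊆ S_{n+1}` fixing the last letter. -/
noncomputable def incl (n : ℕ) : Sym n →* Sym (n + 1) :=
  Equiv.Perm.viaEmbeddingHom Fin.castSuccEmb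

/-- The last adjacent transposition in `S_{n+2}`. -/
def lastSwap (n : ℕ) : Sym (n + 2) := Equiv.swap (Fin.last n).castSucc (Fin.last (n + 1))

/-- Finite-dimensional objects of `∐_n Rep(S_n)`. -/
def isRepSym : ObjectProperty (∀ n, Rep.{1} ℂ (Sym n)) := fun V =>
  (∀ n, Module.Finite ℂ (V n)) ∧ ∃ N, ∀ n, N ≤ n → Subsingleton (V n)

/-- The category `∐_n Rep(S_n)`: finite direct sums of finite-dimensional representations of
symmetric groups. -/
abbrev RepSym : Type 2 := isRepSym.FullSubcategory

/-- Induction on all representations. -/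
noncomputable def indAll : (∀ n, Rep.{1} ℂ (Sym n)) ⥤ (∀ n, Rep.{1} ℂ (Sym n)) :=
  Functor.pi' fun n => match n with
    | 0 => (Functor.const _).obj (Rep.trivial ℂ (Sym 0) PUnit.{2})
    | m + 1 => Pi.eval _ m ⋙ Rep.indFunctor ℂ (incl m)

/-- Restriction on all representations. -/
noncomputable def resAll : (∀ n, Rep.{1} ℂ (Sym n)) ⥤ (∀ n, Rep.{1} ℂ (Sym n)) :=
  Functor.pi' fun n => Pi.eval _ (n + 1) ⋙ Rep.resFunctor (incl n)

theorem ind_finite {G K : Type} [Group G] [Group K] [Finite K] (φ : G →* K) (V : Rep.{1} ℂ G)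
    [Module.Finite ℂ V] : Module.Finite ℂ (Rep.ind φ V) := by
  have h : Module.Finite ℂ (MonoidAlgebra ℂ K) :=
    Module.Finite.equiv (MonoidAlgebra.coeffLinearEquiv ℂ).symm
  exact Module.Finite.of_surjective
    (Representation.Coinvariants.mk
      (Representation.tprod ((Representation.leftRegular ℂ K).comp φ) V.ρ))
    (Representation.Coinvariants.mk_surjective _)

theorem ind_subsingleton {G K : Type} [Group G] [Group K] (φ : G →* K) (V : Rep.{1} ℂ G)
    [Subsingleton V] : Subsingleton (Rep.ind φ V) :=
  (Representation.Coinvariants.mk_surjective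
    (Representation.tprod ((Representation.leftRegular ℂ K).comp φ) V.ρ)).subsingleton

/-- Induction `Rep(S_n) ⟶ Rep(S_{n+1})`, for all `n`. -/
noncomputable def indSym : RepSym ⥤ RepSym :=
  isRepSym.lift (isRepSym.ι ⋙ indAll) (by
    rintro ⟨V, h1, N, h2⟩
    refine ⟨?_, N + 1, ?_⟩
    · rintro (_ | n)
      · exact inferInstanceAs (Module.Finite ℂ PUnit.{2})
      · have := h1 n
        exact ind_finite (incl n) (V n)
    · rintro (_ | n) hn
      · exact inferInstanceAs (Subsingleton PUnit.{2})
      · have := h2 n (by omega)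
        exact ind_subsingleton (incl n) (V n))

/-- Restriction `Rep(S_{n+1}) ⟶ Rep(S_n)`, for all `n`. -/
noncomputable def resSym : RepSym ⥤ RepSym :=
  isRepSym.lift (isRepSym.ι ⋙ resAll) (by
    rintro ⟨V, h1, N, h2⟩
    exact ⟨fun n => h1 (n + 1), N, fun n hn => h2 (n + 1) (by omega)⟩)

/-- The standard finite set with `n` elements. -/
def finFS (n : ℕ) : FS := ⟨Fin n⟩

/-- The action of `S_n` on the value of `V` at the standard `n`-element set. -/
noncomputable def evalAct (n : ℕ) (V : FS ⥤ Vect) : Representation ℂ (Sym n) (V.obj (finFS n)) where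
  toFun g := (V.map (X := finFS n) (Y := finFS n) g).hom
  map_one' := congrArg ModuleCat.Hom.hom (V.map_id (finFS n))
  map_mul' g h := congrArg ModuleCat.Hom.hom
    (V.map_comp (X := finFS n) (Y := finFS n) (Z := finFS n) h g)

/-- Evaluation at the standard `n`-element set. -/
noncomputable def evalRep (n : ℕ) : (FS ⥤ Vect) ⥤ Rep.{1} ℂ (Sym n) where
  obj V := Rep.of (evalAct n V)
  map {V W} f := Rep.ofHom ⟨(f.app (finFS n)).hom, fun g =>
    congrArg ModuleCat.Hom.hom (f.naturality (X := finFS n) (Y := finFS n) g)⟩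

/-- Evaluation on standard finite sets, as a functor `Λ(FS) ⥤ ∐_n Rep(S_n)`. -/
noncomputable def evalSym : Lam FS ⥤ RepSym :=
  isRepSym.lift ((isLam FS).ι ⋙ Functor.pi' evalRep) (by
    rintro ⟨V, h1, s, h2⟩
    refine ⟨fun n => h1 (finFS n), s.sup (fun S => Nat.card S.carrier) + 1, fun n hn => ?_⟩
    change Subsingleton (V.obj (finFS n))
    by_contra hV
    obtain ⟨b, hb, ⟨e⟩⟩ := h2 (finFS n) (not_subsingleton_iff_nontrivial.1 hV)
    have h3 : Nat.card b.carrier = n := (Nat.card_congr e.hom.symm).trans (Nat.card_fin n)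
    have h4 := Finset.le_sup (f := fun S : FS => Nat.card S.carrier) hb
    simp only [h3] at h4
    omega)

/-- A morphism of `∐_n Rep(S_n)` in degree `n`. -/
noncomputable def degree {V W : RepSym} (f : V ⟶ W) (n : ℕ) : V.obj n →ₗ[ℂ] W.obj n :=
  (f.hom n).hom.toLinearMap

/-- The element `g ⊗ v` of the representation `ℂ[S_{n+1}] ⊗_{ℂ[S_n]} V_n`. -/
noncomputable def indElt (V : RepSym) (n : ℕ) (g : Sym (n + 1)) (v : V.obj n) :
    (indSym.obj V).obj (n + 1) :=
  Representation.IndV.mk (incl n) (V.obj n).ρ g⁻¹ v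

/-- The objects `Q₊` and `Q₋` of `H'`. -/
abbrev qPlus : H ℂ := HObj.plus
abbrev qMinus : H ℂ := HObj.minus

section Khovanov

variable [MonoidalLeftAction (H ℂ) RepSym]

/-- If `X` acts by `F` and `Y` acts by `G`, then `X ⊗ Y` acts by "first `G`, then `F`". -/
noncomputable def pairIso {X Y : H ℂ} {F G : RepSym ⥤ RepSym} (e : ∀ V, X ⊙ₗ V ≅ F.obj V)
    (e' : ∀ V, Y ⊙ₗ V ≅ G.obj V) (V : RepSym) : (X ⊗ Y) ⊙ₗ V ≅ F.obj (G.obj V) :=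
  αₗ X Y V ≪≫ e (Y ⊙ₗ V) ≪≫ F.mapIso (e' V)

/-- The action of `f` on `V` in degree `n`, transported along identifications of its source and
target. -/
noncomputable def actDeg {X Y : H ℂ} (f : X ⟶ Y) {V W W' : RepSym} (e : X ⊙ₗ V ≅ W)
    (e' : Y ⊙ₗ V ≅ W') (n : ℕ) : W.obj n →ₗ[ℂ] W'.obj n :=
  degree (e.inv ≫ f ⊵ₗ V ≫ e'.hom) n

/-- Khovanov's action of `H'` by induction and restriction: `Q₊` acts by induction, `Q₋` by
restriction, and the generating morphisms act by Khovanov's bimodule maps. -/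
structure KhovanovAction where
  indIso (V : RepSym) : qPlus ⊙ₗ V ≅ indSym.obj V
  indIso_natural {V W : RepSym} (f : V ⟶ W) :
    qPlus ⊴ₗ f ≫ (indIso W).hom = (indIso V).hom ≫ indSym.map f
  resIso (V : RepSym) : qMinus ⊙ₗ V ≅ resSym.obj V
  resIso_natural {V W : RepSym} (f : V ⟶ W) :
    qMinus ⊴ₗ f ≫ (resIso W).hom = (resIso V).hom ≫ resSym.map f
  /-- The inclusion `ℂ[S_n] ⟶ ℂ[S_{n+1}]`. -/
  cupMP (V : RepSym) (n : ℕ) (v : V.obj n) :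
    actDeg (hom HMor.cupMP) (λₗ V) (pairIso resIso indIso V) n v = indElt V n 1 v
  /-- The projection `ℂ[S_{n+1}] ⟶ ℂ[S_n]`, which is the identity on `S_n` and kills the other
  permutations. -/
  capMP (V : RepSym) (n : ℕ) (h : Sym n) (v : V.obj n) :
    actDeg (hom HMor.capMP) (pairIso resIso indIso V) (λₗ V) n (indElt V n (incl n h) v) =
      (V.obj n).ρ h v
  capMP_zero (V : RepSym) (n : ℕ) (g : Sym (n + 1)) (hg : g ∉ (incl n).range) (v : V.obj n) :
    actDeg (hom HMor.capMP) (pairIso resIso indIso V) (λₗ V) n (indElt V n g v) = 0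
  /-- The map `ℂ[S_{n+1}] ⟶ ℂ[S_{n+1}] ⊗_{ℂ[S_n]} ℂ[S_{n+1}]` sending `1` to the sum of
  `c ⊗ c⁻¹` over coset representatives. -/
  cupPM (V : RepSym) (n : ℕ) (v : V.obj (n + 1)) :
    actDeg (hom HMor.cupPM) (λₗ V) (pairIso indIso resIso V) (n + 1) v =
      ∑ i : Fin (n + 1), indElt (resSym.obj V) n (Equiv.swap i (Fin.last n))
        ((V.obj (n + 1)).ρ (Equiv.swap i (Fin.last n))⁻¹ v)
  /-- The multiplication `ℂ[S_{n+1}] ⊗_{ℂ[S_n]} ℂ[S_{n+1}] ⟶ ℂ[S_{n+1}]`. -/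
  capPM (V : RepSym) (n : ℕ) (g : Sym (n + 1)) (v : V.obj (n + 1)) :
    actDeg (hom HMor.capPM) (pairIso indIso resIso V) (λₗ V) (n + 1)
      (indElt (resSym.obj V) n g v) = (V.obj (n + 1)).ρ g v
  /-- Right multiplication on `ℂ[S_{n+2}]` by the last adjacent transposition. -/
  crossPP (V : RepSym) (n : ℕ) (g : Sym (n + 2)) (h : Sym (n + 1)) (v : V.obj n) :
    actDeg (hom HMor.crossPP) (pairIso indIso indIso V) (pairIso indIso indIso V) (n + 2)
        (indElt (indSym.obj V) (n + 1) g (indElt V n h v)) =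
      indElt (indSym.obj V) (n + 1) (g * incl (n + 1) h * lastSwap n) (indElt V n 1 v)
  /-- Left multiplication on `ℂ[S_{n+2}]` by the last adjacent transposition. -/
  crossMM (V : RepSym) (n : ℕ) (v : V.obj (n + 2)) :
    actDeg (hom HMor.crossMM) (pairIso resIso resIso V) (pairIso resIso resIso V) n v =
      (V.obj (n + 2)).ρ (lastSwap n) v
  /-- The map `ℂ[S_{n+1}] ⊗_{ℂ[S_n]} ℂ[S_{n+1}] ⟶ ℂ[S_{n+2}]` sending `a ⊗ b` to `a s b`, where
  `s` is the last adjacent transposition. -/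
  crossPM (V : RepSym) (n : ℕ) (g : Sym (n + 1)) (v : V.obj (n + 1)) :
    actDeg (hom HMor.crossPM) (pairIso indIso resIso V) (pairIso resIso indIso V) (n + 1)
        (indElt (resSym.obj V) n g v) =
      indElt V (n + 1) (incl (n + 1) g * lastSwap n) v
  /-- The map `ℂ[S_{n+2}] ⟶ ℂ[S_{n+1}] ⊗_{ℂ[S_n]} ℂ[S_{n+1}]` sending `a s b` to `a ⊗ b` and
  `S_{n+1}` to zero. -/
  crossMP (V : RepSym) (n : ℕ) (a b : Sym (n + 1)) (v : V.obj (n + 1)) :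
    actDeg (hom HMor.crossMP) (pairIso resIso indIso V) (pairIso indIso resIso V) (n + 1)
        (indElt V (n + 1) (incl (n + 1) a * lastSwap n * incl (n + 1) b) v) =
      indElt (resSym.obj V) n a ((V.obj (n + 1)).ρ b v)
  crossMP_zero (V : RepSym) (n : ℕ) (a : Sym (n + 1)) (v : V.obj (n + 1)) :
    actDeg (hom HMor.crossMP) (pairIso resIso indIso V) (pairIso indIso resIso V) (n + 1)
      (indElt V (n + 1) (incl (n + 1) a) v) = 0

end Khovanov

/-- An action of `H'` by `ℂ`-linear functors that is `ℂ`-linear on morphisms. -/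
structure IsLinearAction (D : Type 2) [Category.{1} D] [Preadditive D] [Linear ℂ D]
    [MonoidalLeftAction (H ℂ) D] : Prop where
  act_add (X : H ℂ) {V W : D} (f g : V ⟶ W) : X ⊴ₗ (f + g) = X ⊴ₗ f + X ⊴ₗ g
  act_smul (X : H ℂ) (c : ℂ) {V W : D} (f : V ⟶ W) : X ⊴ₗ (c • f) = c • X ⊴ₗ f
  add_act {X Y : HObj} (f g : HMor ℂ X Y) (V : D) :
    hom (f.add g) ⊵ₗ V = hom f ⊵ₗ V + hom g ⊵ₗ V
  smul_act {X Y : HObj} (c : ℂ) (f : HMor ℂ X Y) (V : D) :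
    hom (f.smul c) ⊵ₗ V = c • hom f ⊵ₗ V

end HeisCat

/-!
The points of the groupoids in sight are histories of finite sets: finite sequences of steps which
add a point to a finite set or remove one from it, with identifications in between. The theorem
holds because every 2-cell involved is determined by what it does to histories.

*Tameness.* The functor `+1 : FS ⥤ FS` is a finite covering (`isCover_plusOne`): it is faithful, and
its homotopy fibre over `T` is the set of elements of `T`. Finite coverings are stable under
composition, weak pullback and disjoint union, so that all spans `C(X)` and all spans of spans in
the classes `C(f)` have finite coverings as legs (`isCover_Cobj`, `isCover_Cmor`). Over a groupoid
with finite hom-sets such spans are tame in both directions (`isTameSpan_of_isCover`).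

*Relations of `H'`.* Classes of spans of spans form a category enriched in commutative monoids, with
a horizontal composition that satisfies the interchange law, is bilinear and has natural associators
and unitors. This yields the structural relations. A span of spans whose first leg is an equivalence
is a map between histories, and is determined by the histories to which it relates those from a set
of representatives (`SpanSpan.equiv_of_rel`); hence an isotopy, coherence or braid relation is
checked by following one history through both sides. The first Heisenberg relation says that a
history "add `x`, then remove `y`" has either `y = x` or `y ≠ x`, in which case the two steps can be
exchanged (`isEquivalence_heisenberg`). The curl vanishes because no history in its middle layer
removes the point which the preceding step adds (`Cmor_curl`).

*Linearization.* `Λ(P)(V)(b)` is a colimit over the homotopy fibre of the target leg of `P`, so maps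
out of it are determined on the maps `lamTo` given by histories. A transfer along a faithful functor
is a sum over representatives of the points of its homotopy fibre, all weights being one
(`transferApp_eq_sum`), whence `Λ` of a span of spans sends a history to the sum of the histories
related to it (`lamTo_Lam₂`). Since homotopy fibres of composites are built from pairs of points of
homotopy fibres, `Λ` respects equivalence, sums and both compositions (`Lam₂_eq_of_equiv`,
`Lam₂_add`, `Lam₂_vcomp`, `Lam₂_hcomp`), and it takes the associators and unitors to the comparison
maps (`Lam₂_assocSpan`, `Lam₂_unitorSrc`, `Lam₂_unitorTgt`). Each relation of `H'` over `ℂ` is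
either a formal property of natural transformations or the image of a relation over `ℕ`
(`Lmor_eq_of_hRel`); this gives the action `lamAction`.

*Representations of symmetric groups.* A family of representations of the symmetric groups extends
to all finite sets as the equivariant functions on the identifications of a finite set with a
standard one, so evaluation on the standard sets is an equivalence, along which the action is
transported (`symAction`). A history "add a point to `{1, …, n}`, and identify the result with
`{1, …, n + 1}` by `g`" corresponds to `g ⊗ v` in the induced representation, and the removal of the
last point to restriction (`indIsoPlus`, `resIsoMinus`). Reading the generating spans of spans in
terms of histories of standard sets then yields Khovanov's bimodule maps; the sum over coset
representatives in the cup `1 → Q₊Q₋` is the sum over the points of the homotopy fibre of `+1`.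
-/

/-! ### Finite coverings of groupoids -/


namespace HeisCat

section Covers

variable {X Y Z : Type 1} [Groupoid.{0} X] [Groupoid.{0} Y] [Groupoid.{0} Z]

/-- A finite covering of groupoids: a faithful functor whose homotopy fibres have finitely many
isomorphism classes. Faithfulness says that the homotopy fibres are equivalent to sets. -/
structure IsCover (F : X ⥤ Y) : Prop where
  faithful : F.Faithful
  finite (y : Y) : Finite (FibreClasses F y)

/-- The point of the homotopy fibre of `F` over `y` given by `x` and `h : F x ⟶ y`. -/
abbrev fibrePoint (F : X ⥤ Y) {y : Y} (x : X) (h : F.obj x ⟶ y) : CostructuredArrow F y :=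
  CostructuredArrow.mk h

/-- Isomorphism of points of a homotopy fibre, in terms of maps upstairs. -/
theorem fibreClasses_eq_iff {F : X ⥤ Y} {y : Y} {c d : CostructuredArrow F y} :
    (Quotient.mk _ c : FibreClasses F y) = Quotient.mk _ d ↔
      ∃ k : c.left ⟶ d.left, F.map k ≫ d.hom = c.hom := by
  constructor
  · intro h
    obtain ⟨e⟩ := Quotient.exact (s := isIsomorphicSetoid _) h
    exact ⟨e.hom.left, CostructuredArrow.w e.hom⟩
  · rintro ⟨k, hk⟩
    exact Quotient.sound (s := isIsomorphicSetoid _)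
      ⟨CostructuredArrow.isoMk ((Groupoid.isoEquivHom _ _).symm k) hk⟩

/-- A homotopy fibre has finitely many isomorphism classes if finitely many of its points represent
all of them. -/
theorem finite_fibreClasses {F : X ⥤ Y} {y : Y} {T : Type*} [Finite T]
    (φ : T → CostructuredArrow F y)
    (h : ∀ c : CostructuredArrow F y, ∃ (t : T) (k : c.left ⟶ (φ t).left),
      F.map k ≫ (φ t).hom = c.hom) :
    Finite (FibreClasses F y) :=
  Finite.of_surjective (fun t => Quotient.mk _ (φ t)) <| by
    rintro ⟨c⟩
    obtain ⟨t, k, hk⟩ := h c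
    exact ⟨t, (fibreClasses_eq_iff.2 ⟨k, hk⟩).symm⟩

theorem exists_hom_out {F : X ⥤ Y} {y : Y} (c : CostructuredArrow F y) :
    ∃ (q : FibreClasses F y) (k : c.left ⟶ q.out.left), F.map k ≫ q.out.hom = c.hom :=
  ⟨Quotient.mk _ c, fibreClasses_eq_iff.1 (Quotient.out_eq _).symm⟩

theorem exists_hom_out' {F : X ⥤ Y} {y : Y} (x : X) (h : F.obj x ⟶ y) :
    ∃ (q : FibreClasses F y) (k : x ⟶ q.out.left), F.map k ≫ q.out.hom = h :=
  exists_hom_out (CostructuredArrow.mk h)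

namespace IsCover

theorem comp {F : X ⥤ Y} {G : Y ⥤ Z} (hF : IsCover F) (hG : IsCover G) : IsCover (F ⋙ G) where
  faithful := by have := hF.faithful; have := hG.faithful; infer_instance
  finite z := by
    have := hG.finite z
    have := hF.finite
    refine finite_fibreClasses (T := Σ q : FibreClasses G z, FibreClasses F q.out.left)
      (fun t => CostructuredArrow.mk (Y := t.2.out.left) (G.map t.2.out.hom ≫ t.1.out.hom))
      fun c => ?_
    obtain ⟨q, k, hk⟩ := exists_hom_out' (F := G) (F.obj c.left) c.hom
    obtain ⟨r, m, hm⟩ := exists_hom_out' c.left k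
    refine ⟨⟨q, r⟩, m, ?_⟩
    change G.map (F.map m) ≫ G.map r.out.hom ≫ q.out.hom = c.hom
    rw [← hk, ← hm, Functor.map_comp, Category.assoc]

/-- Cancellation: `F` is a covering if `F ⋙ G` is one and `G` is faithful. Distinct points of a
homotopy fibre of `F` stay distinct in the homotopy fibre of `F ⋙ G`. -/
theorem of_comp {F : X ⥤ Y} {G : Y ⥤ Z} (h : IsCover (F ⋙ G)) (hG : G.Faithful) :
    IsCover F where
  faithful := by have := h.faithful; exact Functor.Faithful.of_comp F G
  finite y := by
    have := h.finite (G.obj y)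
    refine Finite.of_injective (β := FibreClasses (F ⋙ G) (G.obj y))
      (Quotient.map (fun c => CostructuredArrow.mk (Y := c.left) (G.map c.hom)) ?_) ?_
    · rintro c d ⟨e⟩
      exact ⟨CostructuredArrow.isoMk
        ((CategoryTheory.CostructuredArrow.proj F y).mapIso e) (by simp [← Functor.map_comp])⟩
    · rintro ⟨c⟩ ⟨d⟩ e
      obtain ⟨k, hk⟩ := fibreClasses_eq_iff.1 e
      refine fibreClasses_eq_iff.2 ⟨k, G.map_injective ?_⟩
      rw [Functor.map_comp]
      exact hk

theorem of_iso {F G : X ⥤ Y} (h : IsCover F) (α : F ⟶ G) : IsCover G where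
  faithful := by have := h.faithful; exact Functor.Faithful.of_iso (asIso α)
  finite y := by
    have := h.finite y
    refine finite_fibreClasses (T := FibreClasses F y)
      (fun q => CostructuredArrow.mk (Y := q.out.left) (inv (α.app q.out.left) ≫ q.out.hom))
      fun c => ?_
    obtain ⟨q, k, hk⟩ := exists_hom_out' c.left (α.app c.left ≫ c.hom)
    refine ⟨q, k, ?_⟩
    change G.map k ≫ inv (α.app _) ≫ q.out.hom = c.hom
    rw [← cancel_epi (α.app c.left), ← NatTrans.naturality_assoc, IsIso.hom_inv_id_assoc, hk]

theorem of_isEquivalence (F : X ⥤ Y) [F.IsEquivalence] : IsCover F where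
  faithful := inferInstance
  finite y := by
    refine finite_fibreClasses (T := Unit)
      (fun _ => CostructuredArrow.mk (F.objObjPreimageIso y).hom) fun c => ?_
    refine ⟨(), F.preimage (c.hom ≫ (F.objObjPreimageIso y).inv), ?_⟩
    simp

theorem id (X : Type 1) [Groupoid.{0} X] : IsCover (𝟭 X) := of_isEquivalence _

/-- Finite coverings are stable under weak pullback. -/
theorem fst {G : X ⥤ Z} {J : Y ⥤ Z} (h : IsCover J) : IsCover (Comma.fst G J) where
  faithful := ⟨fun {a b} f g e => by
    have := h.faithful
    refine Comma.hom_ext _ _ e (J.map_injective ?_)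
    rw [← cancel_epi a.hom, ← f.w, ← g.w]
    exact congrArg (fun t => G.map t ≫ b.hom) e⟩
  finite x := by
    have := h.finite (G.obj x)
    refine finite_fibreClasses (T := FibreClasses J (G.obj x))
      (fun q => fibrePoint (Comma.fst G J) ⟨x, q.out.left, inv q.out.hom⟩ (𝟙 x)) fun c => ?_
    obtain ⟨q, k, hk⟩ := exists_hom_out' c.left.right (inv c.left.hom ≫ G.map c.hom)
    refine ⟨q, ⟨c.hom, k, ?_⟩, Category.comp_id _⟩
    change G.map c.hom ≫ inv q.out.hom = c.left.hom ≫ J.map k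
    rw [IsIso.comp_inv_eq, Category.assoc, hk, IsIso.hom_inv_id_assoc]

/-- Finite coverings are stable under weak pullback. -/
theorem snd {G : X ⥤ Z} {J : Y ⥤ Z} (h : IsCover G) : IsCover (Comma.snd G J) where
  faithful := ⟨fun {a b} f g e => by
    have := h.faithful
    refine Comma.hom_ext _ _ (G.map_injective ?_) e
    rw [← cancel_mono b.hom, f.w, g.w]
    exact congrArg (fun t => a.hom ≫ J.map t) e⟩
  finite y := by
    have := h.finite (J.obj y)
    refine finite_fibreClasses (T := FibreClasses G (J.obj y))
      (fun q => fibrePoint (Comma.snd G J) ⟨q.out.left, y, q.out.hom⟩ (𝟙 y)) fun c => ?_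
    obtain ⟨q, k, hk⟩ := exists_hom_out' c.left.left (c.left.hom ≫ J.map c.hom)
    exact ⟨q, ⟨k, c.hom, hk⟩, Category.comp_id _⟩

theorem sum' {F : X ⥤ Z} {G : Y ⥤ Z} (hF : IsCover F) (hG : IsCover G) :
    IsCover (Functor.sum' F G) where
  faithful := ⟨by
    have := hF.faithful
    have := hG.faithful
    rintro (a | a) (b | b) ⟨f⟩ ⟨g⟩ e
    · exact congrArg ULift.up (F.map_injective e)
    · exact congrArg ULift.up (G.map_injective e)⟩
  finite z := by
    have := hF.finite z
    have := hG.finite z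
    refine finite_fibreClasses (T := FibreClasses F z ⊕ FibreClasses G z)
      (Sum.elim
        (fun q => fibrePoint (Functor.sum' F G) (.inl q.out.left) q.out.hom)
        (fun q => fibrePoint (Functor.sum' F G) (.inr q.out.left) q.out.hom))
      ?_
    rintro ⟨a | a, ⟨⟨⟩⟩, h⟩
    · obtain ⟨q, k, hk⟩ := exists_hom_out' (F := F) a h
      exact ⟨.inl q, ⟨k⟩, hk⟩
    · obtain ⟨q, k, hk⟩ := exists_hom_out' (F := G) a h
      exact ⟨.inr q, ⟨k⟩, hk⟩

theorem inl_ : IsCover (Sum.inl_ X Y) where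
  faithful := ⟨fun e => congrArg ULift.down e⟩
  finite z := by
    rcases z with z | z
    · refine finite_fibreClasses (T := Unit)
        (fun _ => fibrePoint (Sum.inl_ X Y) z (𝟙 _)) fun c => ?_
      exact ⟨(), c.hom.down, congrArg ULift.up (Category.comp_id _)⟩
    · exact finite_fibreClasses (T := Empty) (fun t => t.elim) fun c => nomatch c.hom

theorem inr_ : IsCover (Sum.inr_ X Y) where
  faithful := ⟨fun e => congrArg ULift.down e⟩
  finite z := by
    rcases z with z | z
    · exact finite_fibreClasses (T := Empty) (fun t => t.elim) fun c => nomatch c.hom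
    · refine finite_fibreClasses (T := Unit)
        (fun _ => fibrePoint (Sum.inr_ X Y) z (𝟙 _)) fun c => ?_
      exact ⟨(), c.hom.down, congrArg ULift.up (Category.comp_id _)⟩

theorem empty : IsCover (emptyFunctor X) where
  faithful := ⟨fun {a} => a.elim⟩
  finite _ := finite_fibreClasses (T := Empty) (fun t => t.elim) fun c => c.left.elim

end IsCover

theorem exists_optionCongr {α β : Type} (e : Option α ≃ Option β) (h : e none = none) :
    ∃ e' : α ≃ β, Equiv.optionCongr e' = e := by
  refine ⟨Equiv.removeNone e, Equiv.ext ?_⟩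
  rintro (_ | x)
  · exact h.symm
  · refine Equiv.removeNone_some e ?_
    rcases hx : e (some x) with _ | y
    · exact absurd (e.injective (hx.trans h.symm)) (by simp)
    · exact ⟨y, rfl⟩

/-- The label of a point `S + 1 ≃ T` of the homotopy fibre of `+1` over `T`: the image of the
added element. -/
def addedElement {T : FS} (c : CostructuredArrow plusOne T) : T.carrier :=
  (show Option c.left.carrier ≃ T.carrier from c.hom) none

theorem exists_hom_of_addedElement_eq {T : FS} {c d : CostructuredArrow plusOne T}
    (h : addedElement c = addedElement d) :
    ∃ k : c.left ⟶ d.left, plusOne.map k ≫ d.hom = c.hom := by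
  let a : Option c.left.carrier ≃ T.carrier := c.hom
  let b : Option d.left.carrier ≃ T.carrier := d.hom
  have h' : a none = b none := h
  obtain ⟨k, hk⟩ := exists_optionCongr (a.trans b.symm) (by simp [h'])
  refine ⟨k, ?_⟩
  change (Equiv.optionCongr k).trans b = a
  rw [hk, Equiv.trans_assoc, Equiv.symm_trans_self, Equiv.trans_refl]

/-- The homotopy fibre of `+1` over `T` is the finite set `T`. -/
theorem isCover_plusOne : IsCover plusOne where
  faithful := ⟨fun {S T} f g e => Equiv.ext fun x =>
    Option.some_injective _ (congrArg (fun k : Option _ ≃ Option _ => k (some x)) e)⟩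
  finite T := by
    refine Finite.of_injective (β := T.carrier) (fun q => addedElement q.out) fun q r e => ?_
    rw [← Quotient.out_eq q, ← Quotient.out_eq r, fibreClasses_eq_iff]
    exact exists_hom_of_addedElement_eq e

/-! ### Tameness -/

theorem isTameGroupoid_of_finite {X : Type 1} [Category.{0} X] [hX : ∀ x y : X, Finite (x ⟶ y)]
    [Finite (Quotient (isIsomorphicSetoid X))] : IsTameGroupoid X := by
  refine ⟨?_, hX, Summable.of_finite⟩
  rw [essentiallySmall_iff]
  refine ⟨?_, inferInstance⟩
  have : Finite (Skeleton X) := inferInstanceAs (Finite (Quotient (isIsomorphicSetoid X)))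
  infer_instance

/-- A locally finite groupoid: all of its hom-sets are finite. -/
abbrev LocallyFinite (X : Type 1) [Category.{0} X] : Prop := ∀ x y : X, Finite (x ⟶ y)

theorem IsCover.locallyFinite {F : X ⥤ Y} (h : IsCover F) (hY : LocallyFinite Y) :
    LocallyFinite X := fun x y =>
  have := h.faithful
  have := hY (F.obj x) (F.obj y)
  Finite.of_injective (F.map : (x ⟶ y) → _) F.map_injective

/-- A span both of whose legs are finite coverings is tame. -/
theorem isTameSpan_of_isCover (hX : LocallyFinite X) {F : X ⥤ Y} {G : X ⥤ Z} (hF : IsCover F)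
    (hG : IsCover G) : IsTameSpan F G := by
  constructor
  · intro a b
    have := hF.finite a
    have hf : LocallyFinite (jointPreimage F G a b).FullSubcategory := fun x y =>
      have := hX x.1 y.1
      Finite.of_injective (fun f : x ⟶ y => f.hom) fun f g e => by ext; exact e
    have : Finite (Quotient (isIsomorphicSetoid (jointPreimage F G a b).FullSubcategory)) := by
      have k (x : (jointPreimage F G a b).FullSubcategory) : F.obj x.1 ≅ a := x.2.1.some
      refine Finite.of_injective (β := FibreClasses F a)
        (fun q => Quotient.mk _ (fibrePoint F q.out.1 (k q.out).hom)) fun q r e => ?_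
      obtain ⟨m, -⟩ := fibreClasses_eq_iff.1 e
      rw [← Quotient.out_eq q, ← Quotient.out_eq r]
      exact Quotient.sound (s := isIsomorphicSetoid _)
        ⟨(ObjectProperty.fullyFaithfulι _).preimageIso ((Groupoid.isoEquivHom _ _).symm m)⟩
    exact isTameGroupoid_of_finite
  · intro b
    classical
    have := hG.finite b
    have := Fintype.ofFinite (FibreClasses G b)
    refine ⟨Finset.univ.image fun q : FibreClasses G b => F.obj q.out.left, ?_⟩
    rintro a ⟨x, ⟨i⟩, ⟨j⟩⟩
    obtain ⟨q, k, -⟩ := exists_hom_out' x j.hom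
    exact ⟨_, Finset.mem_image_of_mem _ (Finset.mem_univ q),
      ⟨i.symm ≪≫ F.mapIso ((Groupoid.isoEquivHom _ _).symm k)⟩⟩

end Covers

theorem locallyFinite_FS : LocallyFinite FS := fun S T =>
  inferInstanceAs (Finite (S.carrier ≃ T.carrier))

theorem FS.nonempty_iso_iff {S T : FS} :
    Nonempty (S ≅ T) ↔ Nat.card S.carrier = Nat.card T.carrier := by
  constructor
  · rintro ⟨e⟩
    exact Nat.card_congr e.hom
  · intro h
    have := Fintype.ofFinite S.carrier
    have := Fintype.ofFinite T.carrier
    rw [Nat.card_eq_fintype_card, Nat.card_eq_fintype_card] at h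
    exact ⟨(Groupoid.isoEquivHom S T).symm (Fintype.equivOfCardEq h)⟩

/-- The groupoid of finite sets has finite cardinality `∑ 1 / n!`. -/
theorem isTameGroupoid_FS : IsTameGroupoid FS := by
  let f : Quotient (isIsomorphicSetoid FS) → ℕ := fun q => Nat.card q.out.carrier
  have hf : Function.Injective f := fun q r e => by
    rw [← Quotient.out_eq q, ← Quotient.out_eq r]
    exact Quotient.sound (s := isIsomorphicSetoid _) (FS.nonempty_iso_iff.2 e)
  refine ⟨?_, locallyFinite_FS, ?_⟩
  · rw [essentiallySmall_iff]
    exact ⟨small_of_injective (α := Skeleton FS) hf, inferInstance⟩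
  · have h : ∀ q : Quotient (isIsomorphicSetoid FS),
        (Nat.card (q.out ≅ q.out) : ℝ)⁻¹ = ((f q).factorial : ℝ)⁻¹ := fun q => by
      rw [Nat.card_congr (Groupoid.isoEquivHom q.out q.out)]
      have : Nat.card (q.out ⟶ q.out) = (f q).factorial := Nat.card_perm
      rw [this]
    simp_rw [h]
    have := (Real.summable_pow_div_factorial 1).comp_injective hf
    simpa [Function.comp_def] using this

/-! ### Spans and spans of spans with finite coverings as legs -/

section Bitame

variable {A B C : Type 1} [Groupoid.{0} A] [Groupoid.{0} B] [Groupoid.{0} C]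

/-- A span of groupoids both of whose legs are finite coverings. -/
structure GSpan.IsCover (P : GSpan A B) : Prop where
  src : HeisCat.IsCover P.src
  tgt : HeisCat.IsCover P.tgt

/-- A span of spans both of whose legs are finite coverings. -/
structure SpanSpan.IsCover {P Q : GSpan A B} (Z : SpanSpan P Q) : Prop where
  top : HeisCat.IsCover Z.top
  bot : HeisCat.IsCover Z.bot

theorem GSpan.IsCover.comp {P : GSpan A B} {P' : GSpan B C} (h : P.IsCover) (h' : P'.IsCover) :
    (P.comp P').IsCover where
  src := h'.src.fst.comp h.src
  tgt := h.tgt.snd.comp h'.tgt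

theorem GSpan.IsCover.isBitame {P : GSpan A B} (h : P.IsCover) (hA : LocallyFinite A) :
    P.IsBitame :=
  have := h.src.locallyFinite hA
  ⟨isTameSpan_of_isCover this h.src h.tgt, isTameSpan_of_isCover this h.tgt h.src⟩

/-- The span of every object of `H'` is composed of annihilation and creation spans by weak
pullback and disjoint union, hence has finite coverings as legs. -/
theorem isCover_Cobj (X : HObj) : (Cobj X).IsCover := by
  induction X with
  | plus => exact ⟨.id FS, isCover_plusOne⟩
  | minus => exact ⟨isCover_plusOne, .id FS⟩
  | unit => exact ⟨.id FS, .id FS⟩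
  | tensor X Y hX hY => exact hY.comp hX
  | zero => exact ⟨.empty, .empty⟩
  | sum X Y hX hY => exact ⟨hX.src.sum' hY.src, hX.tgt.sum' hY.tgt⟩

namespace SpanSpan.IsCover

variable {P Q R : GSpan A B} {P' Q' : GSpan B C}

theorem of_equiv {Z W : SpanSpan P Q} (hZ : Z.IsCover) (h : Z.Equiv W) : W.IsCover := by
  obtain ⟨U, hU, σ, τ, -, -⟩ := h.symm
  exact ⟨((HeisCat.IsCover.of_isEquivalence U).comp hZ.top).of_iso (inv σ),
    ((HeisCat.IsCover.of_isEquivalence U).comp hZ.bot).of_iso (inv τ)⟩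

theorem converse {Z : SpanSpan P Q} (hZ : Z.IsCover) : Z.converse.IsCover := ⟨hZ.bot, hZ.top⟩

theorem ofFunctor {F : P.apex ⥤ Q.apex} {μ : P.tgt ⟶ F ⋙ Q.tgt} {ν : P.src ⟶ F ⋙ Q.src}
    (hF : HeisCat.IsCover F) : (SpanSpan.ofFunctor F μ ν).IsCover := ⟨.id _, hF⟩

theorem vcomp {Z : SpanSpan P Q} {W : SpanSpan Q R} (hZ : Z.IsCover) (hW : W.IsCover) :
    (Z.vcomp W).IsCover :=
  ⟨hW.top.fst.comp hZ.top, hZ.bot.snd.comp hW.bot⟩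

theorem add {Z W : SpanSpan P Q} (hZ : Z.IsCover) (hW : W.IsCover) : (Z.add W).IsCover :=
  ⟨hZ.top.sum' hW.top, hZ.bot.sum' hW.bot⟩

theorem zeroTwo : (SpanSpan.zeroTwo P Q).IsCover := ⟨.empty, .empty⟩

/-- The legs of a horizontal composite are covers: after composition with the faithful legs of
`P.comp P'` and `Q.comp Q'` they become composites of covers. -/
theorem hcomp {Z : SpanSpan P Q} {W : SpanSpan P' Q'} (hP : P'.IsCover) (hQ : Q'.IsCover)
    (hZ : Z.IsCover) (hW : W.IsCover) :
    (Z.hcomp W).IsCover :=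
  ⟨.of_comp (G := Comma.fst P.tgt P'.src)
      (show HeisCat.IsCover (Comma.fst (Z.top ⋙ P.tgt) (W.top ⋙ P'.src) ⋙ Z.top) from
        (hW.top.comp hP.src).fst.comp hZ.top) hP.src.fst.faithful,
    .of_comp (G := Comma.fst Q.tgt Q'.src)
      (show HeisCat.IsCover (Comma.fst (Z.top ⋙ P.tgt) (W.top ⋙ P'.src) ⋙ Z.bot) from
        (hW.top.comp hP.src).fst.comp hZ.bot) hQ.src.fst.faithful⟩

end SpanSpan.IsCover

/-- A 2-cell all of whose representatives have finite coverings as legs. -/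
def TwoCell.IsCover {P Q : GSpan A B} (c : TwoCell P Q) : Prop :=
  ∀ Z : SpanSpan P Q, TwoCell.mk Z = c → Z.IsCover

theorem TwoCell.isCover_mk {P Q : GSpan A B} {Z : SpanSpan P Q} (h : Z.IsCover) :
    (TwoCell.mk Z).IsCover := fun _ hW =>
  h.of_equiv (Quotient.exact hW.symm)

theorem TwoCell.IsCover.isBitame {P Q : GSpan A B} (hP : P.IsCover) (hA : LocallyFinite A)
    {c : TwoCell P Q} (h : c.IsCover) : c.IsBitame := by
  obtain ⟨Z, rfl⟩ := Quotient.exists_rep c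
  have hZ := h Z rfl
  have := (hZ.top.comp hP.src).locallyFinite hA
  exact ⟨Z, rfl, isTameSpan_of_isCover this hZ.top hZ.bot, isTameSpan_of_isCover this hZ.bot hZ.top⟩

end Bitame

section Generators

theorem isCover_fst_id {X B : Type 1} [Groupoid.{0} X] [Groupoid.{0} B] (G : X ⥤ B) :
    IsCover (Comma.fst G (𝟭 B)) := (IsCover.id B).fst

theorem isCover_iId : iId.IsCover :=
  ⟨.id FS, .of_comp (G := Comma.fst plusOne plusOne) (.id FS) isCover_plusOne.fst.faithful⟩

theorem isCover_iAA : iAA.IsCover :=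
  ⟨.of_comp (G := Comma.fst (𝟭 FS) (𝟭 FS)) (.id FS) (isCover_fst_id _).faithful,
    .of_comp (G := Comma.fst plusOne plusOne) isCover_plusOne isCover_plusOne.fst.faithful⟩

theorem isCover_etaSpan : etaSpan.IsCover :=
  ⟨isCover_plusOne, .of_comp (G := Comma.fst (𝟭 FS) (𝟭 FS)) (.id FS) (isCover_fst_id _).faithful⟩

theorem isCover_swapCreat : swapCreat.IsCover :=
  have h : IsCover swapCreat.top :=
    .of_comp (G := Comma.fst plusOne (𝟭 FS)) (.id FS) (isCover_fst_id _).faithful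
  ⟨h, h⟩

theorem isCover_swapAnnih : swapAnnih.IsCover :=
  have h : IsCover swapAnnih.top :=
    .of_comp (G := Comma.snd (𝟭 FS) plusOne) (.id FS) (IsCover.id FS).snd.faithful
  ⟨h, h⟩

end Generators

section

variable {A B C D : Type 1} [Groupoid.{0} A] [Groupoid.{0} B] [Groupoid.{0} C] [Groupoid.{0} D]

theorem isCover_assocSpan {P : GSpan A B} {P' : GSpan B C} {P'' : GSpan C D} (h : P'.IsCover)
    (h' : P''.IsCover) : (assocSpan P P' P'').IsCover :=
  .ofFunctor (.of_comp (G := Comma.fst P.tgt (P'.comp P'').src)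
    (show IsCover (Comma.fst (P.comp P').tgt P''.src ⋙ Comma.fst P.tgt P'.src) from
      h'.src.fst.comp h.src.fst)
      (h.comp h').src.fst.faithful)

end

theorem TwoCell.IsCover.nsmul {A B : Type 1} [Groupoid.{0} A] [Groupoid.{0} B] {P Q : GSpan A B}
    {c : TwoCell P Q} (h : c.IsCover) (n : ℕ) : (TwoCell.nsmul n c).IsCover := by
  obtain ⟨Z, rfl⟩ := Quotient.exists_rep c
  induction n with
  | zero => exact TwoCell.isCover_mk .zeroTwo
  | succ n ih =>
    obtain ⟨W, hW⟩ := Quotient.exists_rep (TwoCell.nsmul n (Quotient.mk _ Z))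
    have : TwoCell.nsmul (n + 1) (Quotient.mk _ Z) = TwoCell.mk (W.add Z) := by
      change TwoCell.add (TwoCell.nsmul n _) _ = _
      rw [← hW]; rfl
    rw [this]
    exact TwoCell.isCover_mk (.add (ih W hW) (h Z rfl))

/-- Every representative of the class of a formal morphism has finite coverings as legs. -/
theorem isCover_Cmor {X Y : HObj} (f : HMor ℕ X Y) : (Cmor f).IsCover := by
  induction f with
  | id X => exact TwoCell.isCover_mk (.ofFunctor (.id _))
  | comp f g hf hg =>
    obtain ⟨Z, hZ⟩ := Quotient.exists_rep (Cmor f)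
    obtain ⟨W, hW⟩ := Quotient.exists_rep (Cmor g)
    rw [Cmor, ← hZ, ← hW]
    exact TwoCell.isCover_mk ((hf Z hZ).vcomp (hg W hW))
  | tensor f g hf hg =>
    obtain ⟨Z, hZ⟩ := Quotient.exists_rep (Cmor f)
    obtain ⟨W, hW⟩ := Quotient.exists_rep (Cmor g)
    rw [Cmor, ← hZ, ← hW]
    exact TwoCell.isCover_mk ((hg W hW).hcomp (isCover_Cobj _) (isCover_Cobj _) (hf Z hZ))
  | assocHom X Y Z =>
    exact TwoCell.isCover_mk (isCover_assocSpan (isCover_Cobj _) (isCover_Cobj _)).converse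
  | assocInv X Y Z =>
    exact TwoCell.isCover_mk (isCover_assocSpan (isCover_Cobj _) (isCover_Cobj _))
  | leftHom X => exact TwoCell.isCover_mk (.ofFunctor (isCover_fst_id _))
  | leftInv X => exact TwoCell.isCover_mk (SpanSpan.IsCover.ofFunctor (isCover_fst_id _)).converse
  | rightHom X => exact TwoCell.isCover_mk (.ofFunctor (IsCover.id FS).snd)
  | rightInv X => exact TwoCell.isCover_mk (SpanSpan.IsCover.ofFunctor (IsCover.id FS).snd).converse
  | zero X Y => exact TwoCell.isCover_mk .zeroTwo
  | add f g hf hg =>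
    obtain ⟨Z, hZ⟩ := Quotient.exists_rep (Cmor f)
    obtain ⟨W, hW⟩ := Quotient.exists_rep (Cmor g)
    rw [Cmor, ← hZ, ← hW]
    exact TwoCell.isCover_mk ((hf Z hZ).add (hg W hW))
  | smul n f hf => exact hf.nsmul n
  | inl X Y => exact TwoCell.isCover_mk (.ofFunctor .inl_)
  | inr X Y => exact TwoCell.isCover_mk (.ofFunctor .inr_)
  | fst X Y => exact TwoCell.isCover_mk (SpanSpan.IsCover.ofFunctor .inl_).converse
  | snd X Y => exact TwoCell.isCover_mk (SpanSpan.IsCover.ofFunctor .inr_).converse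
  | cupMP => exact TwoCell.isCover_mk isCover_iId
  | capMP => exact TwoCell.isCover_mk isCover_iId.converse
  | cupPM => exact TwoCell.isCover_mk isCover_etaSpan
  | capPM => exact TwoCell.isCover_mk isCover_etaSpan.converse
  | crossPP => exact TwoCell.isCover_mk isCover_swapCreat
  | crossMM => exact TwoCell.isCover_mk isCover_swapAnnih
  | crossPM => exact TwoCell.isCover_mk isCover_iAA
  | crossMP => exact TwoCell.isCover_mk isCover_iAA.converse

/-! ### Equivalences between weak pullbacks -/

section Comma

variable {X Y Z : Type 1} [Groupoid.{0} X] [Groupoid.{0} Y] [Groupoid.{0} Z]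

theorem full_fst (G : X ⥤ Z) (J : Y ⥤ Z) [J.Full] : (Comma.fst G J).Full where
  map_surjective {a b} f :=
    ⟨⟨f, J.preimage (inv a.hom ≫ G.map f ≫ b.hom), by simp⟩, rfl⟩

theorem faithful_fst (G : X ⥤ Z) (J : Y ⥤ Z) [J.Faithful] : (Comma.fst G J).Faithful where
  map_injective {a b} f g e := by
    refine Comma.hom_ext _ _ e (J.map_injective ?_)
    rw [← cancel_epi a.hom, ← f.w, ← g.w]
    exact congrArg (fun t => G.map t ≫ b.hom) e

theorem isEquivalence_fst (G : X ⥤ Z) (J : Y ⥤ Z) [J.IsEquivalence] :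
    (Comma.fst G J).IsEquivalence where
  faithful := faithful_fst G J
  full := full_fst G J
  essSurj := ⟨fun x => ⟨⟨x, J.objPreimage (G.obj x), (J.objObjPreimageIso _).inv⟩,
    ⟨Iso.refl _⟩⟩⟩

theorem isEquivalence_snd (G : X ⥤ Z) (J : Y ⥤ Z) [G.IsEquivalence] :
    (Comma.snd G J).IsEquivalence where
  faithful := (IsCover.of_isEquivalence G).snd.faithful
  full := ⟨fun {a b} f =>
    ⟨⟨G.preimage (a.hom ≫ J.map f ≫ inv b.hom), f, by simp⟩, rfl⟩⟩
  essSurj := ⟨fun y => ⟨⟨G.objPreimage (J.obj y), y, (G.objObjPreimageIso _).hom⟩,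
    ⟨Iso.refl _⟩⟩⟩

theorem isEquivalence_sum' {F : X ⥤ Z} {G : Y ⥤ Z} (hF : F.Faithful) (hF' : F.Full)
    (hG : G.Faithful) (hG' : G.Full) (h : ∀ x y, (F.obj x ⟶ G.obj y) → False)
    (hs : ∀ z, (∃ x, Nonempty (F.obj x ⟶ z)) ∨ ∃ y, Nonempty (G.obj y ⟶ z)) :
    (Functor.sum' F G).IsEquivalence where
  faithful := ⟨by
    rintro (a | a) (b | b) ⟨f⟩ ⟨g⟩ e
    · exact congrArg ULift.up (F.map_injective e)
    · exact congrArg ULift.up (G.map_injective e)⟩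
  full := ⟨by
    rintro (a | a) (b | b) f
    · exact ⟨⟨F.preimage f⟩, F.map_preimage f⟩
    · exact (h a b f).elim
    · exact (h b a (inv (show G.obj a ⟶ F.obj b from f))).elim
    · exact ⟨⟨G.preimage f⟩, G.map_preimage f⟩⟩
  essSurj := ⟨fun z => by
    rcases hs z with ⟨x, ⟨f⟩⟩ | ⟨y, ⟨f⟩⟩
    · exact ⟨.inl x, ⟨(Groupoid.isoEquivHom _ _).symm f⟩⟩
    · exact ⟨.inr y, ⟨(Groupoid.isoEquivHom _ _).symm f⟩⟩⟩

theorem isEquivalence_of_inverse (U : X ⥤ Y) (V : Y ⥤ X) (h : U ⋙ V = 𝟭 X) (h' : V ⋙ U = 𝟭 Y) :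
    U.IsEquivalence :=
  (CategoryTheory.Equivalence.mk U V (eqToIso h.symm) (eqToIso h')).isEquivalence_functor

theorem isEquivalence_of_isEmpty (F : X ⥤ Y) (h : Y → False) : F.IsEquivalence where
  faithful := ⟨fun {a} => (h (F.obj a)).elim⟩
  full := ⟨fun {a} => (h (F.obj a)).elim⟩
  essSurj := ⟨fun y => (h y).elim⟩

end Comma

/-! ### Vertical composition of spans of spans -/

section

variable {A B C : Type 1} [Groupoid.{0} A] [Groupoid.{0} B] [Groupoid.{0} C]

namespace SpanSpan

variable {P Q R T : GSpan A B}

/-- A criterion for equivalence of spans of spans with given components. -/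
theorem Equiv.intro {E E' : Type 1} [Groupoid.{0} E] [Groupoid.{0} E'] {t : E ⥤ P.apex}
    {b : E ⥤ Q.apex} {μ : t ⋙ P.tgt ⟶ b ⋙ Q.tgt} {ν : t ⋙ P.src ⟶ b ⋙ Q.src} {t' : E' ⥤ P.apex}
    {b' : E' ⥤ Q.apex} {μ' : t' ⋙ P.tgt ⟶ b' ⋙ Q.tgt} {ν' : t' ⋙ P.src ⟶ b' ⋙ Q.src}
    (U : E ⥤ E') (hU : U.IsEquivalence) (σ : ∀ z, t.obj z ⟶ t'.obj (U.obj z))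
    (τ : ∀ z, b.obj z ⟶ b'.obj (U.obj z))
    (hσ : ∀ {z w} (f : z ⟶ w), t.map f ≫ σ w = σ z ≫ t'.map (U.map f))
    (hτ : ∀ {z w} (f : z ⟶ w), b.map f ≫ τ w = τ z ≫ b'.map (U.map f))
    (h1 : ∀ z, μ.app z ≫ Q.tgt.map (τ z) = P.tgt.map (σ z) ≫ μ'.app (U.obj z))
    (h2 : ∀ z, ν.app z ≫ Q.src.map (τ z) = P.src.map (σ z) ≫ ν'.app (U.obj z)) :
    SpanSpan.Equiv (P := P) (Q := Q) ⟨E, t, b, μ, ν⟩ ⟨E', t', b', μ', ν'⟩ :=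
  ⟨U, hU, ⟨σ, fun _ _ f => hσ f⟩, ⟨τ, fun _ _ f => hτ f⟩, h1, h2⟩

theorem Equiv.conv {Z W : SpanSpan P Q} (h : Z.Equiv W) : Z.converse.Equiv W.converse := by
  obtain ⟨U, hU, σ, τ, h1, h2⟩ := h
  dsimp only [converse]
  refine Equiv.intro U hU (fun z => τ.app z) (fun z => σ.app z) (fun f => τ.naturality f)
    (fun f => σ.naturality f) (fun z => ?_) (fun z => ?_)
  · rw [NatIso.isIso_inv_app, NatIso.isIso_inv_app, IsIso.inv_comp_eq, reassoc_of% (h1 z),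
      IsIso.hom_inv_id, Category.comp_id]
  · rw [NatIso.isIso_inv_app, NatIso.isIso_inv_app, IsIso.inv_comp_eq, reassoc_of% (h2 z),
      IsIso.hom_inv_id, Category.comp_id]

theorem converse_converse (Z : SpanSpan P Q) : Z.converse.converse = Z := by
  obtain ⟨E, t, b, μ, ν⟩ := Z
  change SpanSpan.mk E t b (inv (inv μ)) (inv (inv ν)) = _
  rw [IsIso.inv_inv, IsIso.inv_inv]

theorem vcomp_conv (Z : SpanSpan P Q) (W : SpanSpan Q R) :
    (Z.vcomp W).converse.Equiv (W.converse.vcomp Z.converse) := by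
  let U : Comma Z.bot W.top ⥤ Comma W.top Z.bot :=
    { obj := fun c => ⟨c.right, c.left, inv c.hom⟩
      map := fun {c d} f => ⟨f.right, f.left, by
        rw [IsIso.eq_inv_comp, ← Category.assoc, IsIso.comp_inv_eq, f.w]⟩ }
  have hU : U.IsEquivalence :=
    { faithful := ⟨fun e => Comma.hom_ext _ _ (congrArg CommaMorphism.right e)
        (congrArg CommaMorphism.left e)⟩
      full := ⟨fun {c d} f => ⟨⟨f.right, f.left, by
        have := f.w
        dsimp only [U] at this
        rw [IsIso.eq_inv_comp, ← Category.assoc, IsIso.comp_inv_eq] at this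
        exact this.symm⟩, rfl⟩⟩
      essSurj := ⟨fun c => ⟨⟨c.right, c.left, inv c.hom⟩,
        ⟨Comma.isoMk (Iso.refl _) (Iso.refl _) (by
          dsimp only [U, Iso.refl_hom]
          rw [IsIso.inv_inv, CategoryTheory.Functor.map_id, CategoryTheory.Functor.map_id, Category.id_comp,
            Category.comp_id])⟩⟩⟩ }
  dsimp only [vcomp, converse]
  refine Equiv.intro U hU (fun z => 𝟙 _) (fun z => 𝟙 _) (fun f => ?_) (fun f => ?_)
    (fun z => ?_) (fun z => ?_)
  · exact (Category.comp_id _).trans (Category.id_comp _).symm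
  · exact (Category.comp_id _).trans (Category.id_comp _).symm
  · simp [U]
  · simp [U]

/-- It suffices to compute a vertical composite after taking converses. -/
theorem vcomp_equiv_of_conv {Z : SpanSpan P Q} {W : SpanSpan Q R} {V : SpanSpan P R}
    (h : (W.converse.vcomp Z.converse).Equiv V.converse) : (Z.vcomp W).Equiv V := by
  have := ((vcomp_conv Z W).trans h).conv
  rwa [converse_converse, converse_converse] at this

theorem vcomp_assoc (Z : SpanSpan P Q) (W : SpanSpan Q R) (V : SpanSpan R T) :
    ((Z.vcomp W).vcomp V).Equiv (Z.vcomp (W.vcomp V)) := by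
  let U : Comma (Comma.snd Z.bot W.top ⋙ W.bot) V.top ⥤
      Comma Z.bot (Comma.fst W.bot V.top ⋙ W.top) :=
    { obj := fun c => ⟨c.left.left, ⟨c.left.right, c.right, c.hom⟩, c.left.hom⟩
      map := fun f => ⟨f.left.left, ⟨f.left.right, f.right, f.w⟩, f.left.w⟩ }
  have hU : U.IsEquivalence := isEquivalence_of_inverse U
    { obj := fun c => ⟨⟨c.left, c.right.left, c.hom⟩, c.right.right, c.right.hom⟩
      map := fun f => ⟨⟨f.left, f.right.left, f.w⟩, f.right.right, f.right.w⟩ } rfl rfl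
  dsimp only [vcomp, converse]
  refine Equiv.intro U hU (fun z => 𝟙 _) (fun z => 𝟙 _) (fun f => ?_) (fun f => ?_)
    (fun z => ?_) (fun z => ?_)
  · exact (Category.comp_id _).trans (Category.id_comp _).symm
  · exact (Category.comp_id _).trans (Category.id_comp _).symm
  · simp [U]
  · simp [U]

/-- Postcomposition of the bottom leg with a map of spans. -/
abbrev push (Z : SpanSpan P Q) (F : Q.apex ⥤ R.apex) (μ : Q.tgt ⟶ F ⋙ R.tgt)
    (ν : Q.src ⟶ F ⋙ R.src) : SpanSpan P R :=
  ⟨Z.apex, Z.top, Z.bot ⋙ F, Z.μ ≫ Functor.whiskerLeft Z.bot μ,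
    Z.ν ≫ Functor.whiskerLeft Z.bot ν⟩

theorem vcomp_ofFunctor (Z : SpanSpan P Q) (F : Q.apex ⥤ R.apex) (μ : Q.tgt ⟶ F ⋙ R.tgt)
    (ν : Q.src ⟶ F ⋙ R.src) : (Z.vcomp (ofFunctor F μ ν)).Equiv (Z.push F μ ν) := by
  dsimp only [vcomp, ofFunctor, push]
  refine Equiv.intro (Comma.fst Z.bot (𝟭 Q.apex)) (isEquivalence_fst _ _) (fun z => 𝟙 _)
    (fun z => F.map (inv z.hom)) (fun f => ?_) (fun {z w} f => ?_) (fun z => ?_) (fun z => ?_)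
  · exact (Category.comp_id _).trans (Category.id_comp _).symm
  · change F.map f.right ≫ _ = _ ≫ F.map (Z.bot.map f.left)
    rw [← F.map_comp, ← F.map_comp]
    congr 1
    rw [IsIso.eq_inv_comp, ← Category.assoc, IsIso.comp_inv_eq]
    exact f.w.symm
  · simp; rfl
  · simp; rfl

theorem vcomp_id (Z : SpanSpan P Q) : (Z.vcomp (idTwo Q)).Equiv Z := by
  refine (vcomp_ofFunctor Z _ _ _).trans ?_
  dsimp only [push]
  refine Equiv.intro (𝟭 _) inferInstance (fun z => 𝟙 _) (fun z => 𝟙 _) (fun f => ?_) (fun f => ?_)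
    (fun z => ?_) (fun z => ?_)
  all_goals simp

theorem idTwo_converse (P : GSpan A B) : (idTwo P).converse = idTwo P := by
  have h1 : inv (𝟙 P.tgt) = 𝟙 P.tgt := IsIso.inv_id
  have h2 : inv (𝟙 P.src) = 𝟙 P.src := IsIso.inv_id
  exact congrArg₂ (SpanSpan.mk P.apex (𝟭 P.apex) (𝟭 P.apex)) h1 h2

theorem id_vcomp (Z : SpanSpan P Q) : ((idTwo P).vcomp Z).Equiv Z :=
  vcomp_equiv_of_conv (by rw [idTwo_converse]; exact vcomp_id _)

/-- A fully faithful map of spans followed by its converse is the identity. -/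
theorem vcomp_converse (Z : SpanSpan P Q) [Z.top.IsEquivalence] [Z.bot.Full] [Z.bot.Faithful] :
    (Z.vcomp Z.converse).Equiv (idTwo P) := by
  have h1 : (Comma.fst Z.bot Z.bot).IsEquivalence :=
    { faithful := faithful_fst _ _
      full := full_fst _ _
      essSurj := ⟨fun z => ⟨⟨z, z, 𝟙 _⟩, ⟨Iso.refl _⟩⟩⟩ }
  have h2 : (Comma.fst Z.bot Z.bot ⋙ Z.top).IsEquivalence := inferInstance
  choose k hk using fun z : Comma Z.bot Z.bot => Z.bot.map_surjective z.hom
  dsimp only [vcomp, converse, idTwo, ofFunctor]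
  refine Equiv.intro (Comma.fst Z.bot Z.bot ⋙ Z.top) h2 (fun z => 𝟙 _)
    (fun z => Z.top.map (inv (k z))) (fun f => ?_) (fun {z w} f => ?_) (fun z => ?_) (fun z => ?_)
  · exact (Category.comp_id _).trans (Category.id_comp _).symm
  · change Z.top.map f.right ≫ _ = _ ≫ Z.top.map f.left
    rw [← Functor.map_comp, ← Functor.map_comp]
    congr 1
    rw [IsIso.eq_inv_comp, ← Category.assoc, IsIso.comp_inv_eq]
    apply Z.bot.map_injective
    rw [Functor.map_comp, Functor.map_comp, hk, hk]
    exact f.w.symm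
  · have := Z.μ.naturality (k z)
    simp only [Functor.comp_map, hk] at this
    simp
    rw [← reassoc_of% this, IsIso.hom_inv_id_assoc, IsIso.hom_inv_id]
    rfl
  · have := Z.ν.naturality (k z)
    simp only [Functor.comp_map, hk] at this
    simp
    rw [← reassoc_of% this, IsIso.hom_inv_id_assoc, IsIso.hom_inv_id]
    rfl

/-- The restriction of the identity along a functor into the apex. -/
abbrev restrict {E : Type 1} [Groupoid.{0} E] (F : E ⥤ P.apex) : SpanSpan P P :=
  ⟨E, F, F, 𝟙 _, 𝟙 _⟩

/-- The converse of a map of spans followed by the map is the restriction of the identity to the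
image. -/
theorem converse_vcomp (Z : SpanSpan P Q) [Z.top.IsEquivalence] :
    (Z.converse.vcomp Z).Equiv (restrict Z.bot) := by
  choose k hk using fun z : Comma Z.top Z.top => Z.top.map_surjective z.hom
  dsimp only [vcomp, converse, restrict]
  refine Equiv.intro (Comma.fst Z.top Z.top) (isEquivalence_fst _ _) (fun z => 𝟙 _)
    (fun z => Z.bot.map (inv (k z))) (fun f => ?_) (fun {z w} f => ?_) (fun z => ?_) (fun z => ?_)
  · exact (Category.comp_id _).trans (Category.id_comp _).symm
  · change Z.bot.map f.right ≫ _ = _ ≫ Z.bot.map f.left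
    rw [← Functor.map_comp, ← Functor.map_comp]
    congr 1
    rw [IsIso.eq_inv_comp, ← Category.assoc, IsIso.comp_inv_eq]
    apply Z.top.map_injective
    rw [Functor.map_comp, Functor.map_comp, hk, hk]
    exact f.w.symm
  · have := Z.μ.naturality (k z)
    simp only [Functor.comp_map, hk] at this
    simp [reassoc_of% this]
  · have := Z.ν.naturality (k z)
    simp only [Functor.comp_map, hk] at this
    simp [reassoc_of% this]

/-! ### Sums of spans of spans -/

/-- A span of spans whose apex is decomposed into two parts, on which the legs are given
strictly, is a sum. -/
theorem add_equiv_of_decomposition {E E' E'' : Type 1} [Groupoid.{0} E] [Groupoid.{0} E']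
    [Groupoid.{0} E''] {t : E ⥤ P.apex}
    {b : E ⥤ Q.apex} {μ : t ⋙ P.tgt ⟶ b ⋙ Q.tgt} {ν : t ⋙ P.src ⟶ b ⋙ Q.src} {t' : E' ⥤ P.apex}
    {b' : E' ⥤ Q.apex} {μ' : t' ⋙ P.tgt ⟶ b' ⋙ Q.tgt} {ν' : t' ⋙ P.src ⟶ b' ⋙ Q.src}
    {t'' : E'' ⥤ P.apex} {b'' : E'' ⥤ Q.apex} {μ'' : t'' ⋙ P.tgt ⟶ b'' ⋙ Q.tgt}
    {ν'' : t'' ⋙ P.src ⟶ b'' ⋙ Q.src} (U : E ⥤ E'') (U' : E' ⥤ E'')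
    (hU : (Functor.sum' U U').IsEquivalence)
    (ht : U ⋙ t'' = t) (hb : U ⋙ b'' = b) (ht' : U' ⋙ t'' = t') (hb' : U' ⋙ b'' = b')
    (hμ : ∀ z, μ.app z ≍ μ''.app (U.obj z)) (hν : ∀ z, ν.app z ≍ ν''.app (U.obj z))
    (hμ' : ∀ z, μ'.app z ≍ μ''.app (U'.obj z)) (hν' : ∀ z, ν'.app z ≍ ν''.app (U'.obj z)) :
    (SpanSpan.add (P := P) (Q := Q) ⟨E, t, b, μ, ν⟩ ⟨E', t', b', μ', ν'⟩).Equiv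
      ⟨E'', t'', b'', μ'', ν''⟩ := by
  subst ht hb ht' hb'
  refine Equiv.intro (Functor.sum' U U') hU
    (fun c => match c with
        | .inl z => 𝟙 _
        | .inr w => 𝟙 _)
    (fun c => match c with
        | .inl z => 𝟙 _
        | .inr w => 𝟙 _) ?_ ?_ ?_ ?_
  · rintro (c | c) (d | d) ⟨f⟩
    · exact (Category.comp_id _).trans (Category.id_comp _).symm
    · exact (Category.comp_id _).trans (Category.id_comp _).symm
  · rintro (c | c) (d | d) ⟨f⟩
    · exact (Category.comp_id _).trans (Category.id_comp _).symm
    · exact (Category.comp_id _).trans (Category.id_comp _).symm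
  · rintro (z | z)
    · simpa using eq_of_heq (hμ z)
    · simpa using eq_of_heq (hμ' z)
  · rintro (z | z)
    · simpa using eq_of_heq (hν z)
    · simpa using eq_of_heq (hν' z)

theorem restrict_add_restrict {E E' : Type 1} [Groupoid.{0} E] [Groupoid.{0} E']
    (F : E ⥤ P.apex) (F' : E' ⥤ P.apex) (h : (Functor.sum' F F').IsEquivalence) :
    ((restrict F).add (restrict F')).Equiv (idTwo P) :=
  add_equiv_of_decomposition F F' h rfl rfl rfl rfl (fun _ => HEq.rfl) (fun _ => HEq.rfl)
    (fun _ => HEq.rfl) (fun _ => HEq.rfl)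

theorem equiv_zero {Z : SpanSpan P Q} (h : Z.apex → False) : Z.Equiv (zeroTwo P Q) :=
  Equiv.symm ⟨emptyFunctor _, isEquivalence_of_isEmpty _ h, ⟨fun x => x.elim, fun x => x.elim⟩,
    ⟨fun x => x.elim, fun x => x.elim⟩, fun x => x.elim, fun x => x.elim⟩

theorem add_comm (Z W : SpanSpan P Q) : (Z.add W).Equiv (W.add Z) := by
  refine add_equiv_of_decomposition (Sum.inr_ W.apex Z.apex) (Sum.inl_ W.apex Z.apex)
    (isEquivalence_sum' IsCover.inr_.faithful ⟨fun f => ⟨f.down, rfl⟩⟩ IsCover.inl_.faithful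
      ⟨fun f => ⟨f.down, rfl⟩⟩ (fun _ _ f => nomatch f) ?_) rfl rfl rfl rfl (fun _ => HEq.rfl)
    (fun _ => HEq.rfl) (fun _ => HEq.rfl) (fun _ => HEq.rfl)
  · rintro (z | z)
    · exact .inr ⟨z, ⟨𝟙 _⟩⟩
    · exact .inl ⟨z, ⟨𝟙 _⟩⟩

theorem zero_add (W : SpanSpan P Q) : ((zeroTwo P Q).add W).Equiv W := by
  refine add_equiv_of_decomposition (emptyFunctor _) (𝟭 _)
    (isEquivalence_sum' IsCover.empty.faithful ⟨fun {a} => a.elim⟩ inferInstance inferInstance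
      (fun a => a.elim) fun z => .inr ⟨z, ⟨𝟙 _⟩⟩)
    (Functor.hext (fun x => x.elim) fun {x} => x.elim)
    (Functor.hext (fun x => x.elim) fun {x} => x.elim)
    rfl rfl (fun x => x.elim) (fun x => x.elim) (fun _ => HEq.rfl) (fun _ => HEq.rfl)

theorem add_assoc (Z W V : SpanSpan P Q) : ((Z.add W).add V).Equiv (Z.add (W.add V)) := by
  have hf : (Functor.sum' (Sum.inl_ Z.apex (W.apex ⊕ V.apex))
      (Sum.inl_ W.apex V.apex ⋙ Sum.inr_ Z.apex _)).Faithful := ⟨by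
    rintro (a | a) (b | b) ⟨f⟩ ⟨g⟩ e
    · exact e
    · exact congrArg ULift.down e⟩
  have hf' : (Functor.sum' (Sum.inl_ Z.apex (W.apex ⊕ V.apex))
      (Sum.inl_ W.apex V.apex ⋙ Sum.inr_ Z.apex _)).Full := ⟨by
    rintro (a | a) (b | b) ⟨f⟩
    · exact ⟨⟨f⟩, rfl⟩
    · exact ⟨f, rfl⟩⟩
  have hg : (Sum.inr_ W.apex V.apex ⋙ Sum.inr_ Z.apex _).Faithful :=
    ⟨fun e => congrArg (fun t => t.down.down) e⟩
  have hg' : (Sum.inr_ W.apex V.apex ⋙ Sum.inr_ Z.apex _).Full :=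
    ⟨fun f => ⟨f.down.down, rfl⟩⟩
  refine add_equiv_of_decomposition _ _
    (isEquivalence_sum' hf hf' hg hg' ?_ ?_)
    (Functor.hext (by rintro (z | z) <;> rfl) (by rintro (z | z) (w | w) ⟨f⟩ <;> rfl))
    (Functor.hext (by rintro (z | z) <;> rfl) (by rintro (z | z) (w | w) ⟨f⟩ <;> rfl))
    rfl rfl ?_ ?_ (fun _ => HEq.rfl) (fun _ => HEq.rfl)
  · rintro (a | a) b f
    · nomatch f
    · nomatch f.down
  · rintro (z | z | z)
    · exact .inl ⟨.inl z, ⟨𝟙 _⟩⟩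
    · exact .inl ⟨.inr z, ⟨𝟙 _⟩⟩
    · exact .inr ⟨z, ⟨𝟙 _⟩⟩
  · rintro (z | z) <;> exact HEq.rfl
  · rintro (z | z) <;> exact HEq.rfl

theorem add_vcomp (Z Z' : SpanSpan P Q) (W : SpanSpan Q R) :
    ((Z.add Z').vcomp W).Equiv ((Z.vcomp W).add (Z'.vcomp W)) := by
  let U : Comma Z.bot W.top ⥤ Comma (Functor.sum' Z.bot Z'.bot) W.top :=
    { obj := fun c => ⟨.inl c.left, c.right, c.hom⟩
      map := fun f => ⟨⟨f.left⟩, f.right, f.w⟩ }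
  let U' : Comma Z'.bot W.top ⥤ Comma (Functor.sum' Z.bot Z'.bot) W.top :=
    { obj := fun c => ⟨.inr c.left, c.right, c.hom⟩
      map := fun f => ⟨⟨f.left⟩, f.right, f.w⟩ }
  have hU : U.Faithful := ⟨fun e =>
    Comma.hom_ext _ _ (congrArg (fun t => t.left.down) e) (congrArg (fun t => t.right) e)⟩
  have hU' : U'.Faithful := ⟨fun e =>
    Comma.hom_ext _ _ (congrArg (fun t => t.left.down) e) (congrArg (fun t => t.right) e)⟩
  have hf : U.Full := ⟨fun ⟨⟨f⟩, g, h⟩ => ⟨⟨f, g, h⟩, rfl⟩⟩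
  have hf' : U'.Full := ⟨fun ⟨⟨f⟩, g, h⟩ => ⟨⟨f, g, h⟩, rfl⟩⟩
  refine Equiv.symm (add_equiv_of_decomposition U U'
    (isEquivalence_sum' hU hf hU' hf' (fun _ _ f => nomatch f.left) ?_) rfl rfl rfl rfl (fun _ => HEq.rfl)
    (fun _ => HEq.rfl) (fun _ => HEq.rfl) (fun _ => HEq.rfl))
  · rintro ⟨z | z, w, h⟩
    · exact .inl ⟨⟨z, w, h⟩, ⟨𝟙 _⟩⟩
    · exact .inr ⟨⟨z, w, h⟩, ⟨𝟙 _⟩⟩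

theorem add_conv (Z W : SpanSpan P Q) :
    (Z.add W).converse.Equiv (Z.converse.add W.converse) := by
  refine Equiv.symm (add_equiv_of_decomposition (Sum.inl_ Z.apex W.apex) (Sum.inr_ Z.apex W.apex)
    (isEquivalence_sum' IsCover.inl_.faithful ⟨fun f => ⟨f.down, rfl⟩⟩ IsCover.inr_.faithful
      ⟨fun f => ⟨f.down, rfl⟩⟩ (fun _ _ f => nomatch f) ?_) rfl rfl rfl rfl
    (fun z => heq_of_eq ((NatIso.isIso_inv_app Z.μ z).trans
      (NatIso.isIso_inv_app (Z.add W).μ (.inl z)).symm))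
    (fun z => heq_of_eq ((NatIso.isIso_inv_app Z.ν z).trans
      (NatIso.isIso_inv_app (Z.add W).ν (.inl z)).symm))
    (fun z => heq_of_eq ((NatIso.isIso_inv_app W.μ z).trans
      (NatIso.isIso_inv_app (Z.add W).μ (.inr z)).symm))
    (fun z => heq_of_eq ((NatIso.isIso_inv_app W.ν z).trans
      (NatIso.isIso_inv_app (Z.add W).ν (.inr z)).symm)))
  · rintro (z | z)
    · exact .inl ⟨z, ⟨𝟙 _⟩⟩
    · exact .inr ⟨z, ⟨𝟙 _⟩⟩

theorem vcomp_add (Z : SpanSpan P Q) (W W' : SpanSpan Q R) :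
    (Z.vcomp (W.add W')).Equiv ((Z.vcomp W).add (Z.vcomp W')) := by
  refine vcomp_equiv_of_conv ?_
  refine (vcomp_congr (add_conv W W') (Equiv.refl _)).trans ?_
  refine (add_vcomp _ _ _).trans ?_
  exact (add_congr (vcomp_conv _ _).symm (vcomp_conv _ _).symm).trans (add_conv _ _).symm

end SpanSpan

end

/-! ### Horizontal composition and interchange -/

section

variable {A B C D : Type 1} [Groupoid.{0} A] [Groupoid.{0} B] [Groupoid.{0} C] [Groupoid.{0} D]

namespace SpanSpan

variable {P Q R : GSpan A B} {P' Q' R' : GSpan B C}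

/-- Precomposition of the top leg with a map of spans. -/
noncomputable def pull (F : P.apex ⥤ Q.apex) (μ : P.tgt ⟶ F ⋙ Q.tgt) (ν : P.src ⟶ F ⋙ Q.src)
    (Z : SpanSpan P R) : SpanSpan Q R :=
  ⟨Z.apex, Z.top ⋙ F, Z.bot, Functor.whiskerLeft Z.top (inv μ) ≫ Z.μ,
    Functor.whiskerLeft Z.top (inv ν) ≫ Z.ν⟩

/-- The square behind naturality of the comparison in `ofFunctor_converse_vcomp`. -/
theorem pull_square {E : Type 1} [Groupoid.{0} E] {x₁ x₂ x₃ x₄ x₅ : E} {g : x₁ ⟶ x₂}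
    {i' : x₂ ⟶ x₃} {i : x₁ ⟶ x₄} {h : x₄ ⟶ x₃} {m : x₃ ⟶ x₅} {e : x₅ ⟶ x₅} (he : e = 𝟙 x₅)
    (n : g ≫ i' = i ≫ h) : (i ≫ h ≫ m) ≫ e = g ≫ (i' ≫ m) := by
  rw [he, Category.comp_id, ← reassoc_of% n]

/-- Precomposition with the converse of a map of spans does not need a weak pullback. -/
theorem ofFunctor_converse_vcomp (F : P.apex ⥤ Q.apex) (μ : P.tgt ⟶ F ⋙ Q.tgt)
    (ν : P.src ⟶ F ⋙ Q.src) (Z : SpanSpan P R) :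
    ((ofFunctor F μ ν).converse.vcomp Z).Equiv (Z.pull F μ ν) := by
  dsimp only [vcomp, ofFunctor, converse, pull]
  refine Equiv.intro (Comma.snd (𝟭 P.apex) Z.top) (isEquivalence_snd _ _)
    (fun z => F.map z.hom) (fun z => 𝟙 _) (fun {z w} f => ?_) (fun f => ?_) (fun z => ?_)
    (fun z => ?_)
  · change F.map f.left ≫ _ = _ ≫ F.map (Z.top.map f.right)
    rw [← F.map_comp, ← F.map_comp]
    exact congrArg F.map f.w
  · exact (Category.comp_id _).trans (Category.id_comp _).symm
  · exact pull_square (R.tgt.map_id _) ((inv μ).naturality z.hom)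
  · exact pull_square (R.src.map_id _) ((inv ν).naturality z.hom)

/-- The cancellation behind fullness of the comparison functor in `interchange`. -/
theorem hexagon {E : Type 1} [Groupoid.{0} E] {x₁ x₂ x₃ x₄ x₅ x₆ x₇ x₈ : E} {a : x₁ ⟶ x₂}
    {b : x₂ ⟶ x₃} {e : x₃ ⟶ x₄} {f : x₂ ⟶ x₅} {k : x₅ ⟶ x₄} {g : x₁ ⟶ x₆} {m : x₆ ⟶ x₃}
    {n : x₆ ⟶ x₇} {p : x₁ ⟶ x₈} {w : x₈ ⟶ x₇} {q : x₇ ⟶ x₄} {r : x₈ ⟶ x₅} (h1 : g ≫ m = a ≫ b)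
    (h2 : w ≫ q = r ≫ k) (h3 : g ≫ n = p ≫ w) (hc : a ≫ f = p ≫ r) (hd : m ≫ e = n ≫ q) :
    b ≫ e = f ≫ k := by
  rw [← cancel_epi a, ← reassoc_of% h1, hd, reassoc_of% h3, h2, reassoc_of% hc]

/-- The square behind naturality of the comparison in `interchange`. -/
theorem interchange_square {E : Type 1} [Groupoid.{0} E] {x₁ x₂ x₃ x₄ x₅ x₆ y₁ y₂ : E}
    {a : x₁ ⟶ x₂} {f : x₂ ⟶ x₃} {m : y₁ ⟶ x₁} {h : y₁ ⟶ y₂} {n : y₂ ⟶ x₄} {r : x₄ ⟶ x₃}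
    {m' : x₂ ⟶ x₅} {n' : x₃ ⟶ x₆} {e : x₅ ⟶ x₅} {e' : x₆ ⟶ x₆} (he : e = 𝟙 x₅) (he' : e' = 𝟙 x₆)
    (w : a ≫ f = (inv m ≫ h ≫ n) ≫ r) :
    e ≫ (inv (m ≫ a ≫ m') ≫ h ≫ (n ≫ r ≫ n')) = (inv m' ≫ f ≫ n') ≫ e' := by
  have : f = inv a ≫ (inv m ≫ h ≫ n) ≫ r := by rw [← w, IsIso.inv_hom_id_assoc]
  simp [he, he', this]

/-- The interchange law. Both apices consist of four points, with comparison maps between horizontal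
and between vertical neighbours; the vertical maps are invertible, so that either of the two
horizontal maps determines the other. -/
theorem interchange (Z : SpanSpan P Q) (W : SpanSpan P' Q') (Z' : SpanSpan Q R)
    (W' : SpanSpan Q' R') :
    ((Z.hcomp W).vcomp (Z'.hcomp W')).Equiv ((Z.vcomp Z').hcomp (W.vcomp W')) := by
  let U : Comma (Z.hcomp W).bot (Z'.hcomp W').top ⥤
      Comma (Comma.fst Z.bot Z'.top ⋙ Z.top ⋙ P.tgt) (Comma.fst W.bot W'.top ⋙ W.top ⋙ P'.src) :=
    { obj := fun c => ⟨⟨c.left.left, c.right.left, c.hom.left⟩,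
        ⟨c.left.right, c.right.right, c.hom.right⟩, c.left.hom⟩
      map := fun f => ⟨⟨f.left.left, f.right.left, congrArg CommaMorphism.left f.w⟩,
        ⟨f.left.right, f.right.right, congrArg CommaMorphism.right f.w⟩, f.left.w⟩ }
  have hU : U.IsEquivalence :=
    { faithful := ⟨fun e => Comma.hom_ext _ _
        (Comma.hom_ext _ _ (congrArg (fun t => t.left.left) e)
          (congrArg (fun t => t.right.left) e))
        (Comma.hom_ext _ _ (congrArg (fun t => t.left.right) e)
          (congrArg (fun t => t.right.right) e))⟩
      full := ⟨fun {c d} g => by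
        let l : c.left ⟶ d.left := ⟨g.left.left, g.right.left, g.w⟩
        have h1 := g.left.w
        have h2 := g.right.w
        have h3 := ((Z.hcomp W).bot.map l).w
        have hc := c.hom.w
        have hd := d.hom.w
        exact ⟨⟨l, ⟨g.left.right, g.right.right, hexagon
          ((Q.tgt.map_comp _ _).symm.trans ((congrArg Q.tgt.map h1).trans (Q.tgt.map_comp _ _)))
          ((Q'.src.map_comp _ _).symm.trans ((congrArg Q'.src.map h2).trans (Q'.src.map_comp _ _)))
          h3 hc hd⟩, Comma.hom_ext _ _ h1 h2⟩, rfl⟩⟩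
      essSurj := ⟨fun e => ⟨⟨⟨e.left.left, e.right.left, e.hom⟩,
        ⟨e.left.right, e.right.right, inv (Q.tgt.map e.left.hom) ≫
          (inv (Z.μ.app e.left.left) ≫ e.hom ≫ W.ν.app e.right.left) ≫ Q'.src.map e.right.hom⟩,
        ⟨e.left.hom, e.right.hom, IsIso.hom_inv_id_assoc _ _⟩⟩, ⟨Iso.refl _⟩⟩⟩ }
  have hτ (z : Comma (Z.hcomp W).bot (Z'.hcomp W').top) :
      Q.tgt.map z.hom.left ≫ z.right.hom =
        (inv (Z.μ.app z.left.left) ≫ z.left.hom ≫ W.ν.app z.left.right) ≫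
          Q'.src.map z.hom.right := z.hom.w
  refine Equiv.intro U hU (fun z => 𝟙 _) (fun z => ⟨𝟙 (Z'.bot.obj z.right.left),
    𝟙 (W'.bot.obj z.right.right), ?_⟩) (fun f => ?_) (fun f => ?_) (fun z => ?_) (fun z => ?_)
  · exact interchange_square (m' := Z'.μ.app z.right.left) (n' := W'.ν.app z.right.right)
      (R.tgt.map_id _) (R'.src.map_id _) (hτ z)
  · exact (Category.comp_id _).trans (Category.id_comp _).symm
  · apply Comma.hom_ext
    · exact (Category.comp_id _).trans (Category.id_comp _).symm
    · exact (Category.comp_id _).trans (Category.id_comp _).symm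
  · exact (congrArg _ (R'.tgt.map_id _)).trans
      ((Category.comp_id _).trans ((congrArg (· ≫ _) (P'.tgt.map_id _)).trans
        (Category.id_comp _)).symm)
  · exact (congrArg _ (R.src.map_id _)).trans
      ((Category.comp_id _).trans ((congrArg (· ≫ _) (P.src.map_id _)).trans
        (Category.id_comp _)).symm)

end SpanSpan
end

section

variable {A B C D : Type 1} [Groupoid.{0} A] [Groupoid.{0} B] [Groupoid.{0} C] [Groupoid.{0} D]

namespace SpanSpan

variable {P Q R : GSpan A B} {P' Q' R' : GSpan B C}

theorem add_hcomp (Z Z' : SpanSpan P Q) (W : SpanSpan P' Q') :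
    ((Z.add Z').hcomp W).Equiv ((Z.hcomp W).add (Z'.hcomp W)) := by
  let U : Comma (Z.top ⋙ P.tgt) (W.top ⋙ P'.src) ⥤
      Comma (Functor.sum' Z.top Z'.top ⋙ P.tgt) (W.top ⋙ P'.src) :=
    { obj := fun c => ⟨.inl c.left, c.right, c.hom⟩
      map := fun f => ⟨⟨f.left⟩, f.right, f.w⟩ }
  let U' : Comma (Z'.top ⋙ P.tgt) (W.top ⋙ P'.src) ⥤
      Comma (Functor.sum' Z.top Z'.top ⋙ P.tgt) (W.top ⋙ P'.src) :=
    { obj := fun c => ⟨.inr c.left, c.right, c.hom⟩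
      map := fun f => ⟨⟨f.left⟩, f.right, f.w⟩ }
  have hU : U.Faithful := ⟨fun e =>
    Comma.hom_ext _ _ (congrArg (fun t => t.left.down) e) (congrArg (fun t => t.right) e)⟩
  have hU' : U'.Faithful := ⟨fun e =>
    Comma.hom_ext _ _ (congrArg (fun t => t.left.down) e) (congrArg (fun t => t.right) e)⟩
  have hf : U.Full := ⟨fun ⟨⟨f⟩, g, h⟩ => ⟨⟨f, g, h⟩, rfl⟩⟩
  have hf' : U'.Full := ⟨fun ⟨⟨f⟩, g, h⟩ => ⟨⟨f, g, h⟩, rfl⟩⟩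
  refine Equiv.symm (add_equiv_of_decomposition U U'
    (isEquivalence_sum' hU hf hU' hf' (fun _ _ f => nomatch f.left) ?_) rfl rfl rfl rfl
    (fun _ => HEq.rfl) (fun _ => HEq.rfl) (fun _ => HEq.rfl) (fun _ => HEq.rfl))
  · rintro ⟨z | z, w, h⟩
    · exact .inl ⟨⟨z, w, h⟩, ⟨𝟙 _⟩⟩
    · exact .inr ⟨⟨z, w, h⟩, ⟨𝟙 _⟩⟩

theorem hcomp_add (Z : SpanSpan P Q) (W W' : SpanSpan P' Q') :
    (Z.hcomp (W.add W')).Equiv ((Z.hcomp W).add (Z.hcomp W')) := by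
  let U : Comma (Z.top ⋙ P.tgt) (W.top ⋙ P'.src) ⥤
      Comma (Z.top ⋙ P.tgt) (Functor.sum' W.top W'.top ⋙ P'.src) :=
    { obj := fun c => ⟨c.left, .inl c.right, c.hom⟩
      map := fun f => ⟨f.left, ⟨f.right⟩, f.w⟩ }
  let U' : Comma (Z.top ⋙ P.tgt) (W'.top ⋙ P'.src) ⥤
      Comma (Z.top ⋙ P.tgt) (Functor.sum' W.top W'.top ⋙ P'.src) :=
    { obj := fun c => ⟨c.left, .inr c.right, c.hom⟩
      map := fun f => ⟨f.left, ⟨f.right⟩, f.w⟩ }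
  have hU : U.Faithful := ⟨fun e =>
    Comma.hom_ext _ _ (congrArg (fun t => t.left) e) (congrArg (fun t => t.right.down) e)⟩
  have hU' : U'.Faithful := ⟨fun e =>
    Comma.hom_ext _ _ (congrArg (fun t => t.left) e) (congrArg (fun t => t.right.down) e)⟩
  have hf : U.Full := ⟨fun ⟨f, ⟨g⟩, h⟩ => ⟨⟨f, g, h⟩, rfl⟩⟩
  have hf' : U'.Full := ⟨fun ⟨f, ⟨g⟩, h⟩ => ⟨⟨f, g, h⟩, rfl⟩⟩
  refine Equiv.symm (add_equiv_of_decomposition U U'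
    (isEquivalence_sum' hU hf hU' hf' (fun _ _ f => nomatch f.right) ?_) rfl rfl rfl rfl
    (fun _ => HEq.rfl) (fun _ => HEq.rfl) (fun _ => HEq.rfl) (fun _ => HEq.rfl))
  · rintro ⟨z, w | w, h⟩
    · exact .inl ⟨⟨z, w, h⟩, ⟨𝟙 _⟩⟩
    · exact .inr ⟨⟨z, w, h⟩, ⟨𝟙 _⟩⟩

theorem id_hcomp_id (P : GSpan A B) (P' : GSpan B C) :
    ((idTwo P).hcomp (idTwo P')).Equiv (idTwo (P.comp P')) := by
  have hb (c : Comma P.tgt P'.src) : inv ((𝟙 P.tgt : P.tgt ⟶ P.tgt).app c.left) ≫ c.hom ≫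
      (𝟙 P'.src : P'.src ⟶ P'.src).app c.right = c.hom := by simp
  dsimp only [hcomp, idTwo, ofFunctor]
  refine Equiv.intro (𝟭 (Comma P.tgt P'.src)) Functor.isEquivalence_refl (fun z => 𝟙 _)
    (fun z => ⟨𝟙 z.left, 𝟙 z.right, ?_⟩) (fun f => ?_) (fun f => ?_) (fun z => ?_) (fun z => ?_)
  · exact (congrArg (· ≫ _) (P.tgt.map_id _)).trans ((Category.id_comp _).trans
      ((hb z).symm.trans ((Category.comp_id _).symm.trans
        (congrArg (_ ≫ ·) (P'.src.map_id _).symm))))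
  · exact (Category.comp_id _).trans (Category.id_comp _).symm
  · apply Comma.hom_ext
    · exact (Category.comp_id _).trans (Category.id_comp _).symm
    · exact (Category.comp_id _).trans (Category.id_comp _).symm
  · exact (Category.id_comp _).trans ((P'.tgt.map_id _).trans
      ((congrArg (· ≫ _) (P'.tgt.map_id _)).trans (Category.id_comp _)).symm)
  · exact (Category.id_comp _).trans ((P.src.map_id _).trans
      ((congrArg (· ≫ _) (P.src.map_id _)).trans (Category.id_comp _)).symm)

/-- Conjugation by a pair of maps of spans. -/
theorem conj_equiv {P₁ Q₁ : GSpan A B} (F : P.apex ⥤ P₁.apex) (μ : P.tgt ⟶ F ⋙ P₁.tgt)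
    (ν : P.src ⟶ F ⋙ P₁.src) (G : Q.apex ⥤ Q₁.apex) (μ' : Q.tgt ⟶ G ⋙ Q₁.tgt)
    (ν' : Q.src ⟶ G ⋙ Q₁.src) (Z : SpanSpan P Q) :
    (((ofFunctor F μ ν).converse.vcomp Z).vcomp (ofFunctor G μ' ν')).Equiv
      ((Z.pull F μ ν).push G μ' ν') :=
  (vcomp_congr (ofFunctor_converse_vcomp F μ ν Z) (Equiv.refl _)).trans
    (vcomp_ofFunctor _ _ _ _)

theorem inv_id_app {X Y : Type 1} [Groupoid.{0} X] [Groupoid.{0} Y] (F : X ⥤ Y) (x : X) :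
    (inv (𝟙 F)).app x = 𝟙 (F.obj x) := by simp

/-- Coherence cells at identities drop out of a comparison of composites. -/
theorem frame_eq {E : Type 1} [Groupoid.{0} E] {x y : E} {i e' : x ⟶ x} {m n : x ⟶ y}
    {j e : y ⟶ y} (hi : i = 𝟙 x) (hj : j = 𝟙 y) (he : e = 𝟙 y) (he' : e' = 𝟙 x) (h : m = n) :
    ((i ≫ m) ≫ j) ≫ e = e' ≫ n := by
  simp [hi, hj, he, he', h]

/-- The comparison of the source maps in the naturality of the unitors. -/
theorem conj_src {E : Type 1} [Groupoid.{0} E] {x y z : E} {h i : x ⟶ z} {e' : x ⟶ x} {m : x ⟶ y}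
    {j : z ⟶ y} {e : y ⟶ y} (hi : i = h) (hj : j = inv (inv m ≫ h ≫ 𝟙 z)) (he : e = 𝟙 y)
    (he' : e' = 𝟙 x) : ((i ≫ 𝟙 z) ≫ j) ≫ e = e' ≫ m := by
  simp [hi, hj, he, he']

/-- The comparison of the target maps in the naturality of the unitors. -/
theorem conj_tgt {E : Type 1} [Groupoid.{0} E] {x y z : E} {h : z ⟶ x} {i : x ⟶ z} {e' : x ⟶ x}
    {m : x ⟶ y} {j : z ⟶ y} {e : y ⟶ y} (hi : i = inv h) (hj : j = h ≫ m) (he : e = 𝟙 y)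
    (he' : e' = 𝟙 x) : ((i ≫ 𝟙 z) ≫ j) ≫ e = e' ≫ m := by
  simp [hi, hj, he, he']

theorem assoc_natural {P'' Q'' : GSpan C D} (Z : SpanSpan P Q) (Z' : SpanSpan P' Q')
    (Z'' : SpanSpan P'' Q'') :
    (((assocSpan P P' P'').converse.vcomp ((Z.hcomp Z').hcomp Z'')).vcomp
      (assocSpan Q Q' Q'')).Equiv (Z.hcomp (Z'.hcomp Z'')) := by
  refine (conj_equiv _ _ _ _ _ _ _).trans ?_
  let U : ((Z.hcomp Z').hcomp Z'').apex ⥤ (Z.hcomp (Z'.hcomp Z'')).apex :=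
    { obj := fun c => ⟨c.left.left, ⟨c.left.right, c.right, c.hom⟩, c.left.hom⟩
      map := fun f => ⟨f.left.left, ⟨f.left.right, f.right, f.w⟩, f.left.w⟩ }
  let U' : (Z.hcomp (Z'.hcomp Z'')).apex ⥤ ((Z.hcomp Z').hcomp Z'').apex :=
    { obj := fun c => ⟨⟨c.left, c.right.left, c.hom⟩, c.right.right, c.right.hom⟩
      map := fun f => ⟨⟨f.left, f.right.left, f.w⟩, f.right.right, f.right.w⟩ }
  dsimp only [pull, push]
  refine Equiv.intro U (isEquivalence_of_inverse U U' rfl rfl) (fun z => 𝟙 _) (fun z => 𝟙 _)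
    (fun f => ?_) (fun f => ?_) (fun z => ?_) (fun z => ?_)
  · exact (Category.comp_id _).trans (Category.id_comp _).symm
  · exact (Category.comp_id _).trans (Category.id_comp _).symm
  · exact frame_eq (inv_id_app _ _) rfl (Q''.tgt.map_id _) (P''.tgt.map_id _) rfl
  · exact frame_eq (inv_id_app _ _) rfl (Q.src.map_id _) (P.src.map_id _) rfl

theorem unitorSrc_natural (Z : SpanSpan P Q) :
    (((unitorSrc P).converse.vcomp (Z.hcomp (idTwo (GSpan.idSpan B)))).vcomp
      (unitorSrc Q)).Equiv Z := by
  refine (conj_equiv _ _ _ _ _ _ _).trans ?_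
  dsimp only [pull, push]
  refine Equiv.intro (Comma.fst (Z.top ⋙ P.tgt) (𝟭 B)) (isEquivalence_fst _ _) (fun z => 𝟙 _)
    (fun z => 𝟙 _) (fun f => ?_) (fun f => ?_) (fun z => ?_) (fun z => ?_)
  · exact (Category.comp_id _).trans (Category.id_comp _).symm
  · exact (Category.comp_id _).trans (Category.id_comp _).symm
  · have h1 : (inv (commaInv P.tgt (𝟭 B))).app ((Z.hcomp (idTwo (GSpan.idSpan B))).top.obj z) =
        z.hom := by
      simp [commaInv]; rfl
    have h2 : (commaInv Q.tgt (𝟭 B)).app ((Z.hcomp (idTwo (GSpan.idSpan B))).bot.obj z) =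
        inv (inv (Z.μ.app z.left) ≫ z.hom ≫ 𝟙 _) :=
      NatIso.isIso_inv_app _ _
    exact conj_src h1 h2 (Q.tgt.map_id _) (P.tgt.map_id _)
  · exact frame_eq (inv_id_app _ _) rfl (Q.src.map_id _) (P.src.map_id _) rfl

theorem unitorTgt_natural (Z : SpanSpan P Q) :
    (((unitorTgt P).converse.vcomp ((idTwo (GSpan.idSpan A)).hcomp Z)).vcomp
      (unitorTgt Q)).Equiv Z := by
  refine (conj_equiv _ _ _ _ _ _ _).trans ?_
  dsimp only [pull, push]
  refine Equiv.intro (Comma.snd (𝟭 A) (Z.top ⋙ P.src)) (isEquivalence_snd _ _) (fun z => 𝟙 _)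
    (fun z => 𝟙 _) (fun f => ?_) (fun f => ?_) (fun z => ?_) (fun z => ?_)
  · exact (Category.comp_id _).trans (Category.id_comp _).symm
  · exact (Category.comp_id _).trans (Category.id_comp _).symm
  · exact frame_eq (inv_id_app _ _) rfl (Q.tgt.map_id _) (P.tgt.map_id _) rfl
  · have h1 : (inv (Comma.natTrans (𝟭 A) P.src)).app
        (((idTwo (GSpan.idSpan A)).hcomp Z).top.obj z) = inv z.hom := NatIso.isIso_inv_app _ _
    have h2 : (Comma.natTrans (𝟭 A) Q.src).app (((idTwo (GSpan.idSpan A)).hcomp Z).bot.obj z) =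
        z.hom ≫ Z.ν.app z.right :=
      (congrArg (· ≫ (z.hom ≫ Z.ν.app z.right)) IsIso.inv_id).trans (Category.id_comp _)
    exact conj_tgt h1 h2 (Q.src.map_id _) (P.src.map_id _)

end SpanSpan
end

/-! ### The algebra of 2-cells -/

section

variable {A B C D : Type 1} [Groupoid.{0} A] [Groupoid.{0} B] [Groupoid.{0} C] [Groupoid.{0} D]

namespace TwoCell

variable {P Q R T : GSpan A B} {P' Q' R' : GSpan B C}

instance : Add (TwoCell P Q) := ⟨add⟩

instance : Zero (TwoCell P Q) := ⟨zero P Q⟩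

instance : AddCommMonoid (TwoCell P Q) where
  add_assoc := by rintro ⟨a⟩ ⟨b⟩ ⟨c⟩; exact Quotient.sound (SpanSpan.add_assoc a b c)
  zero_add := by rintro ⟨a⟩; exact Quotient.sound (SpanSpan.zero_add a)
  add_zero := by
    rintro ⟨a⟩
    exact Quotient.sound ((SpanSpan.add_comm _ _).trans (SpanSpan.zero_add a))
  add_comm := by rintro ⟨a⟩ ⟨b⟩; exact Quotient.sound (SpanSpan.add_comm a b)
  nsmul := nsmulRec

theorem nsmul_eq (n : ℕ) (c : TwoCell P Q) : nsmul n c = n • c := by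
  induction n with
  | zero => exact (zero_smul ℕ c).symm
  | succ n ih => exact (congrArg (add · c) ih).trans (succ_nsmul c n).symm

theorem vcomp_assoc (a : TwoCell P Q) (b : TwoCell Q R) (c : TwoCell R T) :
    (a.vcomp b).vcomp c = a.vcomp (b.vcomp c) := by
  obtain ⟨a⟩ := a; obtain ⟨b⟩ := b; obtain ⟨c⟩ := c
  exact Quotient.sound (SpanSpan.vcomp_assoc a b c)

theorem id_vcomp (a : TwoCell P Q) : (mk (SpanSpan.idTwo P)).vcomp a = a := by
  obtain ⟨a⟩ := a; exact Quotient.sound (SpanSpan.id_vcomp a)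

theorem vcomp_id (a : TwoCell P Q) : a.vcomp (mk (SpanSpan.idTwo Q)) = a := by
  obtain ⟨a⟩ := a; exact Quotient.sound (SpanSpan.vcomp_id a)

theorem interchange (a : TwoCell P Q) (b : TwoCell Q R) (a' : TwoCell P' Q')
    (b' : TwoCell Q' R') :
    (a.hcomp a').vcomp (b.hcomp b') = (a.vcomp b).hcomp (a'.vcomp b') := by
  obtain ⟨a⟩ := a; obtain ⟨b⟩ := b; obtain ⟨a'⟩ := a'; obtain ⟨b'⟩ := b'
  exact Quotient.sound (SpanSpan.interchange a a' b b')

theorem add_vcomp (a b : TwoCell P Q) (c : TwoCell Q R) :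
    (a + b).vcomp c = a.vcomp c + b.vcomp c := by
  obtain ⟨a⟩ := a; obtain ⟨b⟩ := b; obtain ⟨c⟩ := c
  exact Quotient.sound (SpanSpan.add_vcomp a b c)

theorem vcomp_add (a : TwoCell P Q) (b c : TwoCell Q R) :
    a.vcomp (b + c) = a.vcomp b + a.vcomp c := by
  obtain ⟨a⟩ := a; obtain ⟨b⟩ := b; obtain ⟨c⟩ := c
  exact Quotient.sound (SpanSpan.vcomp_add a b c)

theorem add_hcomp (a b : TwoCell P Q) (c : TwoCell P' Q') :
    (a + b).hcomp c = a.hcomp c + b.hcomp c := by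
  obtain ⟨a⟩ := a; obtain ⟨b⟩ := b; obtain ⟨c⟩ := c
  exact Quotient.sound (SpanSpan.add_hcomp a b c)

theorem hcomp_add (a : TwoCell P Q) (b c : TwoCell P' Q') :
    a.hcomp (b + c) = a.hcomp b + a.hcomp c := by
  obtain ⟨a⟩ := a; obtain ⟨b⟩ := b; obtain ⟨c⟩ := c
  exact Quotient.sound (SpanSpan.hcomp_add a b c)

theorem zero_vcomp (c : TwoCell Q R) : (0 : TwoCell P Q).vcomp c = 0 := by
  obtain ⟨c⟩ := c
  exact Quotient.sound (SpanSpan.equiv_zero fun z => PEmpty.elim z.left)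

theorem vcomp_zero (c : TwoCell P Q) : c.vcomp (0 : TwoCell Q R) = 0 := by
  obtain ⟨c⟩ := c
  exact Quotient.sound (SpanSpan.equiv_zero fun z => PEmpty.elim z.right)

theorem zero_hcomp (c : TwoCell P' Q') : (0 : TwoCell P Q).hcomp c = 0 := by
  obtain ⟨c⟩ := c
  exact Quotient.sound (SpanSpan.equiv_zero fun z => PEmpty.elim z.left)

theorem hcomp_zero (c : TwoCell P Q) : c.hcomp (0 : TwoCell P' Q') = 0 := by
  obtain ⟨c⟩ := c
  exact Quotient.sound (SpanSpan.equiv_zero fun z => PEmpty.elim z.right)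

/-- A criterion for naturality of an invertible family of 2-cells. -/
theorem natural_of_conj {a : TwoCell P Q} {a' : TwoCell Q P} {b : TwoCell R T}
    {f : TwoCell P R} {g : TwoCell Q T} (ha : a.vcomp a' = mk (SpanSpan.idTwo P))
    (h : (a'.vcomp f).vcomp b = g) : f.vcomp b = a.vcomp g := by
  rw [← h, ← vcomp_assoc, ← vcomp_assoc, ha, id_vcomp]

theorem natural_of_conj' {a' : TwoCell Q P} {b : TwoCell R T} {b' : TwoCell T R}
    {f : TwoCell P R} {g : TwoCell Q T} (hb : b.vcomp b' = mk (SpanSpan.idTwo R))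
    (h : (a'.vcomp f).vcomp b = g) : g.vcomp b' = a'.vcomp f := by
  rw [← h, vcomp_assoc, hb, vcomp_id]

theorem mk_vcomp_converse (Z : SpanSpan P Q) [Z.top.IsEquivalence] [Z.bot.Full]
    [Z.bot.Faithful] : (mk Z).vcomp (mk Z.converse) = mk (SpanSpan.idTwo P) :=
  Quotient.sound (SpanSpan.vcomp_converse Z)

theorem mk_converse_vcomp (Z : SpanSpan P Q) [h : Z.bot.IsEquivalence] [h' : Z.top.Full]
    [h'' : Z.top.Faithful] : (mk Z.converse).vcomp (mk Z) = mk (SpanSpan.idTwo Q) := by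
  have : Z.converse.top.IsEquivalence := h
  have : Z.converse.bot.Full := h'
  have : Z.converse.bot.Faithful := h''
  have := mk_vcomp_converse Z.converse
  rwa [SpanSpan.converse_converse] at this

end TwoCell

section Structural

theorem isEquivalence_assocSpan_top (P : GSpan A B) (P' : GSpan B C) (P'' : GSpan C D) :
    (assocSpan P P' P'').top.IsEquivalence := Functor.isEquivalence_refl

theorem isEquivalence_assocSpan_bot (P : GSpan A B) (P' : GSpan B C) (P'' : GSpan C D) :
    (assocSpan P P' P'').bot.IsEquivalence :=
  isEquivalence_of_inverse _
    { obj := fun c => ⟨⟨c.left, c.right.left, c.hom⟩, c.right.right, c.right.hom⟩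
      map := fun f => ⟨⟨f.left, f.right.left, f.w⟩, f.right.right, f.right.w⟩ } rfl rfl

theorem isEquivalence_unitorSrc_top (P : GSpan A B) : (unitorSrc P).top.IsEquivalence :=
  Functor.isEquivalence_refl

theorem isEquivalence_unitorSrc_bot (P : GSpan A B) : (unitorSrc P).bot.IsEquivalence :=
  isEquivalence_fst P.tgt (𝟭 B)

theorem isEquivalence_unitorTgt_top (P : GSpan A B) : (unitorTgt P).top.IsEquivalence :=
  Functor.isEquivalence_refl

theorem isEquivalence_unitorTgt_bot (P : GSpan A B) : (unitorTgt P).bot.IsEquivalence :=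
  isEquivalence_snd (𝟭 A) P.src

attribute [instance] isEquivalence_assocSpan_top isEquivalence_assocSpan_bot
  isEquivalence_unitorSrc_top isEquivalence_unitorSrc_bot isEquivalence_unitorTgt_top
  isEquivalence_unitorTgt_bot

end Structural

/-! ### Spans of spans as relations between points -/

namespace SpanSpan

variable {P Q R : GSpan A B} {P' Q' : GSpan B C}

/-- The relation between points of the two apices given by a span of spans, together with the
comparison maps between their images under the legs. -/
def Rel (Z : SpanSpan P Q) (p : P.apex) (q : Q.apex) (α : P.src.obj p ⟶ Q.src.obj q)
    (β : P.tgt.obj p ⟶ Q.tgt.obj q) : Prop :=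
  ∃ (z : Z.apex) (s : p ⟶ Z.top.obj z) (t : Z.bot.obj z ⟶ q),
    α = P.src.map s ≫ Z.ν.app z ≫ Q.src.map t ∧ β = P.tgt.map s ≫ Z.μ.app z ≫ Q.tgt.map t

variable {p : P.apex} {q : Q.apex} {r : R.apex} {α : P.src.obj p ⟶ Q.src.obj q}
  {β : P.tgt.obj p ⟶ Q.tgt.obj q}

theorem rel_of (Z : SpanSpan P Q) (z : Z.apex) :
    Z.Rel (Z.top.obj z) (Z.bot.obj z) (Z.ν.app z) (Z.μ.app z) :=
  ⟨z, 𝟙 _, 𝟙 _, by simp, by simp⟩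

theorem Rel.equiv {Z W : SpanSpan P Q} (h : Z.Rel p q α β) (e : Z.Equiv W) : W.Rel p q α β := by
  obtain ⟨z, s, t, rfl, rfl⟩ := h
  obtain ⟨U, hU, σ, τ, h1, h2⟩ := e
  refine ⟨U.obj z, s ≫ σ.app z, inv (τ.app z) ≫ t, ?_, ?_⟩
  · have := h2 z
    simp only [Functor.map_comp, Functor.map_inv, Category.assoc, ← reassoc_of% this]
    simp
  · have := h1 z
    simp only [Functor.map_comp, Functor.map_inv, Category.assoc, ← reassoc_of% this]
    simp

theorem Rel.conv {Z : SpanSpan P Q} (h : Z.Rel p q α β) : Z.converse.Rel q p (inv α) (inv β) := by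
  obtain ⟨z, s, t, rfl, rfl⟩ := h
  refine ⟨z, (inv t : q ⟶ Z.bot.obj z), (inv s : Z.top.obj z ⟶ p), ?_, ?_⟩
  · simp [converse]
  · simp [converse]

theorem Rel.vcomp {Z : SpanSpan P Q} {W : SpanSpan Q R} {α' : Q.src.obj q ⟶ R.src.obj r}
    {β' : Q.tgt.obj q ⟶ R.tgt.obj r} (h : Z.Rel p q α β) (h' : W.Rel q r α' β') :
    (Z.vcomp W).Rel p r (α ≫ α') (β ≫ β') := by
  obtain ⟨z, s, t, rfl, rfl⟩ := h
  obtain ⟨w, s', t', rfl, rfl⟩ := h'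
  refine ⟨⟨z, w, t ≫ s'⟩, s, t', ?_, ?_⟩
  · simp [SpanSpan.vcomp]
  · simp [SpanSpan.vcomp]

theorem Rel.of_vcomp {Z : SpanSpan P Q} {W : SpanSpan Q R} {α : P.src.obj p ⟶ R.src.obj r}
    {β : P.tgt.obj p ⟶ R.tgt.obj r} (h : (Z.vcomp W).Rel p r α β) :
    ∃ q α₁ β₁ α₂ β₂, Z.Rel p q α₁ β₁ ∧ W.Rel q r α₂ β₂ := by
  obtain ⟨z, s, t, -, -⟩ := h
  exact ⟨_, _, _, _, _, ⟨z.left, s, z.hom, rfl, rfl⟩, ⟨z.right, 𝟙 _, t, rfl, rfl⟩⟩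

/-- The compatibility condition for a pair of related points of two composable spans. -/
theorem rel_hcomp_aux {E : Type 1} [Groupoid.{0} E] {x₁ x₂ x₃ x₄ y₁ y₂ y₃ y₄ : E} {s : x₁ ⟶ x₂}
    {m : x₂ ⟶ x₃} {t : x₃ ⟶ x₄} {s' : y₁ ⟶ y₂} {n : y₂ ⟶ y₃} {t' : y₃ ⟶ y₄} {h : x₁ ⟶ y₁}
    {k : x₄ ⟶ y₄} (w : (s ≫ m ≫ t) ≫ k = h ≫ (s' ≫ n ≫ t')) :
    t ≫ k = (inv m ≫ (inv s ≫ h ≫ s') ≫ n) ≫ t' := by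
  simp only [Category.assoc] at w ⊢
  rw [← w]
  simp

theorem Rel.hcomp {Z : SpanSpan P Q} {W : SpanSpan P' Q'} {p' : P'.apex} {q' : Q'.apex}
    {α' : P'.src.obj p' ⟶ Q'.src.obj q'} {β' : P'.tgt.obj p' ⟶ Q'.tgt.obj q'}
    (h : P.tgt.obj p ⟶ P'.src.obj p') (k : Q.tgt.obj q ⟶ Q'.src.obj q') (hZ : Z.Rel p q α β)
    (hW : W.Rel p' q' α' β') (w : β ≫ k = h ≫ α') :
    (Z.hcomp W).Rel (P := P.comp P') (Q := Q.comp Q') ⟨p, p', h⟩ ⟨q, q', k⟩ α β' := by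
  obtain ⟨z, s, t, rfl, rfl⟩ := hZ
  obtain ⟨z', s', t', rfl, rfl⟩ := hW
  exact ⟨⟨z, z', inv (P.tgt.map s) ≫ h ≫ P'.src.map s'⟩, ⟨s, s', (IsIso.hom_inv_id_assoc _ _)⟩,
    ⟨t, t', rel_hcomp_aux w⟩, rfl, rfl⟩

theorem Rel.of_hcomp {Z : SpanSpan P Q} {W : SpanSpan P' Q'} {c : (P.comp P').apex}
    {d : (Q.comp Q').apex} {α : (P.comp P').src.obj c ⟶ (Q.comp Q').src.obj d}
    {β : (P.comp P').tgt.obj c ⟶ (Q.comp Q').tgt.obj d} (h : (Z.hcomp W).Rel c d α β) :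
    (∃ α₁ β₁, Z.Rel c.left d.left α₁ β₁) ∧ ∃ α₂ β₂, W.Rel c.right d.right α₂ β₂ := by
  obtain ⟨z, s, t, -, -⟩ := h
  exact ⟨⟨_, _, z.left, s.left, t.left, rfl, rfl⟩, ⟨_, _, z.right, s.right, t.right, rfl, rfl⟩⟩

/-- Points related to the same point by a span of spans whose top leg is an equivalence are
isomorphic. -/
theorem Rel.unique {Z : SpanSpan P Q} [Z.top.IsEquivalence] (h : Z.Rel p q α β) {q' : Q.apex}
    {α' : P.src.obj p ⟶ Q.src.obj q'} {β' : P.tgt.obj p ⟶ Q.tgt.obj q'} (h' : Z.Rel p q' α' β') :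
    ∃ t : q ⟶ q', α ≫ Q.src.map t = α' ∧ β ≫ Q.tgt.map t = β' := by
  obtain ⟨z, s, t, rfl, rfl⟩ := h
  obtain ⟨z', s', t', rfl, rfl⟩ := h'
  obtain ⟨k, hk⟩ := Z.top.map_surjective (inv s ≫ s')
  rw [IsIso.eq_inv_comp] at hk
  have h1 := Z.μ.naturality k
  have h2 := Z.ν.naturality k
  simp only [Functor.comp_map] at h1 h2
  refine ⟨inv t ≫ Z.bot.map k ≫ t', ?_, ?_⟩
  · simp [← hk, reassoc_of% h2]
  · simp [← hk, reassoc_of% h1]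

/-- The square behind naturality in `equiv_of_rel`. -/
theorem naturality_aux {E : Type 1} [Groupoid.{0} E] {x x' y y' u u' v v' : E} {T : x ⟶ x'}
    {n : x ⟶ y} {n' : x' ⟶ y'} {b : y ⟶ y'} {s : x ⟶ u} {s' : x' ⟶ u'} {T' : u ⟶ u'} {m : u ⟶ v}
    {m' : u' ⟶ v'} {b' : v ⟶ v'} (h1 : T ≫ n' = n ≫ b) (h2 : T' ≫ m' = m ≫ b')
    (h3 : T ≫ s' = s ≫ T') : b ≫ inv n' ≫ s' ≫ m' = (inv n ≫ s ≫ m) ≫ b' := by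
  rw [Category.assoc, IsIso.eq_inv_comp, ← reassoc_of% h1, IsIso.hom_inv_id_assoc, Category.assoc,
    ← h2, reassoc_of% h3]

/-- Two spans of spans whose top legs are equivalences agree if they relate the same points, for
every point of `P` up to isomorphism. -/
theorem equiv_of_rel [hQ : Q.src.Faithful] (Z W : SpanSpan P Q) [Z.top.IsEquivalence]
    [W.top.IsEquivalence] {ι : Type 1} (x : ι → P.apex) (hx : ∀ p, ∃ i, Nonempty (x i ⟶ p))
    (h : ∀ i, ∃ q α β, Z.Rel (x i) q α β ∧ W.Rel (x i) q α β) : Z.Equiv W := by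
  have key (p : P.apex) : ∃ q α β, Z.Rel p q α β ∧ W.Rel p q α β := by
    obtain ⟨i, ⟨f⟩⟩ := hx p
    obtain ⟨q, α, β, ⟨z, s, t, h1, h2⟩, ⟨z', s', t', h3, h4⟩⟩ := h i
    refine ⟨q, inv (P.src.map f) ≫ α, inv (P.tgt.map f) ≫ β,
      ⟨z, inv f ≫ s, t, ?_, ?_⟩, ⟨z', inv f ≫ s', t', ?_, ?_⟩⟩
    · simp [h1]
    · simp [h2]
    · simp [h3]
    · simp [h4]
  -- a point of `Z` determines a point of `W` and comparison maps, since related points are unique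
  have key2 (z : Z.apex) : ∃ (w : W.apex) (σ : Z.top.obj z ⟶ W.top.obj w)
      (τ : Z.bot.obj z ⟶ W.bot.obj w),
      Z.μ.app z ≫ Q.tgt.map τ = P.tgt.map σ ≫ W.μ.app w ∧
      Z.ν.app z ≫ Q.src.map τ = P.src.map σ ≫ W.ν.app w := by
    obtain ⟨q, α, β, h1, h2⟩ := key (Z.top.obj z)
    obtain ⟨t, rfl, rfl⟩ := (Z.rel_of z).unique h1
    obtain ⟨w, s, t', h3, h4⟩ := h2
    refine ⟨w, s, t ≫ inv t', ?_, ?_⟩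
    · rw [Functor.map_comp, reassoc_of% h4]; simp
    · rw [Functor.map_comp, reassoc_of% h3]; simp
  choose w σ τ h1 h2 using key2
  have hσ : ∀ {z z'} (f : z ⟶ z'), W.top.map (W.top.preimage (inv (σ z) ≫ Z.top.map f ≫ σ z')) =
      inv (σ z) ≫ Z.top.map f ≫ σ z' := fun f => W.top.map_preimage _
  let U : Z.apex ⥤ W.apex :=
    { obj := w
      map := fun {z z'} f => W.top.preimage (inv (σ z) ≫ Z.top.map f ≫ σ z')
      map_id := fun z => W.top.map_injective (by rw [hσ]; simp)
      map_comp := fun f g => W.top.map_injective (by rw [W.top.map_comp, hσ, hσ, hσ]; simp) }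
  let σ' : Z.top ≅ U ⋙ W.top := NatIso.ofComponents (fun z => (Groupoid.isoEquivHom _ _).symm (σ z))
    (fun {z z'} f => by
      change Z.top.map f ≫ σ z' = σ z ≫ W.top.map (W.top.preimage (inv (σ z) ≫ Z.top.map f ≫ σ z'))
      rw [hσ, IsIso.hom_inv_id_assoc])
  have hU : U.IsEquivalence := by
    have : (U ⋙ W.top).IsEquivalence := Functor.isEquivalence_of_iso σ'
    exact Functor.isEquivalence_of_comp_right U W.top
  refine ⟨U, hU, σ'.hom, ⟨τ, fun z z' f => ?_⟩, h1, h2⟩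
  apply Q.src.map_injective
  have n1 := Z.ν.naturality f
  have n2 := W.ν.naturality (U.map f)
  have n3 := (P.src.map_comp _ _).symm.trans
    ((congrArg P.src.map (σ'.hom.naturality f)).trans (P.src.map_comp _ _))
  have e : ∀ z, Q.src.map (τ z) = inv (Z.ν.app z) ≫ P.src.map (σ z) ≫ W.ν.app (w z) := fun z => by
    rw [IsIso.eq_inv_comp]; exact h2 z
  rw [Functor.map_comp, Functor.map_comp, e, e]
  exact naturality_aux n1 n2 n3

end SpanSpan

end

/-! ### Converses and maps of spans -/

section

variable {A B C D : Type 1} [Groupoid.{0} A] [Groupoid.{0} B] [Groupoid.{0} C] [Groupoid.{0} D]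

namespace SpanSpan

variable {P Q R : GSpan A B} {P' Q' : GSpan B C}

theorem isEquivalence_hcomp_top (Z : SpanSpan P Q) (W : SpanSpan P' Q') [Z.top.IsEquivalence]
    [W.top.IsEquivalence] : (Z.hcomp W).top.IsEquivalence where
  faithful := ⟨fun e => Comma.hom_ext _ _ (Z.top.map_injective (congrArg CommaMorphism.left e))
    (W.top.map_injective (congrArg CommaMorphism.right e))⟩
  full := ⟨fun {c d} g => ⟨⟨Z.top.preimage g.left, W.top.preimage g.right,
      (congrArg (fun t => P.tgt.map t ≫ d.hom) (Z.top.map_preimage g.left)).trans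
        (g.w.trans (congrArg (fun t => c.hom ≫ P'.src.map t)
          (W.top.map_preimage g.right).symm))⟩,
      Comma.hom_ext _ _ (Z.top.map_preimage _) (W.top.map_preimage _)⟩⟩
  essSurj := ⟨fun c => by
    let e := Z.top.objObjPreimageIso c.left
    let e' := W.top.objObjPreimageIso c.right
    have w : P.tgt.map e.hom ≫ c.hom =
        (P.tgt.map e.hom ≫ c.hom ≫ inv (P'.src.map e'.hom)) ≫ P'.src.map e'.hom := by
      simp only [Category.assoc, IsIso.inv_hom_id, Category.comp_id]
    exact ⟨⟨Z.top.objPreimage c.left, W.top.objPreimage c.right,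
      P.tgt.map e.hom ≫ c.hom ≫ inv (P'.src.map e'.hom)⟩, ⟨(Groupoid.isoEquivHom _ _).symm
        ⟨e.hom, e'.hom, w⟩⟩⟩⟩

/-- The cancellation behind fullness of the comparison functor in `hcomp_conv`. -/
theorem conj_cancel {E : Type 1} [Groupoid.{0} E] {x x' y y' u u' v v' : E} {m : x ⟶ u}
    {m' : x' ⟶ u'} {n : y ⟶ v} {n' : y' ⟶ v'} {a : x ⟶ x'} {b : y ⟶ y'} {a' : u ⟶ u'}
    {b' : v ⟶ v'} {h : x ⟶ y} {h' : x' ⟶ y'} (h1 : a ≫ m' = m ≫ a') (h2 : b ≫ n' = n ≫ b')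
    (w : a' ≫ (inv m' ≫ h' ≫ n') = (inv m ≫ h ≫ n) ≫ b') : a ≫ h' = h ≫ b := by
  have ha : a' = inv m ≫ a ≫ m' := by rw [h1, IsIso.inv_hom_id_assoc]
  have hb : b = n ≫ b' ≫ inv n' := by rw [← Category.assoc, ← h2]; simp
  rw [ha] at w
  rw [hb]
  have := congrArg (fun t => m ≫ t ≫ inv n') w
  simpa using this

theorem hcomp_conv (Z : SpanSpan P Q) (W : SpanSpan P' Q') :
    (Z.hcomp W).converse.Equiv (Z.converse.hcomp W.converse) := by
  let U : Comma (Z.top ⋙ P.tgt) (W.top ⋙ P'.src) ⥤ Comma (Z.bot ⋙ Q.tgt) (W.bot ⋙ Q'.src) :=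
    { obj := fun c => ⟨c.left, c.right, inv (Z.μ.app c.left) ≫ c.hom ≫ W.ν.app c.right⟩
      map := fun f => ⟨f.left, f.right, ((Z.hcomp W).bot.map f).w⟩ }
  have hU : U.IsEquivalence :=
    { faithful := ⟨fun {c d _ _} e => Comma.hom_ext _ _
        (congrArg (fun t : U.obj c ⟶ U.obj d => t.left) e)
        (congrArg (fun t : U.obj c ⟶ U.obj d => t.right) e)⟩
      full := ⟨fun {c d} f => ⟨⟨f.left, f.right, conj_cancel (Z.μ.naturality f.left)
        (W.ν.naturality f.right) f.w⟩, rfl⟩⟩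
      essSurj := ⟨fun c => ⟨⟨c.left, c.right, Z.μ.app c.left ≫ c.hom ≫ inv (W.ν.app c.right)⟩,
        ⟨eqToIso (by
          have : inv (Z.μ.app c.left) ≫ (Z.μ.app c.left ≫ c.hom ≫ inv (W.ν.app c.right)) ≫
            W.ν.app c.right = c.hom := by simp
          exact congrArg (Comma.mk c.left c.right) this)⟩⟩⟩ }
  have hb (c : Comma (Z.top ⋙ P.tgt) (W.top ⋙ P'.src)) : inv ((inv Z.μ).app c.left) ≫
      (inv (Z.μ.app c.left) ≫ c.hom ≫ W.ν.app c.right) ≫ (inv W.ν).app c.right = c.hom := by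
    simp
  dsimp only [hcomp, converse]
  refine Equiv.intro U hU (fun z => 𝟙 _)
    (fun z => ⟨𝟙 (Z.top.obj z.left), 𝟙 (W.top.obj z.right), ?_⟩) (fun f => ?_) (fun f => ?_)
    (fun z => ?_) (fun z => ?_)
  · exact (congrArg (· ≫ _) (P.tgt.map_id _)).trans ((Category.id_comp _).trans
      ((hb z).trans ((Category.comp_id _).symm.trans
        (congrArg (_ ≫ ·) (P'.src.map_id _).symm))))
  · exact (Category.comp_id _).trans (Category.id_comp _).symm
  · apply Comma.hom_ext
    · exact (Category.comp_id _).trans (Category.id_comp _).symm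
    · exact (Category.comp_id _).trans (Category.id_comp _).symm
  · refine (congrArg (_ ≫ ·) (P'.tgt.map_id _)).trans ((Category.comp_id _).trans
      (Eq.trans ?_ ((congrArg (· ≫ _) (Q'.tgt.map_id _)).trans (Category.id_comp _)).symm))
    exact (@NatIso.isIso_inv_app _ _ _ _ _ _ _ (natTransIsIso _) _).trans
      (NatIso.isIso_inv_app W.μ z.right).symm
  · refine (congrArg (_ ≫ ·) (P.src.map_id _)).trans ((Category.comp_id _).trans
      (Eq.trans ?_ ((congrArg (· ≫ _) (Q.src.map_id _)).trans (Category.id_comp _)).symm))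
    exact (@NatIso.isIso_inv_app _ _ _ _ _ _ _ (natTransIsIso _) _).trans
      (NatIso.isIso_inv_app Z.ν z.left).symm

theorem isEquivalence_vcomp_top (Z : SpanSpan P Q) (W : SpanSpan Q R) [Z.top.IsEquivalence]
    [W.top.IsEquivalence] : (Z.vcomp W).top.IsEquivalence := by
  have := isEquivalence_fst Z.bot W.top
  exact inferInstanceAs (Comma.fst Z.bot W.top ⋙ Z.top).IsEquivalence

end SpanSpan

namespace TwoCell

variable {P Q R : GSpan A B} {P' Q' : GSpan B C}

/-- The class of the converse. -/
noncomputable def converse : TwoCell P Q → TwoCell Q P :=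
  Quotient.map SpanSpan.converse fun _ _ h => h.conv

theorem converse_converse (c : TwoCell P Q) : c.converse.converse = c := by
  obtain ⟨Z⟩ := c
  exact congrArg mk (SpanSpan.converse_converse Z)

theorem vcomp_converse (c : TwoCell P Q) (d : TwoCell Q R) :
    (c.vcomp d).converse = d.converse.vcomp c.converse := by
  obtain ⟨Z⟩ := c; obtain ⟨W⟩ := d
  exact Quotient.sound (SpanSpan.vcomp_conv Z W)

theorem hcomp_converse (c : TwoCell P Q) (d : TwoCell P' Q') :
    (c.hcomp d).converse = c.converse.hcomp d.converse := by
  obtain ⟨Z⟩ := c; obtain ⟨W⟩ := d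
  exact Quotient.sound (SpanSpan.hcomp_conv Z W)

/-- A 2-cell is total if it is represented by a map of spans, that is, by a span of spans whose
top leg is an equivalence. -/
def IsTotal (c : TwoCell P Q) : Prop := ∃ Z, mk Z = c ∧ Z.top.IsEquivalence

theorem IsTotal.mk (Z : SpanSpan P Q) (h : Z.top.IsEquivalence) : (TwoCell.mk Z).IsTotal :=
  ⟨Z, rfl, h⟩

theorem IsTotal.vcomp {c : TwoCell P Q} {d : TwoCell Q R} (hc : c.IsTotal) (hd : d.IsTotal) :
    (c.vcomp d).IsTotal := by
  obtain ⟨Z, rfl, hZ⟩ := hc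
  obtain ⟨W, rfl, hW⟩ := hd
  exact ⟨_, rfl, SpanSpan.isEquivalence_vcomp_top Z W⟩

theorem IsTotal.hcomp {c : TwoCell P Q} {d : TwoCell P' Q'} (hc : c.IsTotal) (hd : d.IsTotal) :
    (c.hcomp d).IsTotal := by
  obtain ⟨Z, rfl, hZ⟩ := hc
  obtain ⟨W, rfl, hW⟩ := hd
  exact ⟨_, rfl, SpanSpan.isEquivalence_hcomp_top Z W⟩

/-- The relation between the points of two spans underlying a 2-cell. -/
def Rel (c : TwoCell P Q) (p : P.apex) (q : Q.apex) (α : P.src.obj p ⟶ Q.src.obj q)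
    (β : P.tgt.obj p ⟶ Q.tgt.obj q) : Prop := ∃ Z, mk Z = c ∧ Z.Rel p q α β

variable {p : P.apex} {q : Q.apex} {r : R.apex} {α : P.src.obj p ⟶ Q.src.obj q}
  {β : P.tgt.obj p ⟶ Q.tgt.obj q}

theorem rel_mk {Z : SpanSpan P Q} : (mk Z).Rel p q α β ↔ Z.Rel p q α β :=
  ⟨fun ⟨_, h, h'⟩ => h'.equiv (Quotient.exact h), fun h => ⟨Z, rfl, h⟩⟩

theorem rel_id (p : P.apex) : (mk (SpanSpan.idTwo P)).Rel p p (𝟙 _) (𝟙 _) :=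
  rel_mk.2 ((SpanSpan.idTwo P).rel_of p)

theorem Rel.conv {c : TwoCell P Q} (h : c.Rel p q α β) :
    c.converse.Rel q p (Groupoid.inv α) (Groupoid.inv β) := by
  obtain ⟨Z, rfl, h⟩ := h
  rw [Groupoid.inv_eq_inv, Groupoid.inv_eq_inv]
  exact ⟨_, rfl, h.conv⟩

theorem Rel.vcomp {c : TwoCell P Q} {d : TwoCell Q R} {α' : Q.src.obj q ⟶ R.src.obj r}
    {β' : Q.tgt.obj q ⟶ R.tgt.obj r} (h : c.Rel p q α β) (h' : d.Rel q r α' β') :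
    (c.vcomp d).Rel p r (α ≫ α') (β ≫ β') := by
  obtain ⟨Z, rfl, h⟩ := h
  obtain ⟨W, rfl, h'⟩ := h'
  exact ⟨_, rfl, h.vcomp h'⟩

theorem Rel.of_vcomp {c : TwoCell P Q} {d : TwoCell Q R} {α : P.src.obj p ⟶ R.src.obj r}
    {β : P.tgt.obj p ⟶ R.tgt.obj r} (h : (c.vcomp d).Rel p r α β) :
    ∃ q α₁ β₁ α₂ β₂, c.Rel p q α₁ β₁ ∧ d.Rel q r α₂ β₂ := by
  obtain ⟨Z⟩ := c
  obtain ⟨W⟩ := d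
  obtain ⟨q, α₁, β₁, α₂, β₂, h1, h2⟩ := (rel_mk.1 h).of_vcomp
  exact ⟨q, α₁, β₁, α₂, β₂, rel_mk.2 h1, rel_mk.2 h2⟩

theorem Rel.hcomp {c : TwoCell P Q} {d : TwoCell P' Q'} {p' : P'.apex} {q' : Q'.apex}
    {α' : P'.src.obj p' ⟶ Q'.src.obj q'} {β' : P'.tgt.obj p' ⟶ Q'.tgt.obj q'}
    (h : P.tgt.obj p ⟶ P'.src.obj p') (k : Q.tgt.obj q ⟶ Q'.src.obj q') (hc : c.Rel p q α β)
    (hd : d.Rel p' q' α' β') (w : β ≫ k = h ≫ α') :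
    (c.hcomp d).Rel (P := P.comp P') (Q := Q.comp Q') ⟨p, p', h⟩ ⟨q, q', k⟩ α β' := by
  obtain ⟨Z, rfl, hc⟩ := hc
  obtain ⟨W, rfl, hd⟩ := hd
  exact ⟨_, rfl, hc.hcomp h k hd w⟩

theorem Rel.of_hcomp {c : TwoCell P Q} {d : TwoCell P' Q'} {x : (P.comp P').apex}
    {y : (Q.comp Q').apex} {α : (P.comp P').src.obj x ⟶ (Q.comp Q').src.obj y}
    {β : (P.comp P').tgt.obj x ⟶ (Q.comp Q').tgt.obj y} (h : (c.hcomp d).Rel x y α β) :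
    (∃ α₁ β₁, c.Rel x.left y.left α₁ β₁) ∧ ∃ α₂ β₂, d.Rel x.right y.right α₂ β₂ := by
  obtain ⟨Z⟩ := c
  obtain ⟨W⟩ := d
  obtain ⟨⟨α₁, β₁, h1⟩, α₂, β₂, h2⟩ := (rel_mk.1 h).of_hcomp
  exact ⟨⟨α₁, β₁, rel_mk.2 h1⟩, α₂, β₂, rel_mk.2 h2⟩

theorem Rel.unique {c : TwoCell P Q} (hc : c.IsTotal) (h : c.Rel p q α β) {q' : Q.apex}
    {α' : P.src.obj p ⟶ Q.src.obj q'} {β' : P.tgt.obj p ⟶ Q.tgt.obj q'}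
    (h' : c.Rel p q' α' β') : Nonempty (q ⟶ q') := by
  obtain ⟨Z, rfl, hZ⟩ := hc
  obtain ⟨t, -⟩ := (rel_mk.1 h).unique (rel_mk.1 h')
  exact ⟨t⟩

/-- A total 2-cell is determined by the points to which it relates representatives. -/
theorem IsTotal.eq_of_rel {c d : TwoCell P Q} (hc : c.IsTotal) (hd : d.IsTotal)
    (hQ : Q.src.Faithful) {ι : Type 1} (x : ι → P.apex) (hx : ∀ p, ∃ i, Nonempty (x i ⟶ p))
    (h : ∀ i, ∃ q α β, c.Rel (x i) q α β ∧ d.Rel (x i) q α β) : c = d := by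
  obtain ⟨Z, rfl, hZ⟩ := hc
  obtain ⟨W, rfl, hW⟩ := hd
  refine Quotient.sound (SpanSpan.equiv_of_rel Z W x hx fun i => ?_)
  obtain ⟨q, α, β, h1, h2⟩ := h i
  exact ⟨q, α, β, rel_mk.1 h1, rel_mk.1 h2⟩

/-- A 2-cell that relates no points has an empty apex. -/
theorem eq_zero_of_not_rel {c : TwoCell P Q} (h : ∀ p q α β, ¬ c.Rel p q α β) : c = 0 := by
  obtain ⟨Z⟩ := c
  exact Quotient.sound (SpanSpan.equiv_zero fun z => h _ _ _ _ (rel_mk.2 (Z.rel_of z)))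

end TwoCell

end

/-! ### Total and cototal formal morphisms -/

/-- A formal morphism whose 2-cell is a map of spans. -/
class Total {X Y : HObj} (f : HMor ℕ X Y) : Prop where
  out : (Cmor f).IsTotal

/-- A formal morphism whose 2-cell is the converse of a map of spans. -/
class Cototal {X Y : HObj} (f : HMor ℕ X Y) : Prop where
  out : (Cmor f).converse.IsTotal

section

open HMor

variable {X Y Z X' Y' : HObj}

instance : Total (HMor.id X) := ⟨.mk _ Functor.isEquivalence_refl⟩
instance (f : HMor ℕ X Y) (g : HMor ℕ Y Z) [hf : Total f] [hg : Total g] : Total (f.comp g) :=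
  ⟨hf.out.vcomp hg.out⟩
instance (f : HMor ℕ X Y) (g : HMor ℕ X' Y') [hf : Total f] [hg : Total g] :
    Total (f.tensor g) := ⟨hg.out.hcomp hf.out⟩
instance : Total (assocHom X Y Z) := ⟨.mk _ (isEquivalence_assocSpan_bot _ _ _)⟩
instance : Total (assocInv X Y Z) := ⟨.mk _ (isEquivalence_assocSpan_top _ _ _)⟩
instance : Total (leftHom X) := ⟨.mk _ (isEquivalence_unitorSrc_top _)⟩
instance : Total (leftInv X) := ⟨.mk _ (isEquivalence_unitorSrc_bot _)⟩
instance : Total (rightHom X) := ⟨.mk _ (isEquivalence_unitorTgt_top _)⟩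
instance : Total (rightInv X) := ⟨.mk _ (isEquivalence_unitorTgt_bot _)⟩

instance : Cototal (HMor.id X) := ⟨.mk _ Functor.isEquivalence_refl⟩
instance (f : HMor ℕ X Y) (g : HMor ℕ Y Z) [hf : Cototal f] [hg : Cototal g] :
    Cototal (f.comp g) :=
  ⟨by rw [Cmor, TwoCell.vcomp_converse]; exact hg.out.vcomp hf.out⟩
instance (f : HMor ℕ X Y) (g : HMor ℕ X' Y') [hf : Cototal f] [hg : Cototal g] :
    Cototal (f.tensor g) :=
  ⟨(congrArg TwoCell.IsTotal (TwoCell.hcomp_converse (Cmor g) (Cmor f))).mpr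
    (hg.out.hcomp hf.out)⟩
instance : Cototal (assocHom X Y Z) := ⟨.mk _ (isEquivalence_assocSpan_top _ _ _)⟩
instance : Cototal (assocInv X Y Z) := ⟨.mk _ (isEquivalence_assocSpan_bot _ _ _)⟩
instance : Cototal (leftHom X) := ⟨.mk _ (isEquivalence_unitorSrc_bot _)⟩
instance : Cototal (leftInv X) := ⟨.mk _ (isEquivalence_unitorSrc_top _)⟩
instance : Cototal (rightHom X) := ⟨.mk _ (isEquivalence_unitorTgt_bot _)⟩
instance : Cototal (rightInv X) := ⟨.mk _ (isEquivalence_unitorTgt_top _)⟩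

/-- A section of the projection of a weak pullback along an identity is an equivalence, since the
projection is one. -/
theorem isEquivalence_diag {G : FS ⥤ FS} {d : FS ⥤ Comma G (𝟭 FS)}
    (h : d ⋙ Comma.fst G (𝟭 FS) = 𝟭 FS) : d.IsEquivalence := by
  have := isEquivalence_fst G (𝟭 FS)
  have : (d ⋙ Comma.fst G (𝟭 FS)).IsEquivalence := by rw [h]; exact Functor.isEquivalence_refl
  exact Functor.isEquivalence_of_comp_right d (Comma.fst G (𝟭 FS))

theorem isEquivalence_diag' {G : FS ⥤ FS} {d : FS ⥤ Comma (𝟭 FS) G}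
    (h : d ⋙ Comma.snd (𝟭 FS) G = 𝟭 FS) : d.IsEquivalence := by
  have := isEquivalence_snd (𝟭 FS) G
  have : (d ⋙ Comma.snd (𝟭 FS) G).IsEquivalence := by rw [h]; exact Functor.isEquivalence_refl
  exact Functor.isEquivalence_of_comp_right d (Comma.snd (𝟭 FS) G)

instance isEquivalence_iId_top : iId.top.IsEquivalence := Functor.isEquivalence_refl
instance isEquivalence_iAA_top : iAA.top.IsEquivalence := isEquivalence_diag rfl
theorem isEquivalence_etaSpan_bot : etaSpan.bot.IsEquivalence := isEquivalence_diag rfl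
theorem isEquivalence_swapCreat_top : swapCreat.top.IsEquivalence := isEquivalence_diag rfl
theorem isEquivalence_swapAnnih_top : swapAnnih.top.IsEquivalence := isEquivalence_diag' rfl

instance : Total cupMP := ⟨.mk _ isEquivalence_iId_top⟩
instance : Total capPM := ⟨.mk _ isEquivalence_etaSpan_bot⟩
instance : Total crossPP := ⟨.mk _ isEquivalence_swapCreat_top⟩
instance : Total crossMM := ⟨.mk _ isEquivalence_swapAnnih_top⟩
instance : Total crossPM := ⟨.mk _ isEquivalence_iAA_top⟩
instance : Cototal capMP := ⟨.mk _ isEquivalence_iId_top⟩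
instance : Cototal cupPM := ⟨.mk _ isEquivalence_etaSpan_bot⟩
instance : Cototal crossPP := ⟨.mk _ isEquivalence_swapCreat_top⟩
instance : Cototal crossMM := ⟨.mk _ isEquivalence_swapAnnih_top⟩
instance : Cototal crossMP := ⟨.mk _ isEquivalence_iAA_top⟩

end

section

open HMor HObj

variable {X Y Z X' Y' : HObj}

/-! ### The structural and generating 2-cells as relations between points -/

theorem TwoCell.Rel.congr {A B : Type 1} [Groupoid.{0} A] [Groupoid.{0} B] {P Q : GSpan A B}
    {c : TwoCell P Q} {p : P.apex} {q : Q.apex} {α α' : P.src.obj p ⟶ Q.src.obj q}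
    {β β' : P.tgt.obj p ⟶ Q.tgt.obj q} (h : c.Rel p q α β) (hα : α = α') (hβ : β = β') :
    c.Rel p q α' β' := by rwa [← hα, ← hβ]

theorem TwoCell.Rel.transport {A B : Type 1} [Groupoid.{0} A] [Groupoid.{0} B] {P Q : GSpan A B}
    {c : TwoCell P Q} {p : P.apex} {q q' : Q.apex} {α : P.src.obj p ⟶ Q.src.obj q}
    {β : P.tgt.obj p ⟶ Q.tgt.obj q} (h : c.Rel p q α β) (t : q ⟶ q') :
    c.Rel p q' (α ≫ Q.src.map t) (β ≫ Q.tgt.map t) := by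
  obtain ⟨W, rfl, z, s, u, rfl, rfl⟩ := h
  exact ⟨W, rfl, z, s, u ≫ t, by simp, by simp⟩

/-- The relation between the points of `C(X)` and `C(Y)` given by a formal morphism. -/
abbrev HRelPt (f : HMor ℕ X Y) (p : (Cobj X).apex) (q : (Cobj Y).apex)
    (α : (Cobj X).src.obj p ⟶ (Cobj Y).src.obj q) (β : (Cobj X).tgt.obj p ⟶ (Cobj Y).tgt.obj q) :
    Prop := (Cmor f).Rel p q α β

theorem pt_comp {f : HMor ℕ X Y} {g : HMor ℕ Y Z} {p : (Cobj X).apex} {q : (Cobj Y).apex}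
    {r : (Cobj Z).apex} {α : (Cobj X).src.obj p ⟶ (Cobj Y).src.obj q}
    {β : (Cobj X).tgt.obj p ⟶ (Cobj Y).tgt.obj q} {α' : (Cobj Y).src.obj q ⟶ (Cobj Z).src.obj r}
    {β' : (Cobj Y).tgt.obj q ⟶ (Cobj Z).tgt.obj r} (h : HRelPt f p q α β)
    (h' : HRelPt g q r α' β') : HRelPt (f.comp g) p r (α ≫ α') (β ≫ β') := h.vcomp h'

theorem pt_id (p : (Cobj X).apex) : HRelPt (HMor.id X) p p (𝟙 _) (𝟙 _) := TwoCell.rel_id p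

/-- Tensoring with an identity on the left changes the first step of a history. The identification
`k` of the intermediate sets is adapted to `β`. -/
theorem pt_wl (x : (Cobj Z).apex) {f : HMor ℕ X Y} {p : (Cobj X).apex} {q : (Cobj Y).apex}
    {α : (Cobj X).src.obj p ⟶ (Cobj Y).src.obj q} {β : (Cobj X).tgt.obj p ⟶ (Cobj Y).tgt.obj q}
    (hf : HRelPt f p q α β) (h : (Cobj X).tgt.obj p ⟶ (Cobj Z).src.obj x)
    (k : (Cobj Y).tgt.obj q ⟶ (Cobj Z).src.obj x) (w : β ≫ k = h) :
    HRelPt (f.wl Z) ⟨p, x, h⟩ ⟨q, x, k⟩ α (𝟙 _) :=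
  hf.hcomp h k (pt_id x) (w.trans (Category.comp_id _).symm)

theorem pt_wr (x : (Cobj Z).apex) {f : HMor ℕ X Y} {p : (Cobj X).apex} {q : (Cobj Y).apex}
    {α : (Cobj X).src.obj p ⟶ (Cobj Y).src.obj q} {β : (Cobj X).tgt.obj p ⟶ (Cobj Y).tgt.obj q}
    (hf : HRelPt f p q α β) (h : (Cobj Z).tgt.obj x ⟶ (Cobj X).src.obj p)
    (k : (Cobj Z).tgt.obj x ⟶ (Cobj Y).src.obj q) (w : k = h ≫ α) :
    HRelPt (f.wr Z) ⟨x, p, h⟩ ⟨x, q, k⟩ (𝟙 _) β :=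
  TwoCell.Rel.hcomp h k (pt_id x) hf ((Category.id_comp _).trans w)

theorem pt_assocInv (x : (Cobj X).apex) (y : (Cobj Y).apex) (z : (Cobj Z).apex)
    (h : (Cobj Z).tgt.obj z ⟶ (Cobj Y).src.obj y) (k : (Cobj Y).tgt.obj y ⟶ (Cobj X).src.obj x) :
    HRelPt (assocInv X Y Z) ⟨⟨z, y, h⟩, x, k⟩ ⟨z, ⟨y, x, k⟩, h⟩ (𝟙 _) (𝟙 _) :=
  TwoCell.rel_mk.2 (SpanSpan.rel_of (assocSpan (Cobj Z) (Cobj Y) (Cobj X)) ⟨⟨z, y, h⟩, x, k⟩)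

theorem pt_assocHom (x : (Cobj X).apex) (y : (Cobj Y).apex) (z : (Cobj Z).apex)
    (h : (Cobj Z).tgt.obj z ⟶ (Cobj Y).src.obj y) (k : (Cobj Y).tgt.obj y ⟶ (Cobj X).src.obj x) :
    HRelPt (assocHom X Y Z) ⟨z, ⟨y, x, k⟩, h⟩ ⟨⟨z, y, h⟩, x, k⟩ (𝟙 _) (𝟙 _) :=
  (pt_assocInv x y z h k).conv

theorem pt_leftHom (p : (Cobj X).apex) (b : FS) (h : (Cobj X).tgt.obj p ⟶ b) :
    HRelPt (leftHom X) ⟨p, b, h⟩ p (𝟙 _) (Groupoid.inv h) := by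
  refine (TwoCell.rel_mk.2 (SpanSpan.rel_of (unitorSrc (Cobj X)) ⟨p, b, h⟩)).congr rfl ?_
  exact (@NatIso.isIso_inv_app _ _ _ _ _ _ _ (natTransIsIso _) _).trans
    (Groupoid.inv_eq_inv _).symm

theorem pt_leftInv (p : (Cobj X).apex) (b : FS) (h : (Cobj X).tgt.obj p ⟶ b) :
    HRelPt (leftInv X) p ⟨p, b, h⟩ (𝟙 _) h :=
  (pt_leftHom p b h).conv

theorem pt_rightHom (p : (Cobj X).apex) (a : FS) (h : a ⟶ (Cobj X).src.obj p) :
    HRelPt (rightHom X) ⟨a, p, h⟩ p h (𝟙 _) :=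
  TwoCell.rel_mk.2 (SpanSpan.rel_of (unitorTgt (Cobj X)) ⟨a, p, h⟩)

theorem pt_rightInv (p : (Cobj X).apex) (a : FS) (h : a ⟶ (Cobj X).src.obj p) :
    HRelPt (rightInv X) p ⟨a, p, h⟩ (Groupoid.inv h) (𝟙 _) :=
  (pt_rightHom p a h).conv

theorem pt_cupMP (S : FS) : HRelPt cupMP S ⟨S, S, 𝟙 _⟩ (𝟙 _) (𝟙 _) :=
  TwoCell.rel_mk.2 (iId.rel_of S)

theorem pt_capMP (S : FS) : HRelPt capMP ⟨S, S, 𝟙 _⟩ S (𝟙 _) (𝟙 _) := (pt_cupMP S).conv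

theorem pt_cupPM (S : FS) : HRelPt cupPM (plusOne.obj S) ⟨S, S, 𝟙 _⟩ (𝟙 _) (𝟙 _) :=
  TwoCell.rel_mk.2 (etaSpan.rel_of S)

theorem pt_capPM (S : FS) : HRelPt capPM ⟨S, S, 𝟙 _⟩ (plusOne.obj S) (𝟙 _) (𝟙 _) :=
  (pt_cupPM S).conv

theorem pt_crossPM (S : FS) : HRelPt crossPM ⟨S, S, 𝟙 _⟩
    ⟨plusOne.obj S, plusOne.obj S, swapTwo.app S⟩ (𝟙 _) (𝟙 _) :=
  TwoCell.rel_mk.2 (iAA.rel_of S)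

theorem pt_crossMP (S : FS) : HRelPt crossMP ⟨plusOne.obj S, plusOne.obj S, swapTwo.app S⟩
    ⟨S, S, 𝟙 _⟩ (𝟙 _) (𝟙 _) := (pt_crossPM S).conv

theorem pt_crossMM (S : FS) : HRelPt crossMM ⟨plusOne.obj S, S, 𝟙 _⟩ ⟨plusOne.obj S, S, 𝟙 _⟩
    (swapTwo.app S) (𝟙 _) :=
  TwoCell.rel_mk.2 (swapAnnih.rel_of S)

/-- The action of the exchange on a point `(S, T, h)` of `A† ∘ A†`. -/
theorem pt_crossPP (S T : FS) (h : plusOne.obj S ⟶ T) : HRelPt crossPP ⟨S, T, h⟩ ⟨S, T, h⟩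
    (𝟙 _) (plusOne.map (Groupoid.inv h) ≫ swapTwo.app S ≫ plusOne.map h) := by
  refine TwoCell.rel_mk.2 ⟨S, ⟨𝟙 S, (Groupoid.inv h : T ⟶ plusOne.obj S), ?_⟩, ⟨𝟙 S, h, ?_⟩, rfl, rfl⟩
  · change plusOne.map (𝟙 S) ≫ 𝟙 _ = h ≫ Groupoid.inv h
    simp
  · change plusOne.map (𝟙 S) ≫ h = 𝟙 _ ≫ h
    simp

/-! ### Isotopy, braid and coherence relations -/

/-- Total formal morphisms agree in the combinatorial representation if they relate representatives
of the points of their source to the same points. -/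
theorem Total.eq_of_pt {f g : HMor ℕ X Y} [hf : Total f] [hg : Total g] {ι : Type 1}
    (x : ι → (Cobj X).apex) (hx : ∀ p, ∃ i, Nonempty (x i ⟶ p))
    (h : ∀ i, ∃ q α β, HRelPt f (x i) q α β ∧ HRelPt g (x i) q α β) : Cmor f = Cmor g :=
  hf.out.eq_of_rel hg.out (isCover_Cobj Y).src.faithful x hx h

/-- The converse of `Total.eq_of_pt`, with representatives of the points of the target. -/
theorem Cototal.eq_of_pt {f g : HMor ℕ X Y} [hf : Cototal f] [hg : Cototal g] {ι : Type 1}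
    (x : ι → (Cobj Y).apex) (hx : ∀ p, ∃ i, Nonempty (x i ⟶ p))
    (h : ∀ i, ∃ p α β, HRelPt f p (x i) α β ∧ HRelPt g p (x i) α β) : Cmor f = Cmor g := by
  rw [← (Cmor f).converse_converse, ← (Cmor g).converse_converse]
  refine congrArg _ (hf.out.eq_of_rel hg.out (isCover_Cobj X).src.faithful x hx fun i => ?_)
  obtain ⟨p, α, β, h1, h2⟩ := h i
  exact ⟨p, _, _, h1.conv, h2.conv⟩

theorem exists_std (p : FS) : ∃ S : FS, Nonempty (S ⟶ p) := ⟨p, ⟨𝟙 p⟩⟩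

theorem exists_std_fst {G : FS ⥤ FS} (p : Comma G (𝟭 FS)) :
    ∃ S : FS, Nonempty ((⟨S, G.obj S, 𝟙 _⟩ : Comma G (𝟭 FS)) ⟶ p) :=
  ⟨p.left, ⟨⟨𝟙 _, p.hom, by simp⟩⟩⟩

theorem exists_std_snd {G : FS ⥤ FS} (p : Comma (𝟭 FS) G) :
    ∃ S : FS, Nonempty ((⟨G.obj S, S, 𝟙 _⟩ : Comma (𝟭 FS) G) ⟶ p) :=
  ⟨p.right, ⟨⟨inv p.hom, 𝟙 _, by simp⟩⟩⟩

theorem Cmor_zigzagP : Cmor HMor.zigzagP = Cmor (HMor.id plus) := by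
  have : Total (HMor.zigzagP (R := ℕ)) := by unfold HMor.zigzagP HMor.wl HMor.wr; infer_instance
  refine Total.eq_of_pt (fun S : FS => S) exists_std fun S => ⟨S, _, _, ?_, pt_id _⟩
  exact (pt_comp (pt_rightInv (X := plus) S S (𝟙 S)) <|
    pt_comp (pt_wl (Z := plus) S (pt_cupMP S) (𝟙 _) (𝟙 _) rfl) <|
    pt_comp (pt_assocInv (X := plus) (Y := minus) (Z := plus) S S S (𝟙 _) (𝟙 _)) <|
    pt_comp (pt_wr (Z := plus) S (pt_capPM S) (𝟙 _) (𝟙 _) rfl) <|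
    pt_leftHom (X := plus) S _ (𝟙 _)).congr rfl rfl

theorem Cmor_zigzagM : Cmor HMor.zigzagM = Cmor (HMor.id minus) := by
  have : Total (HMor.zigzagM (R := ℕ)) := by unfold HMor.zigzagM HMor.wl HMor.wr; infer_instance
  refine Total.eq_of_pt (fun S : FS => S) exists_std fun S => ⟨S, _, _, ?_, pt_id _⟩
  exact (pt_comp (pt_leftInv (X := minus) S S (𝟙 S)) <|
    pt_comp (pt_wr (Z := minus) S (pt_cupMP S) (𝟙 _) (𝟙 _) rfl) <|
    pt_comp (pt_assocHom (X := minus) (Y := plus) (Z := minus) S S S (𝟙 _) (𝟙 _)) <|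
    pt_comp (pt_wl (Z := minus) S (pt_capPM S) (𝟙 _) (𝟙 _) rfl) <|
    pt_rightHom (X := minus) S _ (𝟙 _)).congr rfl rfl

theorem Cmor_zigzagM' : Cmor HMor.zigzagM' = Cmor (HMor.id minus) := by
  have : Cototal (HMor.zigzagM' (R := ℕ)) := by
    unfold HMor.zigzagM' HMor.wl HMor.wr; infer_instance
  refine Cototal.eq_of_pt (fun S : FS => S) exists_std fun S => ⟨S, _, _, ?_, pt_id _⟩
  exact (pt_comp (pt_rightInv (X := minus) S (plusOne.obj S) (𝟙 _)) <|
    pt_comp (pt_wl (Z := minus) S (pt_cupPM S) (𝟙 _) (𝟙 _) rfl) <|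
    pt_comp (pt_assocInv (X := minus) (Y := plus) (Z := minus) S S S (𝟙 _) (𝟙 _)) <|
    pt_comp (pt_wr (Z := minus) S (pt_capMP S) (𝟙 _) (𝟙 _) rfl) <|
    pt_leftHom (X := minus) S _ (𝟙 _)).congr rfl rfl

theorem Cmor_zigzagP' : Cmor HMor.zigzagP' = Cmor (HMor.id plus) := by
  have : Cototal (HMor.zigzagP' (R := ℕ)) := by
    unfold HMor.zigzagP' HMor.wl HMor.wr; infer_instance
  refine Cototal.eq_of_pt (fun S : FS => S) exists_std fun S => ⟨S, _, _, ?_, pt_id _⟩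
  exact (pt_comp (pt_leftInv (X := plus) S (plusOne.obj S) (𝟙 _)) <|
    pt_comp (pt_wr (Z := plus) S (pt_cupPM S) (𝟙 _) (𝟙 _) rfl) <|
    pt_comp (pt_assocHom (X := plus) (Y := minus) (Z := plus) S S S (𝟙 _) (𝟙 _)) <|
    pt_comp (pt_wl (Z := plus) S (pt_capMP S) (𝟙 _) (𝟙 _) rfl) <|
    pt_rightHom (X := plus) S _ (𝟙 _)).congr rfl rfl

theorem pt_crossPP_std (S : FS) : HRelPt crossPP ⟨S, plusOne.obj S, 𝟙 _⟩
    ⟨S, plusOne.obj S, 𝟙 _⟩ (𝟙 _) (swapTwo.app S) :=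
  TwoCell.rel_mk.2 (swapCreat.rel_of S)

theorem swapTwo_swapTwo (S : FS) : swapTwo.app S ≫ swapTwo.app S = 𝟙 _ := by
  apply Equiv.ext
  rintro (_ | _ | x) <;> rfl

theorem Cmor_rotL_PP : Cmor (rotL crossPP) = Cmor crossPM := by
  have : Total (rotL (R := ℕ) crossPP) := by unfold rotL HMor.wl HMor.wr; infer_instance
  refine Total.eq_of_pt (fun S : FS => ⟨S, S, 𝟙 _⟩) exists_std_fst
    fun S => ⟨_, _, _, ?_, pt_crossPM S⟩
  exact (pt_comp (pt_leftInv (X := plus.tensor minus) ⟨S, S, 𝟙 _⟩ (plusOne.obj S) (𝟙 _)) <|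
    pt_comp (pt_wr (Z := plus.tensor minus) ⟨S, S, 𝟙 _⟩ (pt_cupMP (plusOne.obj S))
      (𝟙 _) (𝟙 _) rfl) <|
    pt_comp (pt_assocHom (X := minus) (Y := plus) (Z := plus.tensor minus) (plusOne.obj S)
      (plusOne.obj S) ⟨S, S, 𝟙 _⟩ (𝟙 _) (𝟙 _)) <|
    pt_comp (pt_wl (Z := minus) (plusOne.obj S) (pt_assocInv (X := plus) (Y := plus) (Z := minus)
      (plusOne.obj S) S S (𝟙 _) (𝟙 _)) (𝟙 _) (𝟙 _) rfl) <|
    pt_comp (pt_wl (Z := minus) (plusOne.obj S) (pt_wr (Z := minus) S (pt_crossPP_std S)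
      (𝟙 _) (𝟙 _) rfl) (𝟙 _) (swapTwo.app S) (swapTwo_swapTwo S)) <|
    pt_comp (pt_wl (Z := minus) (plusOne.obj S) (pt_assocHom (X := plus) (Y := plus) (Z := minus)
      (plusOne.obj S) S S (𝟙 _) (𝟙 _)) (swapTwo.app S) (swapTwo.app S) rfl) <|
    pt_comp (pt_wl (Z := minus) (plusOne.obj S) (pt_wl (Z := plus) (plusOne.obj S) (pt_capPM S)
      (𝟙 _) (𝟙 _) rfl) (swapTwo.app S) (swapTwo.app S) rfl) <|
    (pt_wl (Z := minus) (plusOne.obj S) (pt_rightHom (X := plus) (plusOne.obj S) _ (𝟙 _))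
      (swapTwo.app S) (swapTwo.app S) rfl)).congr rfl rfl

theorem Cmor_rotL_PM : Cmor (rotL crossPM) = Cmor crossMM := by
  have : Total (rotL (R := ℕ) crossPM) := by unfold rotL HMor.wl HMor.wr; infer_instance
  refine Total.eq_of_pt (fun S : FS => ⟨plusOne.obj S, S, 𝟙 _⟩) exists_std_snd
    fun S => ⟨_, _, _, ?_, pt_crossMM S⟩
  exact (pt_comp (pt_leftInv (X := minus.tensor minus) ⟨plusOne.obj S, S, 𝟙 _⟩ S (𝟙 _)) <|
    pt_comp (pt_wr (Z := minus.tensor minus) ⟨plusOne.obj S, S, 𝟙 _⟩ (pt_cupMP S)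
      (𝟙 _) (𝟙 _) rfl) <|
    pt_comp (pt_assocHom (X := minus) (Y := plus) (Z := minus.tensor minus) S S
      ⟨plusOne.obj S, S, 𝟙 _⟩ (𝟙 _) (𝟙 _)) <|
    pt_comp (pt_wl (Z := minus) S (pt_assocInv (X := plus) (Y := minus) (Z := minus)
      S S (plusOne.obj S) (𝟙 _) (𝟙 _)) (𝟙 _) (𝟙 _) rfl) <|
    pt_comp (pt_wl (Z := minus) S (pt_wr (Z := minus) (plusOne.obj S) (pt_crossPM S)
      (𝟙 _) (𝟙 _) rfl) (𝟙 _) (𝟙 _) rfl) <|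
    pt_comp (pt_wl (Z := minus) S (pt_assocHom (X := minus) (Y := plus) (Z := minus)
      (plusOne.obj S) (plusOne.obj S) (plusOne.obj S) (𝟙 _) (swapTwo.app S)) (𝟙 _) (𝟙 _) rfl) <|
    pt_comp (pt_wl (Z := minus) S (pt_wl (Z := minus) (plusOne.obj S) (pt_capPM (plusOne.obj S))
      (swapTwo.app S) (swapTwo.app S) rfl) (𝟙 _) (𝟙 _) rfl) <|
    (pt_wl (Z := minus) S (pt_rightHom (X := minus) (plusOne.obj S) _ (swapTwo.app S))
      (𝟙 _) (𝟙 _) rfl)).congr rfl rfl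

theorem Cmor_rotR_PP : Cmor (rotR crossPP) = Cmor crossMP := by
  have : Cototal (rotR (R := ℕ) crossPP) := by unfold rotR HMor.wl HMor.wr; infer_instance
  refine Cototal.eq_of_pt (fun S : FS => ⟨S, S, 𝟙 _⟩) exists_std_fst
    fun S => ⟨_, _, _, ?_, pt_crossMP S⟩
  exact (pt_comp (pt_rightInv (X := minus.tensor plus)
      ⟨plusOne.obj S, plusOne.obj S, swapTwo.app S⟩ (plusOne.obj S) (𝟙 _)) <|
    pt_comp (pt_wl (Z := minus.tensor plus) ⟨plusOne.obj S, plusOne.obj S, swapTwo.app S⟩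
      (pt_cupPM S) (𝟙 _) (𝟙 _) rfl) <|
    pt_comp (pt_assocInv (X := minus.tensor plus) (Y := plus) (Z := minus)
      ⟨plusOne.obj S, plusOne.obj S, swapTwo.app S⟩ S S (𝟙 _) (𝟙 _)) <|
    pt_comp (pt_wr (Z := minus) S (pt_assocHom (X := minus) (Y := plus) (Z := plus)
      (plusOne.obj S) (plusOne.obj S) S (𝟙 _) (swapTwo.app S)) (𝟙 _) (𝟙 _) rfl) <|
    pt_comp (pt_wr (Z := minus) S (pt_wl (Z := minus) (plusOne.obj S) (pt_crossPP_std S)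
      (swapTwo.app S) (𝟙 _) rfl) (𝟙 _) (𝟙 _) rfl) <|
    pt_comp (pt_wr (Z := minus) S (pt_assocInv (X := minus) (Y := plus) (Z := plus)
      (plusOne.obj S) (plusOne.obj S) S (𝟙 _) (𝟙 _)) (𝟙 _) (𝟙 _) rfl) <|
    pt_comp (pt_wr (Z := minus) S (pt_wr (Z := plus) S (pt_capMP (plusOne.obj S))
      (𝟙 _) (𝟙 _) rfl) (𝟙 _) (𝟙 _) rfl) <|
    (pt_wr (Z := minus) S (pt_leftHom (X := plus) S _ (𝟙 _)) (𝟙 _) (𝟙 _) rfl)).congr rfl rfl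

theorem Cmor_rotR_MP : Cmor (rotR crossMP) = Cmor crossMM := by
  have : Cototal (rotR (R := ℕ) crossMP) := by unfold rotR HMor.wl HMor.wr; infer_instance
  refine Cototal.eq_of_pt (fun S : FS => ⟨plusOne.obj S, S, 𝟙 _⟩) exists_std_snd
    fun S => ⟨_, _, _, ?_, pt_crossMM S⟩
  exact (pt_comp (pt_rightInv (X := minus.tensor minus)
      ⟨plusOne.obj S, S, 𝟙 _⟩ (plusOne.obj (plusOne.obj S)) (swapTwo.app S)) <|
    pt_comp (pt_wl (Z := minus.tensor minus) ⟨plusOne.obj S, S, 𝟙 _⟩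
      (pt_cupPM (plusOne.obj S)) (swapTwo.app S) (swapTwo.app S) rfl) <|
    pt_comp (pt_assocInv (X := minus.tensor minus) (Y := plus) (Z := minus)
      ⟨plusOne.obj S, S, 𝟙 _⟩ (plusOne.obj S) (plusOne.obj S) (𝟙 _) (swapTwo.app S)) <|
    pt_comp (pt_wr (Z := minus) (plusOne.obj S) (pt_assocHom (X := minus) (Y := minus) (Z := plus)
      S (plusOne.obj S) (plusOne.obj S) (swapTwo.app S) (𝟙 _)) (𝟙 _) (𝟙 _) rfl) <|
    pt_comp (pt_wr (Z := minus) (plusOne.obj S) (pt_wl (Z := minus) S (pt_crossMP S)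
      (𝟙 _) (𝟙 _) rfl) (𝟙 _) (𝟙 _) rfl) <|
    pt_comp (pt_wr (Z := minus) (plusOne.obj S) (pt_assocInv (X := minus) (Y := plus) (Z := minus)
      S S S (𝟙 _) (𝟙 _)) (𝟙 _) (𝟙 _) rfl) <|
    pt_comp (pt_wr (Z := minus) (plusOne.obj S) (pt_wr (Z := minus) S (pt_capMP S)
      (𝟙 _) (𝟙 _) rfl) (𝟙 _) (𝟙 _) rfl) <|
    (pt_wr (Z := minus) (plusOne.obj S) (pt_leftHom (X := minus) S _ (𝟙 _)) (𝟙 _) (𝟙 _) rfl)).congr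
      rfl rfl

theorem Cmor_crossPP_sq : Cmor (crossPP.comp crossPP) = Cmor (HMor.id (plus.tensor plus)) :=
  Total.eq_of_pt (fun S : FS => ⟨S, plusOne.obj S, 𝟙 _⟩) exists_std_fst
    fun S => ⟨_, _, _, (pt_comp (pt_crossPP_std S) (pt_crossPP_std S)).congr rfl
      (swapTwo_swapTwo S), pt_id _⟩

theorem Cmor_crossMM_sq : Cmor (crossMM.comp crossMM) = Cmor (HMor.id (minus.tensor minus)) :=
  Total.eq_of_pt (fun S : FS => ⟨plusOne.obj S, S, 𝟙 _⟩) exists_std_snd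
    fun S => ⟨_, _, _, (pt_comp (pt_crossMM S) (pt_crossMM S)).congr (swapTwo_swapTwo S)
      rfl, pt_id _⟩

end

section

open HMor HObj

theorem Cmor_braid : Cmor braidL = Cmor braidR := by
  have : Total (braidL (R := ℕ)) := by unfold braidL HMor.wl HMor.wr; infer_instance
  have : Total (braidR (R := ℕ)) := by unfold braidR HMor.wl HMor.wr; infer_instance
  refine Total.eq_of_pt (fun S : FS => ⟨S, ⟨plusOne.obj S, plusOne.obj (plusOne.obj S), 𝟙 _⟩, 𝟙 _⟩)
    (fun p => ⟨p.left, ⟨⟨𝟙 _, ⟨p.hom, plusOne.map p.hom ≫ p.right.hom, by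
      change plusOne.map p.hom ≫ p.right.hom = 𝟙 _ ≫ plusOne.map p.hom ≫ p.right.hom
      rw [Category.id_comp]⟩, by
      exact congrArg (· ≫ p.hom) (plusOne.map_id p.left)⟩⟩⟩)
    fun S => ?_
  let S1 : FS := plusOne.obj S
  let S2 : FS := plusOne.obj S1
  let σ : S2 ⟶ S2 := swapTwo.app S
  let τ : plusOne.obj S2 ⟶ plusOne.obj S2 := swapTwo.app S1
  have hσ : σ ≫ σ = 𝟙 _ := swapTwo_swapTwo S
  have hl := pt_comp (pt_wr (Z := plus) S (pt_crossPP_std S1) (𝟙 _) (𝟙 _) rfl) <|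
    pt_comp (pt_assocHom (X := plus) (Y := plus) (Z := plus) S2 S1 S (𝟙 _) (𝟙 _)) <|
    pt_comp (pt_wl (Z := plus) S2 (pt_crossPP_std S) (𝟙 _) σ hσ) <|
    pt_comp (pt_assocInv (X := plus) (Y := plus) (Z := plus) S2 S1 S (𝟙 _) σ) <|
    (pt_wr (Z := plus) S (pt_crossPP S1 S2 σ) (𝟙 _) (𝟙 _) rfl)
  have hr := pt_comp (pt_assocHom (X := plus) (Y := plus) (Z := plus) S2 S1 S (𝟙 _) (𝟙 _)) <|
    pt_comp (pt_wl (Z := plus) S2 (pt_crossPP_std S) (𝟙 _) σ hσ) <|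
    pt_comp (pt_assocInv (X := plus) (Y := plus) (Z := plus) S2 S1 S (𝟙 _) σ) <|
    pt_comp (pt_wr (Z := plus) S (pt_crossPP S1 S2 σ) (𝟙 _) (𝟙 _) rfl) <|
    pt_comp (pt_assocHom (X := plus) (Y := plus) (Z := plus) S2 S1 S (𝟙 _) σ) <|
    pt_comp (pt_wl (Z := plus) S2 (pt_crossPP_std S) σ (𝟙 _) rfl) <|
    (pt_assocInv (X := plus) (Y := plus) (Z := plus) S2 S1 S (𝟙 _) (𝟙 _))
  let q : (Cobj ((plus.tensor plus).tensor plus)).apex := ⟨S, ⟨S1, S2, σ⟩, 𝟙 _⟩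
  let q' : (Cobj ((plus.tensor plus).tensor plus)).apex := ⟨S, ⟨S1, S2, 𝟙 _⟩, 𝟙 _⟩
  let t : q ⟶ q' := ⟨𝟙 S, ⟨𝟙 S1, σ, (congrArg (· ≫ 𝟙 S2) (plusOne.map_id S1)).trans hσ.symm⟩,
    congrArg (· ≫ 𝟙 S1) (plusOne.map_id S)⟩
  refine ⟨q', 𝟙 _, τ ≫ plusOne.map σ ≫ τ, TwoCell.Rel.congr (hl.transport t) rfl ?_,
    TwoCell.Rel.congr hr rfl ?_⟩
  -- both sides reverse the order of the three added points
  · apply Equiv.ext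
    rintro (_ | _ | _ | x) <;> rfl
  · apply Equiv.ext
    rintro (_ | _ | _ | x) <;> rfl

theorem Cmor_pentagon (W X Y Z : HObj) :
    Cmor (((assocHom W X Y).wr Z).comp
          ((assocHom W (X.tensor Y) Z).comp ((assocHom X Y Z).wl W))) =
      Cmor ((assocHom (W.tensor X) Y Z).comp (assocHom W X (Y.tensor Z))) := by
  unfold HMor.wl HMor.wr
  refine Total.eq_of_pt (fun p => p) (fun p => ⟨p, ⟨𝟙 p⟩⟩) ?_
  rintro ⟨z, ⟨y, ⟨x, w, h⟩, k⟩, l⟩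
  refine ⟨⟨⟨⟨z, y, l⟩, x, k⟩, w, h⟩, 𝟙 _, 𝟙 _, ?_, ?_⟩
  · exact (pt_comp (pt_wr (Z := Z) z (pt_assocHom w x y k h) l l rfl) <|
      pt_comp (pt_assocHom (X := W) (Y := X.tensor Y) (Z := Z) w ⟨y, x, k⟩ z l h) <|
      (pt_wl (Z := W) w (pt_assocHom x y z l k) h h rfl)).congr rfl rfl
  · exact (pt_comp (pt_assocHom (X := W.tensor X) (Y := Y) (Z := Z) ⟨x, w, h⟩ y z l k) <|
      (pt_assocHom (X := W) (Y := X) (Z := Y.tensor Z) w x ⟨z, y, l⟩ k h)).congr rfl rfl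

theorem groupoid_inv_comp_assoc {E : Type 1} [Groupoid.{0} E] {x y z : E} (k : x ⟶ y)
    (h : y ⟶ z) : Groupoid.inv k ≫ k ≫ h = h := by
  rw [Groupoid.inv_eq_inv, IsIso.inv_hom_id_assoc]

theorem Cmor_triangle (X Y : HObj) :
    Cmor ((assocHom X unit Y).comp ((leftHom Y).wl X)) = Cmor ((rightHom X).wr Y) := by
  unfold HMor.wl HMor.wr
  refine Total.eq_of_pt (fun p => p) (fun p => ⟨p, ⟨𝟙 p⟩⟩) ?_
  rintro ⟨y, ⟨b, x, h⟩, k⟩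
  refine ⟨⟨y, x, k ≫ h⟩, 𝟙 _, 𝟙 _, ?_, ?_⟩
  · exact (pt_comp (pt_assocHom (X := X) (Y := unit) (Z := Y) x b y k h) <|
      (pt_wl (Z := X) x (pt_leftHom y b k) h (k ≫ h) (groupoid_inv_comp_assoc k h))).congr rfl rfl
  · exact pt_wr (Z := Y) y (pt_rightHom x b h) k (k ≫ h) rfl

/-! ### The Heisenberg relation and the curl -/

/-- A bijection of the form `f + 1` does not exchange the two added elements. -/
theorem swap_ne_plusOne {S T : FS} (f g : plusOne.obj S ⟶ T)
    (h : plusOne.map f ≫ 𝟙 _ = swapTwo.app S ≫ plusOne.map g) : False :=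
  Option.some_ne_none (Equiv.toFun g none)
    (congrArg (fun e : plusOne.obj (plusOne.obj S) ⟶ plusOne.obj T => Equiv.toFun e none) h).symm

theorem groupoid_cancel {E : Type 1} [Groupoid.{0} E] {x y z : E} {a b : x ⟶ y} {c : y ⟶ z}
    (h : a ≫ c = b ≫ c) : a = b := (cancel_mono c).1 h

theorem plusOne_faithful : plusOne.Faithful := isCover_plusOne.faithful

theorem exists_plusOne_map {S T : FS} (e : plusOne.obj S ⟶ plusOne.obj T)
    (h : Equiv.toFun e none = none) : ∃ e' : S ⟶ T, plusOne.map e' = e := exists_optionCongr e h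

theorem iId_bot_faithful : iId.bot.Faithful := ⟨fun e => congrArg CommaMorphism.left e⟩

/-- A morphism between histories "add `x`, then remove `x`" is a bijection between the sets to which
`x` is added. -/
theorem iId_bot_full : iId.bot.Full := ⟨fun {S T} f => by
  have := plusOne_faithful
  refine ⟨f.left, Comma.hom_ext _ _ rfl (plusOne.map_injective ?_)⟩
  exact (Category.comp_id _).symm.trans (f.w.trans (Category.id_comp _))⟩

theorem iAA_bot_faithful : iAA.bot.Faithful :=
  have := plusOne_faithful
  ⟨fun e => plusOne.map_injective (congrArg CommaMorphism.left e)⟩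

theorem iAA_bot_full : iAA.bot.Full := ⟨fun {S T} f => by
  have := plusOne_faithful
  have hw : plusOne.map f.left ≫ swapTwo.app T = swapTwo.app S ≫ plusOne.map f.right := f.w
  have h0 : Equiv.toFun f.right none = none :=
    (Option.some_injective _ (congrArg (fun e : plusOne.obj (plusOne.obj S) ⟶
      plusOne.obj (plusOne.obj T) => Equiv.toFun e none) hw)).symm
  obtain ⟨k, hk⟩ := exists_plusOne_map f.right h0
  have hn : plusOne.map (plusOne.map k) ≫ swapTwo.app T = plusOne.map f.left ≫ swapTwo.app T :=
    (swapTwo.naturality k).trans ((congrArg (fun e => swapTwo.app S ≫ plusOne.map e) hk).trans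
      hw.symm)
  exact ⟨k, Comma.hom_ext _ _ (plusOne.map_injective (groupoid_cancel hn)) hk⟩⟩

/-- Every bijection `S + 1 ⟶ T + 1` either maps the added element to the added element or, up to
isomorphism, exchanges it with another element. -/
theorem isEquivalence_heisenberg : (Functor.sum' iId.bot iAA.bot).IsEquivalence := by
  refine isEquivalence_sum' iId_bot_faithful iId_bot_full iAA_bot_faithful iAA_bot_full
    (fun S T f => ?_) (fun p => ?_)
  · have hw : plusOne.map f.left ≫ swapTwo.app T = 𝟙 _ ≫ plusOne.map f.right := f.w
    exact Option.some_ne_none _ (congrArg (fun e : plusOne.obj (show FS from S) ⟶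
        plusOne.obj (plusOne.obj T) => Equiv.toFun e none) hw)
  · obtain ⟨S, T, h⟩ := p
    change plusOne.obj S ⟶ plusOne.obj T at h
    rcases hn : Equiv.toFun h none with _ | t
    · obtain ⟨e, rfl⟩ := exists_plusOne_map h hn
      exact .inl ⟨S, ⟨⟨𝟙 S, e, (congrArg (· ≫ _) (plusOne.map_id S))⟩⟩⟩
    -- `R` is the set of the points which neither of the two steps adds or removes
    · classical
      let T' : FS := T
      let R : FS := @FS.mk {x : T'.carrier // x ≠ t} Subtype.finite
      let e : plusOne.obj R ⟶ T := Equiv.optionSubtypeNe t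
      have he : Equiv.toFun (swapTwo.app R ≫ plusOne.map e ≫ Groupoid.inv h) none =
          Equiv.symm h (some t) := rfl
      obtain ⟨a, ha⟩ := exists_plusOne_map (swapTwo.app R ≫ plusOne.map e ≫ Groupoid.inv h)
        (he.trans ((Equiv.symm_apply_eq h).2 hn.symm))
      refine .inr ⟨R, ⟨⟨a, e, ?_⟩⟩⟩
      change plusOne.map a ≫ h = swapTwo.app R ≫ plusOne.map e
      rw [ha]
      simp

/-- The two summands are the restrictions of the identity to the two types of histories in
`isEquivalence_heisenberg`. -/
theorem Cmor_heisenberg : Cmor ((capMP.comp cupMP).add (crossMP.comp crossPM)) =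
    Cmor (HMor.id (minus.tensor plus)) := by
  refine Quotient.sound (SpanSpan.Equiv.trans (SpanSpan.add_congr (SpanSpan.converse_vcomp iId)
    (SpanSpan.converse_vcomp iAA)) ?_)
  exact SpanSpan.restrict_add_restrict _ _ isEquivalence_heisenberg

/-- After the crossing, the point removed is not the one added in the preceding step, whereas the cap
only relates histories in which the two agree. Hence the curl relates no points. -/
theorem Cmor_curl : Cmor leftCurl = Cmor (HMor.zero plus plus) := by
  refine TwoCell.eq_zero_of_not_rel fun p q α β h => ?_
  have : Total ((leftInv plus).comp ((cupMP.wr plus).comp ((assocHom minus plus plus).comp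
    ((crossPP.wl minus).comp (assocInv minus plus plus))))) := by
      unfold HMor.wl HMor.wr; infer_instance
  obtain ⟨q₁, α₁, β₁, α', β', h₁, h⟩ := h.of_vcomp
  obtain ⟨q₂, α₂, β₂, α', β', h₂, h⟩ := h.of_vcomp
  obtain ⟨q₃, α₃, β₃, α', β', h₃, h⟩ := h.of_vcomp
  obtain ⟨q₄, α₄, β₄, α', β', h₄, h⟩ := h.of_vcomp
  obtain ⟨q₅, α₅, β₅, α', β', h₅, h⟩ := h.of_vcomp
  obtain ⟨q₆, α₆, β₆, α', β', h₆, h⟩ := h.of_vcomp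
  have hp := pt_comp h₁ (pt_comp h₂ (pt_comp h₃ (pt_comp h₄ h₅)))
  -- the part of the curl before the cap is a map, so the history of `S` leads to one point only
  let S : FS := p
  have hS := pt_comp (pt_leftInv (X := plus) S (plusOne.obj S) (𝟙 _)) <|
    pt_comp (pt_wr (Z := plus) S (pt_cupMP (plusOne.obj S)) (𝟙 _) (𝟙 _) rfl) <|
    pt_comp (pt_assocHom (X := minus) (Y := plus) (Z := plus) (plusOne.obj S) (plusOne.obj S) S
      (𝟙 _) (𝟙 _)) <|
    pt_comp (pt_wl (Z := minus) (plusOne.obj S) (pt_crossPP_std S) (𝟙 _) (swapTwo.app S)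
      (swapTwo_swapTwo S)) <|
    pt_assocInv (X := minus) (Y := plus) (Z := plus) (plusOne.obj S) (plusOne.obj S) S
      (𝟙 _) (swapTwo.app S)
  obtain ⟨t⟩ := hS.unique this.out hp
  obtain ⟨-, α, β, hc⟩ := h₆.of_hcomp
  obtain ⟨T, s, -, -, -⟩ := TwoCell.rel_mk.1 hc
  exact swap_ne_plusOne _ _ (t.right ≫ s).w

/-! ### All relations -/

/-- The combinatorial representation respects the relations of `H'`. -/
theorem Cmor_eq_of_hRel {X Y : HObj} {f g : HMor ℕ X Y} (h : HRel ℕ f g) : Cmor f = Cmor g := by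
  have hs {X Y : HObj} (n : ℕ) (f : HMor ℕ X Y) : Cmor (f.smul n) = n • Cmor f :=
    TwoCell.nsmul_eq n _
  have hc {X Y Z : HObj} (f : HMor ℕ X Y) (g : HMor ℕ Y Z) :
    Cmor (f.comp g) = (Cmor f).vcomp (Cmor g) := rfl
  have ht {X Y X' Y' : HObj} (f : HMor ℕ X Y) (g : HMor ℕ X' Y') :
    Cmor (f.tensor g) = (Cmor g).hcomp (Cmor f) := rfl
  have ha {X Y : HObj} (f g : HMor ℕ X Y) : Cmor (f.add g) = Cmor f + Cmor g := rfl
  have hz (X Y : HObj) : Cmor (HMor.zero X Y) = 0 := rfl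
  have hu (X : HObj) := TwoCell.mk_vcomp_converse (unitorSrc (Cobj X))
  have hv (X : HObj) := TwoCell.mk_vcomp_converse (unitorTgt (Cobj X))
  have hw (X Y Z : HObj) := TwoCell.mk_vcomp_converse (assocSpan (Cobj Z) (Cobj Y) (Cobj X))
  induction h with
  | refl f => rfl
  | symm _ ih => exact ih.symm
  | trans _ _ ih ih' => exact ih.trans ih'
  | comp _ _ ih ih' => exact congrArg₂ TwoCell.vcomp ih ih'
  | tensor _ _ ih ih' => exact congrArg₂ TwoCell.hcomp ih' ih
  | add _ _ ih ih' => exact congrArg₂ TwoCell.add ih ih'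
  | smul r _ ih => exact congrArg (TwoCell.nsmul r) ih
  | id_comp f => exact TwoCell.id_vcomp _
  | comp_id f => exact TwoCell.vcomp_id _
  | assoc f g h => exact TwoCell.vcomp_assoc _ _ _
  | id_tensor_id X Y => exact Quotient.sound (SpanSpan.id_hcomp_id _ _)
  | tensor_comp f g f' g' => exact TwoCell.interchange _ _ _ _
  | assoc_hom_inv X Y Z => exact TwoCell.mk_converse_vcomp (assocSpan (Cobj Z) (Cobj Y) (Cobj X))
  | assoc_inv_hom X Y Z => exact hw X Y Z
  | assoc_nat f g h =>
    refine TwoCell.natural_of_conj' (hw _ _ _) (?_ : _ = (Cmor h).hcomp ((Cmor g).hcomp (Cmor f)))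
    obtain ⟨F, hF⟩ := Quotient.exists_rep (Cmor f)
    obtain ⟨G, hG⟩ := Quotient.exists_rep (Cmor g)
    obtain ⟨K, hK⟩ := Quotient.exists_rep (Cmor h)
    rw [ht, ht, ← hF, ← hG, ← hK]
    exact Quotient.sound (SpanSpan.assoc_natural K G F)
  | left_hom_inv X => exact hu X
  | left_inv_hom X => exact TwoCell.mk_converse_vcomp (unitorSrc (Cobj X))
  | left_nat f =>
    refine TwoCell.natural_of_conj (hu _) ?_
    obtain ⟨F, hF⟩ := Quotient.exists_rep (Cmor f)
    rw [HMor.wl, ht, ← hF]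
    exact Quotient.sound (SpanSpan.unitorSrc_natural F)
  | right_hom_inv X => exact hv X
  | right_inv_hom X => exact TwoCell.mk_converse_vcomp (unitorTgt (Cobj X))
  | right_nat f =>
    refine TwoCell.natural_of_conj (hv _) ?_
    obtain ⟨F, hF⟩ := Quotient.exists_rep (Cmor f)
    rw [HMor.wr, ht, ← hF]
    exact Quotient.sound (SpanSpan.unitorTgt_natural F)
  | pentagon W X Y Z => exact Cmor_pentagon W X Y Z
  | triangle X Y => exact Cmor_triangle X Y
  | add_comm f g => exact add_comm (Cmor f) (Cmor g)
  | add_assoc f g h => exact add_assoc (Cmor f) (Cmor g) (Cmor h)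
  | zero_add f => exact zero_add (Cmor f)
  | one_smul f => rw [hs, one_smul]
  | mul_smul r s f => rw [hs, hs, hs, mul_smul]
  | smul_add r f g => rw [hs, ha, ha, hs, hs, smul_add]
  | add_smul r s f => rw [hs, ha, hs, hs, add_smul]
  | zero_smul f => rw [hs, zero_smul, hz]
  | add_comp f f' g => exact TwoCell.add_vcomp _ _ _
  | comp_add f g g' => exact TwoCell.vcomp_add _ _ _
  | zero_comp X g => exact TwoCell.zero_vcomp _
  | comp_zero f Z => exact TwoCell.vcomp_zero _
  | smul_comp r f g =>
    rw [hc, hs, hs, hc]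
    exact map_nsmul (⟨⟨fun a => a.vcomp (Cmor g), TwoCell.zero_vcomp _⟩,
      fun a b => TwoCell.add_vcomp a b _⟩ : TwoCell _ _ →+ TwoCell _ _) r (Cmor f)
  | comp_smul r f g =>
    rw [hc, hs, hs, hc]
    exact map_nsmul (⟨⟨fun a => (Cmor f).vcomp a, TwoCell.vcomp_zero _⟩,
      fun a b => TwoCell.vcomp_add _ a b⟩ : TwoCell _ _ →+ TwoCell _ _) r (Cmor g)
  | add_tensor f f' g => exact TwoCell.hcomp_add _ _ _
  | tensor_add f g g' => exact TwoCell.add_hcomp _ _ _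
  | zero_tensor X Y g => exact TwoCell.hcomp_zero _
  | tensor_zero f X' Y' => exact TwoCell.zero_hcomp _
  | smul_tensor r f g =>
    rw [ht, hs, hs, ht]
    exact map_nsmul (⟨⟨fun a => (Cmor g).hcomp a, TwoCell.hcomp_zero _⟩,
      fun a b => TwoCell.hcomp_add _ a b⟩ : TwoCell _ _ →+ TwoCell _ _) r (Cmor f)
  | tensor_smul r f g =>
    rw [ht, hs, hs, ht]
    exact map_nsmul (⟨⟨fun a => a.hcomp (Cmor f), TwoCell.zero_hcomp _⟩,
      fun a b => TwoCell.add_hcomp a b _⟩ : TwoCell _ _ →+ TwoCell _ _) r (Cmor g)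
  | zero_obj => exact Quotient.sound (SpanSpan.equiv_zero fun z => PEmpty.elim z)
  | inl_fst X Y => 
    have : (inlSpan (Cobj X) (Cobj Y)).top.IsEquivalence := Functor.isEquivalence_refl
    have : (inlSpan (Cobj X) (Cobj Y)).bot.Full := ⟨fun f => ⟨f.down, rfl⟩⟩
    have : (inlSpan (Cobj X) (Cobj Y)).bot.Faithful := IsCover.inl_.faithful
    exact TwoCell.mk_vcomp_converse (inlSpan (Cobj X) (Cobj Y))
  | inl_snd X Y => exact Quotient.sound (SpanSpan.equiv_zero fun z => nomatch z.hom)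
  | inr_fst X Y => exact Quotient.sound (SpanSpan.equiv_zero fun z => nomatch z.hom)
  | inr_snd X Y =>
    have : (inrSpan (Cobj X) (Cobj Y)).top.IsEquivalence := Functor.isEquivalence_refl
    have : (inrSpan (Cobj X) (Cobj Y)).bot.Full := ⟨fun f => ⟨f.down, rfl⟩⟩
    have : (inrSpan (Cobj X) (Cobj Y)).bot.Faithful := IsCover.inr_.faithful
    exact TwoCell.mk_vcomp_converse (inrSpan (Cobj X) (Cobj Y))
  | biprod_total X Y =>
    have : (inlSpan (Cobj X) (Cobj Y)).top.IsEquivalence := Functor.isEquivalence_refl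
    have : (inrSpan (Cobj X) (Cobj Y)).top.IsEquivalence := Functor.isEquivalence_refl
    refine Quotient.sound (SpanSpan.Equiv.trans (SpanSpan.add_congr
      (SpanSpan.converse_vcomp (inlSpan (Cobj X) (Cobj Y)))
      (SpanSpan.converse_vcomp (inrSpan (Cobj X) (Cobj Y)))) ?_)
    refine SpanSpan.restrict_add_restrict _ _ (isEquivalence_sum' IsCover.inl_.faithful
      ⟨fun f => ⟨f.down, rfl⟩⟩ IsCover.inr_.faithful ⟨fun f => ⟨f.down, rfl⟩⟩
      (fun _ _ f => nomatch f) ?_)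
    rintro (z | z)
    · exact .inl ⟨z, ⟨𝟙 _⟩⟩
    · exact .inr ⟨z, ⟨𝟙 _⟩⟩
  | zigzagP => exact Cmor_zigzagP
  | zigzagM => exact Cmor_zigzagM
  | zigzagM' => exact Cmor_zigzagM'
  | zigzagP' => exact Cmor_zigzagP'
  | rotL_PP => exact Cmor_rotL_PP
  | rotR_PP => exact Cmor_rotR_PP
  | rotL_PM => exact Cmor_rotL_PM
  | rotR_MP => exact Cmor_rotR_MP
  | heisenberg => exact Cmor_heisenberg
  | crossPM_crossMP =>
    have : iAA.bot.Full := iAA_bot_full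
    have : iAA.bot.Faithful := iAA_bot_faithful
    exact TwoCell.mk_vcomp_converse iAA
  | circle =>
    have : iId.bot.Full := iId_bot_full
    have : iId.bot.Faithful := iId_bot_faithful
    exact TwoCell.mk_vcomp_converse iId
  | curl => exact Cmor_curl
  | crossPP_sq => exact Cmor_crossPP_sq
  | crossMM_sq => exact Cmor_crossMM_sq
  | braid => exact Cmor_braid

end

section

variable {A B C D : Type 1} [Groupoid.{0} A] [Groupoid.{0} B] [Groupoid.{0} C] [Groupoid.{0} D]

/-! ### The values of `Λ` on spans -/

section

variable {P : GSpan A B} {V W : A ⥤ Vect}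

/-- The canonical map into the value of `Λ(P)(V)` at the image of a point of the apex. -/
noncomputable def lamIn (P : GSpan A B) (V : A ⥤ Vect) (p : P.apex) :
    V.obj (P.src.obj p) ⟶ ((Lam₁ P).obj V).obj (P.tgt.obj p) :=
  (lamUnit P V).app p

theorem lamIn_nat {p q : P.apex} (f : p ⟶ q) : V.map (P.src.map f) ≫ lamIn P V q =
    lamIn P V p ≫ ((Lam₁ P).obj V).map (P.tgt.map f) :=
  (lamUnit P V).naturality f

theorem lan_homEquiv {X Y : Type 1} [Groupoid.{0} X] [Groupoid.{0} Y] (L : X ⥤ Y) {F : X ⥤ Vect}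
    {U : Y ⥤ Vect} (f : L.lan.obj F ⟶ U) : (L.lanAdjunction Vect).homEquiv F U f =
      L.lanUnit.app F ≫ Functor.whiskerLeft L f := by
  rw [Adjunction.homEquiv_unit, Functor.lanAdjunction_unit]
  rfl

/-- The universal property of the left Kan extension, on the points of the apex. -/
theorem lamIn_desc {U : B ⥤ Vect} (t : P.src ⋙ V ⟶ P.tgt ⋙ U) (p : P.apex) :
    lamIn P V p ≫ (lamDesc P V t).app (P.tgt.obj p) = t.app p := by
  have h : ((P.tgt.lanAdjunction Vect).homEquiv (P.src ⋙ V) U) (lamDesc P V t) = t :=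
    Equiv.apply_symm_apply _ _
  exact congrArg (fun s => s.app p) ((lan_homEquiv P.tgt _).symm.trans h)

theorem lam_ext {U : B ⥤ Vect} {f g : (Lam₁ P).obj V ⟶ U}
    (h : ∀ p, lamIn P V p ≫ f.app (P.tgt.obj p) = lamIn P V p ≫ g.app (P.tgt.obj p)) : f = g := by
  apply ((P.tgt.lanAdjunction Vect).homEquiv (P.src ⋙ V) U).injective
  refine (lan_homEquiv P.tgt f).trans (Eq.trans ?_ (lan_homEquiv P.tgt g).symm)
  ext p : 2
  exact h p

theorem lamIn_map (f : V ⟶ W) (p : P.apex) :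
    lamIn P V p ≫ ((Lam₁ P).map f).app (P.tgt.obj p) = f.app (P.src.obj p) ≫ lamIn P W p :=
  (congrArg (fun s => s.app p) (P.tgt.lanUnit.naturality (Functor.whiskerLeft P.src f))).symm

/-- The value of `Λ(P)(V)` at `b` is a colimit over the homotopy fibre of the target leg. -/
noncomputable def lamIsColimit (P : GSpan A B) (V : A ⥤ Vect) (b : B) :
    Limits.IsColimit ((Functor.LeftExtension.mk ((Lam₁ P).obj V) (lamUnit P V)).coconeAt b) :=
  P.tgt.isPointwiseLeftKanExtensionLeftKanExtensionUnit (P.src ⋙ V) b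

theorem lam_ext_at {b : B} {M : Vect} {f g : ((Lam₁ P).obj V).obj b ⟶ M}
    (h : ∀ (p : P.apex) (k : P.tgt.obj p ⟶ b),
      lamIn P V p ≫ ((Lam₁ P).obj V).map k ≫ f = lamIn P V p ≫ ((Lam₁ P).obj V).map k ≫ g) :
    f = g :=
  (lamIsColimit P V b).hom_ext fun c =>
    (Category.assoc _ _ _).trans ((h c.left c.hom).trans (Category.assoc _ _ _).symm)

/-- Maps out of the value of `Λ(P)(V)` at `b`. -/
noncomputable def lamDescAt {b : B} {M : Vect}
    (t : ∀ (p : P.apex), (P.tgt.obj p ⟶ b) → (V.obj (P.src.obj p) ⟶ M))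
    (ht : ∀ {p q : P.apex} (f : p ⟶ q) (k : P.tgt.obj q ⟶ b),
      V.map (P.src.map f) ≫ t q k = t p (P.tgt.map f ≫ k)) :
    ((Lam₁ P).obj V).obj b ⟶ M :=
  (lamIsColimit P V b).desc ⟨M, ⟨fun c => t c.left c.hom, fun c d f =>
    (ht f.left d.hom).trans (((congrArg (t c.left) (CostructuredArrow.w f))).trans
      (Category.comp_id _).symm)⟩⟩

theorem lamIn_lamDescAt {b : B} {M : Vect}
    (t : ∀ (p : P.apex), (P.tgt.obj p ⟶ b) → (V.obj (P.src.obj p) ⟶ M))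
    (ht : ∀ {p q : P.apex} (f : p ⟶ q) (k : P.tgt.obj q ⟶ b),
      V.map (P.src.map f) ≫ t q k = t p (P.tgt.map f ≫ k)) (p : P.apex) (k : P.tgt.obj p ⟶ b) :
    lamIn P V p ≫ ((Lam₁ P).obj V).map k ≫ lamDescAt t ht = t p k :=
  (Category.assoc _ _ _).symm.trans
    ((lamIsColimit P V b).fac ⟨M, ⟨fun c => t c.left c.hom, _⟩⟩ (CostructuredArrow.mk k))

end

/-! ### Transfer maps as sums over transversals -/

section

variable {X Z : Type 1} [Groupoid.{0} X] [Groupoid.{0} Z]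

/-- A family of representatives of the isomorphism classes of points of a homotopy fibre. -/
def IsTransversal {S : Z ⥤ X} {x : X} {T : Type*} (φ : T → CostructuredArrow S x) : Prop :=
  Function.Bijective fun t => (Quotient.mk _ (φ t) : FibreClasses S x)

theorem isTransversal_iff {S : Z ⥤ X} {x : X} {T : Type*} {φ : T → CostructuredArrow S x} :
    IsTransversal φ ↔
      (∀ t t' (k : (φ t).left ⟶ (φ t').left), S.map k ≫ (φ t').hom = (φ t).hom → t = t') ∧
      ∀ c : CostructuredArrow S x, ∃ (t : T) (k : (φ t).left ⟶ c.left),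
        S.map k ≫ c.hom = (φ t).hom := by
  constructor
  · refine fun h => ⟨fun t t' k hk => h.1 (fibreClasses_eq_iff.2 ⟨k, hk⟩), fun c => ?_⟩
    obtain ⟨t, ht⟩ := h.2 (Quotient.mk _ c)
    exact ⟨t, fibreClasses_eq_iff.1 ht⟩
  · refine fun h => ⟨fun t t' e => ?_, ?_⟩
    · obtain ⟨k, hk⟩ := fibreClasses_eq_iff.1 e
      exact h.1 t t' k hk
    · rintro ⟨c⟩
      obtain ⟨t, k, hk⟩ := h.2 c
      exact ⟨t, fibreClasses_eq_iff.2 ⟨k, hk⟩⟩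

theorem exists_isTransversal (S : Z ⥤ X) (x : X) :
    IsTransversal (fun q : FibreClasses S x => q.out) :=
  ⟨fun _ _ h => (Quotient.out_eq _).symm.trans (h.trans (Quotient.out_eq _)),
    fun q => ⟨q, Quotient.out_eq q⟩⟩

theorem isTransversal_of_full {S : Z ⥤ X} [S.Full] {x : X}
    (c : CostructuredArrow S x) : IsTransversal (fun _ : Unit => c) := by
  refine isTransversal_iff.2 ⟨fun _ _ _ _ => rfl, fun d => ⟨(), S.preimage (c.hom ≫ inv d.hom), ?_⟩⟩
  simp

/-- For a faithful functor, the points of the homotopy fibres have no automorphisms, so that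
every point of a transversal contributes with weight one. -/
theorem transferApp_eq_sum (S : Z ⥤ X) [S.Faithful] {W U : X ⥤ Vect} (θ : S ⋙ W ⟶ S ⋙ U) (x : X)
    {T : Type*} [Fintype T] {φ : T → CostructuredArrow S x} (hφ : IsTransversal φ) :
    transferApp S θ x = ∑ t, W.map (inv (show S.obj (φ t).left ⟶ x from (φ t).hom)) ≫
      θ.app (φ t).left ≫ U.map (φ t).hom := by
  have hfin : Finite (FibreClasses S x) := Finite.of_surjective _ hφ.2
  have := Fintype.ofFinite (FibreClasses S x)
  rw [transferApp, if_pos hfin, finsum_eq_sum_of_fintype]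
  refine (Fintype.sum_bijective _ hφ _ _ fun t => ?_).symm
  have e : Nonempty (φ t ≅ Quotient.out (Quotient.mk _ (φ t) : FibreClasses S x)) :=
    Quotient.exact (s := isIsomorphicSetoid _) (Quotient.out_eq _).symm
  refine Eq.trans ?_ (transferTerm_iso S θ e.some)
  have h1 : Nat.card (φ t ⟶ φ t) = 1 := by
    refine Nat.card_eq_one_iff_unique.2 ⟨⟨fun f g => ?_⟩, ⟨𝟙 _⟩⟩
    apply CostructuredArrow.hom_ext
    apply S.map_injective
    have hf := CostructuredArrow.w f
    have hg := CostructuredArrow.w g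
    exact groupoid_cancel (hf.trans hg.symm)
  rw [transferTerm, h1, Nat.cast_one, inv_one, one_smul, Groupoid.inv_eq_inv]

end

/-! ### The values of `Λ` on spans of spans -/

variable {P Q R : GSpan A B}

/-- The map `V(a) ⟶ Λ(P)(V)(b)` given by a point `p` of the apex and comparison maps of `a` and `b`
with the images of `p`. -/
noncomputable def lamTo (P : GSpan A B) (V : A ⥤ Vect) {a : A} {b : B} (p : P.apex)
    (α : a ⟶ P.src.obj p) (β : b ⟶ P.tgt.obj p) : V.obj a ⟶ ((Lam₁ P).obj V).obj b :=
  V.map α ≫ lamIn P V p ≫ ((Lam₁ P).obj V).map (inv β)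

section

variable {V : A ⥤ Vect} {a a' : A} {b b' : B} {p q : P.apex}

theorem lamTo_id : lamTo P V p (𝟙 _) (𝟙 _) = lamIn P V p := by
  simp [lamTo]

theorem lamTo_pre (γ : a' ⟶ a) (α : a ⟶ P.src.obj p) (β : b ⟶ P.tgt.obj p) :
    V.map γ ≫ lamTo P V p α β = lamTo P V p (γ ≫ α) β := by
  simp [lamTo]

theorem lamTo_post (δ : b ⟶ b') (α : a ⟶ P.src.obj p) (β : b ⟶ P.tgt.obj p) :
    lamTo P V p α β ≫ ((Lam₁ P).obj V).map δ = lamTo P V p α (inv δ ≫ β) := by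
  simp [lamTo]

theorem lamTo_transport (τ : p ⟶ q) (α : a ⟶ P.src.obj p) (β : b ⟶ P.tgt.obj p) :
    lamTo P V p α β = lamTo P V q (α ≫ P.src.map τ) (β ≫ P.tgt.map τ) := by
  simp only [lamTo, Functor.map_comp, Category.assoc, IsIso.inv_comp]
  rw [← Category.assoc (V.map (P.src.map τ)), lamIn_nat]
  simp only [Category.assoc, ← Functor.map_comp, IsIso.hom_inv_id_assoc]

theorem lamTo_map {W : A ⥤ Vect} (f : V ⟶ W) (α : a ⟶ P.src.obj p) (β : b ⟶ P.tgt.obj p) :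
    lamTo P V p α β ≫ ((Lam₁ P).map f).app b = f.app a ≫ lamTo P W p α β := by
  simp only [lamTo, Category.assoc, NatTrans.naturality, ← NatTrans.naturality_assoc]
  rw [← Category.assoc (lamIn P V p), lamIn_map, Category.assoc]

theorem lam_ext_to {M : Vect} {f g : ((Lam₁ P).obj V).obj b ⟶ M}
    (h : ∀ (p : P.apex) (β : b ⟶ P.tgt.obj p),
      lamTo P V p (𝟙 _) β ≫ f = lamTo P V p (𝟙 _) β ≫ g) : f = g :=
  lam_ext_at fun p k => by
    have := h p (inv k)
    simpa [lamTo] using this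

end

/-- The contribution of a point of a homotopy fibre of the top leg to `Λ` of a span of spans. -/
noncomputable def lamTerm (Z : SpanSpan P Q) (V : A ⥤ Vect) {p : P.apex}
    (c : CostructuredArrow Z.top p) :
    V.obj (P.src.obj p) ⟶ ((Lam₁ Q).obj V).obj (P.tgt.obj p) :=
  lamTo Q V (Z.bot.obj c.left) (inv (P.src.map c.hom) ≫ Z.ν.app c.left)
    (inv (P.tgt.map c.hom) ≫ Z.μ.app c.left)

/-- The regrouping of factors behind `lamIn_Lam₂`. -/
theorem term_aux {x₀ x₁ x₂ x₃ x₄ x₅ : Vect} {a : x₀ ⟶ x₁} {n : x₁ ⟶ x₂} {i : x₂ ⟶ x₃} {m : x₃ ⟶ x₄}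
    {t : x₄ ⟶ x₅} {b : x₀ ⟶ x₂} {c : x₃ ⟶ x₅} (hb : b = a ≫ n) (hc : c = m ≫ t) :
    a ≫ (n ≫ i ≫ m) ≫ t = b ≫ i ≫ c := by
  simp only [hb, hc, Category.assoc]

theorem lamIn_Lam₂ (Z : SpanSpan P Q) (hZ : Z.top.Faithful) (V : A ⥤ Vect) {p : P.apex} {T : Type*}
    [Fintype T] {φ : T → CostructuredArrow Z.top p} (hφ : IsTransversal φ) :
    lamIn P V p ≫ ((Lam₂ Z).app V).app (P.tgt.obj p) = ∑ t, lamTerm Z V (φ t) := by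
  refine (lamIn_desc _ p).trans ((transferApp_eq_sum Z.top (lamCore Z V) p hφ).trans ?_)
  refine Finset.sum_congr rfl fun t _ => ?_
  have hμ : inv (inv (P.tgt.map (φ t).hom) ≫ Z.μ.app (φ t).left) =
      (inv Z.μ).app (φ t).left ≫ P.tgt.map (φ t).hom := by
    rw [IsIso.inv_comp, IsIso.inv_inv]
    exact congrArg (· ≫ _) (NatIso.isIso_inv_app Z.μ _).symm
  exact term_aux ((V.map_comp _ _).trans (congrArg (V.map · ≫ _) (P.src.map_inv _).symm))
    ((congrArg _ hμ).trans (((Lam₁ Q).obj V).map_comp _ _))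

/-- `Λ` of a span of spans sends a point to the sum of the points related to it, with one summand for
each point of the homotopy fibre of the top leg. -/
theorem lamTo_Lam₂ (Z : SpanSpan P Q) (hZ : Z.top.Faithful) (V : A ⥤ Vect) {a : A} {b : B}
    {p : P.apex} (α : a ⟶ P.src.obj p) (β : b ⟶ P.tgt.obj p) {T : Type*}
    [Fintype T] {φ : T → CostructuredArrow Z.top p} (hφ : IsTransversal φ) :
    lamTo P V p α β ≫ ((Lam₂ Z).app V).app b = ∑ t, lamTo Q V (Z.bot.obj (φ t).left)
      (α ≫ inv (P.src.map (φ t).hom) ≫ Z.ν.app (φ t).left)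
      (β ≫ inv (P.tgt.map (φ t).hom) ≫ Z.μ.app (φ t).left) := by
  simp only [lamTo, Category.assoc, NatTrans.naturality]
  rw [← Category.assoc (lamIn P V p), lamIn_Lam₂ Z hZ V hφ, Preadditive.sum_comp,
    Preadditive.comp_sum]
  refine Finset.sum_congr rfl fun t _ => ?_
  rw [lamTerm, lamTo_post, lamTo_pre, IsIso.inv_inv]
  rfl

/-- If the top leg is fully faithful, then there is only one contribution. -/
theorem lamTo_Lam₂_of_rel (Z : SpanSpan P Q) [Z.top.Full] [Z.top.Faithful] (V : A ⥤ Vect) {a : A}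
    {b : B}
    {p : P.apex} {q : Q.apex} {α' : P.src.obj p ⟶ Q.src.obj q} {β' : P.tgt.obj p ⟶ Q.tgt.obj q}
    (h : Z.Rel p q α' β') (α : a ⟶ P.src.obj p) (β : b ⟶ P.tgt.obj p) :
    lamTo P V p α β ≫ ((Lam₂ Z).app V).app b = lamTo Q V q (α ≫ α') (β ≫ β') := by
  obtain ⟨z, s, t, rfl, rfl⟩ := h
  refine (lamTo_Lam₂ Z inferInstance V α β
    (isTransversal_of_full (fibrePoint Z.top z (inv s)))).trans ?_
  refine (Fintype.sum_unique _).trans ((lamTo_transport (P := Q) t _ _).trans ?_)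
  change lamTo Q V q ((α ≫ inv (P.src.map (inv s)) ≫ Z.ν.app z) ≫ Q.src.map t)
    ((β ≫ inv (P.tgt.map (inv s)) ≫ Z.μ.app z) ≫ Q.tgt.map t) = _
  simp

end

section

variable {A B C D : Type 1} [Groupoid.{0} A] [Groupoid.{0} B] [Groupoid.{0} C] [Groupoid.{0} D]

theorem IsCover.exists_isTransversal {X Y : Type 1} [Groupoid.{0} X] [Groupoid.{0} Y] {F : X ⥤ Y}
    (h : IsCover F) (y : Y) : ∃ (T : Type 1) (_ : Fintype T) (φ : T → CostructuredArrow F y),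
      IsTransversal φ :=
  have := h.finite y
  ⟨FibreClasses F y, Fintype.ofFinite _, _, HeisCat.exists_isTransversal F y⟩

variable {P Q R : GSpan A B} {P' Q' : GSpan B C}

theorem lamTo_congr {V : A ⥤ Vect} {a : A} {b : B} {p : P.apex} {α α' : a ⟶ P.src.obj p}
    {β β' : b ⟶ P.tgt.obj p} (h : α = α') (h' : β = β') : lamTo P V p α β = lamTo P V p α' β' := by
  rw [h, h']

theorem inv_comp_conj {E F : Type 1} [Groupoid.{0} E] [Groupoid.{0} F] (G : E ⥤ F) {x y z : E}
    {a b : F} {σ : x ⟶ y} {s : x ⟶ z} {n : G.obj x ⟶ a} {m : a ⟶ b} {n' : G.obj y ⟶ b}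
    (h : n ≫ m = G.map σ ≫ n') : (inv (G.map s) ≫ n) ≫ m = inv (G.map (inv σ ≫ s)) ≫ n' := by
  rw [Category.assoc, h]
  simp

/-- An equivalence of spans of spans carries transversals to transversals. -/
theorem Lam₂_eq_of_equiv {Z W : SpanSpan P Q} (h : Z.Equiv W) (hZ : Z.IsCover) :
    Lam₂ Z = Lam₂ W := by
  have hW := hZ.of_equiv h
  obtain ⟨U, hU, σ, τ, h1, h2⟩ := h
  ext V : 2
  refine lam_ext fun p => ?_
  obtain ⟨T, _, φ, hφ⟩ := hZ.top.exists_isTransversal p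
  have hψ : IsTransversal fun t => fibrePoint W.top (U.obj (φ t).left)
      (inv (σ.app (φ t).left) ≫ (φ t).hom) := by
    rw [isTransversal_iff] at hφ ⊢
    refine ⟨fun t t' k hk => hφ.1 t t' (U.preimage k) ?_, fun c => ?_⟩
    · have n := σ.naturality (U.preimage k)
      change W.top.map k ≫ inv (σ.app (φ t').left) ≫ (φ t').hom =
        inv (σ.app (φ t).left) ≫ (φ t).hom at hk
      rw [Functor.comp_map, U.map_preimage] at n
      rw [IsIso.eq_inv_comp] at hk
      rw [← hk, ← reassoc_of% n]
      simp
    · let e := U.objObjPreimageIso c.left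
      obtain ⟨t, k, hk⟩ := hφ.2 (fibrePoint Z.top (U.objPreimage c.left)
        (σ.app _ ≫ W.top.map e.hom ≫ c.hom))
      refine ⟨t, U.map k ≫ e.hom, ?_⟩
      have n := σ.naturality k
      change Z.top.map k ≫ σ.app _ ≫ W.top.map e.hom ≫ c.hom = (φ t).hom at hk
      change W.top.map (U.map k ≫ e.hom) ≫ c.hom = inv (σ.app (φ t).left) ≫ (φ t).hom
      rw [Functor.comp_map] at n
      rw [IsIso.eq_inv_comp, ← hk, Functor.map_comp, Category.assoc, reassoc_of% n]
  rw [← lamTo_id, lamTo_Lam₂ Z hZ.top.faithful V _ _ hφ, lamTo_Lam₂ W hW.top.faithful V _ _ hψ]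
  refine Finset.sum_congr rfl fun t _ => (lamTo_transport (τ.app _) _ _).trans ?_
  simp only [Category.id_comp]
  exact lamTo_congr (inv_comp_conj P.src (h2 _)) (inv_comp_conj P.tgt (h1 _))

theorem Lam₂_idTwo (P : GSpan A B) : Lam₂ (SpanSpan.idTwo P) = 𝟙 _ := by
  have h : (SpanSpan.idTwo P).top.IsEquivalence := Functor.isEquivalence_refl
  ext V : 2
  refine lam_ext fun p => ?_
  rw [← lamTo_id]
  refine (lamTo_Lam₂_of_rel _ V (q := p) (α' := 𝟙 _) (β' := 𝟙 _) ⟨p, 𝟙 _, 𝟙 _, ?_, ?_⟩ _ _).trans ?_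
  · simp [SpanSpan.idTwo, SpanSpan.ofFunctor]
  · simp [SpanSpan.idTwo, SpanSpan.ofFunctor]
  · simp

theorem Lam₂_zeroTwo (P Q : GSpan A B) : Lam₂ (SpanSpan.zeroTwo P Q) = 0 := by
  ext V : 2
  refine lam_ext fun p => ?_
  have hφ : IsTransversal (S := (SpanSpan.zeroTwo P Q).top) (x := p) (fun t : Empty => t.elim) :=
    isTransversal_iff.2 ⟨fun t => t.elim, fun c => c.left.elim⟩
  rw [← lamTo_id, lamTo_Lam₂ _ SpanSpan.IsCover.zeroTwo.top.faithful V _ _ hφ, Fintype.sum_empty]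
  simp

/-- The homotopy fibres of a sum are the disjoint unions of the homotopy fibres of the summands. -/
theorem Lam₂_add {Z W : SpanSpan P Q} (hZ : Z.IsCover) (hW : W.IsCover) :
    Lam₂ (Z.add W) = Lam₂ Z + Lam₂ W := by
  ext V : 2
  refine lam_ext fun p => ?_
  obtain ⟨T, _, φ, hφ⟩ := hZ.top.exists_isTransversal p
  obtain ⟨T', _, φ', hφ'⟩ := hW.top.exists_isTransversal p
  have hψ : IsTransversal (S := (Z.add W).top) (x := p) (Sum.elim
      (fun t => fibrePoint (Z.add W).top (.inl (φ t).left) (φ t).hom)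
      (fun t => fibrePoint (Z.add W).top (.inr (φ' t).left) (φ' t).hom)) := by
    rw [isTransversal_iff] at hφ hφ' ⊢
    refine ⟨?_, ?_⟩
    · rintro (t | t) (t' | t') ⟨k⟩ hk
      · exact congrArg Sum.inl (hφ.1 t t' k hk)
      · exact congrArg Sum.inr (hφ'.1 t t' k hk)
    · rintro ⟨c | c, ⟨⟨⟩⟩, h⟩
      · obtain ⟨t, k, hk⟩ := hφ.2 (fibrePoint Z.top c h)
        exact ⟨.inl t, ⟨k⟩, hk⟩
      · obtain ⟨t, k, hk⟩ := hφ'.2 (fibrePoint W.top c h)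
        exact ⟨.inr t, ⟨k⟩, hk⟩
  rw [← lamTo_id, lamTo_Lam₂ _ (hZ.add hW).top.faithful V _ _ hψ, Fintype.sum_sum_type]
  refine Eq.trans ?_ (Preadditive.comp_add _ _ _ _ _ _).symm
  rw [lamTo_Lam₂ _ hZ.top.faithful V _ _ hφ, lamTo_Lam₂ _ hW.top.faithful V _ _ hφ']
  rfl

theorem inv_comp_conj₂ {E E' F : Type 1} [Groupoid.{0} E] [Groupoid.{0} E'] [Groupoid.{0} F]
    (G : E ⥤ F) (G' : E' ⥤ F) {x y : E} {x' y' : E'} {a b : F} {s : x ⟶ y} {n : G.obj x ⟶ G'.obj y'}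
    {k : x' ⟶ y'} {m : G'.obj x' ⟶ b} {f : a ⟶ G.obj y} :
    (f ≫ inv (G.map s) ≫ n) ≫ inv (G'.map k) ≫ m =
      f ≫ inv (G.map s) ≫ n ≫ G'.map (inv k) ≫ m := by
  simp

/-- The points of the homotopy fibre of the composite of `F` with the projection of a weak pullback
are pairs of points of homotopy fibres. -/
theorem IsTransversal.comma {X Y M N : Type 1} [Groupoid.{0} X] [Groupoid.{0} Y] [Groupoid.{0} M]
    [Groupoid.{0} N] {G : X ⥤ M} {J : Y ⥤ M} {F : X ⥤ N} (hF : F.Faithful) {p : N} {T : Type*}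
    {T' : T → Type*} {φ : T → CostructuredArrow F p}
    {φ' : ∀ t, T' t → CostructuredArrow J (G.obj (φ t).left)} (hφ : IsTransversal φ)
    (hφ' : ∀ t, IsTransversal (φ' t)) :
    IsTransversal (S := Comma.fst G J ⋙ F) (x := p) (fun t : (Σ t, T' t) =>
      fibrePoint (Comma.fst G J ⋙ F) ⟨(φ t.1).left, (φ' t.1 t.2).left, inv (φ' t.1 t.2).hom⟩
        (φ t.1).hom) := by
  rw [isTransversal_iff] at hφ ⊢
  simp only [isTransversal_iff] at hφ'
  refine ⟨?_, ?_⟩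
  · rintro ⟨t, u⟩ ⟨t', u'⟩ k hk
    obtain rfl := hφ.1 t t' k.left hk
    congr 1
    let k₁ : (φ t).left ⟶ (φ t).left := k.left
    let k₂ : (φ' t u).left ⟶ (φ' t u').left := k.right
    have h₁ : F.map k₁ ≫ (φ t).hom = (φ t).hom := hk
    -- points of the homotopy fibre of a faithful functor have no automorphisms
    have hk₁ : k₁ = 𝟙 _ := F.map_injective (groupoid_cancel (h₁.trans (by simp)))
    have hw : G.map k₁ ≫ inv (φ' t u').hom = inv (φ' t u).hom ≫ J.map k₂ := k.w
    refine (hφ' t).1 u u' k₂ ?_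
    rw [hk₁, G.map_id, Category.id_comp, IsIso.eq_inv_comp, IsIso.comp_inv_eq] at hw
    exact hw.symm
  · rintro ⟨c, ⟨⟨⟩⟩, h⟩
    obtain ⟨t, k, hk⟩ := hφ.2 (fibrePoint F c.left h)
    obtain ⟨u, l, hl⟩ := (hφ' t).2 (fibrePoint J c.right (inv c.hom ≫ inv (G.map k)))
    refine ⟨⟨t, u⟩, ⟨k, l, ?_⟩, hk⟩
    change J.map l ≫ inv c.hom ≫ inv (G.map k) = (φ' t u).hom at hl
    change G.map k ≫ c.hom = inv (φ' t u).hom ≫ J.map l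
    rw [← hl]
    simp

/-- The points of the homotopy fibre of a vertical composite are pairs: a point of the homotopy fibre
of `Z`, and a point of the homotopy fibre of `W` over its image. -/
theorem Lam₂_vcomp {Z : SpanSpan P Q} {W : SpanSpan Q R} (hZ : Z.IsCover) (hW : W.IsCover) :
    Lam₂ (Z.vcomp W) = Lam₂ Z ≫ Lam₂ W := by
  ext V : 2
  refine lam_ext fun p => ?_
  obtain ⟨T, _, φ, hφ⟩ := hZ.top.exists_isTransversal p
  choose T' _ φ' hφ' using fun t => hW.top.exists_isTransversal (Z.bot.obj (φ t).left)
  rw [← lamTo_id, lamTo_Lam₂ _ (hZ.vcomp hW).top.faithful V _ _ (hφ.comma hZ.top.faithful hφ'),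
    Fintype.sum_sigma]
  refine Eq.trans ?_ (Category.assoc _ _ _)
  rw [lamTo_Lam₂ _ hZ.top.faithful V _ _ hφ, Preadditive.sum_comp]
  refine Finset.sum_congr rfl fun t _ => ?_
  rw [lamTo_Lam₂ _ hW.top.faithful V _ _ (hφ' t)]
  refine Finset.sum_congr rfl fun u _ => ?_
  exact lamTo_congr (inv_comp_conj₂ P.src Q.src).symm (inv_comp_conj₂ P.tgt Q.tgt).symm

/-! ### The comparison maps for composites and identities -/

theorem lamIn_lamComp (V : A ⥤ Vect) (x : (P.comp P').apex) :
    lamIn (P.comp P') V x ≫ (lamComp P P' V).app ((P.comp P').tgt.obj x) =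
      lamIn P V x.left ≫ ((Lam₁ P).obj V).map x.hom ≫ lamIn P' ((Lam₁ P).obj V) x.right :=
  lamIn_desc _ x

/-- The diagram chase behind `lamTo_lamComp`. -/
theorem comp_aux {x₀ x₁ x₂ x₃ x₄ x₅ x₆ x₇ : Vect} {v : x₀ ⟶ x₁} {i : x₁ ⟶ x₂} {m : x₂ ⟶ x₃} {c : x₃ ⟶ x₄}
    {c' : x₂ ⟶ x₅} {m' : x₅ ⟶ x₄} {i₁ : x₁ ⟶ x₆} {h : x₆ ⟶ x₇} {i₂ : x₇ ⟶ x₅} {b : Vect}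
    {g : x₆ ⟶ b} {d : b ⟶ x₇} (h₁ : m ≫ c = c' ≫ m') (h₂ : i ≫ c' = i₁ ≫ h ≫ i₂) (h₃ : h = g ≫ d) :
    (v ≫ i ≫ m) ≫ c = (v ≫ i₁ ≫ g) ≫ d ≫ i₂ ≫ m' := by
  simp only [Category.assoc, h₁, reassoc_of% h₂, h₃]

theorem lamTo_lamComp (V : A ⥤ Vect) {a : A} {b : B} {c : C} (x : (P.comp P').apex)
    (α : a ⟶ (P.comp P').src.obj x) (β : c ⟶ (P.comp P').tgt.obj x) {γ : b ⟶ P.tgt.obj x.left}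
    {δ : b ⟶ P'.src.obj x.right} (h : γ ≫ x.hom = δ) :
    lamTo (P.comp P') V x α β ≫ (lamComp P P' V).app c =
      lamTo P V x.left α γ ≫ lamTo P' ((Lam₁ P).obj V) x.right δ β :=
  comp_aux ((lamComp P P' V).naturality (inv β)) (lamIn_lamComp V x) (by
    rw [← h, ← Functor.map_comp, IsIso.inv_hom_id_assoc])

/-- The compatibility condition for a pair of points of homotopy fibres in `IsTransversal.hcomp`. -/
theorem conj_aux {E E' F : Type 1} [Groupoid.{0} E] [Groupoid.{0} E'] [Groupoid.{0} F] (G : E ⥤ F)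
    (G' : E' ⥤ F) {a b d : E} {a' b' d' : E'} {k : a ⟶ b} {h : b ⟶ d} {s : a ⟶ d} {l : a' ⟶ b'}
    {h' : b' ⟶ d'} {s' : a' ⟶ d'} {x : G.obj d ⟶ G'.obj d'} {c : G.obj b ⟶ G'.obj b'}
    (hk : k ≫ h = s) (hl : l ≫ h' = s') (hw : G.map h ≫ x = c ≫ G'.map h') :
    G.map k ≫ c = (G.map s ≫ x ≫ inv (G'.map s')) ≫ G'.map l := by
  subst hk hl
  simp [reassoc_of% hw]

/-- The points of the homotopy fibre of a horizontal composite are pairs of points of the homotopy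
fibres of the two factors. -/
theorem IsTransversal.hcomp {Z : SpanSpan P Q} {W : SpanSpan P' Q'} {x : (P.comp P').apex}
    {T T' : Type*} {φ : T → CostructuredArrow Z.top x.left}
    {φ' : T' → CostructuredArrow W.top x.right} (hφ : IsTransversal φ) (hφ' : IsTransversal φ') :
    IsTransversal (S := (Z.hcomp W).top) (x := x) (fun t : T × T' =>
      fibrePoint (Z.hcomp W).top
        ⟨(φ t.1).left, (φ' t.2).left,
          P.tgt.map (φ t.1).hom ≫ x.hom ≫ inv (P'.src.map (φ' t.2).hom)⟩
        ⟨(φ t.1).hom, (φ' t.2).hom, by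
          change P.tgt.map (φ t.1).hom ≫ x.hom =
            (P.tgt.map (φ t.1).hom ≫ x.hom ≫ inv (P'.src.map (φ' t.2).hom)) ≫
              P'.src.map (φ' t.2).hom
          simp⟩) := by
  rw [isTransversal_iff] at hφ hφ' ⊢
  refine ⟨?_, ?_⟩
  · rintro ⟨t, u⟩ ⟨t', u'⟩ k hk
    exact Prod.ext (hφ.1 t t' k.left (congrArg CommaMorphism.left hk))
      (hφ'.1 u u' k.right (congrArg CommaMorphism.right hk))
  · rintro ⟨c, ⟨⟨⟩⟩, h⟩
    obtain ⟨t, k, hk⟩ := hφ.2 (fibrePoint Z.top c.left h.left)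
    obtain ⟨u, l, hl⟩ := hφ'.2 (fibrePoint W.top c.right h.right)
    have hw : P.tgt.map h.left ≫ x.hom = c.hom ≫ P'.src.map h.right := h.w
    change Z.top.map k ≫ h.left = (φ t).hom at hk
    change W.top.map l ≫ h.right = (φ' u).hom at hl
    refine ⟨⟨t, u⟩, ⟨k, l, ?_⟩, Comma.hom_ext _ _ hk hl⟩
    change P.tgt.map (Z.top.map k) ≫ c.hom = (P.tgt.map (φ t).hom ≫ x.hom ≫
      inv (P'.src.map (φ' u).hom)) ≫ P'.src.map (W.top.map l)
    exact conj_aux P.tgt P'.src hk hl hw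

/-- `Λ` takes horizontal composites to horizontal composites of natural transformations. -/
theorem Lam₂_hcomp {Z : SpanSpan P Q} {W : SpanSpan P' Q'} (hZ : Z.IsCover) (hW : W.IsCover)
    (hP : P'.IsCover) (hQ : Q'.IsCover) (V : A ⥤ Vect) :
    (Lam₂ (Z.hcomp W)).app V ≫ lamComp Q Q' V =
      lamComp P P' V ≫ (Lam₁ P').map ((Lam₂ Z).app V) ≫ (Lam₂ W).app ((Lam₁ Q).obj V) := by
  refine lam_ext fun x => ?_
  obtain ⟨T, _, φ, hφ⟩ := hZ.top.exists_isTransversal x.left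
  obtain ⟨T', _, φ', hφ'⟩ := hW.top.exists_isTransversal x.right
  rw [← lamTo_id]
  refine (Category.assoc _ _ _).symm.trans (Eq.trans ?_ (Category.assoc _ _ _))
  rw [lamTo_Lam₂ _ (hZ.hcomp hP hQ hW).top.faithful V _ _ (hφ.hcomp hφ'), Preadditive.sum_comp,
    lamTo_lamComp V x (𝟙 _) (𝟙 _) (b := P.tgt.obj x.left) (γ := 𝟙 _) (δ := x.hom)
      (Category.id_comp _)]
  refine Eq.trans ?_ (Category.assoc _ _ _)
  refine Eq.trans ?_ (congrArg (· ≫ _) (Category.assoc _ _ _).symm)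
  refine Eq.trans ?_ (congrArg (· ≫ _) (congrArg (_ ≫ ·) (lamTo_map _ _ _).symm))
  refine Eq.trans ?_ (congrArg (· ≫ _) (Category.assoc _ _ _))
  refine Eq.trans ?_ (Category.assoc _ _ _).symm
  refine Eq.trans ?_ (congrArg₂ (· ≫ ·)
    (lamTo_Lam₂ Z hZ.top.faithful V _ _ hφ).symm
    (lamTo_Lam₂ W hW.top.faithful _ _ _ hφ').symm)
  rw [Preadditive.sum_comp, Fintype.sum_prod_type]
  refine Finset.sum_congr rfl fun t _ => ?_
  rw [Preadditive.comp_sum]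
  refine Finset.sum_congr rfl fun u _ => ?_
  refine (lamTo_lamComp V _ _ _ ?_).trans (congrArg₂ (· ≫ ·) (lamTo_congr rfl rfl)
    (lamTo_congr rfl rfl))
  change (𝟙 _ ≫ inv (P.tgt.map (φ t).hom) ≫ Z.μ.app (φ t).left) ≫ inv (Z.μ.app (φ t).left) ≫
    (P.tgt.map (φ t).hom ≫ x.hom ≫ inv (P'.src.map (φ' u).hom)) ≫ W.ν.app (φ' u).left =
      x.hom ≫ inv (P'.src.map (φ' u).hom) ≫ W.ν.app (φ' u).left
  simp

/-- The canonical map into `Λ` of a composite span, in terms of the components of a point. -/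
noncomputable def lamPt (P : GSpan A B) (P' : GSpan B C) (V : A ⥤ Vect) (p : P.apex) (p' : P'.apex)
    (k : P.tgt.obj p ⟶ P'.src.obj p') :
    V.obj (P.src.obj p) ⟶ ((Lam₁ (P.comp P')).obj V).obj (P'.tgt.obj p') :=
  lamIn (P.comp P') V (show Comma P.tgt P'.src from ⟨p, p', k⟩)

theorem lamPt_nat (V : A ⥤ Vect) {p q : P.apex} {p' q' : P'.apex} {k : P.tgt.obj p ⟶ P'.src.obj p'}
    {l : P.tgt.obj q ⟶ P'.src.obj q'} (f : p ⟶ q) (f' : p' ⟶ q')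
    (w : P.tgt.map f ≫ l = k ≫ P'.src.map f') : V.map (P.src.map f) ≫ lamPt P P' V q q' l =
      lamPt P P' V p p' k ≫ ((Lam₁ (P.comp P')).obj V).map (P'.tgt.map f') :=
  lamIn_nat (P := P.comp P') (V := V) (p := (show Comma P.tgt P'.src from ⟨p, p', k⟩))
    (q := (show Comma P.tgt P'.src from ⟨q, q', l⟩)) (show CommaMorphism _ _ from ⟨f, f', w⟩)

theorem lamPt_nat_left (V : A ⥤ Vect) {p q : P.apex} {p' : P'.apex} (f : p ⟶ q)
    (l : P.tgt.obj q ⟶ P'.src.obj p') : V.map (P.src.map f) ≫ lamPt P P' V q p' l =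
      lamPt P P' V p p' (P.tgt.map f ≫ l) := by
  have h := lamPt_nat V (k := P.tgt.map f ≫ l) (l := l) f (𝟙 p') (by simp)
  simpa using h

theorem lamPt_nat_right (V : A ⥤ Vect) {p : P.apex} {p' q' : P'.apex} (f : p' ⟶ q')
    (k : P.tgt.obj p ⟶ P'.src.obj p') : lamPt P P' V p q' (k ≫ P'.src.map f) =
      lamPt P P' V p p' k ≫ ((Lam₁ (P.comp P')).obj V).map (P'.tgt.map f) := by
  have h := lamPt_nat V (k := k) (l := k ≫ P'.src.map f) (𝟙 p) f (by simp)
  simpa using h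

/-- The part of the inverse of the comparison map that belongs to a point `p'`. -/
noncomputable def lamCompInvApp (P : GSpan A B) (P' : GSpan B C) (V : A ⥤ Vect) (p' : P'.apex) :
    ((Lam₁ P).obj V).obj (P'.src.obj p') ⟶ ((Lam₁ (P.comp P')).obj V).obj (P'.tgt.obj p') :=
  lamDescAt (fun p k => lamPt P P' V p p' k) (fun f k => lamPt_nat_left V f k)

theorem lamIn_lamCompInvApp (V : A ⥤ Vect) (p : P.apex) (p' : P'.apex)
    (k : P.tgt.obj p ⟶ P'.src.obj p') : lamIn P V p ≫ ((Lam₁ P).obj V).map k ≫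
      lamCompInvApp P P' V p' = lamPt P P' V p p' k :=
  lamIn_lamDescAt _ _ p k

/-- The inverse of the comparison map of a composite. -/
noncomputable def lamCompInv (P : GSpan A B) (P' : GSpan B C) (V : A ⥤ Vect) :
    (Lam₁ P').obj ((Lam₁ P).obj V) ⟶ (Lam₁ (P.comp P')).obj V :=
  lamDesc P' ((Lam₁ P).obj V)
    { app := fun p' => lamCompInvApp P P' V p'
      naturality := fun p' q' f => lam_ext_at fun p k => by
        have h : ((Lam₁ P).obj V).map (k ≫ P'.src.map f) = _ := Functor.map_comp _ _ _
        have h1 := lamIn_lamCompInvApp V p q' (k ≫ P'.src.map f)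
        rw [h, Category.assoc] at h1
        have h2 := (congrArg (· ≫ ((Lam₁ (P.comp P')).obj V).map (P'.tgt.map f))
          (lamIn_lamCompInvApp V p p' k))
        simp only [Category.assoc] at h2
        exact h1.trans ((lamPt_nat_right V f k).trans h2.symm) }

theorem lamIn_lamCompInv (V : A ⥤ Vect) (p : P.apex) (p' : P'.apex)
    (k : P.tgt.obj p ⟶ P'.src.obj p') : lamIn P V p ≫ ((Lam₁ P).obj V).map k ≫
      lamIn P' ((Lam₁ P).obj V) p' ≫ (lamCompInv P P' V).app (P'.tgt.obj p') =
        lamPt P P' V p p' k :=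
  (congrArg (fun t => lamIn P V p ≫ ((Lam₁ P).obj V).map k ≫ t) (lamIn_desc _ p')).trans
    (lamIn_lamCompInvApp V p p' k)

instance isIso_lamComp (P : GSpan A B) (P' : GSpan B C) (V : A ⥤ Vect) :
    IsIso (lamComp P P' V) := by
  refine ⟨lamCompInv P P' V, lam_ext fun x => ?_, lam_ext fun p' => lam_ext_at fun p k => ?_⟩
  · refine (Category.assoc _ _ _).symm.trans ((congrArg (· ≫ _) (lamIn_lamComp V x)).trans ?_)
    refine Eq.trans ?_ ((lamIn_lamCompInv V x.left x.right x.hom).trans (Category.comp_id _).symm)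
    exact (Category.assoc _ _ _).trans (congrArg (_ ≫ ·) (Category.assoc _ _ _))
  · have h := congrArg (· ≫ (lamComp P P' V).app _) (lamIn_lamCompInv V p p' k)
    simp only [Category.assoc] at h
    refine h.trans ((lamIn_lamComp V (show Comma P.tgt P'.src from ⟨p, p', k⟩)).trans ?_)
    exact congrArg (fun t => _ ≫ _ ≫ t) (Category.comp_id _).symm

theorem lamIn_lamId (V : A ⥤ Vect) (a : A) :
    lamIn (GSpan.idSpan A) V a ≫ (lamId V).app a = 𝟙 (V.obj a) :=
  lamIn_desc (P := GSpan.idSpan A) (𝟙 V) a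

instance isIso_lamId (V : A ⥤ Vect) : IsIso (lamId V) := by
  refine ⟨lamUnit (GSpan.idSpan A) V, lam_ext fun a => ?_, ?_⟩
  · refine (Category.assoc _ _ _).symm.trans ((congrArg (· ≫ _) (lamIn_lamId V a)).trans ?_)
    exact (Category.id_comp _).trans (Category.comp_id _).symm
  · ext a : 2
    exact lamIn_lamId V a

/-- The diagram chase behind `lamComp_natural`. -/
theorem natural_aux {D : Type*} [Category* D] {x₀ x₁ x₂ x₃ x₄ y₀ y₁ y₂ y₃ y₄ : D} {i : x₀ ⟶ x₁} {j : x₀ ⟶ x₂}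
    {h : x₂ ⟶ x₃} {l : x₃ ⟶ x₄} {c : x₁ ⟶ x₄} {i' : y₀ ⟶ y₁} {j' : y₀ ⟶ y₂}
    {h' : y₂ ⟶ y₃} {l' : y₃ ⟶ y₄} {c' : y₁ ⟶ y₄} {f₀ : x₀ ⟶ y₀} {f₁ : x₁ ⟶ y₁} {f₂ : x₂ ⟶ y₂}
    {f₃ : x₃ ⟶ y₃} {f₄ : x₄ ⟶ y₄} (h₁ : i ≫ f₁ = f₀ ≫ i') (h₂ : j ≫ f₂ = f₀ ≫ j')
    (h₃ : h ≫ f₃ = f₂ ≫ h') (h₄ : l ≫ f₄ = f₃ ≫ l') (h₅ : i ≫ c = j ≫ h ≫ l)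
    (h₆ : i' ≫ c' = j' ≫ h' ≫ l') : i ≫ f₁ ≫ c' = i ≫ c ≫ f₄ := by
  rw [reassoc_of% h₁, h₆, ← Category.assoc i, h₅]
  simp only [Category.assoc, h₄, reassoc_of% h₃, reassoc_of% h₂]

theorem lamComp_natural {V W : A ⥤ Vect} (f : V ⟶ W) :
    (Lam₁ (P.comp P')).map f ≫ lamComp P P' W =
      lamComp P P' V ≫ (Lam₁ P').map ((Lam₁ P).map f) :=
  lam_ext fun x => natural_aux (lamIn_map f x) (lamIn_map f x.left)
    (((Lam₁ P).map f).naturality x.hom) (lamIn_map ((Lam₁ P).map f) x.right)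
    (lamIn_lamComp V x) (lamIn_lamComp W x)

theorem lamId_natural {V W : A ⥤ Vect} (f : V ⟶ W) :
    (Lam₁ (GSpan.idSpan A)).map f ≫ lamId W = lamId V ≫ f := by
  refine lam_ext fun a => ?_
  refine (Category.assoc _ _ _).symm.trans (Eq.trans ?_ (Category.assoc _ _ _))
  refine (congrArg (· ≫ _) (lamIn_map f a)).trans ((Category.assoc _ _ _).trans ?_)
  refine (congrArg (_ ≫ ·) (lamIn_lamId W a)).trans ((Category.comp_id _).trans ?_)
  exact ((congrArg (· ≫ _) (lamIn_lamId V a)).trans (Category.id_comp _)).symm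

end

section

variable {A B C D : Type 1} [Groupoid.{0} A] [Groupoid.{0} B] [Groupoid.{0} C] [Groupoid.{0} D]
  {P Q : GSpan A B}

theorem lamIn_Lam₂_of_rel (Z : SpanSpan P Q) [hZ : Z.top.IsEquivalence] (V : A ⥤ Vect)
    {p : P.apex} {q : Q.apex} {α : P.src.obj p ⟶ Q.src.obj q} {β : P.tgt.obj p ⟶ Q.tgt.obj q}
    (h : Z.Rel p q α β) : lamIn P V p ≫ ((Lam₂ Z).app V).app (P.tgt.obj p) = lamTo Q V q α β := by
  rw [← lamTo_id, lamTo_Lam₂_of_rel Z V h, Category.id_comp, Category.id_comp]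

theorem rel_ofFunctor (F : P.apex ⥤ Q.apex) (μ : P.tgt ⟶ F ⋙ Q.tgt) (ν : P.src ⟶ F ⋙ Q.src)
    (p : P.apex) : (SpanSpan.ofFunctor F μ ν).Rel p (F.obj p) (ν.app p) (μ.app p) :=
  ⟨p, 𝟙 _, 𝟙 _, by simp [SpanSpan.ofFunctor]; exact (Category.comp_id _).symm,
    by simp [SpanSpan.ofFunctor]; exact (Category.comp_id _).symm⟩

theorem lamIn_Lam₂_ofFunctor (F : P.apex ⥤ Q.apex) (μ : P.tgt ⟶ F ⋙ Q.tgt)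
    (ν : P.src ⟶ F ⋙ Q.src) (V : A ⥤ Vect) (p : P.apex) :
    lamIn P V p ≫ ((Lam₂ (SpanSpan.ofFunctor F μ ν)).app V).app (P.tgt.obj p) =
      lamTo Q V (F.obj p) (ν.app p) (μ.app p) :=
  have : (SpanSpan.ofFunctor F μ ν).top.IsEquivalence := Functor.isEquivalence_refl
  lamIn_Lam₂_of_rel _ V (rel_ofFunctor F μ ν p)

theorem comp_assoc₃ {D : Type*} [Category* D] {x₀ x₁ x₂ x₃ x₄ : D} (a : x₀ ⟶ x₁) (b : x₁ ⟶ x₂)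
    (c : x₂ ⟶ x₃) (d : x₃ ⟶ x₄) : (a ≫ b ≫ c) ≫ d = a ≫ b ≫ c ≫ d := by
  rw [Category.assoc, Category.assoc]

/-- The diagram chase behind `Lam₂_assocSpan`, in any category. -/
theorem assoc_aux {D : Type*} [Category* D] {x₀ x₁ x₂ x₃ x₄ x₅ x₆ y₁ y₂ y₃ z : D}
    {i : x₀ ⟶ x₁} {c : x₁ ⟶ x₂} {j : x₀ ⟶ x₃} {h : x₃ ⟶ x₄} {l : x₄ ⟶ x₂} {d : x₂ ⟶ x₆}
    {l₁ : x₄ ⟶ x₅} {h' : x₅ ⟶ z} {l₂ : z ⟶ x₆} {i' : x₀ ⟶ y₁} {h'' : y₁ ⟶ y₂} {l' : y₂ ⟶ y₃}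
    {m : y₃ ⟶ x₆} {c₁ : y₁ ⟶ x₅} {c₂ : y₂ ⟶ z} {w : D} {k : w ⟶ y₃} {b : x₀ ⟶ w} {a : w ⟶ x₁}
    (h₁ : i ≫ c = j ≫ h ≫ l) (h₂ : l ≫ d = l₁ ≫ h' ≫ l₂) (h₃ : l' ≫ m = c₂ ≫ l₂)
    (h₄ : h'' ≫ c₂ = c₁ ≫ h') (h₅ : i' ≫ c₁ = j ≫ h ≫ l₁) (h₆ : b ≫ k = i' ≫ h'' ≫ l')
    (h₇ : b ≫ a = i) : b ≫ a ≫ c ≫ d = b ≫ k ≫ m := by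
  rw [reassoc_of% h₇, reassoc_of% h₁, h₂, reassoc_of% h₆, h₃, reassoc_of% h₄, reassoc_of% h₅]

/-- `Λ` takes the associator of spans to the associativity constraint of the comparison maps. -/
theorem Lam₂_assocSpan (P : GSpan A B) (P' : GSpan B C) (P'' : GSpan C D) (V : A ⥤ Vect) :
    (Lam₂ (assocSpan P P' P'')).app V ≫ lamComp P (P'.comp P'') V ≫ lamComp P' P'' ((Lam₁ P).obj V) =
      lamComp (P.comp P') P'' V ≫ (Lam₁ P'').map (lamComp P P' V) :=
  lam_ext fun x => assoc_aux
    (lamIn_lamComp (P := P) (P' := P'.comp P'') V ((assocSpan P P' P'').bot.obj x))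
    (lamIn_lamComp (P := P') (P' := P'') _ (show Comma _ _ from ⟨x.left.right, x.right, x.hom⟩))
    (lamIn_map _ x.right) ((lamComp P P' V).naturality x.hom) (lamIn_lamComp V x.left)
    (lamIn_lamComp V x) ((lamIn_Lam₂_ofFunctor _ _ _ V x).trans lamTo_id)

theorem inv_commaInv_app {X Y : Type 1} [Groupoid.{0} X] [Groupoid.{0} Y] {G : X ⥤ B} {J : Y ⥤ B}
    (x : Comma G J) : inv ((commaInv G J).app x) = x.hom :=
  IsIso.inv_eq_of_hom_inv_id (congrArg (fun t => t.app x) (IsIso.inv_hom_id (Comma.natTrans G J)))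

theorem Lam₂_unitorSrc (P : GSpan A B) (V : A ⥤ Vect) :
    (Lam₂ (unitorSrc P)).app V = lamComp P (GSpan.idSpan B) V ≫ lamId ((Lam₁ P).obj V) := by
  refine lam_ext fun x => ?_
  refine (lamIn_Lam₂_ofFunctor _ _ _ V x).trans (Eq.trans ?_ (Category.assoc _ _ _))
  rw [lamIn_lamComp]
  refine Eq.trans ?_ (comp_assoc₃ _ _ _ _).symm
  refine Eq.trans ?_ (congrArg (fun t => _ ≫ _ ≫ t) (lamIn_lamId ((Lam₁ P).obj V) x.right).symm)
  rw [lamTo]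
  refine (congrArg (fun t => V.map (𝟙 _) ≫ _ ≫ ((Lam₁ P).obj V).map t)
    (inv_commaInv_app x)).trans ?_
  rw [V.map_id]
  exact (Category.id_comp _).trans (congrArg (_ ≫ ·) (Category.comp_id _).symm)

theorem Lam₂_unitorTgt (P : GSpan A B) (V : A ⥤ Vect) :
    (Lam₂ (unitorTgt P)).app V = lamComp (GSpan.idSpan A) P V ≫ (Lam₁ P).map (lamId V) := by
  refine lam_ext fun x => ?_
  refine (lamIn_Lam₂_ofFunctor _ _ _ V x).trans (Eq.trans ?_ (Category.assoc _ _ _))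
  rw [lamIn_lamComp]
  refine Eq.trans ?_ (comp_assoc₃ _ _ _ _).symm
  refine Eq.trans ?_ (congrArg (fun t => _ ≫ _ ≫ t) (lamIn_map (lamId V) x.right).symm)
  refine Eq.trans ?_ (congrArg (_ ≫ ·) ((lamId V).naturality_assoc x.hom _).symm)
  refine Eq.trans ?_ (Category.assoc _ _ _)
  refine Eq.trans ?_ (congrArg (· ≫ _) (lamIn_lamId V x.left).symm)
  refine Eq.trans ?_ (Category.id_comp _).symm
  rw [lamTo]
  refine congrArg (_ ≫ ·) ?_
  exact (congrArg (_ ≫ ·) ((congrArg _ IsIso.inv_id).trans (CategoryTheory.Functor.map_id _ _))).trans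
    (Category.comp_id _)

/-! ### Linearity and finiteness -/

instance (P : GSpan A B) : (Lam₁ P).Additive where
  map_add {V W f g} := lam_ext fun p => by
    refine (lamIn_map _ p).trans (Eq.trans ?_ (Preadditive.comp_add _ _ _ _ _ _).symm)
    rw [lamIn_map, lamIn_map]
    exact Preadditive.add_comp _ _ _ _ _ _

instance (P : GSpan A B) : (Lam₁ P).Linear ℂ where
  map_smul {V W} f c := lam_ext fun p => by
    refine (lamIn_map _ p).trans (Eq.trans ?_ (Linear.comp_smul _ _ _ _ _ _).symm)
    rw [lamIn_map]
    exact Linear.smul_comp _ _ _ _ _ _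

/-- The value of `Λ(P)(V)` at `b` is spanned by finitely many finite-dimensional images, one for each
point of the homotopy fibre of the target leg. -/
theorem finite_lam {P : GSpan A B} (hP : P.IsCover) {V : A ⥤ Vect}
    (hV : ∀ a, Module.Finite ℂ (V.obj a)) (b : B) :
    Module.Finite ℂ (((Lam₁ P).obj V).obj b) := by
  obtain ⟨T, _, φ, hφ⟩ := hP.tgt.exists_isTransversal b
  -- the span of the images is everything because the projection to the quotient vanishes
  let S : Submodule ℂ (((Lam₁ P).obj V).obj b) := ⨆ t, LinearMap.range
    (lamTo P V (φ t).left (𝟙 _) (inv (show P.tgt.obj (φ t).left ⟶ b from (φ t).hom))).hom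
  have hS : Module.Finite ℂ S := by
    have (t : T) : Module.Finite ℂ (LinearMap.range
      (lamTo P V (φ t).left (𝟙 _) (inv (show P.tgt.obj (φ t).left ⟶ b from (φ t).hom))).hom) := by
      have := hV (P.src.obj (φ t).left)
      infer_instance
    exact Submodule.finite_iSup _
  have h : ModuleCat.ofHom S.mkQ = (0 : ((Lam₁ P).obj V).obj b ⟶ ModuleCat.of ℂ (_ ⧸ S)) := by
    refine lam_ext_to fun p β => ?_
    obtain ⟨t, k, hk⟩ := (isTransversal_iff.1 hφ).2 (fibrePoint P.tgt p (inv β))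
    have e : lamTo P V p (𝟙 _) β = V.map (inv (P.src.map k)) ≫ lamTo P V (φ t).left (𝟙 _)
        (inv (show P.tgt.obj (φ t).left ⟶ b from (φ t).hom)) := by
      rw [lamTo_pre, lamTo_transport k]
      refine lamTo_congr (by simp) ?_
      rw [← hk]
      simp
    rw [e, Category.assoc, Limits.comp_zero]
    ext v
    refine (Submodule.Quotient.mk_eq_zero S).2 (Submodule.mem_iSup_of_mem t ?_)
    exact ⟨_, rfl⟩
  have hS' : S = ⊤ := by
    rw [← S.ker_mkQ, LinearMap.ker_eq_top]
    exact congrArg ModuleCat.Hom.hom h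
  rw [hS'] at hS
  exact Module.Finite.equiv Submodule.topEquiv

/-- `Λ` of a span with finite coverings as legs preserves functors with finite-dimensional values and
finite support: a value at `b` comes from points over the support of `V`, and these have finitely
many images up to isomorphism. -/
theorem isLam_lam {P : GSpan A B} (hP : P.IsCover) {V : A ⥤ Vect} (hV : isLam A V) :
    isLam B ((Lam₁ P).obj V) := by
  classical
  obtain ⟨h1, s, h2⟩ := hV
  refine ⟨finite_lam hP h1, ?_⟩
  choose T _ φ hφ using fun a => hP.src.exists_isTransversal a
  refine ⟨s.biUnion fun a => Finset.univ.image fun t => P.tgt.obj (φ a t).left, fun b hb => ?_⟩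
  by_contra hn
  refine not_subsingleton_iff_nontrivial.2 hb ?_
  -- every map into the value at `b` comes from a point over a set outside the support of `V`
  suffices h : 𝟙 (((Lam₁ P).obj V).obj b) = 0 from
    ⟨fun v w => (congrArg (fun f => f.hom v) h).trans (congrArg (fun f => f.hom w) h).symm⟩
  refine lam_ext_to fun p β => ?_
  have : Subsingleton (V.obj (P.src.obj p)) := by
    by_contra hp
    obtain ⟨a, ha, ⟨e⟩⟩ := h2 _ (not_subsingleton_iff_nontrivial.1 hp)
    obtain ⟨t, k, -⟩ := (isTransversal_iff.1 (hφ a)).2 (fibrePoint P.src p e.hom)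
    exact hn ⟨_, Finset.mem_biUnion.2 ⟨a, ha, Finset.mem_image_of_mem _ (Finset.mem_univ t)⟩,
      ⟨(Groupoid.isoEquivHom _ _).symm (β ≫ inv (P.tgt.map k))⟩⟩
  ext v
  rw [Subsingleton.elim v 0, map_zero, map_zero]

end

section

variable {A B C D : Type 1} [Groupoid.{0} A] [Groupoid.{0} B] [Groupoid.{0} C] [Groupoid.{0} D]

/-! ### Horizontal composites of transformations -/

section

variable {P Q R : GSpan A B} {P' Q' R' : GSpan B C} {P'' Q'' : GSpan C D}

/-- The horizontal composite of transformations between values of `Λ`, transported to `Λ` of the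
composite spans. -/
noncomputable def lamTensor (a : Lam₁ P ⟶ Lam₁ Q) (b : Lam₁ P' ⟶ Lam₁ Q') :
    Lam₁ (P.comp P') ⟶ Lam₁ (Q.comp Q') where
  app V := lamComp P P' V ≫ (Lam₁ P').map (a.app V) ≫ b.app ((Lam₁ Q).obj V) ≫
    inv (lamComp Q Q' V)
  naturality V W f := by
    rw [← Category.assoc, lamComp_natural]
    simp only [Category.assoc]
    congr 1
    rw [← Category.assoc, ← Functor.map_comp, a.naturality, Functor.map_comp, Category.assoc]
    congr 1
    rw [← Category.assoc, b.naturality, Category.assoc]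
    congr 1
    rw [IsIso.eq_inv_comp, ← Category.assoc, IsIso.comp_inv_eq, lamComp_natural]

/-- The defining property of `lamTensor`. -/
theorem lamTensor_lamComp (a : Lam₁ P ⟶ Lam₁ Q) (b : Lam₁ P' ⟶ Lam₁ Q') (V : A ⥤ Vect) :
    (lamTensor a b).app V ≫ lamComp Q Q' V =
      lamComp P P' V ≫ (Lam₁ P').map (a.app V) ≫ b.app ((Lam₁ Q).obj V) := by
  simp [lamTensor]

theorem lamTensor_unique {a : Lam₁ P ⟶ Lam₁ Q} {b : Lam₁ P' ⟶ Lam₁ Q'}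
    {c : Lam₁ (P.comp P') ⟶ Lam₁ (Q.comp Q')}
    (h : ∀ V, c.app V ≫ lamComp Q Q' V =
      lamComp P P' V ≫ (Lam₁ P').map (a.app V) ≫ b.app ((Lam₁ Q).obj V)) : lamTensor a b = c := by
  ext V : 2
  rw [← cancel_mono (lamComp Q Q' V), h, lamTensor_lamComp]

theorem lamTensor_comp (a : Lam₁ P ⟶ Lam₁ Q) (a' : Lam₁ Q ⟶ Lam₁ R) (b : Lam₁ P' ⟶ Lam₁ Q')
    (b' : Lam₁ Q' ⟶ Lam₁ R') : lamTensor (a ≫ a') (b ≫ b') = lamTensor a b ≫ lamTensor a' b' :=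
  lamTensor_unique fun V => by
    simp only [NatTrans.comp_app, Category.assoc, lamTensor_lamComp, Functor.map_comp]
    rw [← Category.assoc ((lamTensor a b).app V), lamTensor_lamComp]
    simp

theorem lamTensor_assoc (a : Lam₁ P ⟶ Lam₁ Q) (b : Lam₁ P' ⟶ Lam₁ Q') (c : Lam₁ P'' ⟶ Lam₁ Q'') :
    Lam₂ (assocSpan P P' P'') ≫ lamTensor a (lamTensor b c) =
      lamTensor (lamTensor a b) c ≫ Lam₂ (assocSpan Q Q' Q'') := by
  ext V : 2
  rw [← cancel_mono (lamComp Q (Q'.comp Q'') V), ← cancel_mono (lamComp Q' Q'' ((Lam₁ Q).obj V))]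
  simp only [NatTrans.comp_app, Category.assoc]
  rw [Lam₂_assocSpan, ← Category.assoc ((lamTensor a _).app V), lamTensor_lamComp,
    ← Category.assoc ((lamTensor _ c).app V), lamTensor_lamComp]
  simp only [Category.assoc]
  rw [lamTensor_lamComp, ← Category.assoc ((Lam₁ (P'.comp P'')).map _), lamComp_natural]
  simp only [Category.assoc]
  rw [← Category.assoc (lamComp P _ V), ← Category.assoc ((Lam₂ _).app V), Lam₂_assocSpan]
  simp only [Category.assoc]
  rw [← c.naturality, ← Category.assoc ((Lam₁ P'').map ((lamTensor a b).app V)),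
    ← Functor.map_comp, lamTensor_lamComp]
  simp only [Functor.map_comp, Category.assoc]

theorem lamTensor_unitorSrc (a : Lam₁ P ⟶ Lam₁ Q) :
    lamTensor a (𝟙 (Lam₁ (GSpan.idSpan B))) ≫ Lam₂ (unitorSrc Q) = Lam₂ (unitorSrc P) ≫ a := by
  ext V : 2
  simp only [NatTrans.comp_app, Lam₂_unitorSrc]
  rw [← Category.assoc, lamTensor_lamComp]
  simp [lamId_natural]

theorem lamTensor_unitorTgt (a : Lam₁ P ⟶ Lam₁ Q) :
    lamTensor (𝟙 (Lam₁ (GSpan.idSpan A))) a ≫ Lam₂ (unitorTgt Q) = Lam₂ (unitorTgt P) ≫ a := by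
  ext V : 2
  simp only [NatTrans.comp_app, Lam₂_unitorTgt]
  rw [← Category.assoc, lamTensor_lamComp]
  simp

theorem add_lamTensor (a a' : Lam₁ P ⟶ Lam₁ Q) (b : Lam₁ P' ⟶ Lam₁ Q') :
    lamTensor (a + a') b = lamTensor a b + lamTensor a' b :=
  lamTensor_unique fun V => by
    simp [Preadditive.add_comp, lamTensor_lamComp, Functor.map_add]

theorem lamTensor_add (a : Lam₁ P ⟶ Lam₁ Q) (b b' : Lam₁ P' ⟶ Lam₁ Q') :
    lamTensor a (b + b') = lamTensor a b + lamTensor a b' :=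
  lamTensor_unique fun V => by simp [Preadditive.add_comp, lamTensor_lamComp]

theorem zero_lamTensor (b : Lam₁ P' ⟶ Lam₁ Q') : lamTensor (0 : Lam₁ P ⟶ Lam₁ Q) b = 0 :=
  lamTensor_unique fun V => by simp

theorem lamTensor_zero (a : Lam₁ P ⟶ Lam₁ Q) : lamTensor a (0 : Lam₁ P' ⟶ Lam₁ Q') = 0 :=
  lamTensor_unique fun V => by simp

theorem smul_lamTensor (r : ℂ) (a : Lam₁ P ⟶ Lam₁ Q) (b : Lam₁ P' ⟶ Lam₁ Q') :
    lamTensor (r • a) b = r • lamTensor a b :=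
  lamTensor_unique fun V => by
    simp [Linear.smul_comp, lamTensor_lamComp, Functor.map_smul]

theorem lamTensor_smul (r : ℂ) (a : Lam₁ P ⟶ Lam₁ Q) (b : Lam₁ P' ⟶ Lam₁ Q') :
    lamTensor a (r • b) = r • lamTensor a b :=
  lamTensor_unique fun V => by simp [Linear.smul_comp, lamTensor_lamComp]

end

end

/-! ### The action of formal morphisms on functors -/

/-- The action of formal morphisms of `H'` by natural transformations: generators and structural
morphisms act by `Λ` of their spans of spans, and composites, tensor products and linear
combinations are formed on the side of natural transformations. -/
noncomputable def Lmor : ∀ {X Y : HObj}, HMor ℂ X Y → (Lam₁ (Cobj X) ⟶ Lam₁ (Cobj Y))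
  | _, _, .id X => 𝟙 _
  | _, _, .comp f g => Lmor f ≫ Lmor g
  | _, _, .tensor f g => lamTensor (Lmor g) (Lmor f)
  | _, _, .assocHom X Y Z => Lam₂ (assocSpan (Cobj Z) (Cobj Y) (Cobj X)).converse
  | _, _, .assocInv X Y Z => Lam₂ (assocSpan (Cobj Z) (Cobj Y) (Cobj X))
  | _, _, .leftHom X => Lam₂ (unitorSrc (Cobj X))
  | _, _, .leftInv X => Lam₂ (unitorSrc (Cobj X)).converse
  | _, _, .rightHom X => Lam₂ (unitorTgt (Cobj X))
  | _, _, .rightInv X => Lam₂ (unitorTgt (Cobj X)).converse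
  | _, _, .zero X Y => 0
  | _, _, .add f g => Lmor f + Lmor g
  | _, _, .smul r f => r • Lmor f
  | _, _, .inl X Y => Lam₂ (inlSpan (Cobj X) (Cobj Y))
  | _, _, .inr X Y => Lam₂ (inrSpan (Cobj X) (Cobj Y))
  | _, _, .fst X Y => Lam₂ (inlSpan (Cobj X) (Cobj Y)).converse
  | _, _, .snd X Y => Lam₂ (inrSpan (Cobj X) (Cobj Y)).converse
  | _, _, .cupMP => Lam₂ iId
  | _, _, .capMP => Lam₂ iId.converse
  | _, _, .cupPM => Lam₂ etaSpan
  | _, _, .capPM => Lam₂ etaSpan.converse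
  | _, _, .crossPP => Lam₂ swapCreat
  | _, _, .crossMM => Lam₂ swapAnnih
  | _, _, .crossPM => Lam₂ iAA
  | _, _, .crossMP => Lam₂ iAA.converse

section

variable {A B : Type 1} [Groupoid.{0} A] [Groupoid.{0} B] {P Q : GSpan A B}

theorem Lam₂_eq_of_mk_eq {Z W : SpanSpan P Q} (hW : (TwoCell.mk W).IsCover)
    (h : TwoCell.mk Z = TwoCell.mk W) : Lam₂ Z = Lam₂ W :=
  Lam₂_eq_of_equiv (Quotient.exact h) (hW Z h)

theorem Lam₂_nsmul {Z : SpanSpan P Q} (hZ : Z.IsCover) (n : ℕ) :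
    ∀ W : SpanSpan P Q, TwoCell.mk W = TwoCell.nsmul n (TwoCell.mk Z) →
      Lam₂ W = (n : ℂ) • Lam₂ Z := by
  induction n with
  | zero =>
    intro W hW
    rw [Lam₂_eq_of_mk_eq (TwoCell.isCover_mk .zeroTwo) hW, Lam₂_zeroTwo, Nat.cast_zero, zero_smul]
  | succ n ih =>
    intro W hW
    obtain ⟨U, hU⟩ := Quotient.exists_rep (TwoCell.nsmul n (TwoCell.mk Z))
    have hU' : U.IsCover := (TwoCell.isCover_mk hZ).nsmul n U hU
    have h : TwoCell.mk W = TwoCell.mk (U.add Z) := by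
      refine hW.trans ?_
      change TwoCell.add (TwoCell.nsmul n _) _ = _
      rw [← hU]
      rfl
    rw [Lam₂_eq_of_mk_eq (TwoCell.isCover_mk (hU'.add hZ)) h, Lam₂_add hU' hZ, ih U hU,
      Nat.cast_succ, add_smul, one_smul]

end

/-- The action of a formal morphism with natural coefficients is `Λ` of every span of spans in its
class under the combinatorial representation. -/
theorem Lmor_natCast {X Y : HObj} (f : HMor ℕ X Y) : ∀ Z : SpanSpan (Cobj X) (Cobj Y),
    TwoCell.mk Z = Cmor f → Lmor (natCast ℂ f) = Lam₂ Z := by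
  have key {X Y : HObj} (f : HMor ℕ X Y) {W Z : SpanSpan (Cobj X) (Cobj Y)}
      (h : TwoCell.mk W = Cmor f) (hZ : TwoCell.mk Z = Cmor f) : Lam₂ W = Lam₂ Z :=
    Lam₂_eq_of_mk_eq (TwoCell.isCover_mk (isCover_Cmor f Z hZ)) (h.trans hZ.symm)
  induction f with
  | id X => exact fun Z hZ => (Lam₂_idTwo _).symm.trans (key (.id X) rfl hZ)
  | comp f g hf hg =>
    intro Z hZ
    obtain ⟨U, hU⟩ := Quotient.exists_rep (Cmor f)
    obtain ⟨W, hW⟩ := Quotient.exists_rep (Cmor g)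
    have h : TwoCell.mk (U.vcomp W) = Cmor (f.comp g) := by rw [Cmor, ← hU, ← hW]; rfl
    rw [← key _ h hZ, Lam₂_vcomp (isCover_Cmor f U hU) (isCover_Cmor g W hW), ← hf U hU, ← hg W hW]
    rfl
  | tensor f g hf hg =>
    intro Z hZ
    obtain ⟨U, hU⟩ := Quotient.exists_rep (Cmor f)
    obtain ⟨W, hW⟩ := Quotient.exists_rep (Cmor g)
    have h : TwoCell.mk (W.hcomp U) = Cmor (f.tensor g) := by rw [Cmor, ← hU, ← hW]; rfl
    rw [← key _ h hZ]
    refine Eq.trans (congrArg₂ lamTensor (hg W hW) (hf U hU)) (lamTensor_unique fun V => ?_)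
    exact Lam₂_hcomp (isCover_Cmor g W hW) (isCover_Cmor f U hU) (isCover_Cobj _) (isCover_Cobj _) V
  | zero X Y => exact fun Z hZ => (Lam₂_zeroTwo _ _).symm.trans (key (.zero X Y) rfl hZ)
  | add f g hf hg =>
    intro Z hZ
    obtain ⟨U, hU⟩ := Quotient.exists_rep (Cmor f)
    obtain ⟨W, hW⟩ := Quotient.exists_rep (Cmor g)
    have h : TwoCell.mk (U.add W) = Cmor (f.add g) := by rw [Cmor, ← hU, ← hW]; rfl
    rw [← key _ h hZ, Lam₂_add (isCover_Cmor f U hU) (isCover_Cmor g W hW), ← hf U hU, ← hg W hW]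
    rfl
  | smul n f hf =>
    intro Z hZ
    obtain ⟨U, hU⟩ := Quotient.exists_rep (Cmor f)
    rw [Lam₂_nsmul (isCover_Cmor f U hU) n Z (by rw [hZ, Cmor, ← hU]; rfl), ← hf U hU]
    rfl
  | assocHom X Y Z => exact fun _ hZ => key (.assocHom X Y Z) rfl hZ
  | assocInv X Y Z => exact fun _ hZ => key (.assocInv X Y Z) rfl hZ
  | leftHom X => exact fun _ hZ => key (.leftHom X) rfl hZ
  | leftInv X => exact fun _ hZ => key (.leftInv X) rfl hZ
  | rightHom X => exact fun _ hZ => key (.rightHom X) rfl hZ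
  | rightInv X => exact fun _ hZ => key (.rightInv X) rfl hZ
  | inl X Y => exact fun _ hZ => key (.inl X Y) rfl hZ
  | inr X Y => exact fun _ hZ => key (.inr X Y) rfl hZ
  | fst X Y => exact fun _ hZ => key (.fst X Y) rfl hZ
  | snd X Y => exact fun _ hZ => key (.snd X Y) rfl hZ
  | cupMP => exact fun _ hZ => key .cupMP rfl hZ
  | capMP => exact fun _ hZ => key .capMP rfl hZ
  | cupPM => exact fun _ hZ => key .cupPM rfl hZ
  | capPM => exact fun _ hZ => key .capPM rfl hZ
  | crossPP => exact fun _ hZ => key .crossPP rfl hZ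
  | crossMM => exact fun _ hZ => key .crossMM rfl hZ
  | crossPM => exact fun _ hZ => key .crossPM rfl hZ
  | crossMP => exact fun _ hZ => key .crossMP rfl hZ

/-- Relations with natural coefficients hold for the action since they hold for the combinatorial
representation. -/
theorem Lmor_natCast_eq {X Y : HObj} {f g : HMor ℕ X Y} (h : HRel ℕ f g) :
    Lmor (natCast ℂ f) = Lmor (natCast ℂ g) := by
  obtain ⟨Z, hZ⟩ := Quotient.exists_rep (Cmor f)
  rw [Lmor_natCast f Z hZ, Lmor_natCast g Z (hZ.trans (Cmor_eq_of_hRel h))]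

/-- Naturality of a family of isomorphisms follows from naturality of the inverses. -/
theorem conj_of_inverse {D : Type*} [Category* D] {x x' y y' : D} {h : x ⟶ y} {i : y ⟶ x} {h' : x' ⟶ y'}
    {i' : y' ⟶ x'} {a : x ⟶ x'} {b : y ⟶ y'} (hi : h ≫ i = 𝟙 x) (ih : i' ≫ h' = 𝟙 y')
    (e : i ≫ a = b ≫ i') : h ≫ b = a ≫ h' := by
  have := congrArg (fun t => h ≫ t ≫ h') e
  simpa [reassoc_of% hi, ih] using this.symm

/-- The action of formal morphisms respects the relations of `H'`. Relations without variable
morphisms have natural coefficients, so that they follow from the combinatorial representation. -/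
theorem Lmor_eq_of_hRel {X Y : HObj} {f g : HMor ℂ X Y} (h : HRel ℂ f g) : Lmor f = Lmor g := by
  have hom_inv (X Y Z : HObj) : Lmor (.assocHom X Y Z) ≫ Lmor (.assocInv X Y Z) = 𝟙 _ :=
    Lmor_natCast_eq (HRel.assoc_hom_inv X Y Z)
  have inv_hom (X Y Z : HObj) : Lmor (.assocInv X Y Z) ≫ Lmor (.assocHom X Y Z) = 𝟙 _ :=
    Lmor_natCast_eq (HRel.assoc_inv_hom X Y Z)
  induction h with
  | refl f => rfl
  | symm _ ih => exact ih.symm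
  | trans _ _ h h' => exact h.trans h'
  | comp _ _ h h' => exact congrArg₂ (· ≫ ·) h h'
  | tensor _ _ h h' => exact congrArg₂ lamTensor h' h
  | add _ _ h h' => exact congrArg₂ (· + ·) h h'
  | smul r _ h => exact congrArg (r • ·) h
  | id_comp f => exact Category.id_comp _
  | comp_id f => exact Category.comp_id _
  | assoc f g h => exact Category.assoc _ _ _
  | id_tensor_id X Y => exact Lmor_natCast_eq (HRel.id_tensor_id X Y)
  | tensor_comp f g f' g' => exact (lamTensor_comp _ _ _ _).symm
  | assoc_hom_inv X Y Z => exact hom_inv X Y Z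
  | assoc_inv_hom X Y Z => exact inv_hom X Y Z
  | @assoc_nat X Y Z X' Y' Z' f g h =>
    have e := lamTensor_assoc (Lmor h) (Lmor g) (Lmor f)
    exact (conj_of_inverse (hom_inv X Y Z) (inv_hom X' Y' Z') e).symm
  | left_hom_inv X => exact Lmor_natCast_eq (HRel.left_hom_inv X)
  | left_inv_hom X => exact Lmor_natCast_eq (HRel.left_inv_hom X)
  | left_nat f => exact lamTensor_unitorSrc (Lmor f)
  | right_hom_inv X => exact Lmor_natCast_eq (HRel.right_hom_inv X)
  | right_inv_hom X => exact Lmor_natCast_eq (HRel.right_inv_hom X)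
  | right_nat f => exact lamTensor_unitorTgt (Lmor f)
  | pentagon W X Y Z => exact Lmor_natCast_eq (HRel.pentagon W X Y Z)
  | triangle X Y => exact Lmor_natCast_eq (HRel.triangle X Y)
  | add_comm f g => exact add_comm _ _
  | add_assoc f g h => exact add_assoc _ _ _
  | zero_add f => exact zero_add _
  | one_smul f => exact one_smul _ _
  | mul_smul r s f => exact mul_smul r s _
  | smul_add r f g => exact smul_add r _ _
  | add_smul r s f => exact add_smul r s _
  | zero_smul f => exact zero_smul _ _
  | add_comp f f' g => exact Preadditive.add_comp _ _ _ _ _ _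
  | comp_add f g g' => exact Preadditive.comp_add _ _ _ _ _ _
  | zero_comp X g => exact Limits.zero_comp
  | comp_zero f Z => exact Limits.comp_zero
  | smul_comp r f g => exact Linear.smul_comp _ _ _ _ _ _
  | comp_smul r f g => exact Linear.comp_smul _ _ _ _ _ _
  | add_tensor f f' g => exact lamTensor_add _ _ _
  | tensor_add f g g' => exact add_lamTensor _ _ _
  | zero_tensor X Y g => exact lamTensor_zero _
  | tensor_zero f X Y => exact zero_lamTensor _
  | smul_tensor r f g => exact lamTensor_smul _ _ _
  | tensor_smul r f g => exact smul_lamTensor _ _ _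
  | zero_obj => exact Lmor_natCast_eq HRel.zero_obj
  | inl_fst X Y => exact Lmor_natCast_eq (HRel.inl_fst X Y)
  | inl_snd X Y => exact Lmor_natCast_eq (HRel.inl_snd X Y)
  | inr_fst X Y => exact Lmor_natCast_eq (HRel.inr_fst X Y)
  | inr_snd X Y => exact Lmor_natCast_eq (HRel.inr_snd X Y)
  | biprod_total X Y => exact Lmor_natCast_eq (HRel.biprod_total X Y)
  | zigzagP => exact Lmor_natCast_eq HRel.zigzagP
  | zigzagM => exact Lmor_natCast_eq HRel.zigzagM
  | zigzagM' => exact Lmor_natCast_eq HRel.zigzagM'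
  | zigzagP' => exact Lmor_natCast_eq HRel.zigzagP'
  | rotL_PP => exact Lmor_natCast_eq HRel.rotL_PP
  | rotR_PP => exact Lmor_natCast_eq HRel.rotR_PP
  | rotL_PM => exact Lmor_natCast_eq HRel.rotL_PM
  | rotR_MP => exact Lmor_natCast_eq HRel.rotR_MP
  | heisenberg => exact Lmor_natCast_eq HRel.heisenberg
  | crossPM_crossMP => exact Lmor_natCast_eq HRel.crossPM_crossMP
  | circle => exact Lmor_natCast_eq HRel.circle
  | curl => exact Lmor_natCast_eq HRel.curl
  | crossPP_sq => exact Lmor_natCast_eq HRel.crossPP_sq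
  | crossMM_sq => exact Lmor_natCast_eq HRel.crossMM_sq
  | braid => exact Lmor_natCast_eq HRel.braid

/-! ### The action of `H'` on `Λ(FS)` -/

/-- The action of morphisms of `H'` by natural transformations. -/
noncomputable def Lhom {X Y : H ℂ} (f : X ⟶ Y) :
    Lam₁ (Cobj (show HObj from X)) ⟶ Lam₁ (Cobj (show HObj from Y)) :=
  Quotient.lift (s := hSetoid ℂ X Y) Lmor (fun _ _ h => Lmor_eq_of_hRel h) f

/-- The comparison map of a composite as an isomorphism. -/
noncomputable def lamCompIso {A B C : Type 1} [Groupoid.{0} A] [Groupoid.{0} B] [Groupoid.{0} C]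
    (P : GSpan A B) (P' : GSpan B C) (V : A ⥤ Vect) :
    (Lam₁ (P.comp P')).obj V ≅ (Lam₁ P').obj ((Lam₁ P).obj V) := asIso (lamComp P P' V)

/-- The comparison map of the identity as an isomorphism. -/
noncomputable def lamIdIso {A : Type 1} [Groupoid.{0} A] (V : A ⥤ Vect) :
    (Lam₁ (GSpan.idSpan A)).obj V ≅ V := asIso (lamId V)

theorem Lmor_wl (X : HObj) {Y Y' : HObj} (f : HMor ℂ Y Y') (V : FS ⥤ Vect) :
    (Lmor (f.wl X)).app V = (lamCompIso (Cobj Y) (Cobj X) V).hom ≫ (Lam₁ (Cobj X)).map ((Lmor f).app V) ≫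
      (lamCompIso (Cobj Y') (Cobj X) V).inv :=
  congrArg (fun t => (lamCompIso (Cobj Y) (Cobj X) V).hom ≫ (Lam₁ (Cobj X)).map ((Lmor f).app V) ≫ t)
    (Category.id_comp _)

theorem Lmor_wr (Y : HObj) {X X' : HObj} (f : HMor ℂ X X') (V : FS ⥤ Vect) :
    (Lmor (f.wr Y)).app V = (lamCompIso (Cobj Y) (Cobj X) V).hom ≫ (Lmor f).app ((Lam₁ (Cobj Y)).obj V) ≫
      (lamCompIso (Cobj Y) (Cobj X') V).inv :=
  congrArg (fun t => (lamCompIso (Cobj Y) (Cobj X) V).hom ≫ t)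
    ((congrArg (· ≫ _) ((Lam₁ (Cobj X)).map_id _)).trans (Category.id_comp _))

section

variable {D : Type*} [Category* D] {x₀ x₁ x₂ x₃ x₄ y : D}

/-- The diagram chase behind functoriality of the action. -/
theorem hcomp_aux {a : x₀ ⟶ x₁} {b : x₁ ⟶ x₂} {b' : y ⟶ x₃} {g : x₂ ⟶ x₃} {g' : x₃ ⟶ x₄}
    {h : x₂ ⟶ x₄} {k : x₁ ⟶ y} (e : k ≫ b' = b ≫ g) (e' : h = g ≫ g') :
    (a ≫ b) ≫ h = (a ≫ k) ≫ b' ≫ g' := by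
  simp only [Category.assoc, reassoc_of% e, e']

/-- The diagram chase behind `Lmor_tensor`. -/
theorem tensor_aux {w z : D} {t : x₀ ⟶ x₁} {m : x₁ ⟶ x₂} {c : x₂ ⟶ x₃} {c' : x₁ ⟶ x₄} {m' : x₄ ⟶ x₃}
    {k : x₀ ⟶ y} {g : y ⟶ z} {f : z ⟶ x₄} {q : z ⟶ w} {f' : w ⟶ x₃} {p : y ⟶ w} {v : D} {f₀ : y ⟶ v}
    {p' : v ⟶ x₃} (e : m ≫ c = c' ≫ m') (e' : t ≫ c' = k ≫ g ≫ f) (e₁ : q ≫ f' = f ≫ m')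
    (e₂ : p ≫ f' = f₀ ≫ p') (e₃ : p = g ≫ q) : (t ≫ m) ≫ c = k ≫ f₀ ≫ p' := by
  rw [Category.assoc, e, reassoc_of% e', ← e₂, e₃, Category.assoc, e₁]

end

/-- Naturality of the associativity constraint of the action. -/
theorem Lmor_tensor {X X' Y Y' : HObj} (f : HMor ℂ X X') (g : HMor ℂ Y Y') {V W : FS ⥤ Vect}
    (h : V ⟶ W) : ((Lmor (f.tensor g)).app V ≫ (Lam₁ (Cobj (X'.tensor Y'))).map h) ≫
      lamComp (Cobj Y') (Cobj X') W =
    lamComp (Cobj Y) (Cobj X) V ≫ (Lmor f).app ((Lam₁ (Cobj Y)).obj V) ≫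
      (Lam₁ (Cobj X')).map ((Lmor g).app V ≫ (Lam₁ (Cobj Y')).map h) :=
  tensor_aux (lamComp_natural h) (lamTensor_lamComp (Lmor g) (Lmor f) V)
    ((Lmor f).naturality ((Lam₁ (Cobj Y')).map h))
    ((Lmor f).naturality ((Lmor g).app V ≫ (Lam₁ (Cobj Y')).map h))
    ((Lam₁ (Cobj X)).map_comp _ _)

/-- The action of `H'` on `Λ(FS)`. -/
@[reducible] noncomputable def lamAction : MonoidalLeftAction (H ℂ) (Lam FS) where
  actionObj X V := ⟨(Lam₁ (Cobj X)).obj V.obj, isLam_lam (isCover_Cobj X) V.property⟩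
  actionHomLeft f V := ObjectProperty.homMk ((Lhom f).app V.obj)
  actionHomRight X _ _ f := ObjectProperty.homMk ((Lam₁ (Cobj X)).map f.hom)
  actionAssocIso X Y V := ObjectProperty.isoMk _ (lamCompIso (Cobj Y) (Cobj X) V.obj)
  actionUnitIso V := ObjectProperty.isoMk _ (lamIdIso V.obj)
  actionHom_def _ _ := rfl
  actionHomRight_id X V := by ext1; exact (Lam₁ (Cobj X)).map_id V.obj
  id_actionHomLeft X V := rfl
  actionHom_comp := by
    rintro X X' X'' V V' V'' ⟨f⟩ ⟨f'⟩ g g'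
    ext1
    exact hcomp_aux ((Lmor f').naturality g.hom) ((Lam₁ (Cobj X'')).map_comp g.hom g'.hom)
  actionAssocIso_hom_naturality := by
    rintro X X' Y Y' V V' ⟨f⟩ ⟨g⟩ h
    ext1
    exact Lmor_tensor f g h.hom
  actionUnitIso_hom_naturality f := by ext1; exact (lamId_natural f.hom).symm
  whiskerLeft_actionHomLeft := by
    rintro X Y Y' ⟨f⟩ V
    ext1
    exact Lmor_wl X f V.obj
  whiskerRight_actionHomLeft := by
    rintro X X' Y ⟨f⟩ V
    ext1
    exact Lmor_wr Y f V.obj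
  associator_actionHom X Y Z V := by
    ext1
    have h := congrArg (fun t => t.app V.obj) (Lmor_natCast_eq (HRel.assoc_hom_inv X Y Z))
    exact (congrArg (_ ≫ ·) (Lam₂_assocSpan (Cobj Z) (Cobj Y) (Cobj X) V.obj).symm).trans
      ((Category.assoc _ _ _).symm.trans ((congrArg (· ≫ _) h).trans (Category.id_comp _)))
  leftUnitor_actionHom X V := by ext1; exact Lam₂_unitorSrc (Cobj X) V.obj
  rightUnitor_actionHom X V := by ext1; exact Lam₂_unitorTgt (Cobj X) V.obj

/-- The action of `H'` on `Λ(FS)` is the composite of `Λ` and the combinatorial representation. -/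
noncomputable def lamRealizes : @Realizes lamAction :=
  letI := lamAction
  { iso := fun X V => Iso.refl ((Lam₁ (Cobj X)).obj V.obj)
    iso_natural := fun X _ _ f =>
      (Category.comp_id ((Lam₁ (Cobj X)).map f.hom)).trans (Category.id_comp _).symm
    iso_hom := fun f Z hZ V => (Category.comp_id ((Lmor (natCast ℂ f)).app V.obj)).trans
      ((congrArg (fun t => t.app V.obj) (Lmor_natCast f Z hZ)).trans (Category.id_comp _).symm)
    iso_assoc := fun X Y V => (Category.id_comp (lamComp (Cobj Y) (Cobj X) V.obj)).trans
      ((congrArg (_ ≫ ·) ((congrArg (𝟙 _ ≫ ·) ((Lam₁ (Cobj X)).map_id _)).trans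
        (Category.comp_id _))).trans (Category.comp_id _)).symm
    iso_unit := fun V => Category.id_comp (lamId V.obj) }

theorem isLinearAction_lamAction : @IsLinearAction (Lam FS) _ _ _ lamAction :=
  letI := lamAction
  { act_add := fun X V W f g => by ext1; exact (Lam₁ (Cobj X)).map_add (f := f.hom) (g := g.hom)
    act_smul := fun X c V W f => by ext1; exact Functor.map_smul (Lam₁ (Cobj X)) c f.hom
    add_act := fun f g V => rfl
    smul_act := fun c f V => rfl }

/-! ### Evaluation on the standard finite sets is an equivalence -/

theorem FS.exists_hom_finFS (S : FS) : Nonempty (S ⟶ finFS (Nat.card S.carrier)) :=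
  (FS.nonempty_iso_iff.2 (Nat.card_fin _).symm).map fun e => e.hom

/-- Isomorphisms in `∐_n Rep(S_n)`, degree by degree. -/
def repSymIso {V W : RepSym} (e : ∀ n, V.obj n ≅ W.obj n) : V ≅ W :=
  ObjectProperty.isoMk _ ⟨fun n => (e n).hom, fun n => (e n).inv, funext fun n => (e n).hom_inv_id,
    funext fun n => (e n).inv_hom_id⟩

theorem repSym_ext {V W : RepSym} {f g : V ⟶ W} (h : ∀ n (v : V.obj n), degree f n v = degree g n v) :
    f = g := by
  ext1
  funext n
  apply Rep.hom_ext
  apply Representation.IntertwiningMap.ext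
  exact LinearMap.ext (h n)

theorem degree_ρ {V W : RepSym} (f : V ⟶ W) (n : ℕ) (g : Sym n) (v : V.obj n) :
    degree f n ((V.obj n).ρ g v) = (W.obj n).ρ g (degree f n v) :=
  Rep.hom_comm_apply (f.hom n) g v

theorem degree_comp {U V W : RepSym} (f : U ⟶ V) (g : V ⟶ W) (n : ℕ) (v : U.obj n) :
    degree (f ≫ g) n v = degree g n (degree f n v) := rfl

theorem degree_id (V : RepSym) (n : ℕ) (v : V.obj n) : degree (𝟙 V) n v = v := rfl

theorem vect_hom_ext_finFS {V W : FS ⥤ Vect} {f g : V ⟶ W}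
    (h : ∀ n (v : V.obj (finFS n)), (f.app (finFS n)).hom v = (g.app (finFS n)).hom v) : f = g := by
  ext S : 2
  obtain ⟨e⟩ := FS.exists_hom_finFS S
  have h' : f.app (finFS (Nat.card S.carrier)) = g.app (finFS (Nat.card S.carrier)) :=
    ModuleCat.hom_ext (LinearMap.ext (h _))
  rw [← cancel_mono (W.map e), ← f.naturality, ← g.naturality, h']

instance : evalSym.Faithful where
  map_injective {V W f g} h := by
    ext1
    exact vect_hom_ext_finFS fun n v => congrArg (fun t => degree t n v) h

section

variable {V W : Lam FS} (f : evalSym.obj V ⟶ evalSym.obj W)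

/-- A morphism of representations of the symmetric group as a linear map between values at the
standard set. -/
noncomputable def degVect (n : ℕ) : V.obj.obj (finFS n) ⟶ W.obj.obj (finFS n) :=
  ModuleCat.ofHom (degree f n)

theorem degVect_nat {n : ℕ} (g : finFS n ⟶ finFS n) :
    V.obj.map g ≫ degVect f n = degVect f n ≫ W.obj.map g := by
  ext v
  exact degree_ρ f n g v

/-- The extension of a morphism between representations to a finite set that is identified with a
standard one. -/
noncomputable def extendAt {S : FS} {n : ℕ} (e : S ⟶ finFS n) : V.obj.obj S ⟶ W.obj.obj S :=
  V.obj.map e ≫ degVect f n ≫ W.obj.map (inv e)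

theorem extendAt_nat {S T : FS} {n m : ℕ} (e : S ⟶ finFS n) (e' : T ⟶ finFS m) (h : S ⟶ T) :
    V.obj.map h ≫ extendAt f e' = extendAt f e ≫ W.obj.map h := by
  obtain rfl : n = m := Fin.equiv_iff_eq.1
    ⟨(show finFS n ⟶ finFS m from inv e ≫ h ≫ e')⟩
  have h1 : V.obj.map h ≫ V.obj.map e' = V.obj.map e ≫ V.obj.map (inv e ≫ h ≫ e') := by
    simp [← Functor.map_comp]
  have h2 : W.obj.map (inv e) ≫ W.obj.map h = W.obj.map (inv e ≫ h ≫ e') ≫ W.obj.map (inv e') := by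
    simp [← Functor.map_comp]
  simp only [extendAt, Category.assoc, h2]
  rw [reassoc_of% h1, reassoc_of% (degVect_nat f (inv e ≫ h ≫ e'))]

theorem extendAt_id {n m : ℕ} (e : finFS n ⟶ finFS m) : extendAt f e = degVect f n := by
  have h := extendAt_nat f (𝟙 (finFS n)) e (𝟙 _)
  rw [V.obj.map_id, W.obj.map_id, Category.id_comp, Category.comp_id] at h
  rw [h]
  simp [extendAt]

end

instance : evalSym.Full where
  map_surjective {V W} f := by
    let e (S : FS) : S ⟶ finFS (Nat.card S.carrier) := (FS.exists_hom_finFS S).some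
    refine ⟨ObjectProperty.homMk ⟨fun S => extendAt f (e S), fun S T h => extendAt_nat f _ _ h⟩, ?_⟩
    exact repSym_ext fun n v => congrArg (fun t => t.hom v) (extendAt_id f (e (finFS n)))

section

variable (R : RepSym)

/-- The representation of the groupoid of finite sets that extends a family of representations of
symmetric groups: equivariant functions on the identifications of `S` with standard sets. -/
def extendRep (S : FS) : Submodule ℂ (∀ n, (S.carrier ≃ Fin n) → R.obj n) where
  carrier := {φ | ∀ n (e : S.carrier ≃ Fin n) (g : Sym n), φ n (e.trans g) = (R.obj n).ρ g (φ n e)}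
  add_mem' {φ ψ} hφ hψ n e g := by
    change φ n _ + ψ n _ = (R.obj n).ρ g (φ n e + ψ n e)
    rw [hφ, hψ, map_add]
  zero_mem' n e g := (map_zero _).symm
  smul_mem' c φ hφ n e g := by
    change c • φ n _ = (R.obj n).ρ g (c • φ n e)
    rw [hφ, map_smul]

/-- Functoriality of `extendRep`. -/
def extendFunctor : FS ⥤ Vect where
  obj S := ModuleCat.of ℂ (extendRep R S)
  map h := ModuleCat.ofHom
    { toFun := fun φ => ⟨fun n e => φ.1 n (Equiv.trans h e), fun n e g => φ.2 n (Equiv.trans h e) g⟩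
      map_add' := fun _ _ => rfl
      map_smul' := fun _ _ => rfl }
  map_id _ := rfl
  map_comp _ _ := rfl

theorem extendRep_ext {S : FS} {n : ℕ} (e : S.carrier ≃ Fin n) {φ ψ : extendRep R S}
    (h : φ.1 n e = ψ.1 n e) : φ = ψ := by
  apply Subtype.ext
  funext m e'
  obtain rfl : n = m := Fin.equiv_iff_eq.1 ⟨e.symm.trans e'⟩
  have h1 : e' = e.trans (e.symm.trans e') := by
    apply Equiv.ext; intro x; simp
  rw [h1, φ.2, ψ.2, h]

/-- A vector extends to an equivariant function on all identifications: the symmetric group acts freely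
and transitively on the self-identifications of the standard set. -/
theorem exists_extendRep (n : ℕ) (v : R.obj n) : ∃ φ : extendRep R (finFS n),
    φ.1 n (Equiv.refl _) = v := by
  have key : ∀ m, (Fin n ≃ Fin m) → n = m := fun m e => Fin.equiv_iff_eq.1 ⟨e⟩
  let a : ∀ m, n = m → (Fin n ≃ Fin m) → R.obj m := fun m h =>
    Eq.rec (motive := fun m _ => (Fin n ≃ Fin m) → R.obj m) (fun e => (R.obj n).ρ e v) h
  refine ⟨⟨fun m e => a m (key m e) e, fun m e g => ?_⟩, ?_⟩
  · change Fin n ≃ Fin m at e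
    obtain rfl := key m e
    change (R.obj n).ρ (e.trans g) v = (R.obj n).ρ g ((R.obj n).ρ e v)
    exact congrArg (fun t => t v) ((R.obj n).ρ.map_mul g e)
  · change (R.obj n).ρ 1 v = v
    rw [map_one]
    rfl

/-- Evaluation of `extendRep` at a standard set. -/
noncomputable def extendEquiv (n : ℕ) : extendRep R (finFS n) ≃ₗ[ℂ] R.obj n :=
  LinearEquiv.ofBijective
    ({ toFun := fun φ => φ.1 n (Equiv.refl _)
       map_add' := fun _ _ => rfl
       map_smul' := fun _ _ => rfl } : extendRep R (finFS n) →ₗ[ℂ] R.obj n)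
    ⟨fun _ _ h => extendRep_ext R (Equiv.refl _) h, exists_extendRep R n⟩

theorem isLam_extendFunctor : isLam FS (extendFunctor R) := by
  classical
  obtain ⟨h1, N, h2⟩ := R.property
  have key {S : FS} {n : ℕ} (e : S ⟶ finFS n) : extendRep R S ≃ₗ[ℂ] R.obj n :=
    ((extendFunctor R).mapIso ((Groupoid.isoEquivHom _ _).symm e)).toLinearEquiv.trans
      (extendEquiv R n)
  refine ⟨fun S => ?_, (Finset.range N).image finFS, fun S hS => ?_⟩
  · obtain ⟨e⟩ := FS.exists_hom_finFS S
    have := h1 (Nat.card S.carrier)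
    exact Module.Finite.equiv (key e).symm
  · obtain ⟨e⟩ := FS.exists_hom_finFS S
    refine ⟨_, Finset.mem_image_of_mem _ (Finset.mem_range.2 ?_), ⟨(Groupoid.isoEquivHom _ _).symm e⟩⟩
    by_contra hN
    have := h2 _ (not_lt.1 hN)
    exact not_subsingleton_iff_nontrivial.2 hS (key e).toEquiv.subsingleton

end

instance : evalSym.EssSurj where
  mem_essImage R := by
    refine ⟨⟨extendFunctor R, isLam_extendFunctor R⟩, ⟨repSymIso fun n => Rep.mkIso
      (Representation.Equiv.mk (extendEquiv R n) fun g => ?_)⟩⟩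
    ext φ
    exact φ.2 n (Equiv.refl _) g

instance isEquivalence_evalSym : evalSym.IsEquivalence where

/-! ### Transport of actions along equivalences -/

section

variable {M D D' : Type*} [Category* M] [MonoidalCategory M] [Category* D] [Category* D']

open MonoidalLeftAction

/-- Transport of an action along an equivalence `E`: the object `X` acts by `E(X ⊙ E⁻¹ -)`. -/
@[reducible] def transportAction [MonoidalLeftAction M D] (E : D ≌ D') : MonoidalLeftAction M D' where
  actionObj X V := E.functor.obj (X ⊙ₗ E.inverse.obj V)
  actionHomLeft f V := E.functor.map (f ⊵ₗ E.inverse.obj V)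
  actionHomRight X _ _ f := E.functor.map (X ⊴ₗ E.inverse.map f)
  actionAssocIso X Y V := E.functor.mapIso
    (αₗ X Y (E.inverse.obj V) ≪≫ ⟨X ⊴ₗ E.unit.app _, X ⊴ₗ E.unitInv.app _,
      by rw [← actionHomRight_comp]; simp, by rw [← actionHomRight_comp]; simp⟩)
  actionUnitIso V := E.functor.mapIso (λₗ (E.inverse.obj V)) ≪≫ E.counitIso.app V
  actionHom_def _ _ := rfl
  actionHomRight_id X V := by simp
  id_actionHomLeft X V := by simp
  actionHom_comp f f' g g' := by
    simp only [← Functor.map_comp, ← actionHom_def, ← MonoidalLeftAction.actionHom_comp]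
  actionAssocIso_hom_naturality {X X' Y Y' V V'} f g h := by
    have e := actionAssocIso_hom_naturality f g (E.inverse.map h)
    have n := E.unit.naturality ((g ⊵ₗ E.inverse.obj V) ≫ Y' ⊴ₗ E.inverse.map h)
    simp only [Functor.id_obj, Functor.comp_obj, Functor.id_map, Functor.comp_map] at n
    simp only [Functor.mapIso_hom, Iso.trans_hom, ← Functor.map_comp, Category.assoc]
    congr 1
    simp only [actionHom_def, Category.assoc] at e
    rw [reassoc_of% e, ← actionHomRight_comp, n, actionHomRight_comp,
      ← action_exchange_assoc]
  actionUnitIso_hom_naturality f := by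
    have e := actionUnitIso_hom_naturality (C := M) (E.inverse.map f)
    have n := E.counit.naturality f
    simp only [Functor.id_obj, Functor.comp_obj, Functor.id_map, Functor.comp_map] at n
    simp only [Functor.mapIso_hom, Iso.trans_hom, Category.assoc, ← Functor.map_comp_assoc]
    rw [← e, Functor.map_comp_assoc]
    exact congrArg (_ ≫ ·) n.symm
  whiskerLeft_actionHomLeft X Y Y' f V := by
    have n := E.unit.naturality (f ⊵ₗ E.inverse.obj V)
    simp only [Functor.id_obj, Functor.comp_obj, Functor.id_map, Functor.comp_map] at n
    simp only [Functor.mapIso_hom, Functor.mapIso_inv, Iso.trans_hom, Iso.trans_inv,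
      ← Functor.map_comp, Category.assoc, MonoidalLeftAction.whiskerLeft_actionHomLeft]
    congr 2
    rw [← actionHomRight_comp_assoc, ← actionHomRight_comp_assoc, ← n]
    simp
  whiskerRight_actionHomLeft {X X'} Y f V := by
    simp only [Functor.mapIso_hom, Functor.mapIso_inv, Iso.trans_hom, Iso.trans_inv,
      ← Functor.map_comp, Category.assoc, MonoidalLeftAction.whiskerRight_actionHomLeft]
    congr 2
    rw [action_exchange_assoc, ← actionHomRight_comp_assoc]
    simp
  associator_actionHom X Y Z V := by
    have e := associator_actionHom X Y Z (E.inverse.obj V)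
    have n := E.unit.naturality ((αₗ Y Z (E.inverse.obj V)).hom ≫
      Y ⊴ₗ E.unit.app (Z ⊙ₗ E.inverse.obj V))
    have h := actionAssocIso_hom_naturality (𝟙 X) (𝟙 Y) (E.unit.app (Z ⊙ₗ E.inverse.obj V))
    simp only [Functor.id_obj, Functor.comp_obj, Functor.id_map, Functor.comp_map] at n
    simp only [Functor.mapIso_hom, Iso.trans_hom, ← Functor.map_comp, Category.assoc]
    congr 1
    rw [← actionHomRight_comp, ← n, actionHomRight_comp, actionHomRight_comp, Category.assoc, reassoc_of% e]
    simp only [actionHom_def, id_actionHomLeft, Category.id_comp, id_tensorHom_id] at h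
    exact congrArg (_ ≫ ·) (((Category.assoc _ _ _).symm.trans
      (congrArg (· ≫ _) h.symm)).trans (Category.assoc _ _ _))
  leftUnitor_actionHom X V := by
    have e := leftUnitor_actionHom X (E.inverse.obj V)
    have n := actionUnitIso_hom_naturality (C := M) (E.unit.app (X ⊙ₗ E.inverse.obj V))
    have t := E.functor_unit_comp (X ⊙ₗ E.inverse.obj V)
    simp only [Functor.mapIso_hom, Iso.trans_hom, Functor.map_comp, Category.assoc, e,
      Iso.app_hom]
    congr 1
    rw [← Functor.map_comp_assoc]
    erw [← n]
    rw [Functor.map_comp_assoc]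
    exact ((congrArg (_ ≫ ·) t).trans (Category.comp_id _)).symm
  rightUnitor_actionHom X V := by
    have e := rightUnitor_actionHom X (E.inverse.obj V)
    have n := E.unit.naturality (λₗ[M] (E.inverse.obj V)).hom
    have t := E.unit_inverse_comp V
    simp only [Functor.id_obj, Functor.comp_obj, Functor.id_map, Functor.comp_map] at n
    simp only [Functor.mapIso_hom, Iso.trans_hom, ← Functor.map_comp, Category.assoc, e,
      Iso.app_hom]
    congr 2
    rw [← actionHomRight_comp]
    congr 1
    rw [Functor.map_comp, ← reassoc_of% n]
    exact ((congrArg (_ ≫ ·) t).trans (Category.comp_id _)).symm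

/-- An equivalence is linear for the action that it transports. -/
@[reducible] def transportLeftLinear [MonoidalLeftAction M D] (E : D ≌ D') :
    letI := transportAction (M := M) E
    E.functor.LeftLinear M :=
  letI := transportAction (M := M) E
  { μₗ X V := E.functor.map (X ⊴ₗ E.unitInv.app V)
    δₗ X V := E.functor.map (X ⊴ₗ E.unit.app V)
    μₗ_naturality_left f V := by
      change E.functor.map (f ⊵ₗ _) ≫ E.functor.map _ = E.functor.map _ ≫ E.functor.map _
      simp only [← Functor.map_comp]
      exact congrArg _ (action_exchange f _).symm
    μₗ_naturality_right X V V' f := by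
      have n := E.unitInv.naturality f
      simp only [Functor.id_obj, Functor.comp_obj, Functor.id_map, Functor.comp_map] at n
      change E.functor.map (X ⊴ₗ E.inverse.map (E.functor.map f)) ≫ E.functor.map _ =
        E.functor.map _ ≫ E.functor.map _
      simp only [← Functor.map_comp, ← actionHomRight_comp, n]
    μₗ_associativity X Y V := by
      have h := actionAssocIso_hom_naturality (𝟙 X) (𝟙 Y) (E.unitInv.app V)
      simp only [actionHom_def, id_actionHomLeft, Category.id_comp, id_tensorHom_id,
        Functor.id_obj, Functor.comp_obj] at h
      change E.functor.map _ ≫ E.functor.map _ = E.functor.map (_ ≫ X ⊴ₗ E.unit.app _) ≫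
        E.functor.map (X ⊴ₗ E.inverse.map (E.functor.map (Y ⊴ₗ E.unitInv.app V))) ≫
          E.functor.map (X ⊴ₗ E.unitInv.app _)
      simp only [← Functor.map_comp, Category.assoc, h, ← actionHomRight_comp]
      congr 3
      simp
    μₗ_unitality V := by
      have n := actionUnitIso_hom_naturality (C := M) (E.unitInv.app V)
      simp only [Functor.id_obj, Functor.comp_obj] at n
      change E.functor.map _ ≫ E.counit.app _ = E.functor.map _ ≫ E.functor.map _
      simp only [← Functor.map_comp, ← n]
      rw [Functor.map_comp]
      exact congrArg (_ ≫ ·) (E.counit_app_functor V)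
    δₗ_naturality_left f V := by
      change E.functor.map _ ≫ E.functor.map _ = E.functor.map _ ≫ E.functor.map (f ⊵ₗ _)
      simp only [← Functor.map_comp]
      exact congrArg _ (action_exchange f _).symm
    δₗ_naturality_right X V V' f := by
      have n := E.unit.naturality f
      simp only [Functor.id_obj, Functor.comp_obj, Functor.id_map, Functor.comp_map] at n
      change E.functor.map _ ≫ E.functor.map _ =
        E.functor.map _ ≫ E.functor.map (X ⊴ₗ E.inverse.map (E.functor.map f))
      simp only [← Functor.map_comp, ← actionHomRight_comp, n]
    δₗ_associativity X Y V := by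
      have n := E.unit.naturality (Y ⊴ₗ E.unit.app V)
      have h := actionAssocIso_hom_naturality (𝟙 X) (𝟙 Y) (E.unit.app V)
      simp only [actionHom_def, id_actionHomLeft, Category.id_comp, id_tensorHom_id,
        Functor.id_obj, Functor.comp_obj, Functor.id_map, Functor.comp_map] at h n
      change E.functor.map _ ≫ E.functor.map (_ ≫ X ⊴ₗ E.unit.app _) =
        E.functor.map _ ≫ E.functor.map (X ⊴ₗ E.unit.app _) ≫
          E.functor.map (X ⊴ₗ E.inverse.map (E.functor.map (Y ⊴ₗ E.unit.app V)))
      simp only [← Functor.map_comp]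
      refine congrArg _ (((Category.assoc _ _ _).symm.trans (congrArg (· ≫ _) h)).trans
        ((Category.assoc _ _ _).trans (congrArg (_ ≫ ·) ?_)))
      exact (actionHomRight_comp _ _ _).symm.trans
        ((congrArg (X ⊴ₗ ·) n).trans (actionHomRight_comp _ _ _))
    δₗ_unitality_inv V := by
      have n := actionUnitIso_inv_naturality (C := M) (E.unit.app V)
      simp only [Functor.id_obj, Functor.comp_obj] at n
      change E.counitInv.app _ ≫ E.functor.map _ = E.functor.map _ ≫ E.functor.map _
      rw [← Functor.map_comp]
      refine Eq.trans ?_ (congrArg E.functor.map n.symm)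
      rw [Functor.map_comp]
      exact congrArg (· ≫ _) (E.counitInv_app_functor V)
    μₗ_comp_δₗ X V := by
      refine (E.functor.map_comp _ _).symm.trans ?_
      rw [← actionHomRight_comp]
      simp
      rfl
    δₗ_comp_μₗ X V := by
      refine (E.functor.map_comp _ _).symm.trans ?_
      rw [← actionHomRight_comp]
      simp }

end

/-! ### Standard finite sets and the inclusions of symmetric groups -/

/-- Identification of `n` elements plus one with `n + 1` elements; the new element becomes the last
one. -/
def stdEquiv (n : ℕ) : Option (Fin n) ≃ Fin (n + 1) := finSuccEquivLast.symm

/-- Identification of the standard `n`-element set plus one element with the standard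
`(n+1)`-element set; the new element becomes the last one. -/
def std (n : ℕ) : plusOne.obj (finFS n) ⟶ finFS (n + 1) := stdEquiv n

/-- A permutation as a morphism of finite sets. -/
abbrev perm {n : ℕ} (g : Sym n) : finFS n ⟶ finFS n := g

theorem FS.inv_eq_symm {S T : FS} (f : S ⟶ T) : inv f = Equiv.symm f := (Groupoid.inv_eq_inv f).symm

theorem std_none (n : ℕ) : stdEquiv n none = Fin.last n :=
  finSuccEquivLast_symm_none

theorem std_some {n : ℕ} (i : Fin n) :
    stdEquiv n (some i) = i.castSucc :=
  finSuccEquivLast_symm_some i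

theorem incl_last {n : ℕ} (g : Sym n) : incl n g (Fin.last n) = Fin.last n :=
  Equiv.Perm.viaEmbedding_apply_of_notMem g Fin.castSuccEmb (Fin.last n) (by
    rintro ⟨i, hi⟩; exact (Fin.castSucc_lt_last i).ne hi)

theorem incl_castSucc {n : ℕ} (g : Sym n) (i : Fin n) : incl n g i.castSucc = (g i).castSucc :=
  Equiv.Perm.viaEmbedding_apply g Fin.castSuccEmb i

/-- Adding a fixed point to a permutation is the inclusion `S_n → S_{n+1}`. -/
theorem plusOne_map_std {n : ℕ} (g : Sym n) :
    plusOne.map (perm g) ≫ std n = std n ≫ perm (incl n g) := by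
  apply Equiv.ext
  rintro (_ | i)
  · exact (std_none n).trans ((incl_last g).symm.trans (congrArg (incl n g) (std_none n).symm))
  · exact (std_some (g i)).trans
      ((incl_castSucc g i).symm.trans (congrArg (incl n g) (std_some i).symm))

/-- The exchange of the two added points is the last adjacent transposition of the standard set. -/
theorem swapTwo_std (n : ℕ) : swapTwo.app (finFS n) ≫ plusOne.map (std n) ≫ std (n + 1) =
    plusOne.map (std n) ≫ std (n + 1) ≫ perm (lastSwap n) := by
  let s := stdEquiv (n + 1)
  have h0 : s none = Fin.last (n + 1) := std_none _
  have h1 : s (some (stdEquiv n none)) = (Fin.last n).castSucc :=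
    (std_some _).trans (congrArg Fin.castSucc (std_none n))
  have h2 (i : Fin n) : s (some (stdEquiv n (some i))) = i.castSucc.castSucc :=
    (std_some _).trans (congrArg Fin.castSucc (std_some i))
  apply Equiv.ext
  rintro (_ | _ | i)
  · exact h1.trans ((Equiv.swap_apply_right _ _).symm.trans (congrArg (lastSwap n) h0.symm))
  · exact h0.trans ((Equiv.swap_apply_left _ _).symm.trans (congrArg (lastSwap n) h1.symm))
  · refine (h2 i).trans ((Equiv.swap_apply_of_ne_of_ne ?_ ?_).symm.trans
      (congrArg (lastSwap n) (h2 i).symm))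
    · exact fun h => (Fin.castSucc_lt_last i).ne (Fin.castSucc_injective _ h)
    · exact (Fin.castSucc_lt_last _).ne

/-! ### Induced representations -/

/-- The relation `g h ⊗ v = g ⊗ h v` in the induced representation. -/
theorem indElt_mul_incl (V : RepSym) (n : ℕ) (g : Sym (n + 1)) (h : Sym n) (v : V.obj n) :
    indElt V n (g * incl n h) v = indElt V n g ((V.obj n).ρ h v) := by
  unfold indElt
  rw [mul_inv_rev, ← map_inv]
  have e := Representation.Coinvariants.mk_inv_tmul
    ((Representation.leftRegular ℂ (Sym (n + 1))).comp (incl n)) (V.obj n).ρ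
    (.single g⁻¹ 1) v h
  simp only [MonoidHom.comp_apply] at e
  rw [Representation.ofMulAction_single] at e
  exact e

theorem ρ_indElt (V : RepSym) (n : ℕ) (g h : Sym (n + 1)) (v : V.obj n) :
    ((indSym.obj V).obj (n + 1)).ρ g (indElt V n h v) = indElt V n (g * h) v := by
  refine (Representation.ind_mk (incl n) (V.obj n).ρ g h⁻¹ v).trans ?_
  rw [indElt, mul_inv_rev]

theorem degree_indSym_map {V W : RepSym} (f : V ⟶ W) (n : ℕ) (g : Sym (n + 1)) (v : V.obj n) :
    degree (indSym.map f) (n + 1) (indElt V n g v) = indElt W n g (degree f n v) := rfl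

/-- The elements `g ⊗ v` span the induced representations. The representation in degree zero is zero. -/
theorem indSym_ext {V U : RepSym} {f g : indSym.obj V ⟶ U} (h : ∀ n x v,
    degree f (n + 1) (indElt V n x v) = degree g (n + 1) (indElt V n x v)) : f = g := by
  apply repSym_ext
  rintro (_ | n)
  · intro v
    obtain rfl : v = 0 := Subsingleton.elim (α := PUnit) _ _
    rw [map_zero, map_zero]
  · refine fun v => LinearMap.congr_fun ?_ v
    apply Representation.IndV.hom_ext
    intro x
    ext v
    have := h n x⁻¹ v
    simp only [indElt, inv_inv] at this
    exact this

theorem perm_comp {n : ℕ} (g h : Sym n) : perm g ≫ perm h = perm (h * g) := rfl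

/-- The permutation of the standard set that corresponds to an identification of the standard set
plus one. -/
noncomputable def stdPerm {n : ℕ} (k : plusOne.obj (finFS n) ⟶ finFS (n + 1)) : Sym (n + 1) :=
  inv (std n) ≫ k

theorem std_stdPerm {n : ℕ} (k : plusOne.obj (finFS n) ⟶ finFS (n + 1)) :
    std n ≫ perm (stdPerm k) = k := by
  change std n ≫ inv (std n) ≫ k = k
  simp

theorem stdPerm_std {n : ℕ} (g : Sym (n + 1)) : stdPerm (std n ≫ perm g) = g :=
  show inv (std n) ≫ std n ≫ perm g = perm g by simp

theorem stdPerm_map {n : ℕ} (h : Sym n) (k : plusOne.obj (finFS n) ⟶ finFS (n + 1)) :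
    stdPerm (plusOne.map (perm h) ≫ k) = stdPerm k * incl n h := by
  have e : inv (std n) ≫ plusOne.map (perm h) ≫ k = perm (incl n h) ≫ inv (std n) ≫ k := by
    rw [IsIso.inv_comp_eq, ← reassoc_of% (plusOne_map_std h)]
    simp
  exact e

/-! ### Creation is induction, annihilation is restriction -/

section

variable (W W' : Lam FS)

/-- The value of `Λ` of the creation span at `W`. -/
noncomputable abbrev plusLam : Lam FS :=
  ⟨(Lam₁ creat).obj W.obj, isLam_lam (isCover_Cobj .plus) W.property⟩

/-- The value of `Λ` of the annihilation span at `W`. -/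
noncomputable abbrev minusLam : Lam FS :=
  ⟨(Lam₁ annih).obj W.obj, isLam_lam (isCover_Cobj .minus) W.property⟩

variable {W W'}

/-- Functoriality of `plusLam`. -/
noncomputable abbrev plusLamMap (f : W ⟶ W') : plusLam W ⟶ plusLam W' :=
  ObjectProperty.homMk (X := plusLam W) (Y := plusLam W') ((Lam₁ creat).map f.hom)

/-- Functoriality of `minusLam`. -/
noncomputable abbrev minusLamMap (f : W ⟶ W') : minusLam W ⟶ minusLam W' :=
  ObjectProperty.homMk (X := minusLam W) (Y := minusLam W') ((Lam₁ annih).map f.hom)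

end

theorem lamTo_lamDescAt {A B : Type 1} [Groupoid.{0} A] [Groupoid.{0} B] (P : GSpan A B)
    (V : A ⥤ Vect) {a : A} {b : B} {M : Vect}
    (t : ∀ (p : P.apex), (P.tgt.obj p ⟶ b) → (V.obj (P.src.obj p) ⟶ M))
    (ht : ∀ {p q : P.apex} (f : p ⟶ q) (k : P.tgt.obj q ⟶ b),
      V.map (P.src.map f) ≫ t q k = t p (P.tgt.map f ≫ k)) {p : P.apex} (α : a ⟶ P.src.obj p)
    (β : b ⟶ P.tgt.obj p) : lamTo P V p α β ≫ lamDescAt t ht = V.map α ≫ t p (inv β) := by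
  rw [lamTo, Category.assoc, Category.assoc, lamIn_lamDescAt]

section

variable (V : FS ⥤ Vect) {a b c S T : FS}

/-- The map into `Λ(A†)(V)` given by the history "add a point to `S`". -/
noncomputable def creatTo (α : a ⟶ S) (β : b ⟶ plusOne.obj S) :
    V.obj a ⟶ ((Lam₁ creat).obj V).obj b := lamTo creat V (p := (S : FS)) α β

/-- The map into `Λ(A)(V)` given by the history "remove a point from `S + 1`". -/
noncomputable def annihTo (α : a ⟶ plusOne.obj S) (β : b ⟶ S) :
    V.obj a ⟶ ((Lam₁ annih).obj V).obj b := lamTo annih V (p := (S : FS)) α β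

theorem map_creatTo (γ : c ⟶ a) (α : a ⟶ S) (β : b ⟶ plusOne.obj S) :
    V.map γ ≫ creatTo V α β = creatTo V (γ ≫ α) β := lamTo_pre γ _ _

theorem creatTo_map (γ : b ⟶ c) (α : a ⟶ S) (β : b ⟶ plusOne.obj S) :
    creatTo V α β ≫ ((Lam₁ creat).obj V).map γ = creatTo V α (inv γ ≫ β) := lamTo_post γ _ _

theorem creatTo_transport (τ : S ⟶ T) (α : a ⟶ S) (β : b ⟶ plusOne.obj S) :
    creatTo V α β = creatTo V (α ≫ τ) (β ≫ plusOne.map τ) :=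
  lamTo_transport (P := creat) (p := (S : FS)) (q := (T : FS)) τ α β

theorem creatTo_nat {V V' : FS ⥤ Vect} (f : V ⟶ V') (α : a ⟶ S) (β : b ⟶ plusOne.obj S) :
    creatTo V α β ≫ ((Lam₁ creat).map f).app b = f.app a ≫ creatTo V' α β :=
  lamTo_map (P := creat) (p := (S : FS)) f α β

theorem annihTo_nat {V V' : FS ⥤ Vect} (f : V ⟶ V') (α : a ⟶ plusOne.obj S) (β : b ⟶ S) :
    annihTo V α β ≫ ((Lam₁ annih).map f).app b = f.app a ≫ annihTo V' α β :=
  lamTo_map (P := annih) (p := (S : FS)) f α β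

theorem map_annihTo (γ : c ⟶ a) (α : a ⟶ plusOne.obj S) (β : b ⟶ S) :
    V.map γ ≫ annihTo V α β = annihTo V (γ ≫ α) β := lamTo_pre γ _ _

theorem annihTo_map (γ : b ⟶ c) (α : a ⟶ plusOne.obj S) (β : b ⟶ S) :
    annihTo V α β ≫ ((Lam₁ annih).obj V).map γ = annihTo V α (inv γ ≫ β) := lamTo_post γ _ _

theorem annihTo_transport (τ : S ⟶ T) (α : a ⟶ plusOne.obj S) (β : b ⟶ S) :
    annihTo V α β = annihTo V (α ≫ plusOne.map τ) (β ≫ τ) :=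
  lamTo_transport (P := annih) (p := (S : FS)) (q := (T : FS)) τ α β

end

section

variable (W W' : Lam FS)

/-- The element of `Λ(A†)(W)` obtained from an element of `W` by creating a point, which is
identified with a point of the standard set by a permutation. -/
noncomputable def createAt (n : ℕ) (g : Sym (n + 1)) :
    W.obj.obj (finFS n) ⟶ (plusLam W).obj.obj (finFS (n + 1)) :=
  creatTo W.obj (𝟙 (finFS n)) (inv (std n ≫ perm g))

/-- The element of `Λ(A)(W)` obtained from an element of `W` by annihilating the last point. -/
noncomputable def annihilateAt (n : ℕ) : W.obj.obj (finFS (n + 1)) ⟶ (minusLam W).obj.obj (finFS n) :=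
  annihTo W.obj (inv (std n)) (𝟙 (finFS n))

theorem createAt_map (n : ℕ) (g h : Sym (n + 1)) :
    createAt W n g ≫ (plusLam W).obj.map (perm h) = createAt W n (h * g) := by
  refine (creatTo_map _ _ _ _).trans (congrArg (creatTo _ _) ?_)
  simp only [← perm_comp, IsIso.inv_comp, Category.assoc]

theorem map_createAt (n : ℕ) (g : Sym n) (h : Sym (n + 1)) :
    W.obj.map (perm g) ≫ createAt W n h = createAt W n (h * incl n g) := by
  refine (map_creatTo _ _ _ _).trans (Eq.symm ?_)
  refine (creatTo_transport _ (perm g) _ _).trans ?_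
  have e : inv (std n ≫ perm (h * incl n g)) ≫ plusOne.map (perm g) = inv (std n ≫ perm h) := by
    rw [IsIso.inv_comp_eq, IsIso.eq_comp_inv]
    exact ((Category.assoc _ _ _).symm.trans (congrArg (· ≫ perm h) (plusOne_map_std g))).trans
      (Category.assoc _ _ _)
  rw [e, Category.comp_id, Category.id_comp]

/-- The comparison map from the induced representation, in positive degree. -/
noncomputable def indToPlus (n : ℕ) : (indSym.obj (evalSym.obj W)).obj (n + 1) ⟶
    (evalSym.obj (plusLam W)).obj (n + 1) :=
  (Rep.indResHomEquiv (incl n) ((evalSym.obj W).obj n) ((evalSym.obj (plusLam W)).obj (n + 1))).symm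
    (Rep.ofHom ⟨(createAt W n 1).hom, fun g => by
      have h := (map_createAt W n g 1).trans ((congrArg (createAt W n)
        (by simp)).trans (createAt_map W n 1 (incl n g)).symm)
      exact congrArg ModuleCat.Hom.hom h⟩)

theorem indToPlus_indElt (n : ℕ) (g : Sym (n + 1)) (w : W.obj.obj (finFS n)) :
    (indToPlus W n).hom (indElt (evalSym.obj W) n g w) = (createAt W n g).hom w := by
  have h := Rep.hom_comm_apply (indToPlus W n) g (indElt (evalSym.obj W) n 1 w)
  have h1 : (indToPlus W n).hom (indElt (evalSym.obj W) n 1 w) = (createAt W n 1).hom w := by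
    have h0 : indElt (evalSym.obj W) n 1 w =
        Representation.IndV.mk (incl n) ((evalSym.obj W).obj n).ρ 1 w :=
      congrArg (fun x => Representation.IndV.mk (incl n) ((evalSym.obj W).obj n).ρ x w) inv_one
    rw [h0]
    exact congrArg (fun f => f.hom w) ((Rep.indResHomEquiv (incl n) ((evalSym.obj W).obj n)
      ((evalSym.obj (plusLam W)).obj (n + 1))).apply_symm_apply _)
  have e1 := ρ_indElt (evalSym.obj W) n g 1 w
  have e2 := congrArg (fun t => t.hom w) (createAt_map W n 1 g)
  rw [mul_one] at e1 e2
  exact (congrArg (indToPlus W n).hom e1.symm).trans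
    (h.trans ((congrArg (((evalSym.obj (plusLam W)).obj (n + 1)).ρ g) h1).trans e2))

/-- The map `w ↦ g ⊗ w` into the induced representation. -/
noncomputable def indHom (n : ℕ) (g : Sym (n + 1)) : W.obj.obj (finFS n) ⟶
    ModuleCat.of ℂ ((indSym.obj (evalSym.obj W)).obj (n + 1)) :=
  ModuleCat.ofHom (Representation.IndV.mk (incl n) ((evalSym.obj W).obj n).ρ g⁻¹)

theorem map_indHom (n : ℕ) (g : Sym n) (h : Sym (n + 1)) :
    W.obj.map (perm g) ≫ indHom W n h = indHom W n (h * incl n g) := by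
  ext w
  exact (indElt_mul_incl (evalSym.obj W) n h g w).symm

theorem FS.exists_hom_of_plusOne {S : FS} {n : ℕ} (k : plusOne.obj S ⟶ finFS (n + 1)) :
    Nonempty (S ⟶ finFS n) := by
  obtain ⟨e⟩ := FS.exists_hom_finFS S
  have h : n + 1 = Nat.card S.carrier + 1 :=
    Fin.equiv_iff_eq.1 ⟨(inv k ≫ plusOne.map e ≫ std _ : finFS (n + 1) ⟶ finFS _)⟩
  obtain rfl : n = Nat.card S.carrier := by omega
  exact ⟨e⟩

/-- The component of `plusToInd` at a history does not depend on the identification of `S` with a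
standard set. -/
theorem map_indHom_congr {n : ℕ} {S : FS} (k : plusOne.obj S ⟶ finFS (n + 1)) (a b : S ⟶ finFS n) :
    W.obj.map a ≫ indHom W n (stdPerm (plusOne.map (inv a) ≫ k)) =
      W.obj.map b ≫ indHom W n (stdPerm (plusOne.map (inv b) ≫ k)) := by
  let g : Sym n := inv b ≫ a
  have h : W.obj.map a = W.obj.map b ≫ W.obj.map (perm g) := by
    rw [← Functor.map_comp]
    exact congrArg W.obj.map (show a = b ≫ inv b ≫ a by simp)
  rw [h, Category.assoc, map_indHom, ← stdPerm_map]
  have e : plusOne.map (perm g) ≫ plusOne.map (inv a) ≫ k = plusOne.map (inv b) ≫ k := by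
    rw [← Functor.map_comp_assoc]
    exact congrArg (fun t => plusOne.map t ≫ k) (show (inv b ≫ a) ≫ inv a = inv b by simp)
  rw [e]

/-- The component of `plusToInd` at a history. -/
noncomputable def indTerm {n : ℕ} {S : FS} (k : plusOne.obj S ⟶ finFS (n + 1)) : W.obj.obj S ⟶
    ModuleCat.of ℂ ((indSym.obj (evalSym.obj W)).obj (n + 1)) :=
  W.obj.map (FS.exists_hom_of_plusOne k).some ≫
    indHom W n (stdPerm (plusOne.map (inv (FS.exists_hom_of_plusOne k).some) ≫ k))

theorem map_indTerm {n : ℕ} {S T : FS} (f : S ⟶ T) (k : plusOne.obj T ⟶ finFS (n + 1)) :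
    W.obj.map f ≫ indTerm W k = indTerm W (plusOne.map f ≫ k) := by
  refine Eq.trans ?_ (map_indHom_congr W (plusOne.map f ≫ k)
    (f ≫ (FS.exists_hom_of_plusOne k).some) _)
  rw [Functor.map_comp, Category.assoc, IsIso.inv_comp, Functor.map_comp, Category.assoc]
  have e : plusOne.map (inv f) ≫ plusOne.map f ≫ k = k := by
    rw [← Functor.map_comp_assoc]; simp
  rw [e]
  rfl

/-- The comparison map to the induced representation, in positive degree. -/
noncomputable def plusToInd (n : ℕ) : (plusLam W).obj.obj (finFS (n + 1)) ⟶
    ModuleCat.of ℂ ((indSym.obj (evalSym.obj W)).obj (n + 1)) :=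
  lamDescAt (P := creat) (fun (S : FS) (k : plusOne.obj S ⟶ finFS (n + 1)) => indTerm W k)
    fun {S T : FS} (f : S ⟶ T) (k : plusOne.obj T ⟶ finFS (n + 1)) => map_indTerm W f k

theorem creatTo_plusToInd {n : ℕ} {S : FS} (β : finFS (n + 1) ⟶ plusOne.obj S) :
    creatTo W.obj (𝟙 S) β ≫ plusToInd W n = indTerm W (inv β) := by
  refine (lamTo_lamDescAt creat W.obj (fun (S : FS) (k : plusOne.obj S ⟶ finFS (n + 1)) => indTerm W k)
    (fun {S T : FS} (f : S ⟶ T) (k : plusOne.obj T ⟶ finFS (n + 1)) => map_indTerm W f k)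
    (p := (S : FS)) (𝟙 S) β).trans ?_
  exact (congrArg (· ≫ indTerm W (inv β)) (W.obj.map_id S)).trans (Category.id_comp _)

theorem createAt_plusToInd (n : ℕ) (g : Sym (n + 1)) :
    createAt W n g ≫ plusToInd W n = indHom W n g := by
  refine (creatTo_plusToInd W _).trans ((map_indHom_congr W _ _ (𝟙 _)).trans ?_)
  simp [stdPerm_std]

/-- Every creation history is one of standard sets. -/
theorem creatTo_eq {n : ℕ} {S : FS} (β : finFS (n + 1) ⟶ plusOne.obj S) (a : S ⟶ finFS n) :
    creatTo W.obj (𝟙 S) β = W.obj.map a ≫ createAt W n (stdPerm (plusOne.map (inv a) ≫ inv β)) := by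
  refine Eq.trans ?_ (map_creatTo _ _ _ _).symm
  refine (creatTo_transport _ a _ _).trans ?_
  simp only [std_stdPerm, IsIso.inv_comp, Functor.map_inv, IsIso.inv_inv, Category.id_comp,
    Category.comp_id]

theorem plusLam_ext {n : ℕ} {M : Vect} {f h : (plusLam W).obj.obj (finFS (n + 1)) ⟶ M}
    (e : ∀ g, createAt W n g ≫ f = createAt W n g ≫ h) : f = h := by
  refine lam_ext_to (P := creat) fun (S : FS) (β : finFS (n + 1) ⟶ plusOne.obj S) => ?_
  obtain ⟨a⟩ := FS.exists_hom_of_plusOne (inv β)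
  change creatTo W.obj (𝟙 S) β ≫ f = creatTo W.obj (𝟙 S) β ≫ h
  rw [creatTo_eq W β a, Category.assoc, Category.assoc, e]

theorem subsingleton_plusLam : Subsingleton ((plusLam W).obj.obj (finFS 0)) := by
  have h : (𝟙 ((plusLam W).obj.obj (finFS 0))) = 0 :=
    lam_ext_to (P := creat) fun (S : FS) (β : finFS 0 ⟶ plusOne.obj S) =>
      (Equiv.symm β none : Fin 0).elim0
  exact subsingleton_of_forall_eq 0 fun v => congrArg (fun t => t.hom v) h

theorem plusToInd_indToPlus (n : ℕ) :
    plusToInd W n ≫ ModuleCat.ofHom (indToPlus W n).hom.toLinearMap = 𝟙 _ := by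
  refine plusLam_ext W fun g => ?_
  rw [← Category.assoc, createAt_plusToInd]
  refine Eq.trans ?_ (Category.comp_id _).symm
  ext w
  exact indToPlus_indElt W n g w

theorem indToPlus_plusToInd (n : ℕ) :
    (plusToInd W n).hom ∘ₗ (indToPlus W n).hom.toLinearMap = LinearMap.id := by
  apply Representation.IndV.hom_ext
  intro x
  ext w
  have h1 := indToPlus_indElt W n x⁻¹ w
  have h2 := congrArg (fun t => t.hom w) (createAt_plusToInd W n x⁻¹)
  have h3 := (congrArg (plusToInd W n).hom h1).trans h2
  simp only [indElt, indHom, inv_inv] at h3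
  exact h3

theorem rep_hom_ext {G : Type} [Group G] {A B : Rep.{1} ℂ G} {f g : A ⟶ B}
    (h : ∀ v, f.hom v = g.hom v) : f = g :=
  Rep.hom_ext (Representation.IntertwiningMap.ext (LinearMap.ext h))

/-- Induction is creation. -/
noncomputable def indIsoPlus : indSym.obj (evalSym.obj W) ≅ evalSym.obj (plusLam W) :=
  repSymIso fun
    | 0 => ⟨0, 0, rep_hom_ext fun _ => Subsingleton.elim (α := PUnit) _ _,
        rep_hom_ext fun _ => (subsingleton_plusLam W).elim _ _⟩
    | n + 1 => Rep.mkIso (Representation.Equiv.mk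
        (LinearEquiv.ofLinearMap (indToPlus W n).hom.toLinearMap (plusToInd W n).hom
          (congrArg ModuleCat.Hom.hom (plusToInd_indToPlus W n)) (indToPlus_plusToInd W n))
        (indToPlus W n).hom.isIntertwining')

theorem indIsoPlus_indElt (n : ℕ) (g : Sym (n + 1)) (w : W.obj.obj (finFS n)) :
    degree (indIsoPlus W).hom (n + 1) (indElt (evalSym.obj W) n g w) = (createAt W n g).hom w :=
  indToPlus_indElt W n g w

variable {W W'} in
theorem indIsoPlus_natural (f : W ⟶ W') : indSym.map (evalSym.map f) ≫ (indIsoPlus W').hom =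
    (indIsoPlus W).hom ≫ evalSym.map (plusLamMap f) := by
  refine indSym_ext fun n g w => ?_
  rw [degree_comp, degree_comp, degree_indSym_map]
  refine (indIsoPlus_indElt W' n g _).trans (Eq.trans ?_
    (congrArg (degree (evalSym.map (plusLamMap f)) (n + 1)) (indIsoPlus_indElt W n g w)).symm)
  exact congrArg (fun t => t.hom w) (creatTo_nat f.hom (𝟙 _) (inv (std n ≫ perm g))).symm

theorem annihilateAt_map (n : ℕ) (g : Sym n) :
    annihilateAt W n ≫ (minusLam W).obj.map (perm g) =
      W.obj.map (perm (incl n g)) ≫ annihilateAt W n := by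
  refine (annihTo_map _ _ _ _).trans (Eq.trans ?_ (map_annihTo _ _ _ _).symm)
  refine (annihTo_transport _ (perm g) _ _).trans ?_
  have e : inv (std n) ≫ plusOne.map (perm g) = perm (incl n g) ≫ inv (std n) := by
    rw [IsIso.inv_comp_eq, ← Category.assoc, IsIso.eq_comp_inv, plusOne_map_std]
  rw [e]
  simp

theorem map_minusTerm {n : ℕ} {S T : FS} (f : S ⟶ T) (k : T ⟶ finFS n) :
    W.obj.map (plusOne.map f) ≫ W.obj.map (plusOne.map k ≫ std n) =
      W.obj.map (plusOne.map (f ≫ k) ≫ std n) := by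
  rw [← Functor.map_comp, plusOne.map_comp, Category.assoc]

/-- The inverse of `annihilateAt`. -/
noncomputable def minusToRes (n : ℕ) : (minusLam W).obj.obj (finFS n) ⟶ W.obj.obj (finFS (n + 1)) :=
  lamDescAt (P := annih) (fun (S : FS) (k : S ⟶ finFS n) => W.obj.map (plusOne.map k ≫ std n))
    fun {S T : FS} (f : S ⟶ T) (k : T ⟶ finFS n) => map_minusTerm W f k

theorem annihTo_minusToRes {n : ℕ} {a S : FS} (α : a ⟶ plusOne.obj S) (β : finFS n ⟶ S) :
    annihTo W.obj α β ≫ minusToRes W n = W.obj.map (α ≫ plusOne.map (inv β) ≫ std n) := by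
  refine (lamTo_lamDescAt annih W.obj
    (fun (S : FS) (k : S ⟶ finFS n) => W.obj.map (plusOne.map k ≫ std n))
    (fun {S T : FS} (f : S ⟶ T) (k : T ⟶ finFS n) => map_minusTerm W f k) (p := (S : FS)) α β).trans ?_
  exact (W.obj.map_comp _ _).symm

theorem annihilateAt_minusToRes (n : ℕ) : annihilateAt W n ≫ minusToRes W n = 𝟙 _ := by
  refine (annihTo_minusToRes W _ _).trans ?_
  rw [← W.obj.map_id]
  congr 1
  simp

theorem minusToRes_annihilateAt (n : ℕ) : minusToRes W n ≫ annihilateAt W n = 𝟙 _ := by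
  refine lam_ext_to (P := annih) fun (S : FS) (β : finFS n ⟶ S) => ?_
  change annihTo W.obj (𝟙 _) β ≫ _ = annihTo W.obj (𝟙 _) β ≫ _
  rw [← Category.assoc, annihTo_minusToRes]
  refine (map_annihTo _ _ _ _).trans (Eq.trans ?_ (Category.comp_id _).symm)
  refine (annihTo_transport _ β _ _).trans ?_
  have e : ((𝟙 _ ≫ plusOne.map (inv β) ≫ std n) ≫ inv (std n)) ≫ plusOne.map β = 𝟙 _ := by
    simp only [Category.id_comp, Category.assoc, IsIso.hom_inv_id_assoc]
    rw [← Functor.map_comp]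
    simp
  rw [e, Category.id_comp]

/-- Restriction is annihilation. -/
noncomputable def resIsoMinus : resSym.obj (evalSym.obj W) ≅ evalSym.obj (minusLam W) :=
  repSymIso fun n => Rep.mkIso (Representation.Equiv.mk
    (LinearEquiv.ofLinearMap (annihilateAt W n).hom (minusToRes W n).hom
      (congrArg ModuleCat.Hom.hom (minusToRes_annihilateAt W n))
      (congrArg ModuleCat.Hom.hom (annihilateAt_minusToRes W n)))
    (fun g => congrArg ModuleCat.Hom.hom (annihilateAt_map W n g).symm))

theorem degree_resIsoMinus (n : ℕ) (w : W.obj.obj (finFS (n + 1))) :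
    degree (resIsoMinus W).hom n w = (annihilateAt W n).hom w := rfl

variable {W W'} in
theorem resIsoMinus_natural (f : W ⟶ W') : resSym.map (evalSym.map f) ≫ (resIsoMinus W').hom =
    (resIsoMinus W).hom ≫ evalSym.map (minusLamMap f) := by
  refine repSym_ext fun n w => ?_
  exact congrArg (fun t => t.hom w) (annihTo_nat f.hom (inv (std n)) (𝟙 _)).symm

end

/-! ### `Λ` of the generating spans of spans -/

/-- The diagram chase behind `lamTo_lamId`. -/
theorem unit_aux {D : Type*} [Category* D] {x₀ x₁ x₂ x₃ x₄ : D} {m : x₀ ⟶ x₁} {i : x₁ ⟶ x₂}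
    {j : x₂ ⟶ x₃} {l : x₃ ⟶ x₄} {l' : x₂ ⟶ x₁} {k : x₁ ⟶ x₄} (h₁ : j ≫ l = l' ≫ k)
    (h₂ : i ≫ l' = 𝟙 _) : (m ≫ i ≫ j) ≫ l = m ≫ k := by
  rw [Category.assoc, Category.assoc, h₁, reassoc_of% h₂]

theorem lamTo_lamId {A : Type 1} [Groupoid.{0} A] (V : A ⥤ Vect) {a b s : A} (α : a ⟶ s)
    (β : b ⟶ s) : lamTo (GSpan.idSpan A) V (p := (s : A)) α β ≫ (lamId V).app b =
      V.map (α ≫ inv β) :=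
  (unit_aux (x₁ := V.obj s) ((lamId V).naturality (inv β)) (lamIn_lamId V s)).trans
    (V.map_comp _ _).symm

section

variable (V : FS ⥤ Vect) {a b S T : FS}

/-- The map into `Λ` of the identity span given by the history of `S`. -/
noncomputable def idTo (α : a ⟶ S) (β : b ⟶ S) : V.obj a ⟶ ((Lam₁ (GSpan.idSpan FS)).obj V).obj b :=
  lamTo (GSpan.idSpan FS) V (p := (S : FS)) α β

/-- The map into `Λ(A† ∘ A)` given by the history "remove a point from `S + 1`, then add it". -/
noncomputable def pmTo (α : a ⟶ plusOne.obj S) (β : b ⟶ plusOne.obj S) :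
    V.obj a ⟶ ((Lam₁ (annih.comp creat)).obj V).obj b :=
  lamTo (annih.comp creat) V (p := ⟨S, S, 𝟙 S⟩) α β

/-- The map into `Λ(A ∘ A†)` given by the history "add a point to `S`, identify the result with
`T + 1`, and remove the last point". -/
noncomputable def mpTo (h : plusOne.obj S ⟶ plusOne.obj T) (α : a ⟶ S) (β : b ⟶ T) :
    V.obj a ⟶ ((Lam₁ (creat.comp annih)).obj V).obj b :=
  lamTo (creat.comp annih) V (p := ⟨S, T, h⟩) α β

/-- The map into `Λ(A† ∘ A†)` given by the history "add two points to `S`". -/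
noncomputable def ppTo (α : a ⟶ S) (β : b ⟶ plusOne.obj (plusOne.obj S)) :
    V.obj a ⟶ ((Lam₁ (creat.comp creat)).obj V).obj b :=
  lamTo (creat.comp creat) V (p := ⟨S, plusOne.obj S, 𝟙 _⟩) α β

/-- The map into `Λ(A ∘ A)` given by the history "remove two points from `S + 2`". -/
noncomputable def mmTo (α : a ⟶ plusOne.obj (plusOne.obj S)) (β : b ⟶ S) :
    V.obj a ⟶ ((Lam₁ (annih.comp annih)).obj V).obj b :=
  lamTo (annih.comp annih) V (p := ⟨plusOne.obj S, S, 𝟙 _⟩) α β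

theorem map_pmTo {c : FS} (γ : c ⟶ a) (α : a ⟶ plusOne.obj S) (β : b ⟶ plusOne.obj S) :
    V.map γ ≫ pmTo V α β = pmTo V (γ ≫ α) β := lamTo_pre γ _ _

theorem map_mmTo {c : FS} (γ : c ⟶ a) (α : a ⟶ plusOne.obj (plusOne.obj S)) (β : b ⟶ S) :
    V.map γ ≫ mmTo V α β = mmTo V (γ ≫ α) β := lamTo_pre γ _ _

theorem mpTo_transport {S' T' : FS} {h : plusOne.obj S ⟶ plusOne.obj T}
    {h' : plusOne.obj S' ⟶ plusOne.obj T'} (σ : S ⟶ S') (τ : T ⟶ T')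
    (w : plusOne.map σ ≫ h' = h ≫ plusOne.map τ) (α : a ⟶ S) (β : b ⟶ T) :
    mpTo V h α β = mpTo V h' (α ≫ σ) (β ≫ τ) :=
  lamTo_transport (P := creat.comp annih) (p := ⟨S, T, h⟩) (q := ⟨S', T', h'⟩) ⟨σ, τ, w⟩ α β

theorem idTo_lamId (α : a ⟶ S) (β : b ⟶ S) :
    idTo V α β ≫ (lamId V).app b = V.map (α ≫ inv β) := lamTo_lamId V α β

theorem idTo_cupMP (α : a ⟶ S) (β : b ⟶ S) :
    idTo V α β ≫ ((Lam₂ iId).app V).app b = mpTo V (𝟙 _) α β := by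
  refine (lamTo_Lam₂_of_rel iId V (iId.rel_of S) α β).trans ?_
  exact lamTo_congr (Category.comp_id _) (Category.comp_id _)

theorem mpTo_capMP (α : a ⟶ S) (β : b ⟶ S) :
    mpTo V (𝟙 _) α β ≫ ((Lam₂ iId.converse).app V).app b = idTo V α β := by
  have : iId.converse.top.Full := iId_bot_full
  have : iId.converse.top.Faithful := iId_bot_faithful
  refine (lamTo_Lam₂_of_rel iId.converse V (TwoCell.rel_mk.1 (pt_capMP S)) α β).trans ?_
  exact lamTo_congr (Category.comp_id _) (Category.comp_id _)

theorem pmTo_capPM (α : a ⟶ plusOne.obj S) (β : b ⟶ plusOne.obj S) :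
    pmTo V α β ≫ ((Lam₂ etaSpan.converse).app V).app b = idTo V α β := by
  have : etaSpan.converse.top.IsEquivalence := isEquivalence_etaSpan_bot
  refine (lamTo_Lam₂_of_rel etaSpan.converse V (TwoCell.rel_mk.1 (pt_capPM S)) α β).trans ?_
  exact lamTo_congr (Category.comp_id _) (Category.comp_id _)

theorem ppTo_crossPP (α : a ⟶ S) (β : b ⟶ plusOne.obj (plusOne.obj S)) :
    ppTo V α β ≫ ((Lam₂ swapCreat).app V).app b = ppTo V α (β ≫ swapTwo.app S) := by
  have := isEquivalence_swapCreat_top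
  refine (lamTo_Lam₂_of_rel swapCreat V (swapCreat.rel_of S) α β).trans ?_
  exact lamTo_congr (Category.comp_id _) rfl

theorem mmTo_crossMM (α : a ⟶ plusOne.obj (plusOne.obj S)) (β : b ⟶ S) :
    mmTo V α β ≫ ((Lam₂ swapAnnih).app V).app b = mmTo V (α ≫ swapTwo.app S) β := by
  have := isEquivalence_swapAnnih_top
  refine (lamTo_Lam₂_of_rel swapAnnih V (swapAnnih.rel_of S) α β).trans ?_
  exact lamTo_congr rfl (Category.comp_id _)

theorem pmTo_crossPM (α : a ⟶ plusOne.obj S) (β : b ⟶ plusOne.obj S) :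
    pmTo V α β ≫ ((Lam₂ iAA).app V).app b = mpTo V (swapTwo.app S) α β := by
  refine (lamTo_Lam₂_of_rel iAA V (iAA.rel_of S) α β).trans ?_
  exact lamTo_congr (Category.comp_id _) (Category.comp_id _)

theorem mpTo_crossMP (α : a ⟶ plusOne.obj S) (β : b ⟶ plusOne.obj S) :
    mpTo V (swapTwo.app S) α β ≫ ((Lam₂ iAA.converse).app V).app b = pmTo V α β := by
  have : iAA.converse.top.Full := iAA_bot_full
  have : iAA.converse.top.Faithful := iAA_bot_faithful
  refine (lamTo_Lam₂_of_rel iAA.converse V (TwoCell.rel_mk.1 (pt_crossMP S)) α β).trans ?_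
  exact lamTo_congr (Category.comp_id _) (Category.comp_id _)

theorem pmTo_lamComp (α : a ⟶ plusOne.obj S) (β : b ⟶ plusOne.obj S) :
    pmTo V α β ≫ (lamComp annih creat V).app b =
      annihTo V α (𝟙 S) ≫ creatTo ((Lam₁ annih).obj V) (𝟙 S) β :=
  lamTo_lamComp (P := annih) (P' := creat) V (b := S) ⟨S, S, 𝟙 S⟩ α β (Category.comp_id (𝟙 S))

theorem mpTo_lamComp {c : FS} (h : plusOne.obj S ⟶ plusOne.obj T) (α : a ⟶ S) (β : b ⟶ T)
    (γ : c ⟶ plusOne.obj S) : mpTo V h α β ≫ (lamComp creat annih V).app b =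
      creatTo V α γ ≫ annihTo ((Lam₁ creat).obj V) (γ ≫ h) β :=
  lamTo_lamComp (P := creat) (P' := annih) V (b := c) ⟨S, T, h⟩ α β (γ := γ) rfl

theorem ppTo_lamComp {c : FS} (α : a ⟶ S) (β : b ⟶ plusOne.obj (plusOne.obj S))
    (γ : c ⟶ plusOne.obj S) : ppTo V α β ≫ (lamComp creat creat V).app b =
      creatTo V α γ ≫ creatTo ((Lam₁ creat).obj V) γ β :=
  lamTo_lamComp (P := creat) (P' := creat) V (b := c) ⟨S, plusOne.obj S, 𝟙 _⟩ α β (γ := γ)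
    (Category.comp_id γ)

theorem mmTo_lamComp {c : FS} (α : a ⟶ plusOne.obj (plusOne.obj S)) (β : b ⟶ S)
    (γ : c ⟶ plusOne.obj S) : mmTo V α β ≫ (lamComp annih annih V).app b =
      annihTo V α γ ≫ annihTo ((Lam₁ annih).obj V) γ β :=
  lamTo_lamComp (P := annih) (P' := annih) V (b := c) ⟨plusOne.obj S, S, 𝟙 _⟩ α β (γ := γ)
    (Category.comp_id γ)

/-- A point to which no point is related is sent to zero. -/
theorem lamTo_Lam₂_of_isEmpty {A B : Type 1} [Groupoid.{0} A] [Groupoid.{0} B] {P Q : GSpan A B}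
    (Z : SpanSpan P Q) (hZ : Z.top.Faithful) (V : A ⥤ Vect) {a : A} {b : B}
    {p : P.apex} (α : a ⟶ P.src.obj p) (β : b ⟶ P.tgt.obj p)
    (h : ∀ z, (Z.top.obj z ⟶ p) → False) :
    lamTo P V p α β ≫ ((Lam₂ Z).app V).app b = 0 :=
  (lamTo_Lam₂ Z hZ V α β (φ := (Empty.elim : Empty → _))
    (isTransversal_iff.2 ⟨fun t => t.elim, fun c => (h _ c.hom).elim⟩)).trans (Fintype.sum_empty _)

/-- The cap kills a history in which the point removed is not the point added. -/
theorem mpTo_capMP_zero {h : plusOne.obj S ⟶ plusOne.obj T} (α : a ⟶ S) (β : b ⟶ T)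
    (hh : ∀ f : S ⟶ T, plusOne.map f ≠ h) :
    mpTo V h α β ≫ ((Lam₂ iId.converse).app V).app b = 0 := by
  have h0 : ∀ U : FS, (iId.converse.top.obj U ⟶ (⟨S, T, h⟩ : Comma plusOne plusOne)) → False := by
    intro U c
    let σ : U ⟶ S := CommaMorphism.left c
    let τ : U ⟶ T := CommaMorphism.right c
    have w : plusOne.map σ ≫ h = 𝟙 _ ≫ plusOne.map τ := CommaMorphism.w c
    refine hh (inv σ ≫ τ) ?_
    rw [Functor.map_comp, Functor.map_inv, IsIso.inv_comp_eq, w, Category.id_comp]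
  exact lamTo_Lam₂_of_isEmpty iId.converse iId_bot_faithful V (p := ⟨S, T, h⟩) α β h0

/-- The crossing kills a history in which the point removed is the point added. -/
theorem mpTo_crossMP_zero (f : S ⟶ T) (α : a ⟶ S) (β : b ⟶ T) :
    mpTo V (plusOne.map f) α β ≫ ((Lam₂ iAA.converse).app V).app b = 0 := by
  have h0 : ∀ U : FS, (iAA.converse.top.obj U ⟶
      (⟨S, T, plusOne.map f⟩ : Comma plusOne plusOne)) → False := by
    intro U c
    let σ : plusOne.obj U ⟶ S := CommaMorphism.left c
    let τ : plusOne.obj U ⟶ T := CommaMorphism.right c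
    have w : plusOne.map σ ≫ plusOne.map f = swapTwo.app U ≫ plusOne.map τ := CommaMorphism.w c
    have w' : (none : Option T.carrier) = some ((show Option U.carrier ≃ T.carrier from τ) none) :=
      congrArg (fun e : Option (Option U.carrier) ≃ Option T.carrier => e none) w
    exact Option.noConfusion rfl (heq_of_eq w')
  exact lamTo_Lam₂_of_isEmpty iAA.converse iAA_bot_faithful V (p := ⟨S, T, plusOne.map f⟩) α β h0

/-- The points of a finite set with `n + 1` elements are the ways to write it as `n` elements plus
one. -/
theorem isTransversal_plusOne (n : ℕ) : IsTransversal (S := plusOne) (x := finFS (n + 1))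
    fun i : Fin (n + 1) => CostructuredArrow.mk (Y := finFS n)
      (std n ≫ perm (Equiv.swap i (Fin.last n))) := by
  have h (i : Fin (n + 1)) : Equiv.swap i (Fin.last n) (stdEquiv n none) = i := by
    rw [std_none]; exact Equiv.swap_apply_right _ _
  refine isTransversal_iff.2 ⟨fun i j k w => ?_, fun c => ?_⟩
  · have w' := congrArg (fun e : Option (Fin n) ≃ Fin (n + 1) => e none) w
    exact ((h j).symm.trans (w'.trans (h i))).symm
  · obtain ⟨a⟩ := FS.exists_hom_of_plusOne c.hom
    let k : plusOne.obj (finFS n) ⟶ finFS (n + 1) := plusOne.map (inv a) ≫ c.hom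
    -- the identification `k` and a transposition agree on the new point, so they differ by a
    -- bijection of the remaining points
    let k' : Option (Fin n) ≃ Fin (n + 1) := k
    let s := Equiv.swap (k' none) (Fin.last n)
    let e : Option (Fin n) ≃ Option (Fin n) := ((stdEquiv n).trans s).trans k'.symm
    have he : e none = none := by
      change k'.symm (s (stdEquiv n none)) = none
      rw [h, Equiv.symm_apply_apply]
    obtain ⟨r, hr⟩ := exists_plusOne_map (S := finFS n) (T := finFS n) e he
    have hr' : plusOne.map r ≫ k = std n ≫ perm s :=
      (congrArg (· ≫ k) hr).trans (Equiv.ext fun x => k'.apply_symm_apply _)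
    refine ⟨k' none, r ≫ inv a, ?_⟩
    rw [Functor.map_comp, Category.assoc]
    exact hr'

/-- The identity history of an `(n+1)`-element set is sent to the sum over its elements `i` of the
histories "remove `i`, then add it". -/
theorem idTo_cupPM (n : ℕ) : idTo V (𝟙 (finFS (n + 1))) (𝟙 _) ≫ ((Lam₂ etaSpan).app V).app _ =
    ∑ i : Fin (n + 1), pmTo V (S := finFS n) (inv (std n ≫ perm (Equiv.swap i (Fin.last n))))
      (inv (std n ≫ perm (Equiv.swap i (Fin.last n)))) := by
  refine (lamTo_Lam₂ etaSpan plusOne_faithful V _ _ (isTransversal_plusOne n)).trans ?_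
  refine Finset.sum_congr rfl fun i _ => lamTo_congr ?_ ?_
  · exact (Category.id_comp _).trans (Category.comp_id _)
  · exact (Category.id_comp _).trans (Category.comp_id _)

end

/-! ### The action on representations of symmetric groups -/

/-- Evaluation on standard finite sets as an equivalence. -/
noncomputable def symEquiv : Lam FS ≌ RepSym := evalSym.asEquivalence

attribute [local instance] lamAction

/-- The action of `H'` on `∐_n Rep(S_n)`, transported from `Λ(FS)`. -/
@[reducible] noncomputable def symAction : MonoidalLeftAction (H ℂ) RepSym :=
  transportAction symEquiv

attribute [local instance] symAction

/-- The object of `Λ(FS)` that corresponds to a family of representations. -/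
noncomputable abbrev symInv (V : RepSym) : Lam FS := symEquiv.inverse.obj V

/-- The counit of the equivalence between `Λ(FS)` and `∐_n Rep(S_n)`. -/
noncomputable abbrev symCounit (V : RepSym) : evalSym.obj (symInv V) ≅ V := symEquiv.counitIso.app V

theorem evalSym_map_unit (W : Lam FS) :
    evalSym.map (symEquiv.unit.app W) ≫ (symCounit (evalSym.obj W)).hom = 𝟙 _ :=
  symEquiv.functor_unit_comp W

/-- `Q₊` acts by induction. -/
noncomputable def symIndIso (V : RepSym) : qPlus ⊙ₗ V ≅ indSym.obj V :=
  (indIsoPlus (symInv V)).symm ≪≫ indSym.mapIso (symCounit V)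

/-- `Q₋` acts by restriction. -/
noncomputable def symResIso (V : RepSym) : qMinus ⊙ₗ V ≅ resSym.obj V :=
  (resIsoMinus (symInv V)).symm ≪≫ resSym.mapIso (symCounit V)

/-- Naturality of an isomorphism composed from the inverse of a natural isomorphism and a natural map. -/
theorem iso_natural_aux {D : Type*} [Category* D] {x x' y y' z z' : D} {e : x ≅ y} {e' : x' ≅ y'}
    {f : x ⟶ x'} {g : y ⟶ y'} {c : x ⟶ z} {c' : x' ⟶ z'} {h : z ⟶ z'} (w : f ≫ e'.hom = e.hom ≫ g)
    (w' : f ≫ c' = c ≫ h) : g ≫ e'.inv ≫ c' = (e.inv ≫ c) ≫ h := by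
  rw [Category.assoc, ← w', Iso.eq_inv_comp, ← reassoc_of% w, Iso.hom_inv_id_assoc]

theorem symIndIso_natural {V W : RepSym} (f : V ⟶ W) :
    qPlus ⊴ₗ f ≫ (symIndIso W).hom = (symIndIso V).hom ≫ indSym.map f :=
  iso_natural_aux (indIsoPlus_natural (symEquiv.inverse.map f)) (by
    rw [Functor.mapIso_hom, Functor.mapIso_hom, ← Functor.map_comp, ← Functor.map_comp]
    exact congrArg indSym.map (symEquiv.counit.naturality f))

theorem symResIso_natural {V W : RepSym} (f : V ⟶ W) :
    qMinus ⊴ₗ f ≫ (symResIso W).hom = (symResIso V).hom ≫ resSym.map f :=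
  iso_natural_aux (resIsoMinus_natural (symEquiv.inverse.map f)) (by
    rw [Functor.mapIso_hom, Functor.mapIso_hom, ← Functor.map_comp, ← Functor.map_comp]
    exact congrArg resSym.map (symEquiv.counit.naturality f))

theorem map_unit_symIndIso (W : Lam FS) : evalSym.map (plusLamMap (symEquiv.unit.app W)) ≫
    (symIndIso (evalSym.obj W)).hom = (indIsoPlus W).inv := by
  refine (iso_natural_aux (c := 𝟙 _) (h := 𝟙 _) (indIsoPlus_natural (symEquiv.unit.app W)) ?_).trans
    ((Category.comp_id _).trans (Category.comp_id _))
  refine ((indSym.map_comp _ _).symm.trans (congrArg indSym.map (evalSym_map_unit W))).trans ?_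
  rw [CategoryTheory.Functor.map_id, Category.comp_id]

theorem map_unit_symResIso (W : Lam FS) : evalSym.map (minusLamMap (symEquiv.unit.app W)) ≫
    (symResIso (evalSym.obj W)).hom = (resIsoMinus W).inv := by
  refine (iso_natural_aux (c := 𝟙 _) (h := 𝟙 _) (resIsoMinus_natural (symEquiv.unit.app W)) ?_).trans
    ((Category.comp_id _).trans (Category.comp_id _))
  refine ((resSym.map_comp _ _).symm.trans (congrArg resSym.map (evalSym_map_unit W))).trans ?_
  rw [CategoryTheory.Functor.map_id, Category.comp_id]

section

variable (V : RepSym)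

/-- The identification of the action of `Q₊ ⊗ Y` through the one of `Y`, evaluated on `Λ(FS)`: the units
of the equivalence cancel. -/
theorem pairIso_plus {Y : H ℂ} {G : RepSym ⥤ RepSym} (e : ∀ V, Y ⊙ₗ V ≅ G.obj V) :
    (pairIso symIndIso e V).hom = evalSym.map (αₗ qPlus Y (symInv V)).hom ≫
      (indIsoPlus (Y ⊙ₗ symInv V)).inv ≫ indSym.map (e V).hom := by
  refine Eq.trans ?_ (congrArg (fun t => _ ≫ t ≫ _) (map_unit_symIndIso (Y ⊙ₗ symInv V)))
  refine (congrArg (· ≫ _) (evalSym.map_comp _ _)).trans ?_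
  exact (Category.assoc _ _ _).trans (congrArg (_ ≫ ·) (Category.assoc _ _ _).symm)

/-- The identification of the action of `Q₋ ⊗ Y` through the one of `Y`, evaluated on `Λ(FS)`: the units
of the equivalence cancel. -/
theorem pairIso_minus {Y : H ℂ} {G : RepSym ⥤ RepSym} (e : ∀ V, Y ⊙ₗ V ≅ G.obj V) :
    (pairIso symResIso e V).hom = evalSym.map (αₗ qMinus Y (symInv V)).hom ≫
      (resIsoMinus (Y ⊙ₗ symInv V)).inv ≫ resSym.map (e V).hom := by
  refine Eq.trans ?_ (congrArg (fun t => _ ≫ t ≫ _) (map_unit_symResIso (Y ⊙ₗ symInv V)))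
  refine (congrArg (· ≫ _) (evalSym.map_comp _ _)).trans ?_
  exact (Category.assoc _ _ _).trans (congrArg (_ ≫ ·) (Category.assoc _ _ _).symm)

theorem degree_inv_of_eq {V W : RepSym} (e : V ≅ W) {n : ℕ} {v : V.obj n} {w : W.obj n}
    (h : degree e.hom n v = w) : degree e.inv n w = v := by
  rw [← h, ← degree_comp, e.hom_inv_id, degree_id]

theorem indIsoPlus_inv_createAt (W : Lam FS) (n : ℕ) (g : Sym (n + 1)) (w : W.obj.obj (finFS n)) :
    degree (indIsoPlus W).inv (n + 1) ((createAt W n g).hom w) = indElt (evalSym.obj W) n g w :=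
  degree_inv_of_eq _ (indIsoPlus_indElt W n g w)

theorem resIsoMinus_inv_annihilateAt (W : Lam FS) (n : ℕ) (w : W.obj.obj (finFS (n + 1))) :
    degree (resIsoMinus W).inv n ((annihilateAt W n).hom w) = w :=
  degree_inv_of_eq _ (degree_resIsoMinus W n w)

/-- An element of the value of the inverse equivalence as an element of the representation. -/
noncomputable def counitAt (n : ℕ) : (symInv V).obj.obj (finFS n) →ₗ[ℂ] V.obj n :=
  degree (symCounit V).hom n

theorem counitAt_surjective (n : ℕ) : Function.Surjective (counitAt V n) := fun v =>
  ⟨degree (symCounit V).inv n v, by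
    exact congrArg (fun f => degree f n v) (symCounit V).inv_hom_id⟩

theorem counitAt_map (n : ℕ) (g : Sym n) (w : (symInv V).obj.obj (finFS n)) :
    counitAt V n (((symInv V).obj.map (perm g)).hom w) = (V.obj n).ρ g (counitAt V n w) :=
  degree_ρ (symCounit V).hom n g w

theorem symIndIso_createAt (n : ℕ) (g : Sym (n + 1)) (w : (symInv V).obj.obj (finFS n)) :
    degree (symIndIso V).hom (n + 1) ((createAt (symInv V) n g).hom w) =
      indElt V n g (counitAt V n w) :=
  congrArg (degree (indSym.map (symCounit V).hom) (n + 1)) (indIsoPlus_inv_createAt _ n g w)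

theorem symResIso_annihilateAt (n : ℕ) (w : (symInv V).obj.obj (finFS (n + 1))) :
    degree (symResIso V).hom n ((annihilateAt (symInv V) n).hom w) = counitAt V (n + 1) w :=
  congrArg (degree (resSym.map (symCounit V).hom) n) (resIsoMinus_inv_annihilateAt _ n w)

/-! ### Khovanov's bimodules in terms of histories -/

/-- Evaluation of a threefold composite on an element. -/
theorem degree_comp₃ {V₀ V₁ V₂ V₃ : RepSym} {f : V₀ ⟶ V₁} {g : V₁ ⟶ V₂} {h : V₂ ⟶ V₃} {k : V₀ ⟶ V₃}
    (hk : k = f ≫ g ≫ h) {n : ℕ} {x : V₀.obj n} {y : V₁.obj n} {z : V₂.obj n} (hx : degree f n x = y)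
    (hy : degree g n y = z) : degree k n x = degree h n z := by
  rw [hk, degree_comp, degree_comp, hx, hy]

theorem pairIso_plus_apply {Y : H ℂ} {G : RepSym ⥤ RepSym} (e : ∀ V, Y ⊙ₗ V ≅ G.obj V) {n : ℕ}
    {g : Sym (n + 1)} {U : Vect} {x : U ⟶ ((qPlus ⊗ Y) ⊙ₗ symInv V).obj.obj (finFS (n + 1))}
    {u : U ⟶ (Y ⊙ₗ symInv V).obj.obj (finFS n)}
    (hx : x ≫ (αₗ qPlus Y (symInv V)).hom.hom.app _ = u ≫ createAt (Y ⊙ₗ symInv V) n g) (w : U) :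
    degree (pairIso symIndIso e V).hom (n + 1) (x.hom w) =
      indElt (G.obj V) n g (degree (e V).hom n (u.hom w)) :=
  degree_comp₃ (pairIso_plus V e) (congrArg (fun t => t.hom w) hx)
    (indIsoPlus_inv_createAt (Y ⊙ₗ symInv V) n g (u.hom w))

theorem pairIso_minus_apply {Y : H ℂ} {G : RepSym ⥤ RepSym} (e : ∀ V, Y ⊙ₗ V ≅ G.obj V) {n : ℕ}
    {U : Vect} {x : U ⟶ ((qMinus ⊗ Y) ⊙ₗ symInv V).obj.obj (finFS n)}
    {u : U ⟶ (Y ⊙ₗ symInv V).obj.obj (finFS (n + 1))}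
    (hx : x ≫ (αₗ qMinus Y (symInv V)).hom.hom.app _ = u ≫ annihilateAt (Y ⊙ₗ symInv V) n) (w : U) :
    degree (pairIso symResIso e V).hom n (x.hom w) = degree (e V).hom (n + 1) (u.hom w) :=
  degree_comp₃ (pairIso_minus V e) (congrArg (fun t => t.hom w) hx)
    (resIsoMinus_inv_annihilateAt (Y ⊙ₗ symInv V) n (u.hom w))

/-- The history "remove the last point, then add a point by `g`" is `g ⊗ v`, for `v` in the
restriction. -/
theorem pairIso_pmTo (n : ℕ) (g : Sym (n + 1)) (w : (symInv V).obj.obj (finFS (n + 1))) :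
    degree (pairIso symIndIso symResIso V).hom (n + 1)
      ((pmTo (symInv V).obj (inv (std n)) (inv (std n ≫ perm g))).hom w) =
      indElt (resSym.obj V) n g (counitAt V (n + 1) w) := by
  refine (pairIso_plus_apply V symResIso (g := g) (u := annihilateAt (symInv V) n)
    (pmTo_lamComp (symInv V).obj _ _) w).trans ?_
  exact congrArg (indElt (resSym.obj V) n g) (symResIso_annihilateAt V n w)

/-- The history "add a point by `g`, then remove the last point" is `g ⊗ v`, in the restriction of the
induced representation. -/
theorem pairIso_mpTo (n : ℕ) (g : Sym (n + 1)) (w : (symInv V).obj.obj (finFS n)) :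
    degree (pairIso symResIso symIndIso V).hom n
      ((mpTo (symInv V).obj (std n ≫ perm g ≫ inv (std n)) (𝟙 _) (𝟙 _)).hom w) =
      indElt V n g (counitAt V n w) := by
  have e : inv (std n ≫ perm g) ≫ std n ≫ perm g ≫ inv (std n) = inv (std n) := by simp
  have h := mpTo_lamComp (symInv V).obj (std n ≫ perm g ≫ inv (std n)) (𝟙 _) (𝟙 _)
    (inv (std n ≫ perm g))
  rw [e] at h
  exact (pairIso_minus_apply V symIndIso (u := createAt (symInv V) n g) h w).trans
    (symIndIso_createAt V n g w)

/-- Identification of `n` elements plus two with `n + 2` elements. -/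
def stdTwo (n : ℕ) : plusOne.obj (plusOne.obj (finFS n)) ⟶ finFS (n + 2) :=
  plusOne.map (std n) ≫ std (n + 1)

theorem swapTwo_stdTwo (n : ℕ) :
    swapTwo.app (finFS n) ≫ stdTwo n = stdTwo n ≫ perm (lastSwap n) := by
  rw [stdTwo, Category.assoc, swapTwo_std]

theorem plusOne_map_std_perm (n : ℕ) (g : Sym (n + 2)) (h : Sym (n + 1)) :
    plusOne.map (std n ≫ perm h) ≫ std (n + 1) ≫ perm g =
      stdTwo n ≫ perm (g * incl (n + 1) h) := by
  rw [Functor.map_comp, Category.assoc, stdTwo, Category.assoc, ← perm_comp]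
  exact congrArg (plusOne.map (std n) ≫ ·) (((Category.assoc _ _ _).symm.trans
    (congrArg (· ≫ perm g) (plusOne_map_std h))).trans (Category.assoc _ _ _))

/-- The history "add a point by `h`, then add a point by `g`" is `g ⊗ h ⊗ v`. -/
theorem pairIso_ppTo (n : ℕ) (g : Sym (n + 2)) (h : Sym (n + 1)) (w : (symInv V).obj.obj (finFS n)) :
    degree (pairIso symIndIso symIndIso V).hom (n + 2)
      ((ppTo (symInv V).obj (𝟙 _) (inv (stdTwo n ≫ perm (g * incl (n + 1) h)))).hom w) =
      indElt (indSym.obj V) (n + 1) g (indElt V n h (counitAt V n w)) := by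
  have e : inv (std (n + 1) ≫ perm g) ≫ plusOne.map (inv (std n ≫ perm h)) =
      inv (stdTwo n ≫ perm (g * incl (n + 1) h)) := by
    rw [Functor.map_inv, ← IsIso.inv_comp]
    simp only [plusOne_map_std_perm]
  have h1 : ppTo (symInv V).obj (𝟙 _) (inv (stdTwo n ≫ perm (g * incl (n + 1) h))) ≫
      (lamComp creat creat (symInv V).obj).app _ =
        createAt (symInv V) n h ≫ createAt (plusLam (symInv V)) (n + 1) g := by
    refine (ppTo_lamComp (symInv V).obj _ _ (inv (std n ≫ perm h))).trans ?_
    refine congrArg (createAt (symInv V) n h ≫ ·) ?_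
    refine Eq.trans ?_ (creatTo_transport _ (inv (std n ≫ perm h)) _ _).symm
    rw [e, Category.id_comp]
  refine (pairIso_plus_apply V symIndIso (g := g) (u := createAt (symInv V) n h) h1 w).trans ?_
  exact congrArg (indElt (indSym.obj V) (n + 1) g) (symIndIso_createAt V n h w)

/-- The history "remove the last two points" is the identity of the twofold restriction. -/
theorem pairIso_mmTo (n : ℕ) (w : (symInv V).obj.obj (finFS (n + 2))) :
    degree (pairIso symResIso symResIso V).hom n
      ((mmTo (symInv V).obj (inv (stdTwo n)) (𝟙 _)).hom w) = counitAt V (n + 2) w := by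
  have e : inv (std (n + 1)) ≫ plusOne.map (inv (std n)) = inv (stdTwo n) := by
    rw [Functor.map_inv, ← IsIso.inv_comp]
    rfl
  have h : mmTo (symInv V).obj (inv (stdTwo n)) (𝟙 _) ≫
      (lamComp annih annih (symInv V).obj).app _ =
        annihilateAt (symInv V) (n + 1) ≫ annihilateAt (minusLam (symInv V)) n := by
    refine (mmTo_lamComp (symInv V).obj _ _ (inv (std n))).trans ?_
    refine congrArg (· ≫ annihilateAt (minusLam (symInv V)) n) ?_
    refine Eq.trans ?_ (annihTo_transport _ (inv (std n)) _ _).symm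
    rw [e, Category.id_comp]
  exact (pairIso_minus_apply V symResIso (u := annihilateAt (symInv V) (n + 1)) h w).trans
    (symResIso_annihilateAt V (n + 1) w)

/-- The identity history corresponds to the vector itself. -/
theorem unit_idTo {S : FS} (n : ℕ) (α β : finFS n ⟶ S) (w : (symInv V).obj.obj (finFS n)) :
    degree (λₗ[H ℂ] V).hom n ((idTo (symInv V).obj α β).hom w) =
      counitAt V n (((symInv V).obj.map (α ≫ inv β)).hom w) :=
  congrArg (counitAt V n) (congrArg (fun t => t.hom w) (idTo_lamId (symInv V).obj α β))

/-- A generating morphism acts on representations as it acts on the corresponding histories. -/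
theorem actDeg_eq {X Y : HObj} (f : HMor ℂ X Y) {W W' : RepSym} (e : (show H ℂ from X) ⊙ₗ V ≅ W)
    (e' : (show H ℂ from Y) ⊙ₗ V ≅ W') {n : ℕ} {U : Vect}
    {x : U ⟶ ((Lam₁ (Cobj X)).obj (symInv V).obj).obj (finFS n)}
    {x' : U ⟶ ((Lam₁ (Cobj Y)).obj (symInv V).obj).obj (finFS n)}
    (hf : x ≫ ((Lmor f).app (symInv V).obj).app (finFS n) = x') (w : U) {y : W.obj n} {z : W'.obj n}
    (hx : degree e.hom n (x.hom w) = y) (hz : degree e'.hom n (x'.hom w) = z) :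
    actDeg (hom f) e e' n y = z :=
  (degree_comp₃ (f := e.inv) (g := hom f ⊵ₗ V) (h := e'.hom) rfl (degree_inv_of_eq _ hx)
    (congrArg (fun t => t.hom w) hf)).trans hz

end

/-! ### The generating morphisms act by Khovanov's bimodule maps -/

theorem perm_one (n : ℕ) : perm (1 : Sym n) = 𝟙 (finFS n) := rfl

theorem std_perm_incl {n : ℕ} (g : Sym n) :
    std n ≫ perm (incl n g) ≫ inv (std n) = plusOne.map (perm g) := by
  rw [← Category.assoc, IsIso.comp_inv_eq, plusOne_map_std]

/-- Under the identification with the standard set, the permutation `g s` is the exchange of the two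
added points followed by `g`, extended by a fixed point. -/
theorem plusOne_std_lastSwap {n : ℕ} (g : Sym (n + 1)) :
    plusOne.map (std n) ≫ std (n + 1) ≫ perm (incl (n + 1) g * lastSwap n) ≫ inv (std (n + 1)) =
      swapTwo.app (finFS n) ≫ plusOne.map (std n ≫ perm g) := by
  have h : swapTwo.app (finFS n) ≫ plusOne.map (std n ≫ perm g) ≫ std (n + 1) =
      plusOne.map (std n) ≫ std (n + 1) ≫ perm (incl (n + 1) g * lastSwap n) := by
    rw [← perm_comp, ← Category.assoc (std (n + 1)), ← Category.assoc (plusOne.map (std n)),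
      ← swapTwo_std, plusOne.map_comp]
    simp only [Category.assoc]
    exact congrArg (fun t => swapTwo.app (finFS n) ≫ plusOne.map (std n) ≫ t) (plusOne_map_std g)
  rw [← cancel_mono (std (n + 1))]
  simp only [Category.assoc, IsIso.inv_hom_id, Category.comp_id]
  exact h.symm

section

variable (V : FS ⥤ Vect) (n : ℕ)

theorem idTo_cupMP_std : idTo V (𝟙 (finFS n)) (𝟙 _) ≫ ((Lam₂ iId).app V).app _ =
    mpTo V (std n ≫ perm 1 ≫ inv (std n)) (𝟙 _) (𝟙 _) := by
  rw [idTo_cupMP, perm_one, Category.id_comp, IsIso.hom_inv_id]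

theorem mpTo_capMP_std (h : Sym n) :
    mpTo V (std n ≫ perm (incl n h) ≫ inv (std n)) (𝟙 _) (𝟙 _) ≫
      ((Lam₂ iId.converse).app V).app _ = idTo V (perm h) (𝟙 _) := by
  rw [std_perm_incl, ← mpTo_capMP, mpTo_transport V (h' := 𝟙 _) (perm h) (𝟙 _) (by simp)]
  simp only [Category.id_comp]

theorem mpTo_capMP_zero_std (g : Sym (n + 1)) (hg : g ∉ (incl n).range) :
    mpTo V (std n ≫ perm g ≫ inv (std n)) (𝟙 _) (𝟙 _) ≫
      ((Lam₂ iId.converse).app V).app (finFS n) = 0 := by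
  have key (f : Sym n) (hf : plusOne.map (perm f) = std n ≫ perm g ≫ inv (std n)) :
      perm (incl n f) = perm g := by
    rw [← cancel_epi (std n), ← plusOne_map_std, ← cancel_mono (inv (std n)), Category.assoc,
      Category.assoc, IsIso.hom_inv_id, Category.comp_id]
    exact hf
  exact mpTo_capMP_zero V _ _ fun f hf => hg ⟨f, key f hf⟩

theorem idTo_cupPM_std : idTo V (𝟙 (finFS (n + 1))) (𝟙 _) ≫ ((Lam₂ etaSpan).app V).app _ =
    ∑ i : Fin (n + 1), V.map (perm (Equiv.swap i (Fin.last n))⁻¹) ≫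
      pmTo V (inv (std n)) (inv (std n ≫ perm (Equiv.swap i (Fin.last n)))) := by
  rw [idTo_cupPM]
  refine Finset.sum_congr rfl fun i _ => ?_
  rw [map_pmTo]
  congr 1
  rw [IsIso.inv_comp, FS.inv_eq_symm (perm _)]
  rfl

theorem ppTo_crossPP_std (g : Sym (n + 2)) :
    ppTo V (𝟙 _) (inv (stdTwo n ≫ perm g)) ≫ ((Lam₂ swapCreat).app V).app _ =
      ppTo V (𝟙 _) (inv (stdTwo n ≫ perm (g * lastSwap n))) := by
  have e : stdTwo n ≫ perm (g * lastSwap n) = swapTwo.app (finFS n) ≫ stdTwo n ≫ perm g := by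
    rw [← perm_comp, ← Category.assoc, ← swapTwo_stdTwo, Category.assoc]
  have e' : inv (swapTwo.app (finFS n)) = swapTwo.app (finFS n) :=
    IsIso.inv_eq_of_hom_inv_id (swapTwo_swapTwo _)
  rw [ppTo_crossPP]
  congr 1
  simp only [e, IsIso.inv_comp, e', Category.assoc]

theorem mmTo_crossMM_std : mmTo V (inv (stdTwo n)) (𝟙 _) ≫ ((Lam₂ swapAnnih).app V).app _ =
    V.map (perm (lastSwap n)) ≫ mmTo V (inv (stdTwo n)) (𝟙 _) := by
  rw [mmTo_crossMM, map_mmTo]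
  congr 1
  rw [IsIso.inv_comp_eq, ← Category.assoc, IsIso.eq_comp_inv, swapTwo_stdTwo]

theorem pmTo_crossPM_std (g : Sym (n + 1)) :
    pmTo V (inv (std n)) (inv (std n ≫ perm g)) ≫ ((Lam₂ iAA).app V).app _ =
      mpTo V (std (n + 1) ≫ perm (incl (n + 1) g * lastSwap n) ≫ inv (std (n + 1)))
        (𝟙 _) (𝟙 _) := by
  rw [pmTo_crossPM, mpTo_transport V (std n) (std n ≫ perm g) (plusOne_std_lastSwap g),
    IsIso.inv_hom_id, IsIso.inv_hom_id]

theorem mpTo_crossMP_std (a b : Sym (n + 1)) :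
    mpTo V (std (n + 1) ≫ perm (incl (n + 1) a * lastSwap n * incl (n + 1) b) ≫ inv (std (n + 1)))
        (𝟙 _) (𝟙 _) ≫ ((Lam₂ iAA.converse).app V).app _ =
      V.map (perm b) ≫ pmTo V (inv (std n)) (inv (std n ≫ perm a)) := by
  have e : plusOne.map (perm b ≫ inv (std n)) ≫ swapTwo.app (finFS n) =
      (std (n + 1) ≫ perm (incl (n + 1) a * lastSwap n * incl (n + 1) b) ≫ inv (std (n + 1))) ≫
        plusOne.map (inv (std n ≫ perm a)) := by
    rw [plusOne.map_inv, IsIso.eq_comp_inv, Category.assoc, ← plusOne_std_lastSwap,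
      ← Category.assoc, ← plusOne.map_comp, Category.assoc, IsIso.inv_hom_id, Category.comp_id,
      ← Category.assoc, plusOne_map_std, ← perm_comp]
    simp only [Category.assoc]
    rfl
  rw [map_pmTo, mpTo_transport V _ _ e, mpTo_crossMP, Category.id_comp, Category.id_comp]

theorem mpTo_crossMP_zero_std (a : Sym (n + 1)) :
    mpTo V (std (n + 1) ≫ perm (incl (n + 1) a) ≫ inv (std (n + 1))) (𝟙 _) (𝟙 _) ≫
      ((Lam₂ iAA.converse).app V).app _ = 0 := by
  rw [std_perm_incl, mpTo_crossMP_zero]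

end

section

attribute [local instance] lamAction symAction

variable (V : RepSym) (n : ℕ)

theorem unit_one (w : (symInv V).obj.obj (finFS n)) :
    degree (λₗ[H ℂ] V).hom n ((idTo (symInv V).obj (𝟙 (finFS n)) (𝟙 _)).hom w) = counitAt V n w := by
  refine (unit_idTo V n (𝟙 _) (𝟙 _) w).trans ?_
  simp

theorem sym_cupMP (v : V.obj n) :
    actDeg (hom HMor.cupMP) (λₗ V) (pairIso symResIso symIndIso V) n v = indElt V n 1 v := by
  obtain ⟨w, rfl⟩ := counitAt_surjective V n v
  exact actDeg_eq V HMor.cupMP _ _ (idTo_cupMP_std (symInv V).obj n) w (unit_one V n w)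
    (pairIso_mpTo V n 1 w)

theorem sym_capMP (h : Sym n) (v : V.obj n) :
    actDeg (hom HMor.capMP) (pairIso symResIso symIndIso V) (λₗ V) n (indElt V n (incl n h) v) =
      (V.obj n).ρ h v := by
  obtain ⟨w, rfl⟩ := counitAt_surjective V n v
  refine actDeg_eq V HMor.capMP _ _ (mpTo_capMP_std (symInv V).obj n h) w
    (pairIso_mpTo V n (incl n h) w) ((unit_idTo V n (perm h) (𝟙 _) w).trans ?_)
  rw [IsIso.inv_id, Category.comp_id, counitAt_map]

theorem sym_capMP_zero (g : Sym (n + 1)) (hg : g ∉ (incl n).range) (v : V.obj n) :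
    actDeg (hom HMor.capMP) (pairIso symResIso symIndIso V) (λₗ V) n (indElt V n g v) = 0 := by
  obtain ⟨w, rfl⟩ := counitAt_surjective V n v
  exact actDeg_eq V HMor.capMP _ _ (mpTo_capMP_zero_std (symInv V).obj n g hg) w
    (pairIso_mpTo V n g w) (map_zero _)

theorem hom_sum_apply {U M : Vect} {ι : Type*} [Fintype ι] (f : ι → (U ⟶ M)) (w : U) :
    (∑ i, f i).hom w = ∑ i, (f i).hom w := by
  rw [ModuleCat.hom_sum, LinearMap.sum_apply]

theorem sym_cupPM (v : V.obj (n + 1)) :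
    actDeg (hom HMor.cupPM) (λₗ V) (pairIso symIndIso symResIso V) (n + 1) v =
      ∑ i : Fin (n + 1), indElt (resSym.obj V) n (Equiv.swap i (Fin.last n))
        ((V.obj (n + 1)).ρ (Equiv.swap i (Fin.last n))⁻¹ v) := by
  obtain ⟨w, rfl⟩ := counitAt_surjective V (n + 1) v
  refine actDeg_eq V HMor.cupPM _ _ (idTo_cupPM_std (symInv V).obj n) w (unit_one V (n + 1) w) ?_
  refine ((congrArg _ (hom_sum_apply _ w)).trans (map_sum _ _ _)).trans
    (Finset.sum_congr rfl fun i _ => ?_)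
  rw [← counitAt_map]
  exact pairIso_pmTo V n _ _

theorem sym_capPM (g : Sym (n + 1)) (v : V.obj (n + 1)) :
    actDeg (hom HMor.capPM) (pairIso symIndIso symResIso V) (λₗ V) (n + 1)
      (indElt (resSym.obj V) n g v) = (V.obj (n + 1)).ρ g v := by
  obtain ⟨w, rfl⟩ := counitAt_surjective V (n + 1) v
  refine actDeg_eq V HMor.capPM _ _ (pmTo_capPM (symInv V).obj _ _) w
    (pairIso_pmTo V n g w) ((unit_idTo V (n + 1) _ _ w).trans ?_)
  rw [IsIso.inv_inv, IsIso.inv_hom_id_assoc, counitAt_map]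

theorem sym_crossPP (g : Sym (n + 2)) (h : Sym (n + 1)) (v : V.obj n) :
    actDeg (hom HMor.crossPP) (pairIso symIndIso symIndIso V) (pairIso symIndIso symIndIso V) (n + 2)
        (indElt (indSym.obj V) (n + 1) g (indElt V n h v)) =
      indElt (indSym.obj V) (n + 1) (g * incl (n + 1) h * lastSwap n) (indElt V n 1 v) := by
  obtain ⟨w, rfl⟩ := counitAt_surjective V n v
  have h1 := pairIso_ppTo V n (g * incl (n + 1) h * lastSwap n) 1 w
  rw [map_one, mul_one] at h1
  exact actDeg_eq V HMor.crossPP _ _ (ppTo_crossPP_std (symInv V).obj n _) w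
    (pairIso_ppTo V n g h w) h1

theorem sym_crossMM (v : V.obj (n + 2)) :
    actDeg (hom HMor.crossMM) (pairIso symResIso symResIso V) (pairIso symResIso symResIso V) n v =
      (V.obj (n + 2)).ρ (lastSwap n) v := by
  obtain ⟨w, rfl⟩ := counitAt_surjective V (n + 2) v
  rw [← counitAt_map]
  exact actDeg_eq V HMor.crossMM _ _ (mmTo_crossMM_std (symInv V).obj n) w
    (pairIso_mmTo V n w) (pairIso_mmTo V n _)

theorem sym_crossPM (g : Sym (n + 1)) (v : V.obj (n + 1)) :
    actDeg (hom HMor.crossPM) (pairIso symIndIso symResIso V) (pairIso symResIso symIndIso V) (n + 1)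
        (indElt (resSym.obj V) n g v) =
      indElt V (n + 1) (incl (n + 1) g * lastSwap n) v := by
  obtain ⟨w, rfl⟩ := counitAt_surjective V (n + 1) v
  exact actDeg_eq V HMor.crossPM _ _ (pmTo_crossPM_std (symInv V).obj n g) w
    (pairIso_pmTo V n g w) (pairIso_mpTo V (n + 1) _ w)

theorem sym_crossMP (a b : Sym (n + 1)) (v : V.obj (n + 1)) :
    actDeg (hom HMor.crossMP) (pairIso symResIso symIndIso V) (pairIso symIndIso symResIso V) (n + 1)
        (indElt V (n + 1) (incl (n + 1) a * lastSwap n * incl (n + 1) b) v) =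
      indElt (resSym.obj V) n a ((V.obj (n + 1)).ρ b v) := by
  obtain ⟨w, rfl⟩ := counitAt_surjective V (n + 1) v
  rw [← counitAt_map]
  exact actDeg_eq V HMor.crossMP _ _ (mpTo_crossMP_std (symInv V).obj n a b) w
    (pairIso_mpTo V (n + 1) _ w) (pairIso_pmTo V n a _)

theorem sym_crossMP_zero (a : Sym (n + 1)) (v : V.obj (n + 1)) :
    actDeg (hom HMor.crossMP) (pairIso symResIso symIndIso V) (pairIso symIndIso symResIso V) (n + 1)
      (indElt V (n + 1) (incl (n + 1) a) v) = 0 := by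
  obtain ⟨w, rfl⟩ := counitAt_surjective V (n + 1) v
  exact actDeg_eq V HMor.crossMP _ _ (mpTo_crossMP_zero_std (symInv V).obj n a) w
    (pairIso_mpTo V (n + 1) _ w) (map_zero _)

/-- The action on `∐_n Rep(S_n)` is Khovanov's. -/
noncomputable def symKhovanovAction : KhovanovAction where
  indIso := symIndIso
  indIso_natural := symIndIso_natural
  resIso := symResIso
  resIso_natural := symResIso_natural
  cupMP := sym_cupMP
  capMP := sym_capMP
  capMP_zero := sym_capMP_zero
  cupPM := sym_cupPM
  capPM := sym_capPM
  crossPP := sym_crossPP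
  crossMM := sym_crossMM
  crossPM := sym_crossPM
  crossMP := sym_crossMP
  crossMP_zero := sym_crossMP_zero

end

end HeisCat

theorem mainTheorem5 :
    HeisCat.IsTameGroupoid HeisCat.FS ∧
    (∀ X : HeisCat.HObj, (HeisCat.Cobj X).IsBitame) ∧
    (∀ {X Y : HeisCat.HObj} (f : HeisCat.HMor ℕ X Y), (HeisCat.Cmor f).IsBitame) ∧
    (∀ {X Y : HeisCat.HObj} (f g : HeisCat.HMor ℕ X Y),
      HeisCat.hom f = HeisCat.hom g → HeisCat.Cmor f = HeisCat.Cmor g) ∧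
    HeisCat.evalSym.IsEquivalence ∧
    ∃ _ : MonoidalLeftAction (HeisCat.H ℂ) (HeisCat.Lam HeisCat.FS),
      Nonempty HeisCat.Realizes ∧ HeisCat.IsLinearAction (HeisCat.Lam HeisCat.FS) ∧
      ∃ _ : MonoidalLeftAction (HeisCat.H ℂ) HeisCat.RepSym,
        Nonempty HeisCat.KhovanovAction ∧
        Nonempty (HeisCat.evalSym.LeftLinear (HeisCat.H ℂ)) := by
  refine ⟨HeisCat.isTameGroupoid_FS,
    fun X => (HeisCat.isCover_Cobj X).isBitame HeisCat.locallyFinite_FS,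
    fun {X Y} f => (HeisCat.isCover_Cmor f).isBitame (HeisCat.isCover_Cobj X)
      HeisCat.locallyFinite_FS,
    fun f g h => HeisCat.Cmor_eq_of_hRel (Quotient.exact h), HeisCat.isEquivalence_evalSym,
    HeisCat.lamAction, ⟨HeisCat.lamRealizes⟩, HeisCat.isLinearAction_lamAction,
    HeisCat.symAction, ⟨HeisCat.symKhovanovAction⟩, ?_⟩
  let := HeisCat.lamAction
  exact ⟨HeisCat.transportLeftLinear HeisCat.symEquiv⟩
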